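/- **Setting.** A *2-multicategory* is a multicategory enriched in $\mathbf{Cat}$: it has objects, hom-categories $\mathbb C(X_1,\dots,X_n;Y)$ ($n\ge 0$) of 1-cells $f:X_1,\dots,X_n\to Y$ and 2-cells between them, identities $1_X$, and strictly associative and unital functorial composition. Write $f\circ_k g$ for composition of $g$ into the $k$-th argument of $f$, and $f\circ(g_1,\dots,g_n)$ for simultaneous composition. A *multicategorical 2-functor* $J:\mathbb D\to\mathbb C$ preserves identities and composition strictly, on 1-cells and 2-cells. A *pseudo-multifunctor* $F:\mathbb D\to\mathbb C$ consists of a function on objects, functors $\mathbb D(X_1,\dots,X_n;Y)\to\mathbb C(FX_1,\dots,FX_n;FY)$, and invertible 2-cells $F1_X\Rightarrow 1_{FX}$ and $F(f\circ_i g)\Rightarrow Ff\circ_i Fg$, the latter natural in $f$ and $g$, satisfying the left and right unit axioms and the associativity axiom for $f\circ_i(g\circ_j h)=(f\circ_i g)\circ_{i+j-1}h$. A *relative pseudomonad* along $J$ (restricted to unary 1-cells) consists of objects $TX$, unit 1-cells $i_X:JX\to TX$, extension functors $(-)^*:\mathbb C(JX;TY)\to\mathbb C(TX;TY)$, and invertible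 families $\eta_f:f\to f^*i_X$ and $\mu_{f,g}:(f^*g)^*\to f^*g^*$, natural in $f,g$, and $\theta_X:i_X^*\to 1_{TX}$, satisfying the associativity axiom $$(f^*\mu_{g,h})\cdot\mu_{f,g^*h}\cdot(\mu_{f,g}h)^*=(\mu_{f,g}h^*)\cdot\mu_{f^*g,h}$$ and the unit axiom $(f^*\theta)\cdot\mu_{f,i}\cdot(\eta_f)^*=1_{f^*}$. A *strong relative pseudomonad* $T$ along $J$ consists of objects $TX$, 1-cells $i_X:JX\to TX$, functors $$(-)^{t_j}:\mathbb C(B_1,\dots,JX,\dots,B_n;TY)\to\mathbb C(B_1,\dots,TX,\dots,B_n;TY)$$ for every argument position $j$, pseudonatural in all the other arguments $B_k$ (by invertible 2-cells $(f\circ_k b)^{t}\cong f^{t}\circ_k b$ natural in $f$ and $b$, coherent with identities, with iterated composition in one argument and with composition in two different arguments), and invertible 2-cells $$\tilde t_f:f\to f^{t}\circ_t i,\qquad \hat t_{f,g}:(f^{t}\circ_t g)^{t}\to f^{t}\circ_t g^{t},\qquad \theta_X:(i_X)^{t}\to 1_{TX},$$ for $f:B_1,\dots,JX,\dots,B_n\to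 TY$ and $g:C_1,\dots,JW,\dots,C_m\to TX$, where $\circ_t$ is composition in the strengthened argument. The families $\tilde t$ and $\hat t$ are natural in $f,g$ and compatible with the pseudonaturality 2-cells, and the two axioms displayed above hold with $(-)^t,\tilde t,\hat t,\theta$ in place of $(-)^*,\eta,\mu,\theta$. Restricting to unary 1-cells gives the *underlying relative pseudomonad* of $T$, with $(-)^*=(-)^t$, $\eta=\tilde t$, $\mu=\hat t$. $T$ is *pseudocommutative* if for all positions $j<k$ and $f:B_1,\dots,JX,\dots,JY,\dots,B_n\to TZ$ (with $JX$, $JY$ in positions $j$, $k$) there is an invertible 2-cell $\gamma_f:f^{t_kt_j}\to f^{t_jt_k}$, where $f^{t_kt_j}=(f^{t_k})^{t_j}$, natural in $f$, compatible with the pseudonaturality 2-cells in each of the remaining arguments, and compatible in the codomain with $h^t\circ-$ for every $h:JZ\to TZ'$ (that is, $\hat t$ carries $\gamma_{h^t\circ f}$ to $h^t\circ\gamma_f$), such that the following hold, where $s$ and $t$ denote strengthening in the left and in the right one of the two arguments, $\hat s$, $\tilde s$ denote $\hat t$, $\tilde t$ for the left one, and $\cong$ denotes the pseudonaturality 2-cells: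 1. $\big(f^t\xrightarrow{\tilde s}f^{ts}\circ_s i\xrightarrow{\gamma_f\circ_s i}f^{st}\circ_s i\cong(f^s\circ_s i)^t\big)=(\tilde s_f)^t$; 2. $\big(f^s\xrightarrow{(\tilde t_f)^s}(f^t\circ_t i)^s\cong f^{ts}\circ_t i\xrightarrow{\gamma_f\circ_t i}f^{st}\circ_t i\big)=\tilde t_{f^s}$; 3. for $g:C_1,\dots,JW,\dots,C_m\to TX$, the composite $(f^{ts}\circ_s g)^s\xrightarrow{\hat s}f^{ts}\circ_s g^t\xrightarrow{\gamma_f\circ_s g^t}f^{st}\circ_s g^t\cong(f^s\circ_s g^t)^t$ equals $(f^{ts}\circ_s g)^s\xrightarrow{(\gamma_f\circ_s g)^s}(f^{st}\circ_s g)^s\cong(f^s\circ_s g)^{ts}\xrightarrow{\gamma}(f^s\circ_s g)^{st}\xrightarrow{(\hat s_{f,g})^t}(f^s\circ_s g^t)^t$; 4. for $h:D_1,\dots,JV,\dots,D_l\to TY$, the composite $(f^t\circ_t h)^{ts}\xrightarrow{(\hat t_{f,h})^s}(f^t\circ_t h^t)^s\cong f^{ts}\circ_t h^t\xrightarrow{\gamma_f\circ_t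 h^t}f^{st}\circ_t h^t$ equals $(f^t\circ_t h)^{ts}\xrightarrow{\gamma}(f^t\circ_t h)^{st}\cong(f^{ts}\circ_t h)^t\xrightarrow{(\gamma_f\circ_t h)^t}(f^{st}\circ_t h)^t\xrightarrow{\hat t_{f^s,h}}f^{st}\circ_t h^t$; 5. for $f$ with three arguments $JW,JX,JY$, strengthened, from left to right, by $s,t,u$, the two composites $f^{uts}\to f^{tus}\to f^{tsu}\to f^{stu}$ and $f^{uts}\to f^{ust}\to f^{sut}\to f^{stu}$ of 2-cells $\gamma$ are equal. **Theorem.** Let $J:\mathbb D\to\mathbb C$ be a multicategorical 2-functor between 2-multicategories and let $T$ be a strong relative pseudomonad along $J$ which is pseudocommutative. Then (the underlying relative pseudomonad of) $T$ is a multicategorical relative pseudomonad. That is, the functors $f\mapsto Tf:=(i_Y\circ Jf)^{t_1t_2\cdots t_n}$, for $f:X_1,\dots,X_n\to Y$ (so $Tf=(i_Y\circ Jf)^*$ for unary $f$), are part of the structure of a pseudo-multifunctor $T:\mathbb D\to\mathbb C$ with $X\mapsto TX$ on objects; there are invertible 2-cells $$\bar\imath_f:i_Y\circ Jf\to Tf\circ(i_{X_1},\dots,i_{X_n})\qquad\text{for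 } f:X_1,\dots,X_n\to Y;$$ and there is an operation assigning to every 2-cell $\alpha:h\circ Jf\to Tf'\circ(g_1,\dots,g_n)$, where $f:X_1,\dots,X_n\to Y$ and $f':X_1',\dots,X_n'\to Y'$ in $\mathbb D$ and $h:JY\to TY'$ and $g_k:JX_k\to TX_k'$ in $\mathbb C$, a 2-cell $\alpha^*:h^*\circ Tf\to Tf'\circ(g_1^*,\dots,g_n^*)$, such that: (1) for every such $\alpha$, the composite $h\circ Jf\xrightarrow{\eta_h}h^*\circ i_Y\circ Jf\xrightarrow{\bar\imath_f}h^*\circ Tf\circ(i,\dots,i)\xrightarrow{\alpha^*}Tf'\circ(g_1^*i,\dots,g_n^*i)$ equals $h\circ Jf\xrightarrow{\alpha}Tf'\circ(g_1,\dots,g_n)\xrightarrow{\eta_{g_1},\dots,\eta_{g_n}}Tf'\circ(g_1^*i,\dots,g_n^*i)$; (2) for every such $\alpha$ and every $\beta:h'\circ Jf'\to Tf''\circ(g_1',\dots,g_n')$, the composite $(h'^*h)^*\circ Tf\xrightarrow{\mu_{h',h}}h'^*h^*\circ Tf\xrightarrow{\alpha^*}h'^*\circ Tf'\circ(g_1^*,\dots,g_n^*)\xrightarrow{\beta^*}Tf''\circ(g_1'^*g_1^*,\dots,g_n'^*g_n^*)$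 equals $(h'^*h)^*\circ Tf\xrightarrow{(\beta^*\alpha)^*}Tf''\circ((g_1'^*g_1)^*,\dots,(g_n'^*g_n)^*)\xrightarrow{\mu_{g_1',g_1},\dots,\mu_{g_n',g_n}}Tf''\circ(g_1'^*g_1^*,\dots,g_n'^*g_n^*)$, where $\beta^*\alpha$ is the composite $h'^*h\circ Jf\xrightarrow{\alpha}h'^*\circ Tf'\circ(g_1,\dots,g_n)\xrightarrow{\beta^*}Tf''\circ(g_1'^*g_1,\dots,g_n'^*g_n)$; (3) for every $f:X_1,\dots,X_n\to Y$, the composite $i_Y^*\circ Tf\xrightarrow{(\bar\imath_f)^*}Tf\circ(i_{X_1}^*,\dots,i_{X_n}^*)\xrightarrow{\theta,\dots,\theta}Tf$ equals $\theta_Y\circ Tf:i_Y^*\circ Tf\to Tf$. -/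

import Mathlib

open CategoryTheory

universe u v w u' v' w'

/-! ### Contexts -/

/-- `Replaces L k X Ξ M`: the entry of the list `L` at position `k` (counted from `0`) is `X`, and `M`
is obtained from `L` by replacing that entry by the list `Ξ`. -/
def Replaces {α : Type*} (L : List α) (k : ℕ) (X : α) (Ξ M : List α) : Prop :=
  ∃ Γ Δ : List α, Γ.length = k ∧ L = Γ ++ X :: Δ ∧ M = Γ ++ Ξ ++ Δ

theorem Replaces.whole {α : Type*} (X : α) (Ξ : List α) : Replaces [X] 0 X Ξ Ξ :=
  ⟨[], [], rfl, rfl, by simp⟩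

theorem Replaces.mid {α : Type*} (Γ : List α) (X : α) (Ξ Δ : List α) {L M : List α}
    (hL : L = Γ ++ X :: Δ) (hM : M = Γ ++ Ξ ++ Δ) : Replaces L Γ.length X Ξ M :=
  ⟨Γ, Δ, rfl, hL, hM⟩

theorem Replaces.map {α β : Type*} (φ : α → β) {L M Ξ : List α} {k : ℕ} {X : α}
    (s : Replaces L k X Ξ M) : Replaces (L.map φ) k (φ X) (Ξ.map φ) (M.map φ) := by
  obtain ⟨Γ, Δ, hk, rfl, rfl⟩ := s
  exact ⟨Γ.map φ, Δ.map φ, by simpa using hk, by simp, by simp⟩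

/-- The position, after the entry at position `k` has been replaced by a list of length `m`, of the
entry that was at position `j ≠ k` before. -/
def shift (k m j : ℕ) : ℕ := if j < k then j else j + m - 1

/-- Two replacements in `L` at distinct positions, `A` at `j` by `Φ` and `B` at `k` by `Ω`, carried
out in either order:
`L ⟶ M` replaces `B`, then `M ⟶ P` replaces `A` (now at position `p`);
`L ⟶ N` replaces `A`, then `N ⟶ P` replaces `B` (now at position `q`). -/
structure Parallel {α : Type*} (L : List α) (j : ℕ) (A : α) (Φ : List α) (k : ℕ) (B : α)
    (Ω : List α) (p q : ℕ) (M N P : List α) : Prop where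
  ne : j ≠ k
  hp : p = shift k Ω.length j
  hq : q = shift j Φ.length k
  left : Replaces L k B Ω M
  left' : Replaces M p A Φ P
  right : Replaces L j A Φ N
  right' : Replaces N q B Ω P

/-- A replacement in `L` of `X` at `k` by `Ξ` together with a replacement in `Ξ` of `Y` at `l` by `Θ`,
carried out in either order:
`L ⟶ M` replaces `X` by `Ξ`, then `M ⟶ N` replaces `Y` (now at position `r`) by `Θ`;
`Ξ ⟶ Ξ'` replaces `Y` by `Θ`, and `L ⟶ N` replaces `X` by `Ξ'`. -/
structure Nested {α : Type*} (L : List α) (k : ℕ) (X : α) (Ξ : List α) (l : ℕ) (Y : α)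
    (Θ : List α) (r : ℕ) (M Ξ' N : List α) : Prop where
  hr : r = k + l
  out : Replaces L k X Ξ M
  inn : Replaces M r Y Θ N
  inn' : Replaces Ξ l Y Θ Ξ'
  out' : Replaces L k X Ξ' N

/-! ### 2-multicategories -/

/-- A 2-multicategory (a multicategory enriched in `Cat`), presented by the composites `f ∘ₖ g`.
The argument `s : Replaces L k X Ξ M` of `comp` says that the `k`-th argument of `f` is `X` and that
`M` is the list of arguments of `f ∘ₖ g`. Equations between 2-cells whose sources and targets are equal
1-cells, but not syntactically so, are expressed by `HEq`. -/
structure TwoMulticategory where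
  Ob : Type u
  Hom : List Ob → Ob → Type v
  cat : ∀ L Y, Category.{w} (Hom L Y)
  one : ∀ X, Hom [X] X
  comp : ∀ {L : List Ob} {k : ℕ} {X : Ob} {Ξ M : List Ob} {Y : Ob},
    Replaces L k X Ξ M → Hom L Y → Hom Ξ X → Hom M Y
  /-- the action of composition on 2-cells (horizontal composition) -/
  comp₂ : ∀ {L : List Ob} {k : ℕ} {X : Ob} {Ξ M : List Ob} {Y : Ob} (s : Replaces L k X Ξ M)
    {f f' : Hom L Y} {g g' : Hom Ξ X}, (f ⟶ f') → (g ⟶ g') → (comp s f g ⟶ comp s f' g')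
  comp₂_id : ∀ {L : List Ob} {k : ℕ} {X : Ob} {Ξ M : List Ob} {Y : Ob} (s : Replaces L k X Ξ M)
    (f : Hom L Y) (g : Hom Ξ X), comp₂ s (𝟙 f) (𝟙 g) = 𝟙 (comp s f g)
  comp₂_comp : ∀ {L : List Ob} {k : ℕ} {X : Ob} {Ξ M : List Ob} {Y : Ob} (s : Replaces L k X Ξ M)
    {f f' f'' : Hom L Y} {g g' g'' : Hom Ξ X} (α : f ⟶ f') (α' : f' ⟶ f'') (β : g ⟶ g')
    (β' : g' ⟶ g''), comp₂ s (α ≫ α') (β ≫ β') = comp₂ s α β ≫ comp₂ s α' β'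
  comp_one : ∀ {L : List Ob} {k : ℕ} {X Y : Ob} (s : Replaces L k X [X] L) (f : Hom L Y),
    comp s f (one X) = f
  comp₂_one : ∀ {L : List Ob} {k : ℕ} {X Y : Ob} (s : Replaces L k X [X] L) {f f' : Hom L Y}
    (α : f ⟶ f'), HEq (comp₂ s α (𝟙 (one X))) α
  one_comp : ∀ {L : List Ob} {Y : Ob} (s : Replaces [Y] 0 Y L L) (f : Hom L Y),
    comp s (one Y) f = f
  one_comp₂ : ∀ {L : List Ob} {Y : Ob} (s : Replaces [Y] 0 Y L L) {f f' : Hom L Y} (α : f ⟶ f'),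
    HEq (comp₂ s (𝟙 (one Y)) α) α
  assoc : ∀ {L Ξ Θ M Ξ' N : List Ob} {k l r : ℕ} {X X' Y : Ob}
    (S : Nested L k X Ξ l X' Θ r M Ξ' N) (f : Hom L Y) (g : Hom Ξ X) (h : Hom Θ X'),
    comp S.inn (comp S.out f g) h = comp S.out' f (comp S.inn' g h)
  assoc₂ : ∀ {L Ξ Θ M Ξ' N : List Ob} {k l r : ℕ} {X X' Y : Ob}
    (S : Nested L k X Ξ l X' Θ r M Ξ' N) {f f' : Hom L Y} {g g' : Hom Ξ X} {h h' : Hom Θ X'}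
    (α : f ⟶ f') (β : g ⟶ g') (δ : h ⟶ h'),
    HEq (comp₂ S.inn (comp₂ S.out α β) δ) (comp₂ S.out' α (comp₂ S.inn' β δ))
  parallel : ∀ {L Φ Ω M N P : List Ob} {j k p q : ℕ} {A B Y : Ob}
    (S : Parallel L j A Φ k B Ω p q M N P) (f : Hom L Y) (a : Hom Φ A) (b : Hom Ω B),
    comp S.left' (comp S.left f b) a = comp S.right' (comp S.right f a) b
  parallel₂ : ∀ {L Φ Ω M N P : List Ob} {j k p q : ℕ} {A B Y : Ob}
    (S : Parallel L j A Φ k B Ω p q M N P) {f f' : Hom L Y} {a a' : Hom Φ A} {b b' : Hom Ω B}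
    (φ : f ⟶ f') (α : a ⟶ a') (β : b ⟶ b'),
    HEq (comp₂ S.left' (comp₂ S.left φ β) α) (comp₂ S.right' (comp₂ S.right φ α) β)

attribute [instance] TwoMulticategory.cat

namespace TwoMulticategory

variable (C : TwoMulticategory.{u, v, w})

/-- The identity functor between hom-categories with equal lists of arguments. -/
def castCtx {M N : List C.Ob} (h : M = N) (Z : C.Ob) : C.Hom M Z ⥤ C.Hom N Z :=
  h ▸ 𝟭 (C.Hom M Z)

/-- The composite `h ∘ f` with a unary 1-cell `h`. -/
def post {L : List C.Ob} {Y Z : C.Ob} (h : C.Hom [Y] Z) (f : C.Hom L Y) : C.Hom L Z :=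
  C.comp (Replaces.whole Y L) h f

def post₂ {L : List C.Ob} {Y Z : C.Ob} {h h' : C.Hom [Y] Z} {f f' : C.Hom L Y}
    (α : h ⟶ h') (β : f ⟶ f') : C.post h f ⟶ C.post h' f' :=
  C.comp₂ (Replaces.whole Y L) α β

/-- `h ∘ -` as a functor, for a unary 1-cell `h`. -/
def postFunctor (L : List C.Ob) {Y Z : C.Ob} (h : C.Hom [Y] Z) : C.Hom L Y ⥤ C.Hom L Z where
  obj f := C.post h f
  map β := C.post₂ (𝟙 h) β
  map_id f := C.comp₂_id _ _ _
  map_comp β β' := by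
    have := C.comp₂_comp (Replaces.whole Y L) (𝟙 h) (𝟙 h) β β'
    rwa [Category.comp_id] at this

theorem post_post {L : List C.Ob} {X Y Z : C.Ob} (h : C.Hom [Y] Z) (g : C.Hom [X] Y)
    (f : C.Hom L X) : C.post (C.post h g) f = C.post h (C.post g f) :=
  C.assoc (k := 0) (l := 0) (r := 0)
    ⟨rfl, Replaces.whole _ _, Replaces.whole _ _, Replaces.whole _ _, Replaces.whole _ _⟩ h g f

/-- Composition of `F` with unary 1-cells `g₁, …, gₙ` in its last `n` arguments, from left to right;
`P` is the list of the remaining arguments. -/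
def simultAux : ∀ (n : ℕ) (P : List C.Ob) {A B : Fin n → C.Ob} {M N : List C.Ob} {Z : C.Ob},
    M = P ++ List.ofFn B → N = P ++ List.ofFn A → C.Hom M Z → (∀ k, C.Hom [A k] (B k)) → C.Hom N Z
  | 0, _, _, _, _, _, Z, hM, hN, F, _ => (C.castCtx (hM.trans (by simpa using hN.symm)) Z).obj F
  | n + 1, P, A, B, _, _, _, hM, hN, F, g =>
    simultAux n (P ++ [A 0]) (A := fun k => A k.succ) (B := fun k => B k.succ)
      (M := P ++ A 0 :: List.ofFn fun k => B k.succ) (by simp) (by simpa [List.ofFn_succ] using hN)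
      (C.comp (Replaces.mid P (B 0) [A 0] (List.ofFn fun k => B k.succ)
        (by simpa [List.ofFn_succ] using hM) (by simp)) F (g 0)) (fun k => g k.succ)

def simultAux₂ : ∀ (n : ℕ) (P : List C.Ob) {A B : Fin n → C.Ob} {M N : List C.Ob} {Z : C.Ob}
    (hM : M = P ++ List.ofFn B) (hN : N = P ++ List.ofFn A) {F F' : C.Hom M Z}
    {g g' : ∀ k, C.Hom [A k] (B k)}, (F ⟶ F') → (∀ k, g k ⟶ g' k) →
    (C.simultAux n P hM hN F g ⟶ C.simultAux n P hM hN F' g')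
  | 0, _, _, _, _, _, Z, hM, hN, _, _, _, _, φ, _ =>
    (C.castCtx (hM.trans (by simpa using hN.symm)) Z).map φ
  | n + 1, P, A, B, _, _, _, hM, hN, _, _, _, _, φ, β =>
    simultAux₂ n (P ++ [A 0]) (A := fun k => A k.succ) (B := fun k => B k.succ)
      (M := P ++ A 0 :: List.ofFn fun k => B k.succ) (by simp) (by simpa [List.ofFn_succ] using hN)
      (C.comp₂ (Replaces.mid P (B 0) [A 0] (List.ofFn fun k => B k.succ)
        (by simpa [List.ofFn_succ] using hM) (by simp)) φ (β 0)) (fun k => β k.succ)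

/-- The simultaneous composite `F ∘ (g₁, …, gₙ)` with unary 1-cells `gₖ : Aₖ → Bₖ`. -/
def simult {n : ℕ} {A B : Fin n → C.Ob} {M N : List C.Ob} {Z : C.Ob} (hM : M = List.ofFn B)
    (hN : N = List.ofFn A) (F : C.Hom M Z) (g : ∀ k, C.Hom [A k] (B k)) : C.Hom N Z :=
  C.simultAux n [] hM hN F g

/-- The action of `F ∘ (g₁, …, gₙ)` on 2-cells. -/
def simult₂ {n : ℕ} {A B : Fin n → C.Ob} {M N : List C.Ob} {Z : C.Ob} (hM : M = List.ofFn B)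
    (hN : N = List.ofFn A) {F F' : C.Hom M Z} {g g' : ∀ k, C.Hom [A k] (B k)} (φ : F ⟶ F')
    (β : ∀ k, g k ⟶ g' k) : C.simult hM hN F g ⟶ C.simult hM hN F' g' :=
  C.simultAux₂ n [] hM hN φ β

theorem post_simultAux (n : ℕ) : ∀ (P : List C.Ob) {A B : Fin n → C.Ob} {M N : List C.Ob}
    {Y Z : C.Ob} (hM : M = P ++ List.ofFn B) (hN : N = P ++ List.ofFn A) (h : C.Hom [Y] Z)
    (F : C.Hom M Y) (g : ∀ k, C.Hom [A k] (B k)),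
    C.post h (C.simultAux n P hM hN F g) = C.simultAux n P hM hN (C.post h F) g := by
  induction n with
  | zero =>
    intro P A B M N Y Z hM hN h F g
    have e : M = N := hM.trans (by simpa using hN.symm)
    subst e
    rfl
  | succ n ih =>
    intro P A B M N Y Z hM hN h F g
    simp only [simultAux]
    rw [ih]
    congr 1
    have s : Replaces M P.length (B 0) [A 0] (P ++ A 0 :: List.ofFn fun k => B k.succ) :=
      Replaces.mid P (B 0) [A 0] (List.ofFn fun k => B k.succ)
        (by simpa [List.ofFn_succ] using hM) (by simp)
    exact (C.assoc (k := 0) (l := P.length) (r := P.length)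
      ⟨by simp, Replaces.whole _ _, s, s, Replaces.whole _ _⟩ h F (g 0)).symm

theorem post_simult {n : ℕ} {A B : Fin n → C.Ob} {M N : List C.Ob} {Y Z : C.Ob}
    (hM : M = List.ofFn B) (hN : N = List.ofFn A) (h : C.Hom [Y] Z) (F : C.Hom M Y)
    (g : ∀ k, C.Hom [A k] (B k)) :
    C.post h (C.simult hM hN F g) = C.simult hM hN (C.post h F) g :=
  C.post_simultAux n [] hM hN h F g

theorem comp_simultAux (n : ℕ) : ∀ (P Q : List C.Ob) {A B : Fin n → C.Ob} {M N M' N' : List C.Ob}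
    {X X' Z : C.Ob} (hM : M = (P ++ X :: Q) ++ List.ofFn B) (hN : N = (P ++ X :: Q) ++ List.ofFn A)
    (hM' : M' = (P ++ X' :: Q) ++ List.ofFn B) (hN' : N' = (P ++ X' :: Q) ++ List.ofFn A)
    (s : Replaces N P.length X [X'] N') (s' : Replaces M P.length X [X'] M')
    (F : C.Hom M Z) (a : C.Hom [X'] X) (g : ∀ k, C.Hom [A k] (B k)),
    C.comp s (C.simultAux n _ hM hN F g) a = C.simultAux n _ hM' hN' (C.comp s' F a) g := by
  induction n with
  | zero =>
    intro P Q A B M N M' N' X X' Z hM hN hM' hN' s s' F a g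
    have e : M = N := hM.trans (by simpa using hN.symm)
    have e' : M' = N' := hM'.trans (by simpa using hN'.symm)
    subst e e'
    rfl
  | succ n ih =>
    intro P Q A B M N M' N' X X' Z hM hN hM' hN' s s' F a g
    simp only [simultAux]
    have key := ih P (Q ++ [A 0]) (A := fun k => A k.succ) (B := fun k => B k.succ)
      (M := (P ++ X :: Q) ++ A 0 :: List.ofFn fun k => B k.succ) (N := N)
      (M' := (P ++ X' :: Q) ++ A 0 :: List.ofFn fun k => B k.succ) (N' := N') (X := X) (X' := X')
      (Z := Z)
      (by simp) (by simpa [List.ofFn_succ] using hN) (by simp) (by simpa [List.ofFn_succ] using hN')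
      s (Replaces.mid P X [X'] (Q ++ A 0 :: List.ofFn fun k => B k.succ) (by simp) (by simp))
      (C.comp (Replaces.mid (P ++ X :: Q) (B 0) [A 0] (List.ofFn fun k => B k.succ)
        (by simpa [List.ofFn_succ] using hM) (by simp)) F (g 0)) a (fun k => g k.succ)
    have e1 : (P ++ X :: Q) ++ [A 0] = P ++ X :: (Q ++ [A 0]) := by simp
    have e2 : (P ++ X' :: Q) ++ [A 0] = P ++ X' :: (Q ++ [A 0]) := by simp
    simp only [e1, e2]
    rw [key]
    congr 1
    have t : Replaces M (P ++ X :: Q).length (B 0) [A 0]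
        ((P ++ X :: Q) ++ A 0 :: List.ofFn fun k => B k.succ) :=
      Replaces.mid _ _ _ _ (by simpa [List.ofFn_succ] using hM) (by simp)
    have t' : Replaces ((P ++ X :: Q) ++ A 0 :: List.ofFn fun k => B k.succ) P.length X [X']
        ((P ++ X' :: Q) ++ A 0 :: List.ofFn fun k => B k.succ) :=
      Replaces.mid P X [X'] (Q ++ A 0 :: List.ofFn fun k => B k.succ) (by simp) (by simp)
    exact C.parallel (j := P.length) (k := (P ++ X :: Q).length) (p := P.length)
      (q := (P ++ X' :: Q).length) (Φ := [X']) (Ω := [A 0])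
      ⟨by simp, by simp [shift], by simp [shift], t, t', s',
        Replaces.mid _ _ _ _ (by simpa [List.ofFn_succ] using hM') (by simp)⟩ F a (g 0)

theorem simultAux_simultAux (n : ℕ) : ∀ (P : List C.Ob) {A B E : Fin n → C.Ob} {M N R : List C.Ob}
    {Z : C.Ob} (hM : M = P ++ List.ofFn E) (hN : N = P ++ List.ofFn B) (hR : R = P ++ List.ofFn A)
    (F : C.Hom M Z) (g' : ∀ k, C.Hom [B k] (E k)) (g : ∀ k, C.Hom [A k] (B k)),
    C.simultAux n P hN hR (C.simultAux n P hM hN F g') g =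
      C.simultAux n P hM hR F (fun k => C.post (g' k) (g k)) := by
  induction n with
  | zero =>
    intro P A B E M N R Z hM hN hR F g' g
    have e : M = N := hM.trans (by simpa using hN.symm)
    have e' : N = R := hN.trans (by simpa using hR.symm)
    subst e e'
    rfl
  | succ n ih =>
    intro P A B E M N R Z hM hN hR F g' g
    simp only [simultAux]
    rw [← ih (P ++ [A 0]) (B := fun k => B k.succ) (N := P ++ A 0 :: List.ofFn fun k => B k.succ)
      _ (by simp) _ _ (fun k => g' k.succ) (fun k => g k.succ)]
    congr 1
    have t : Replaces M P.length (E 0) [B 0] (P ++ B 0 :: List.ofFn fun k => E k.succ) :=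
      Replaces.mid _ _ _ _ (by simpa [List.ofFn_succ] using hM) (by simp)
    have t' : Replaces (P ++ B 0 :: List.ofFn fun k => E k.succ) P.length (B 0) [A 0]
        (P ++ A 0 :: List.ofFn fun k => E k.succ) :=
      Replaces.mid _ _ _ _ rfl (by simp)
    rw [C.comp_simultAux n P [] (by simp) (by simpa [List.ofFn_succ] using hN)
      (M' := P ++ A 0 :: List.ofFn fun k => E k.succ) (by simp) (by simp) _ t']
    congr 1
    exact C.assoc (k := P.length) (l := 0) (r := P.length)
      ⟨by simp, t, t', Replaces.whole _ _,
        Replaces.mid _ _ _ _ (by simpa [List.ofFn_succ] using hM) (by simp)⟩ F (g' 0) (g 0)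

theorem simult_simult {n : ℕ} {A B E : Fin n → C.Ob} {M N R : List C.Ob} {Z : C.Ob}
    (hM : M = List.ofFn E) (hN : N = List.ofFn B) (hR : R = List.ofFn A) (F : C.Hom M Z)
    (g' : ∀ k, C.Hom [B k] (E k)) (g : ∀ k, C.Hom [A k] (B k)) :
    C.simult hN hR (C.simult hM hN F g') g =
      C.simult hM hR F (fun k => C.post (g' k) (g k)) :=
  C.simultAux_simultAux n [] hM hN hR F g' g

theorem simultAux_one (n : ℕ) : ∀ (P : List C.Ob) {A : Fin n → C.Ob} {M : List C.Ob} {Z : C.Ob}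
    (hM hM' : M = P ++ List.ofFn A) (F : C.Hom M Z),
    C.simultAux n P hM hM' F (fun k => C.one (A k)) = F := by
  induction n with
  | zero => intros; rfl
  | succ n ih =>
    intro P A M Z hM hM' F
    have e : M = P ++ A 0 :: List.ofFn fun k => A k.succ := by simpa [List.ofFn_succ] using hM
    subst e
    simp only [simultAux]
    rw [ih, C.comp_one]

theorem simult_one {n : ℕ} {A : Fin n → C.Ob} {M : List C.Ob} {Z : C.Ob}
    (hM hM' : M = List.ofFn A) (F : C.Hom M Z) :
    C.simult hM hM' F (fun k => C.one (A k)) = F :=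
  C.simultAux_one n [] hM hM' F

end TwoMulticategory

/-! ### Multicategorical 2-functors and pseudo-multifunctors -/

/-- A (strict) multicategorical 2-functor. -/
structure MultiFunctor (D : TwoMulticategory.{u, v, w}) (C : TwoMulticategory.{u', v', w'}) where
  obj : D.Ob → C.Ob
  map : ∀ (L : List D.Ob) (Y : D.Ob), D.Hom L Y ⥤ C.Hom (L.map obj) (obj Y)
  map_one : ∀ X, (map [X] X).obj (D.one X) = C.one (obj X)
  map_comp : ∀ {L Ξ M : List D.Ob} {k : ℕ} {X Y : D.Ob} (s : Replaces L k X Ξ M) (f : D.Hom L Y)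
    (g : D.Hom Ξ X), (map M Y).obj (D.comp s f g) =
      C.comp (s.map obj) ((map L Y).obj f) ((map Ξ X).obj g)
  map_comp₂ : ∀ {L Ξ M : List D.Ob} {k : ℕ} {X Y : D.Ob} (s : Replaces L k X Ξ M)
    {f f' : D.Hom L Y} {g g' : D.Hom Ξ X} (α : f ⟶ f') (β : g ⟶ g'),
    HEq ((map M Y).map (D.comp₂ s α β))
      (C.comp₂ (s.map obj) ((map L Y).map α) ((map Ξ X).map β))

/-- The structure of a pseudo-multifunctor on a function `F : ob D → ob C`. -/
structure PseudoMultifunctor (D : TwoMulticategory.{u, v, w}) (C : TwoMulticategory.{u', v', w'})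
    (F : D.Ob → C.Ob) where
  map : ∀ (L : List D.Ob) (Y : D.Ob), D.Hom L Y ⥤ C.Hom (L.map F) (F Y)
  mapOne : ∀ X, (map [X] X).obj (D.one X) ≅ C.one (F X)
  mapComp : ∀ {L Ξ M : List D.Ob} {k : ℕ} {X Y : D.Ob} (s : Replaces L k X Ξ M) (f : D.Hom L Y)
    (g : D.Hom Ξ X), (map M Y).obj (D.comp s f g) ≅
      C.comp (s.map F) ((map L Y).obj f) ((map Ξ X).obj g)
  mapComp_naturality : ∀ {L Ξ M : List D.Ob} {k : ℕ} {X Y : D.Ob} (s : Replaces L k X Ξ M)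
    {f f' : D.Hom L Y} {g g' : D.Hom Ξ X} (α : f ⟶ f') (β : g ⟶ g'),
    (map M Y).map (D.comp₂ s α β) ≫ (mapComp s f' g').hom =
      (mapComp s f g).hom ≫ C.comp₂ (s.map F) ((map L Y).map α) ((map Ξ X).map β)
  one_left : ∀ {L : List D.Ob} {Y : D.Ob} (f : D.Hom L Y),
    (mapComp (Replaces.whole Y L) (D.one Y) f).hom ≫
        C.comp₂ ((Replaces.whole Y L).map F) (mapOne Y).hom (𝟙 ((map L Y).obj f)) =
      eqToHom ((congrArg (map L Y).obj (D.one_comp _ f)).trans (C.one_comp _ _).symm)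
  one_right : ∀ {L : List D.Ob} {k : ℕ} {X Y : D.Ob} (s : Replaces L k X [X] L) (f : D.Hom L Y),
    (mapComp s f (D.one X)).hom ≫ C.comp₂ (s.map F) (𝟙 ((map L Y).obj f)) (mapOne X).hom =
      eqToHom ((congrArg (map L Y).obj (D.comp_one s f)).trans (C.comp_one _ _).symm)
  associativity : ∀ {L Ξ Θ M Ξ' N : List D.Ob} {k l r : ℕ} {X X' Y : D.Ob}
    (S : Nested L k X Ξ l X' Θ r M Ξ' N) (f : D.Hom L Y) (g : D.Hom Ξ X) (h : D.Hom Θ X'),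
    (mapComp S.out' f (D.comp S.inn' g h)).hom ≫
        C.comp₂ (S.out'.map F) (𝟙 ((map L Y).obj f)) (mapComp S.inn' g h).hom =
      eqToHom (congrArg (map N Y).obj (D.assoc S f g h).symm) ≫
        (mapComp S.inn (D.comp S.out f g) h).hom ≫
        C.comp₂ (S.inn.map F) (mapComp S.out f g).hom (𝟙 ((map Θ X').obj h)) ≫
        eqToHom (C.assoc ⟨S.hr, S.out.map F, S.inn.map F, S.inn'.map F, S.out'.map F⟩ _ _ _)

section Monads

variable {D : TwoMulticategory.{u, v, w}} {C : TwoMulticategory.{u', v', w'}}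

/-! ### Relative pseudomonads -/

/-- A relative pseudomonad along (the restriction to unary 1-cells of) `J`. -/
structure RelativePseudomonad (J : MultiFunctor D C) where
  obj : D.Ob → C.Ob
  unit : ∀ X, C.Hom [J.obj X] (obj X)
  ext : ∀ X Y, C.Hom [J.obj X] (obj Y) ⥤ C.Hom [obj X] (obj Y)
  η : ∀ {X Y : D.Ob} (f : C.Hom [J.obj X] (obj Y)), f ≅ C.post ((ext X Y).obj f) (unit X)
  η_naturality : ∀ {X Y : D.Ob} {f f' : C.Hom [J.obj X] (obj Y)} (α : f ⟶ f'),
    α ≫ (η f').hom = (η f).hom ≫ C.post₂ ((ext X Y).map α) (𝟙 (unit X))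
  μ : ∀ {X Y Z : D.Ob} (f : C.Hom [J.obj Y] (obj Z)) (g : C.Hom [J.obj X] (obj Y)),
    (ext X Z).obj (C.post ((ext Y Z).obj f) g) ≅ C.post ((ext Y Z).obj f) ((ext X Y).obj g)
  μ_naturality : ∀ {X Y Z : D.Ob} {f f' : C.Hom [J.obj Y] (obj Z)} {g g' : C.Hom [J.obj X] (obj Y)}
    (α : f ⟶ f') (β : g ⟶ g'),
    (ext X Z).map (C.post₂ ((ext Y Z).map α) β) ≫ (μ f' g').hom =
      (μ f g).hom ≫ C.post₂ ((ext Y Z).map α) ((ext X Y).map β)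
  θ : ∀ X, (ext X X).obj (unit X) ≅ C.one (obj X)
  associativity : ∀ {V W X Y : D.Ob} (f : C.Hom [J.obj X] (obj Y)) (g : C.Hom [J.obj W] (obj X))
    (h : C.Hom [J.obj V] (obj W)),
    (μ (C.post ((ext X Y).obj f) g) h).hom ≫ C.post₂ (μ f g).hom (𝟙 ((ext V W).obj h)) ≫
        eqToHom (C.post_post _ _ _) =
      (ext V Y).map (C.post₂ (μ f g).hom (𝟙 h)) ≫
        eqToHom (congrArg (ext V Y).obj (C.post_post _ _ _)) ≫
        (μ f (C.post ((ext W X).obj g) h)).hom ≫ C.post₂ (𝟙 ((ext X Y).obj f)) (μ g h).hom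
  unitality : ∀ {X Y : D.Ob} (f : C.Hom [J.obj X] (obj Y)),
    (ext X Y).map (η f).hom ≫ (μ f (unit X)).hom ≫ C.post₂ (𝟙 ((ext X Y).obj f)) (θ X).hom =
      eqToHom (C.comp_one _ _).symm

/-- A strong relative pseudomonad along `J`. The functor `str s` strengthens the argument at position
`j`; `strNat` is its pseudonaturality in the other arguments, `unitCell` is the family `t̃`, `multCell`
is the family `t̂`. (Pseudonaturality in the strengthened argument and in the codomain is given by
`unitCell` and `multCell`.) -/
structure StrongRelativePseudomonad (J : MultiFunctor D C) where
  obj : D.Ob → C.Ob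
  unit : ∀ X, C.Hom [J.obj X] (obj X)
  str : ∀ {L M : List C.Ob} {j : ℕ} {X Y : D.Ob}, Replaces L j (J.obj X) [obj X] M →
    (C.Hom L (obj Y) ⥤ C.Hom M (obj Y))
  /-- `(f ∘ₖ b)ᵗ ≅ fᵗ ∘ₖ b`, where `b` is composed in an argument which is not strengthened -/
  strNat : ∀ {L Ω M N P : List C.Ob} {j k p q : ℕ} {X Y : D.Ob} {B : C.Ob}
    (S : Parallel L j (J.obj X) [obj X] k B Ω p q M N P) (f : C.Hom L (obj Y)) (b : C.Hom Ω B),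
    (str S.left').obj (C.comp S.left f b) ≅ C.comp S.right' ((str S.right).obj f) b
  strNat_naturality : ∀ {L Ω M N P : List C.Ob} {j k p q : ℕ} {X Y : D.Ob} {B : C.Ob}
    (S : Parallel L j (J.obj X) [obj X] k B Ω p q M N P) {f f' : C.Hom L (obj Y)}
    {b b' : C.Hom Ω B} (α : f ⟶ f') (β : b ⟶ b'),
    (str S.left').map (C.comp₂ S.left α β) ≫ (strNat S f' b').hom =
      (strNat S f b).hom ≫ C.comp₂ S.right' ((str S.right).map α) β
  strNat_one : ∀ {L N : List C.Ob} {j k p q : ℕ} {X Y : D.Ob} {B : C.Ob}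
    (S : Parallel L j (J.obj X) [obj X] k B [B] p q L N N) (f : C.Hom L (obj Y)),
    HEq (strNat S f (C.one B)).hom (𝟙 ((str S.right).obj f))
  strNat_comp : ∀ {L Ξ Θ M Ξ' N L₁ M₁ N₁ : List C.Ob} {j k l r p p' q q' q'' : ℕ} {X Y : D.Ob}
    {B B' : C.Ob} (S : Nested L k B Ξ l B' Θ r M Ξ' N)
    (S₁ : Parallel L j (J.obj X) [obj X] k B Ξ p q M L₁ M₁)
    (S₂ : Parallel M p (J.obj X) [obj X] r B' Θ p' q' N M₁ N₁)
    (S₃ : Parallel L j (J.obj X) [obj X] k B Ξ' p' q'' N L₁ N₁)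
    (f : C.Hom L (obj Y)) (b : C.Hom Ξ B) (b' : C.Hom Θ B'),
    HEq (strNat S₃ f (C.comp S.inn' b b')).hom
      ((strNat S₂ (C.comp S.out f b) b').hom ≫ C.comp₂ S₂.right' (strNat S₁ f b).hom (𝟙 b'))
  strNat_parallel : ∀ {L Ξ Ξ' M M' R L₁ M₁ M₁' R₁ : List C.Ob} {j k k' c c' p p' q q' r d d' : ℕ}
    {X Y : D.Ob} {B B' : C.Ob} (S : Parallel L k B Ξ k' B' Ξ' c c' M' M R)
    (S₁ : Parallel L j (J.obj X) [obj X] k B Ξ p q M L₁ M₁)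
    (S₂ : Parallel M p (J.obj X) [obj X] c' B' Ξ' r d R M₁ R₁)
    (S₁' : Parallel L j (J.obj X) [obj X] k' B' Ξ' p' q' M' L₁ M₁')
    (S₂' : Parallel M' p' (J.obj X) [obj X] c B Ξ r d' R M₁' R₁)
    (f : C.Hom L (obj Y)) (b : C.Hom Ξ B) (b' : C.Hom Ξ' B'),
    HEq
      ((strNat S₂ (C.comp S.right f b) b').hom ≫ C.comp₂ S₂.right' (strNat S₁ f b).hom (𝟙 b'))
      ((strNat S₂' (C.comp S.left f b') b).hom ≫ C.comp₂ S₂'.right' (strNat S₁' f b').hom (𝟙 b))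
  unitCell : ∀ {L M : List C.Ob} {j : ℕ} {X Y : D.Ob} (s : Replaces L j (J.obj X) [obj X] M)
    (s' : Replaces M j (obj X) [J.obj X] L) (f : C.Hom L (obj Y)),
    f ≅ C.comp s' ((str s).obj f) (unit X)
  unitCell_naturality : ∀ {L M : List C.Ob} {j : ℕ} {X Y : D.Ob}
    (s : Replaces L j (J.obj X) [obj X] M) (s' : Replaces M j (obj X) [J.obj X] L)
    {f f' : C.Hom L (obj Y)} (α : f ⟶ f'),
    α ≫ (unitCell s s' f').hom = (unitCell s s' f).hom ≫ C.comp₂ s' ((str s).map α) (𝟙 (unit X))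
  /-- `unitCell` is compatible with `strNat` -/
  unitCell_strNat : ∀ {L Ω M N P : List C.Ob} {j k p q : ℕ} {X Y : D.Ob} {B : C.Ob}
    (S : Parallel L j (J.obj X) [obj X] k B Ω p q M N P) (s : Replaces N j (obj X) [J.obj X] L)
    (s' : Replaces P p (obj X) [J.obj X] M) (f : C.Hom L (obj Y)) (b : C.Hom Ω B),
    HEq
      ((unitCell S.left' s' (C.comp S.left f b)).hom ≫
        C.comp₂ s' (strNat S f b).hom (𝟙 (unit X)))
      (C.comp₂ S.left (unitCell S.right s f).hom (𝟙 b))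
  multCell : ∀ {L M Ξ A Ξ' A' : List C.Ob} {j l u : ℕ} {W X Y : D.Ob}
    (s : Replaces L j (J.obj X) [obj X] M)
    (S : Nested M j (obj X) Ξ l (J.obj W) [obj W] u A Ξ' A')
    (f : C.Hom L (obj Y)) (g : C.Hom Ξ (obj X)),
    (str S.inn).obj (C.comp S.out ((str s).obj f) g) ≅
      C.comp S.out' ((str s).obj f) ((str S.inn').obj g)
  multCell_naturality : ∀ {L M Ξ A Ξ' A' : List C.Ob} {j l u : ℕ} {W X Y : D.Ob}
    (s : Replaces L j (J.obj X) [obj X] M)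
    (S : Nested M j (obj X) Ξ l (J.obj W) [obj W] u A Ξ' A')
    {f f' : C.Hom L (obj Y)} {g g' : C.Hom Ξ (obj X)} (α : f ⟶ f') (β : g ⟶ g'),
    (str S.inn).map (C.comp₂ S.out ((str s).map α) β) ≫ (multCell s S f' g').hom =
      (multCell s S f g).hom ≫ C.comp₂ S.out' ((str s).map α) ((str S.inn').map β)
  /-- `multCell` is compatible with `strNat` in the arguments of `f` -/
  multCell_strNat_left : ∀ {L Ω M N P Ξ A Ξ' A' A₁ A₁' : List C.Ob} {j k p q l u u₁ a a' : ℕ}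
    {W X Y : D.Ob} {B : C.Ob} (S : Parallel L j (J.obj X) [obj X] k B Ω p q M N P)
    (T : Nested N j (obj X) Ξ l (J.obj W) [obj W] u A Ξ' A')
    (T₁ : Nested P p (obj X) Ξ l (J.obj W) [obj W] u₁ A₁ Ξ' A₁')
    (S₁ : Parallel A u (J.obj W) [obj W] a B Ω u₁ a' A₁ A' A₁')
    (S₂ : Parallel N j (obj X) Ξ q B Ω p a P A A₁)
    (f : C.Hom L (obj Y)) (b : C.Hom Ω B) (g : C.Hom Ξ (obj X)),
    HEq
      ((multCell S.left' T₁ (C.comp S.left f b) g).hom ≫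
        C.comp₂ T₁.out' (strNat S f b).hom (𝟙 ((str T₁.inn').obj g)))
      ((str T₁.inn).map (C.comp₂ T₁.out (strNat S f b).hom (𝟙 g)) ≫
        eqToHom (congrArg (str T₁.inn).obj (C.parallel S₂ ((str S.right).obj f) g b)) ≫
        (strNat S₁ (C.comp T.out ((str S.right).obj f) g) b).hom ≫
        C.comp₂ S₁.right' (multCell S.right T f g).hom (𝟙 b))
  /-- `multCell` is compatible with `strNat` in the arguments of `g` -/
  multCell_strNat_right : ∀ {L M Ξ Ω Ξ₁ Ξ' Ξ₁' A A' A₁ A₁' : List C.Ob}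
    {j l m p q u u₁ a a' : ℕ} {W X Y : D.Ob} {B : C.Ob}
    (s : Replaces L j (J.obj X) [obj X] M)
    (S : Parallel Ξ l (J.obj W) [obj W] m B Ω p q Ξ₁ Ξ' Ξ₁')
    (T : Nested M j (obj X) Ξ l (J.obj W) [obj W] u A Ξ' A')
    (T₁ : Nested M j (obj X) Ξ₁ p (J.obj W) [obj W] u₁ A₁ Ξ₁' A₁')
    (_T₂ : Nested M j (obj X) Ξ m B Ω a A Ξ₁ A₁)
    (S₁ : Parallel A u (J.obj W) [obj W] a B Ω u₁ a' A₁ A' A₁')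
    (f : C.Hom L (obj Y)) (g : C.Hom Ξ (obj X)) (b : C.Hom Ω B),
    HEq
      ((multCell s T₁ f (C.comp S.left g b)).hom ≫
        C.comp₂ T₁.out' (𝟙 ((str s).obj f)) (strNat S g b).hom)
      ((strNat S₁ (C.comp T.out ((str s).obj f) g) b).hom ≫
        C.comp₂ S₁.right' (multCell s T f g).hom (𝟙 b))
  θ : ∀ X, (str (Replaces.whole (J.obj X) [obj X])).obj (unit X) ≅ C.one (obj X)
  associativity : ∀ {L M Ξ A Ξ' A' Θ B Θ' B' E E' : List C.Ob} {j l m u r x : ℕ}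
    {V W X Y : D.Ob} (s : Replaces L j (J.obj X) [obj X] M)
    (S₁ : Nested M j (obj X) Ξ l (J.obj W) [obj W] u A Ξ' A')
    (S₂ : Nested Ξ' l (obj W) Θ m (J.obj V) [obj V] r B Θ' B')
    (S₃ : Nested A' u (obj W) Θ m (J.obj V) [obj V] x E Θ' E')
    (S₄ : Nested M j (obj X) B r (J.obj V) [obj V] x E B' E')
    (S₅ : Nested M j (obj X) Ξ' l (obj W) Θ u A' B E)
    (f : C.Hom L (obj Y)) (g : C.Hom Ξ (obj X)) (h : C.Hom Θ (obj W)),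
    HEq
      ((multCell S₁.inn S₃ (C.comp S₁.out ((str s).obj f) g) h).hom ≫
        C.comp₂ S₃.out' (multCell s S₁ f g).hom (𝟙 ((str S₃.inn').obj h)))
      ((str S₃.inn).map (C.comp₂ S₃.out (multCell s S₁ f g).hom (𝟙 h)) ≫
        eqToHom (congrArg (str S₃.inn).obj
          (C.assoc S₅ ((str s).obj f) ((str S₁.inn').obj g) h)) ≫
        (multCell s S₄ f (C.comp S₂.out ((str S₁.inn').obj g) h)).hom ≫
        C.comp₂ S₄.out' (𝟙 ((str s).obj f)) (multCell S₁.inn' S₂ g h).hom)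
  unitality : ∀ {L M : List C.Ob} {j : ℕ} {X Y : D.Ob} (s : Replaces L j (J.obj X) [obj X] M)
    (S : Nested M j (obj X) [J.obj X] 0 (J.obj X) [obj X] j L [obj X] M) (f : C.Hom L (obj Y)),
    HEq
      ((str s).map (unitCell s S.out f).hom ≫ (multCell s S f (unit X)).hom ≫
        C.comp₂ S.out' (𝟙 ((str s).obj f)) (θ X).hom)
      (𝟙 ((str s).obj f))

namespace StrongRelativePseudomonad

variable {J : MultiFunctor D C} (T : StrongRelativePseudomonad J)

theorem nested_unary {α : Type*} (X Y Z : α) : Nested [X] 0 X [Y] 0 Y [Z] 0 [Y] [Z] [Z] :=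
  ⟨rfl, Replaces.whole _ _, Replaces.whole _ _, Replaces.whole _ _, Replaces.whole _ _⟩

/-- The relative pseudomonad obtained from `T` by restriction to unary 1-cells. -/
def toRelativePseudomonad : RelativePseudomonad J where
  obj := T.obj
  unit := T.unit
  ext X Y := T.str (Replaces.whole (J.obj X) [T.obj X])
  η f := T.unitCell _ (Replaces.whole _ _) f
  η_naturality α := T.unitCell_naturality _ _ α
  μ f g := T.multCell (Replaces.whole _ _) (nested_unary _ _ _) f g
  μ_naturality α β := T.multCell_naturality (Replaces.whole _ _) (nested_unary _ _ _) α β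
  θ := T.θ
  associativity f g h := by
    rw [← Category.assoc]
    apply eq_of_heq
    refine HEq.trans (comp_eqToHom_heq _ _) ?_
    exact T.associativity (Replaces.whole _ _) (nested_unary _ _ _) (nested_unary _ _ _)
      (nested_unary _ _ _) (nested_unary _ _ _) (nested_unary _ _ _) f g h
  unitality {X Y} f := by
    apply eq_of_heq
    refine HEq.trans (T.unitality (Replaces.whole _ _) (nested_unary _ _ _) f) ?_
    exact (eqToHom_heq_id_dom _ _ _).symm

/-- Successive strengthening, from left to right, of the arguments `JX₁, …, JXₙ` which follow the
arguments `P`. -/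
def strAux (Y : D.Ob) : ∀ (P : List C.Ob) (L : List D.Ob) {M N : List C.Ob},
    M = P ++ L.map J.obj → N = P ++ L.map T.obj → (C.Hom M (T.obj Y) ⥤ C.Hom N (T.obj Y))
  | _, [], _, _, hM, hN => C.castCtx (hM.trans hN.symm) (T.obj Y)
  | P, X :: L, _, _, hM, hN =>
    T.str (Replaces.mid P (J.obj X) [T.obj X] (L.map J.obj) hM rfl) ⋙
      strAux Y (P ++ [T.obj X]) L rfl (hN.trans (by simp))

/-- The action `f ↦ (i ∘ Jf)^{t₁ t₂ … tₙ}` of `T` on the hom-categories of `D`. -/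
def map (L : List D.Ob) (Y : D.Ob) : D.Hom L Y ⥤ C.Hom (L.map T.obj) (T.obj Y) :=
  J.map L Y ⋙ C.postFunctor _ (T.unit Y) ⋙ T.strAux Y [] L rfl rfl

/-! ### Pseudocommutativity -/

/-- A pseudocommutativity of `T`. For `S : Parallel L j (JX) [TX] k (JY) [TY] j k M N P` the functors
`str S.left`, `str S.left'`, `str S.right`, `str S.right'` are `f ↦ f^{t_k}`, `f^{t_k} ↦ f^{t_k t_j}`,
`f ↦ f^{t_j}` and `f^{t_j} ↦ f^{t_j t_k}`. -/
structure Pseudocommutativity where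
  γ : ∀ {L M N P : List C.Ob} {j k : ℕ} {X Y Z : D.Ob}
    (S : Parallel L j (J.obj X) [T.obj X] k (J.obj Y) [T.obj Y] j k M N P), j < k →
    ∀ f : C.Hom L (T.obj Z),
    (T.str S.left').obj ((T.str S.left).obj f) ≅ (T.str S.right').obj ((T.str S.right).obj f)
  γ_naturality : ∀ {L M N P : List C.Ob} {j k : ℕ} {X Y Z : D.Ob}
    (S : Parallel L j (J.obj X) [T.obj X] k (J.obj Y) [T.obj Y] j k M N P) (hjk : j < k)
    {f f' : C.Hom L (T.obj Z)} (α : f ⟶ f'),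
    (T.str S.left').map ((T.str S.left).map α) ≫ (γ S hjk f').hom =
      (γ S hjk f).hom ≫ (T.str S.right').map ((T.str S.right).map α)
  /-- pseudonaturality in the remaining arguments -/
  γ_strNat : ∀ {L M N P Ω L₁ M₁ N₁ P₁ : List C.Ob} {j k l j₁ k₁ c d e : ℕ} {X Y Z : D.Ob} {B : C.Ob}
    (S : Parallel L j (J.obj X) [T.obj X] k (J.obj Y) [T.obj Y] j k M N P) (hjk : j < k)
    (S₁ : Parallel L₁ j₁ (J.obj X) [T.obj X] k₁ (J.obj Y) [T.obj Y] j₁ k₁ M₁ N₁ P₁)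
    (hjk₁ : j₁ < k₁)
    (Rj : Parallel L j (J.obj X) [T.obj X] l B Ω j₁ c L₁ N N₁)
    (Rk : Parallel L k (J.obj Y) [T.obj Y] l B Ω k₁ d L₁ M M₁)
    (Rkj : Parallel M j (J.obj X) [T.obj X] d B Ω j₁ e M₁ P P₁)
    (Rjk : Parallel N k (J.obj Y) [T.obj Y] c B Ω k₁ e N₁ P P₁)
    (f : C.Hom L (T.obj Z)) (b : C.Hom Ω B),
    (γ S₁ hjk₁ (C.comp Rj.left f b)).hom ≫ (T.str S₁.right').map (T.strNat Rj f b).hom ≫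
        (T.strNat Rjk ((T.str S.right).obj f) b).hom =
      (T.str S₁.left').map (T.strNat Rk f b).hom ≫
        (T.strNat Rkj ((T.str S.left).obj f) b).hom ≫ C.comp₂ Rkj.right' (γ S hjk f).hom (𝟙 b)
  /-- pseudonaturality in the codomain, along `hᵗ ∘ -` for `h : JZ → TZ'` -/
  γ_codomain : ∀ {L M N P : List C.Ob} {j k : ℕ} {X Y Z Z' : D.Ob}
    (S : Parallel L j (J.obj X) [T.obj X] k (J.obj Y) [T.obj Y] j k M N P) (hjk : j < k)
    (R₁ : Nested [T.obj Z] 0 (T.obj Z) L k (J.obj Y) [T.obj Y] k L M M)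
    (R₂ : Nested [T.obj Z] 0 (T.obj Z) M j (J.obj X) [T.obj X] j M P P)
    (R₃ : Nested [T.obj Z] 0 (T.obj Z) L j (J.obj X) [T.obj X] j L N N)
    (R₄ : Nested [T.obj Z] 0 (T.obj Z) N k (J.obj Y) [T.obj Y] k N P P)
    (s : Replaces [J.obj Z] 0 (J.obj Z) [T.obj Z] [T.obj Z])
    (h : C.Hom [J.obj Z] (T.obj Z')) (f : C.Hom L (T.obj Z)),
    (γ S hjk (C.comp R₁.out ((T.str s).obj h) f)).hom ≫
        (T.str S.right').map (T.multCell s R₃ h f).hom ≫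
        (T.multCell s R₄ h ((T.str S.right).obj f)).hom =
      (T.str S.left').map (T.multCell s R₁ h f).hom ≫
        (T.multCell s R₂ h ((T.str S.left).obj f)).hom ≫
        C.comp₂ R₂.out' (𝟙 ((T.str s).obj h)) (γ S hjk f).hom
  /-- precomposition with a unit in the left argument -/
  γ_unit_left : ∀ {L M N P : List C.Ob} {j k : ℕ} {X Y Z : D.Ob}
    (S : Parallel L j (J.obj X) [T.obj X] k (J.obj Y) [T.obj Y] j k M N P) (hjk : j < k)
    (R : Parallel N k (J.obj Y) [T.obj Y] j (T.obj X) [J.obj X] k j L P M)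
    (f : C.Hom L (T.obj Z)),
    (T.unitCell S.left' R.right' ((T.str S.left).obj f)).hom ≫
        C.comp₂ R.right' (γ S hjk f).hom (𝟙 (T.unit X)) =
      (T.str S.left).map (T.unitCell S.right R.left f).hom ≫
        (T.strNat R ((T.str S.right).obj f) (T.unit X)).hom
  /-- precomposition with a unit in the right argument -/
  γ_unit_right : ∀ {L M N P : List C.Ob} {j k : ℕ} {X Y Z : D.Ob}
    (S : Parallel L j (J.obj X) [T.obj X] k (J.obj Y) [T.obj Y] j k M N P) (hjk : j < k)
    (R : Parallel M j (J.obj X) [T.obj X] k (T.obj Y) [J.obj Y] j k L P N)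
    (f : C.Hom L (T.obj Z)),
    (T.str S.right).map (T.unitCell S.left R.left f).hom ≫
        (T.strNat R ((T.str S.left).obj f) (T.unit Y)).hom ≫
        C.comp₂ R.right' (γ S hjk f).hom (𝟙 (T.unit Y)) =
      (T.unitCell S.right' R.right' ((T.str S.right).obj f)).hom
  /-- precomposition with a strengthened map in the left argument -/
  γ_mult_left : ∀ {L M N P Ξ A Ξ' A' B B' : List C.Ob} {j k l u k₁ : ℕ} {W X Y Z : D.Ob}
    (S : Parallel L j (J.obj X) [T.obj X] k (J.obj Y) [T.obj Y] j k M N P) (hjk : j < k)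
    (R₁ : Nested P j (T.obj X) Ξ l (J.obj W) [T.obj W] u A Ξ' A')
    (R₂ : Nested N j (T.obj X) Ξ l (J.obj W) [T.obj W] u B Ξ' B')
    (Q : Parallel N k (J.obj Y) [T.obj Y] j (T.obj X) Ξ k₁ j B P A)
    (Q' : Parallel N k (J.obj Y) [T.obj Y] j (T.obj X) Ξ' k₁ j B' P A')
    (S' : Parallel B u (J.obj W) [T.obj W] k₁ (J.obj Y) [T.obj Y] u k₁ A B' A') (hjk' : u < k₁)
    (f : C.Hom L (T.obj Z)) (g : C.Hom Ξ (T.obj X)),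
    (T.multCell S.left' R₁ ((T.str S.left).obj f) g).hom ≫
        C.comp₂ R₁.out' (γ S hjk f).hom (𝟙 ((T.str R₁.inn').obj g)) ≫
        (T.strNat Q' ((T.str S.right).obj f) ((T.str R₁.inn').obj g)).inv =
      (T.str R₁.inn).map (C.comp₂ R₁.out (γ S hjk f).hom (𝟙 g)) ≫
        (T.str R₁.inn).map (T.strNat Q ((T.str S.right).obj f) g).inv ≫
        (γ S' hjk' (C.comp Q.left ((T.str S.right).obj f) g)).hom ≫
        (T.str S'.right').map (T.multCell S.right R₂ f g).hom
  /-- precomposition with a strengthened map in the right argument -/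
  γ_mult_right : ∀ {L M N P Ξ A Ξ' A' B B' : List C.Ob} {j k l u : ℕ} {V X Y Z : D.Ob}
    (S : Parallel L j (J.obj X) [T.obj X] k (J.obj Y) [T.obj Y] j k M N P) (hjk : j < k)
    (R₁ : Nested P k (T.obj Y) Ξ l (J.obj V) [T.obj V] u A Ξ' A')
    (R₂ : Nested M k (T.obj Y) Ξ l (J.obj V) [T.obj V] u B Ξ' B')
    (Q : Parallel M j (J.obj X) [T.obj X] k (T.obj Y) Ξ j k B P A)
    (Q' : Parallel M j (J.obj X) [T.obj X] k (T.obj Y) Ξ' j k B' P A')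
    (S' : Parallel B j (J.obj X) [T.obj X] u (J.obj V) [T.obj V] j u B' A A') (hjk' : j < u)
    (f : C.Hom L (T.obj Z)) (h : C.Hom Ξ (T.obj Y)),
    (T.str S'.left').map (T.multCell S.left R₂ f h).hom ≫
        (T.strNat Q' ((T.str S.left).obj f) ((T.str R₂.inn').obj h)).hom ≫
        C.comp₂ Q'.right' (γ S hjk f).hom (𝟙 ((T.str R₂.inn').obj h)) =
      (γ S' hjk' (C.comp R₂.out ((T.str S.left).obj f) h)).hom ≫
        (T.str S'.right').map (T.strNat Q ((T.str S.left).obj f) h).hom ≫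
        (T.str S'.right').map (C.comp₂ Q.right' (γ S hjk f).hom (𝟙 h)) ≫
        (T.multCell S.right' R₁ ((T.str S.right).obj f) h).hom
  /-- the braiding axiom, for the arguments `s`, `t`, `u` at positions `a < b < c` -/
  γ_braid : ∀ {L Ls Lt Lu Lst Lsu Ltu Lstu : List C.Ob} {a b c : ℕ} {W X Y Z : D.Ob}
    (hab : a < b) (hbc : b < c) (hac : a < c)
    (Stu : Parallel L b (J.obj X) [T.obj X] c (J.obj Y) [T.obj Y] b c Lu Lt Ltu)
    (Ssu : Parallel L a (J.obj W) [T.obj W] c (J.obj Y) [T.obj Y] a c Lu Ls Lsu)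
    (Sst : Parallel L a (J.obj W) [T.obj W] b (J.obj X) [T.obj X] a b Lt Ls Lst)
    (Rsu : Parallel Lt a (J.obj W) [T.obj W] c (J.obj Y) [T.obj Y] a c Ltu Lst Lstu)
    (Rst : Parallel Lu a (J.obj W) [T.obj W] b (J.obj X) [T.obj X] a b Ltu Lsu Lstu)
    (Rtu : Parallel Ls b (J.obj X) [T.obj X] c (J.obj Y) [T.obj Y] b c Lsu Lst Lstu)
    (f : C.Hom L (T.obj Z)),
    (T.str Rsu.left').map (γ Stu hbc f).hom ≫ (γ Rsu hac ((T.str Stu.right).obj f)).hom ≫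
        (T.str Rsu.right').map (γ Sst hab f).hom =
      (γ Rst hab ((T.str Stu.left).obj f)).hom ≫ (T.str Rst.right').map (γ Ssu hac f).hom ≫
        (γ Rtu hbc ((T.str Ssu.right).obj f)).hom

end StrongRelativePseudomonad

/-! ### Multicategorical relative pseudomonads -/

/-- The structure of a multicategorical relative pseudomonad on a relative pseudomonad `T`. -/
structure MulticategoricalStructure {J : MultiFunctor D C} (T : RelativePseudomonad J) where
  /-- `T` is a pseudo-multifunctor -/
  functor : PseudoMultifunctor D C T.obj
  /-- on unary 1-cells, the pseudo-multifunctor is `f ↦ (i ∘ Jf)^*` -/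
  functor_unary : ∀ X Y, functor.map [X] Y =
    J.map [X] Y ⋙ C.postFunctor [J.obj X] (T.unit Y) ⋙ T.ext X Y
  /-- the 2-cells `i ∘ Jf ≅ Tf ∘ (i, …, i)` -/
  ι : ∀ {n : ℕ} {X : Fin n → D.Ob} {Y : D.Ob} (f : D.Hom (List.ofFn X) Y),
    C.post (T.unit Y) ((J.map _ _).obj f) ≅
      C.simult (B := fun k => T.obj (X k)) (A := fun k => J.obj (X k)) List.map_ofFn
        List.map_ofFn ((functor.map _ _).obj f) (fun k => T.unit (X k))
  /-- the extension of 2-cells -/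
  star : ∀ {n : ℕ} {X X' : Fin n → D.Ob} {Y Y' : D.Ob} (f : D.Hom (List.ofFn X) Y)
    (f' : D.Hom (List.ofFn X') Y') (h : C.Hom [J.obj Y] (T.obj Y'))
    (g : ∀ k, C.Hom [J.obj (X k)] (T.obj (X' k))),
    (C.post h ((J.map _ _).obj f) ⟶
      C.simult (B := fun k => T.obj (X' k)) (A := fun k => J.obj (X k)) List.map_ofFn
        List.map_ofFn ((functor.map _ _).obj f') g) →
    (C.post ((T.ext Y Y').obj h) ((functor.map _ _).obj f) ⟶
      C.simult (B := fun k => T.obj (X' k)) (A := fun k => T.obj (X k)) List.map_ofFn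
        List.map_ofFn ((functor.map _ _).obj f')
        (fun k => (T.ext (X k) (X' k)).obj (g k)))
  /-- compatibility with `η` -/
  star_η : ∀ {n : ℕ} {X X' : Fin n → D.Ob} {Y Y' : D.Ob} (f : D.Hom (List.ofFn X) Y)
    (f' : D.Hom (List.ofFn X') Y') (h : C.Hom [J.obj Y] (T.obj Y'))
    (g : ∀ k, C.Hom [J.obj (X k)] (T.obj (X' k)))
    (α : C.post h ((J.map _ _).obj f) ⟶
      C.simult (B := fun k => T.obj (X' k)) (A := fun k => J.obj (X k)) List.map_ofFn
        List.map_ofFn ((functor.map _ _).obj f') g),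
    C.post₂ (T.η h).hom (𝟙 ((J.map _ _).obj f)) ≫
        eqToHom (C.post_post _ _ _) ≫
        C.post₂ (𝟙 ((T.ext Y Y').obj h)) (ι f).hom ≫
        eqToHom (C.post_simult _ _ _ _ _) ≫
        C.simult₂ _ _ (star f f' h g α) (fun k => 𝟙 (T.unit (X k))) ≫
        eqToHom (C.simult_simult _ _ _ _ _ _) =
      α ≫ C.simult₂ _ _ (𝟙 ((functor.map _ _).obj f')) (fun k => (T.η (g k)).hom)
  /-- compatibility with `μ` -/
  star_μ : ∀ {n : ℕ} {X X' X'' : Fin n → D.Ob} {Y Y' Y'' : D.Ob} (f : D.Hom (List.ofFn X) Y)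
    (f' : D.Hom (List.ofFn X') Y') (f'' : D.Hom (List.ofFn X'') Y'')
    (h : C.Hom [J.obj Y] (T.obj Y')) (h' : C.Hom [J.obj Y'] (T.obj Y''))
    (g : ∀ k, C.Hom [J.obj (X k)] (T.obj (X' k))) (g' : ∀ k, C.Hom [J.obj (X' k)] (T.obj (X'' k)))
    (α : C.post h ((J.map _ _).obj f) ⟶
      C.simult (B := fun k => T.obj (X' k)) (A := fun k => J.obj (X k)) List.map_ofFn
        List.map_ofFn ((functor.map _ _).obj f') g)
    (β : C.post h' ((J.map _ _).obj f') ⟶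
      C.simult (B := fun k => T.obj (X'' k)) (A := fun k => J.obj (X' k)) List.map_ofFn
        List.map_ofFn ((functor.map _ _).obj f'') g'),
    C.post₂ (T.μ h' h).hom (𝟙 ((functor.map _ _).obj f)) ≫
        eqToHom (C.post_post _ _ _) ≫
        C.post₂ (𝟙 ((T.ext Y' Y'').obj h')) (star f f' h g α) ≫
        eqToHom (C.post_simult _ _ _ _ _) ≫
        C.simult₂ _ _ (star f' f'' h' g' β) (fun k => 𝟙 ((T.ext (X k) (X' k)).obj (g k))) ≫
        eqToHom (C.simult_simult _ _ _ _ _ _) =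
      star f f'' (C.post ((T.ext Y' Y'').obj h') h)
          (fun k => C.post ((T.ext (X' k) (X'' k)).obj (g' k)) (g k))
          (eqToHom (C.post_post _ _ _) ≫
            C.post₂ (𝟙 ((T.ext Y' Y'').obj h')) α ≫
            eqToHom (C.post_simult _ _ _ _ _) ≫
            C.simult₂ _ _ (star f' f'' h' g' β) (fun k => 𝟙 (g k)) ≫
            eqToHom (C.simult_simult _ _ _ _ _ _)) ≫
        C.simult₂ _ _ (𝟙 ((functor.map _ _).obj f'')) (fun k => (T.μ (g' k) (g k)).hom)
  /-- compatibility with `θ` -/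
  star_θ : ∀ {n : ℕ} {X : Fin n → D.Ob} {Y : D.Ob} (f : D.Hom (List.ofFn X) Y),
    star f f (T.unit Y) (fun k => T.unit (X k)) (ι f).hom ≫
        C.simult₂ _ _ (𝟙 ((functor.map _ _).obj f)) (fun k => (T.θ (X k)).hom) ≫
        eqToHom (C.simult_one _ _ _) =
      C.post₂ (T.θ Y).hom (𝟙 ((functor.map _ _).obj f)) ≫ eqToHom (C.one_comp _ _)

end Monads

/-!
Write `fᵗ` for a strengthening of `f`, `Tf` for `(i ∘ Jf)^{t₁ ⋯ tₙ}`, and `h^*` for the strengthening of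
a unary `h`.

**The pseudo-multifunctor.** The 2-cell `T(f ∘ₖ g) ≅ Tf ∘ₖ Tg` is built by strengthening the arguments
one after the other, from left to right. At the arguments of `f` before the `k`-th it is the
pseudonaturality 2-cell. At the `k`-th argument, `unitCell` replaces `i ∘ Jf` by `(i ∘ Jf)ᵗ ∘ i`, and
`(i ∘ Jf)ᵗ` is then composed with `i ∘ Jg`. At the arguments of `g` it is `multCell`, and at the remaining
arguments of `f` it is pseudonaturality again. These stages are `strAuxComp`, `strAuxMult` and
`strAuxNat`. The associativity axiom (`strAuxComp_strAuxComp`) and the unit axioms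
(`strAuxComp_θ_left`, `strAuxComp_θ_right`) follow by induction on the strengthened arguments. They use,
besides the two axioms of a strong relative pseudomonad, three consequences of these which a
pseudomonad is often required to satisfy as well: `unitCell_multCell`, `unitCell_θ` and `multCell_θ`. The
proofs of these three are the usual ones for redundant unit laws. The pseudocommutativity plays no
role up to here.

**The extension of 2-cells.** Call a 1-cell `F` with an argument `TX` *linear* in it when it is presented
as `F ≅ F₀ᵗ`, and a 2-cell between such 1-cells linear when it comes from a 2-cell `F₀ → F₀'`. Linearity
passes to composites by pseudonaturality and `multCell`, and the axioms say that the
associativity and unity equations of composition are linear 2-cells. Since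
`f ≅ fᵗ ∘ i`, a linear 2-cell is determined by its composite with `i` (`IsLin.ext`), and every 2-cell
`f → G ∘ i` with `G` linear extends to a linear 2-cell `fᵗ → G`.

In several arguments, the 1-cell `f^{t₁ ⋯ tₙ}` is linear by definition only in the last one. It is the
pseudocommutativity `γ` that makes it linear in all of them (`MultiLin.strAux`). Linear structures of `F`
in two arguments *commute* (`Comm`) when they come from one 1-cell with both arguments replaced, by the
two orders of strengthening, and agree up to `γ`. The axioms of a pseudocommutativity say that
commuting structures are stable under composition and, by the braid axiom, under strengthening. If the
linear structures of `G` commute, then the one-variable extension preserves linearity in the earlier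
arguments (`IsLin.extend`). Hence each multilinear `f → G ∘ (i, …, i)` extends to a multilinear
`f^{t₁ ⋯ tₙ} → G` (`exists_extension`), and uniquely so (`IsMultiLin.ext_evAux`).

Both `h^* ∘ Tf` and `Tf' ∘ (g₁^*, …, gₙ^*)` are multilinear and commutative, and the 2-cell
`h ∘ Jf → (h^* ∘ Tf) ∘ (i, …, i)` is invertible. The universal property, applied to both, gives exactly one
multilinear 2-cell `α^* : h^* ∘ Tf → Tf' ∘ (g₁^*, …, gₙ^*)` satisfying condition (1) (`exists_star`). In
conditions (2) and (3) both sides are multilinear, so that it suffices to compare them after composition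
with the units, where they reduce to (1) and the identities between `η`, `μ` and `θ` (`star_μ_of`,
`star_θ_of`).
-/

/-! ### Composition of 2-cells in a 2-multicategory -/

namespace TwoMulticategory

variable (C : TwoMulticategory.{u, v, w})

section Comp

variable {L Ξ M : List C.Ob} {k : ℕ} {X Y : C.Ob} (s : Replaces L k X Ξ M)

theorem comp₂_comp_id {f f' f'' : C.Hom L Y} (α : f ⟶ f') (α' : f' ⟶ f'') (g : C.Hom Ξ X) :
    C.comp₂ s (α ≫ α') (𝟙 g) = C.comp₂ s α (𝟙 g) ≫ C.comp₂ s α' (𝟙 g) := by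
  rw [← C.comp₂_comp, Category.comp_id]

theorem comp₂_id_comp (f : C.Hom L Y) {g g' g'' : C.Hom Ξ X} (β : g ⟶ g') (β' : g' ⟶ g'') :
    C.comp₂ s (𝟙 f) (β ≫ β') = C.comp₂ s (𝟙 f) β ≫ C.comp₂ s (𝟙 f) β' := by
  rw [← C.comp₂_comp, Category.comp_id]

theorem comp₂_left_right {f f' : C.Hom L Y} {g g' : C.Hom Ξ X} (α : f ⟶ f') (β : g ⟶ g') :
    C.comp₂ s α (𝟙 g) ≫ C.comp₂ s (𝟙 f') β = C.comp₂ s α β := by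
  rw [← C.comp₂_comp, Category.comp_id, Category.id_comp]

theorem comp₂_right_left {f f' : C.Hom L Y} {g g' : C.Hom Ξ X} (α : f ⟶ f') (β : g ⟶ g') :
    C.comp₂ s (𝟙 f) β ≫ C.comp₂ s α (𝟙 g') = C.comp₂ s α β := by
  rw [← C.comp₂_comp, Category.comp_id, Category.id_comp]

theorem comp₂_exchange {f f' : C.Hom L Y} {g g' : C.Hom Ξ X} (α : f ⟶ f') (β : g ⟶ g') :
    C.comp₂ s α (𝟙 g) ≫ C.comp₂ s (𝟙 f') β = C.comp₂ s (𝟙 f) β ≫ C.comp₂ s α (𝟙 g') := by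
  rw [comp₂_left_right, comp₂_right_left]

@[simp]
theorem comp₂_eqToHom_id {f f' : C.Hom L Y} (g : C.Hom Ξ X) (h : f = f') :
    C.comp₂ s (eqToHom h) (𝟙 g) = eqToHom (by rw [h]) := by
  subst h; exact C.comp₂_id _ _ _

@[simp]
theorem comp₂_id_eqToHom (f : C.Hom L Y) {g g' : C.Hom Ξ X} (h : g = g') :
    C.comp₂ s (𝟙 f) (eqToHom h) = eqToHom (by rw [h]) := by
  subst h; exact C.comp₂_id _ _ _

/-- The invertible 2-cell between composites given by two invertible 2-cells. -/
@[simps]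
def compIso {f f' : C.Hom L Y} {g g' : C.Hom Ξ X} (α : f ≅ f') (β : g ≅ g') :
    C.comp s f g ≅ C.comp s f' g' where
  hom := C.comp₂ s α.hom β.hom
  inv := C.comp₂ s α.inv β.inv
  hom_inv_id := by rw [← C.comp₂_comp, α.hom_inv_id, β.hom_inv_id, C.comp₂_id]
  inv_hom_id := by rw [← C.comp₂_comp, α.inv_hom_id, β.inv_hom_id, C.comp₂_id]

instance isIso_comp₂ {f f' : C.Hom L Y} {g g' : C.Hom Ξ X} (α : f ⟶ f') (β : g ⟶ g') [IsIso α]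
    [IsIso β] : IsIso (C.comp₂ s α β) :=
  (C.compIso s (asIso α) (asIso β)).isIso_hom

end Comp

theorem assoc₂_eqToHom {L Ξ Θ M Ξ' N : List C.Ob} {k l r : ℕ} {X X' Y : C.Ob}
    (S : Nested L k X Ξ l X' Θ r M Ξ' N) {f f' : C.Hom L Y} {g g' : C.Hom Ξ X} {h h' : C.Hom Θ X'}
    (α : f ⟶ f') (β : g ⟶ g') (δ : h ⟶ h') :
    C.comp₂ S.inn (C.comp₂ S.out α β) δ ≫ eqToHom (C.assoc S f' g' h') =
      eqToHom (C.assoc S f g h) ≫ C.comp₂ S.out' α (C.comp₂ S.inn' β δ) := by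
  apply eq_of_heq
  simpa [-heq_eq_eq] using C.assoc₂ S α β δ

theorem parallel₂_eqToHom {L Φ Ω M N P : List C.Ob} {j k p q : ℕ} {A B Y : C.Ob}
    (S : Parallel L j A Φ k B Ω p q M N P) {f f' : C.Hom L Y} {a a' : C.Hom Φ A} {b b' : C.Hom Ω B}
    (φ : f ⟶ f') (α : a ⟶ a') (β : b ⟶ b') :
    C.comp₂ S.left' (C.comp₂ S.left φ β) α ≫ eqToHom (C.parallel S f' a' b') =
      eqToHom (C.parallel S f a b) ≫ C.comp₂ S.right' (C.comp₂ S.right φ α) β := by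
  apply eq_of_heq
  simpa [-heq_eq_eq] using C.parallel₂ S φ α β

theorem comp₂_one_eqToHom {L : List C.Ob} {k : ℕ} {X Y : C.Ob} (s : Replaces L k X [X] L)
    {f f' : C.Hom L Y} (α : f ⟶ f') :
    C.comp₂ s α (𝟙 (C.one X)) ≫ eqToHom (C.comp_one s f') = eqToHom (C.comp_one s f) ≫ α := by
  apply eq_of_heq
  simpa [-heq_eq_eq] using C.comp₂_one s α

theorem one_comp₂_eqToHom {L : List C.Ob} {Y : C.Ob} (s : Replaces [Y] 0 Y L L)
    {f f' : C.Hom L Y} (α : f ⟶ f') :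
    C.comp₂ s (𝟙 (C.one Y)) α ≫ eqToHom (C.one_comp s f') = eqToHom (C.one_comp s f) ≫ α := by
  apply eq_of_heq
  simpa [-heq_eq_eq] using C.one_comp₂ s α

end TwoMulticategory

/-! ### Coherence of strengthening -/

namespace StrongRelativePseudomonad

variable {D : TwoMulticategory.{u, v, w}} {C : TwoMulticategory.{u', v', w'}}
  {J : MultiFunctor D C} (T : StrongRelativePseudomonad J)

theorem strNat_comp_eqToHom {L Ξ Θ M Ξ' N L₁ M₁ N₁ : List C.Ob} {j k l r p p' q q' : ℕ}
    {X Y : D.Ob} {B B' : C.Ob} (S : Nested L k B Ξ l B' Θ r M Ξ' N)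
    (S₁ : Parallel L j (J.obj X) [T.obj X] k B Ξ p q M L₁ M₁)
    (S₂ : Parallel M p (J.obj X) [T.obj X] r B' Θ p' q' N M₁ N₁)
    (S₃ : Parallel L j (J.obj X) [T.obj X] k B Ξ' p' q N L₁ N₁)
    (S' : Nested L₁ q B Ξ l B' Θ q' M₁ Ξ' N₁)
    (f : C.Hom L (T.obj Y)) (b : C.Hom Ξ B) (b' : C.Hom Θ B') :
    (T.strNat S₂ (C.comp S.out f b) b').hom ≫ C.comp₂ S₂.right' (T.strNat S₁ f b).hom (𝟙 b') ≫
        eqToHom (C.assoc S' ((T.str S₁.right).obj f) b b') =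
      (T.str S₂.left').map (eqToHom (C.assoc S f b b')) ≫
        (T.strNat S₃ f (C.comp S.inn' b b')).hom := by
  apply eq_of_heq
  simpa [-heq_eq_eq, eqToHom_map, ← Category.assoc] using (T.strNat_comp S S₁ S₂ S₃ f b b').symm

theorem strNat_parallel_eqToHom {L Ξ Ξ' M M' R L₁ M₁ M₁' R₁ : List C.Ob}
    {j k k' c c' p p' q q' r d d' : ℕ}
    {X Y : D.Ob} {B B' : C.Ob} (S : Parallel L k B Ξ k' B' Ξ' c c' M' M R)
    (S₁ : Parallel L j (J.obj X) [T.obj X] k B Ξ p q M L₁ M₁)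
    (S₂ : Parallel M p (J.obj X) [T.obj X] c' B' Ξ' r d R M₁ R₁)
    (S₁' : Parallel L j (J.obj X) [T.obj X] k' B' Ξ' p' q' M' L₁ M₁')
    (S₂' : Parallel M' p' (J.obj X) [T.obj X] c B Ξ r d' R M₁' R₁)
    (S' : Parallel L₁ q B Ξ q' B' Ξ' d' d M₁' M₁ R₁)
    (f : C.Hom L (T.obj Y)) (b : C.Hom Ξ B) (b' : C.Hom Ξ' B') :
    (T.str S₂'.left').map (eqToHom (C.parallel S f b b')) ≫
      (T.strNat S₂ (C.comp S.right f b) b').hom ≫ C.comp₂ S₂.right' (T.strNat S₁ f b).hom (𝟙 b') =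
      (T.strNat S₂' (C.comp S.left f b') b).hom ≫
        C.comp₂ S₂'.right' (T.strNat S₁' f b').hom (𝟙 b) ≫
        eqToHom (C.parallel S' ((T.str S₁.right).obj f) b b') := by
  apply eq_of_heq
  rw [← Category.assoc (T.strNat S₂' _ _).hom]
  simpa only [eqToHom_map, eqToHom_comp_heq_iff, heq_comp_eqToHom_iff] using
    T.strNat_parallel S S₁ S₂ S₁' S₂' f b b'

theorem strNat_one_eqToHom {L N : List C.Ob} {j k p q : ℕ} {X Y : D.Ob} {B : C.Ob}
    (S : Parallel L j (J.obj X) [T.obj X] k B [B] p q L N N) (f : C.Hom L (T.obj Y)) :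
    (T.strNat S f (C.one B)).hom ≫ eqToHom (C.comp_one S.right' _) =
      (T.str S.left').map (eqToHom (C.comp_one S.left f)) ≫
        eqToHom (by have := S.hp; have := S.ne; congr 2; simp_all [shift]) := by
  apply eq_of_heq
  simp only [eqToHom_map, eqToHom_trans, comp_eqToHom_heq_iff]
  exact (T.strNat_one S f).trans (eqToHom_heq_id_cod _ _ _).symm

theorem multCell_strNat_left_eqToHom {L Ω M N P Ξ A Ξ' A' A₁ A₁' : List C.Ob}
    {j k p q l u u₁ a a' : ℕ} {W X Y : D.Ob} {B : C.Ob}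
    (S : Parallel L j (J.obj X) [T.obj X] k B Ω p q M N P)
    (R : Nested N j (T.obj X) Ξ l (J.obj W) [T.obj W] u A Ξ' A')
    (R₁ : Nested P p (T.obj X) Ξ l (J.obj W) [T.obj W] u₁ A₁ Ξ' A₁')
    (S₁ : Parallel A u (J.obj W) [T.obj W] a B Ω u₁ a' A₁ A' A₁')
    (S₂ : Parallel N j (T.obj X) Ξ q B Ω p a P A A₁)
    (S₃ : Parallel N j (T.obj X) Ξ' q B Ω p a' P A' A₁')
    (f : C.Hom L (T.obj Y)) (b : C.Hom Ω B) (g : C.Hom Ξ (T.obj X)) :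
    (T.multCell S.left' R₁ (C.comp S.left f b) g).hom ≫
        C.comp₂ R₁.out' (T.strNat S f b).hom (𝟙 ((T.str R₁.inn').obj g)) ≫
        eqToHom (C.parallel S₃ _ _ _) =
      (T.str R₁.inn).map (C.comp₂ R₁.out (T.strNat S f b).hom (𝟙 g)) ≫
        (T.str R₁.inn).map (eqToHom (C.parallel S₂ ((T.str S.right).obj f) g b)) ≫
        (T.strNat S₁ (C.comp R.out ((T.str S.right).obj f) g) b).hom ≫
        C.comp₂ S₁.right' (T.multCell S.right R f g).hom (𝟙 b) := by
  apply eq_of_heq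
  simpa [-heq_eq_eq, eqToHom_map, ← Category.assoc] using (T.multCell_strNat_left S R R₁ S₁ S₂ f b g)

theorem multCell_strNat_right_eqToHom {L M Ξ Ω Ξ₁ Ξ' Ξ₁' A A' A₁ A₁' : List C.Ob}
    {j l m p q u u₁ a a' : ℕ} {W X Y : D.Ob} {B : C.Ob}
    (s : Replaces L j (J.obj X) [T.obj X] M)
    (S : Parallel Ξ l (J.obj W) [T.obj W] m B Ω p q Ξ₁ Ξ' Ξ₁')
    (R : Nested M j (T.obj X) Ξ l (J.obj W) [T.obj W] u A Ξ' A')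
    (R₁ : Nested M j (T.obj X) Ξ₁ p (J.obj W) [T.obj W] u₁ A₁ Ξ₁' A₁')
    (R₂ : Nested M j (T.obj X) Ξ m B Ω a A Ξ₁ A₁)
    (R₃ : Nested M j (T.obj X) Ξ' q B Ω a' A' Ξ₁' A₁')
    (S₁ : Parallel A u (J.obj W) [T.obj W] a B Ω u₁ a' A₁ A' A₁')
    (f : C.Hom L (T.obj Y)) (g : C.Hom Ξ (T.obj X)) (b : C.Hom Ω B) :
    (T.strNat S₁ (C.comp R.out ((T.str s).obj f) g) b).hom ≫
        C.comp₂ S₁.right' (T.multCell s R f g).hom (𝟙 b) ≫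
        eqToHom (C.assoc R₃ ((T.str s).obj f) ((T.str R.inn').obj g) b) =
      (T.str S₁.left').map (eqToHom (C.assoc R₂ ((T.str s).obj f) g b)) ≫
        (T.multCell s R₁ f (C.comp S.left g b)).hom ≫
        C.comp₂ R₁.out' (𝟙 ((T.str s).obj f)) (T.strNat S g b).hom := by
  apply eq_of_heq
  rw [← Category.assoc (T.strNat S₁ _ _).hom]
  simpa only [eqToHom_map, heq_eqToHom_comp_iff, comp_eqToHom_heq_iff] using
    (T.multCell_strNat_right s S R R₁ R₂ S₁ f g b).symm

theorem associativity_eqToHom {L M Ξ A Ξ' A' Θ B Θ' B' E E' : List C.Ob} {j l m u r x : ℕ}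
    {V W X Y : D.Ob} (s : Replaces L j (J.obj X) [T.obj X] M)
    (S₁ : Nested M j (T.obj X) Ξ l (J.obj W) [T.obj W] u A Ξ' A')
    (S₂ : Nested Ξ' l (T.obj W) Θ m (J.obj V) [T.obj V] r B Θ' B')
    (S₃ : Nested A' u (T.obj W) Θ m (J.obj V) [T.obj V] x E Θ' E')
    (S₄ : Nested M j (T.obj X) B r (J.obj V) [T.obj V] x E B' E')
    (S₅ : Nested M j (T.obj X) Ξ' l (T.obj W) Θ u A' B E)
    (S₆ : Nested M j (T.obj X) Ξ' l (T.obj W) Θ' u A' B' E')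
    (f : C.Hom L (T.obj Y)) (g : C.Hom Ξ (T.obj X)) (h : C.Hom Θ (T.obj W)) :
    (T.multCell S₁.inn S₃ (C.comp S₁.out ((T.str s).obj f) g) h).hom ≫
        C.comp₂ S₃.out' (T.multCell s S₁ f g).hom (𝟙 ((T.str S₃.inn').obj h)) ≫
        eqToHom (C.assoc S₆ _ _ _) =
      (T.str S₃.inn).map (C.comp₂ S₃.out (T.multCell s S₁ f g).hom (𝟙 h)) ≫
        (T.str S₃.inn).map (eqToHom (C.assoc S₅ ((T.str s).obj f) ((T.str S₁.inn').obj g) h)) ≫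
        (T.multCell s S₄ f (C.comp S₂.out ((T.str S₁.inn').obj g) h)).hom ≫
        C.comp₂ S₄.out' (𝟙 ((T.str s).obj f)) (T.multCell S₁.inn' S₂ g h).hom := by
  apply eq_of_heq
  simpa [-heq_eq_eq, eqToHom_map, ← Category.assoc] using
    (T.associativity s S₁ S₂ S₃ S₄ S₅ f g h)

theorem unitality_eqToHom {L M : List C.Ob} {j : ℕ} {X Y : D.Ob}
    (s : Replaces L j (J.obj X) [T.obj X] M) (s' : Replaces M j (T.obj X) [T.obj X] M)
    (S : Nested M j (T.obj X) [J.obj X] 0 (J.obj X) [T.obj X] j L [T.obj X] M)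
    (f : C.Hom L (T.obj Y)) :
    (T.str s).map (T.unitCell s S.out f).hom ≫ (T.multCell s S f (T.unit X)).hom ≫
        C.comp₂ S.out' (𝟙 ((T.str s).obj f)) (T.θ X).hom ≫ eqToHom (C.comp_one s' _) =
      𝟙 ((T.str s).obj f) := by
  apply eq_of_heq
  rw [← Category.assoc, ← Category.assoc, comp_eqToHom_heq_iff, Category.assoc]
  exact T.unitality s S f

end StrongRelativePseudomonad

/-! ### Replacing single entries of a context -/

section Contexts

variable {α : Type*}

theorem Replaces.unary_iff {L M : List α} {k : ℕ} {X Y : α} :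
    Replaces L k X [Y] M ↔ L[k]? = some X ∧ M = L.set k Y := by
  constructor
  · rintro ⟨Γ, Δ, rfl, rfl, rfl⟩
    simp
  · rintro ⟨h, rfl⟩
    obtain ⟨hk, hX⟩ := List.getElem?_eq_some_iff.mp h
    refine ⟨L.take k, L.drop (k + 1), by simp; omega, ?_, ?_⟩
    · rw [← hX]; simp
    · rw [List.set_eq_take_append_cons_drop]; simp [hk]

theorem Replaces.back {L M : List α} {k : ℕ} {X Y : α} (s : Replaces L k X [Y] M) :
    Replaces M k Y [X] L := by
  obtain ⟨Γ, Δ, h, rfl, rfl⟩ := s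
  exact ⟨Γ, Δ, h, by simp, by simp⟩

theorem Replaces.self {L M Ξ : List α} {k : ℕ} {X : α} (s : Replaces L k X Ξ M) :
    Replaces L k X [X] L := by
  obtain ⟨Γ, Δ, h, rfl, rfl⟩ := s
  exact ⟨Γ, Δ, h, by simp, by simp⟩

theorem Replaces.eq_of_source {L M M' Ξ : List α} {k : ℕ} {X X' : α} (s : Replaces L k X Ξ M)
    (s' : Replaces L k X' Ξ M') : X = X' ∧ M = M' := by
  obtain ⟨Γ, Δ, h, rfl, rfl⟩ := s
  obtain ⟨Γ', Δ', h', e, rfl⟩ := s'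
  obtain ⟨rfl, h⟩ := List.append_inj e (by omega)
  obtain ⟨rfl, rfl⟩ := List.cons.inj h
  exact ⟨rfl, rfl⟩

theorem Replaces.source_unique {L L' M : List α} {k : ℕ} {X Y : α} (s : Replaces L k X [Y] M)
    (s' : Replaces L' k X [Y] M) : L = L' :=
  (s.back.eq_of_source s'.back).2

theorem Nested.of {L Ξ Θ M Ξ' N : List α} {k l r : ℕ} {X Y : α} (hr : r = k + l)
    (out : Replaces L k X Ξ M) (inn' : Replaces Ξ l Y Θ Ξ') (out' : Replaces L k X Ξ' N) :
    Nested L k X Ξ l Y Θ r M Ξ' N := by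
  refine ⟨hr, out, ?_, inn', out'⟩
  obtain ⟨Γ, Δ, h, rfl, rfl⟩ := out
  obtain ⟨Γ', Δ', h', e, rfl⟩ := out'
  obtain ⟨rfl, h⟩ := List.append_inj e (by omega)
  obtain ⟨-, rfl⟩ := List.cons.inj h
  obtain ⟨Γ₁, Δ₁, h₁, rfl, rfl⟩ := inn'
  exact ⟨Γ ++ Γ₁, Δ₁ ++ Δ, by simp; omega, by simp, by simp⟩

theorem Nested.unary {L M N : List α} {k : ℕ} {X Y Z : α} (s : Replaces L k X [Y] M)
    (s' : Replaces L k X [Z] N) : Nested L k X [Y] 0 Y [Z] k M [Z] N :=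
  Nested.of rfl s (Replaces.whole _ _) s'

theorem Nested.back {L Ξ M Ξ' N : List α} {k l r : ℕ} {X Y Z : α}
    (S : Nested L k X Ξ l Y [Z] r M Ξ' N) : Nested L k X Ξ' l Z [Y] r N Ξ M :=
  Nested.of S.hr S.out' S.inn'.back S.out

theorem Nested.self {L Ξ Θ M Ξ' N : List α} {k l r : ℕ} {X Y : α}
    (S : Nested L k X Ξ l Y Θ r M Ξ' N) : Nested L k X Ξ l Y [Y] r M Ξ M :=
  Nested.of S.hr S.out S.inn'.self S.out

end Contexts

namespace TwoMulticategory

variable (C : TwoMulticategory.{u, v, w})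

theorem eqToHom_swap {A : Type*} [Category* A] {a b c d : A} {x : a ⟶ c} {y : b ⟶ d} (h : c = d)
    (h' : a = b) (e : x ≫ eqToHom h = eqToHom h' ≫ y) :
    y ≫ eqToHom h.symm = eqToHom h'.symm ≫ x := by
  subst h h'
  simpa using e.symm

theorem post_comp {L Θ M : List C.Ob} {l : ℕ} {X Y Z : C.Ob} (s : Replaces L l X Θ M)
    (h : C.Hom [Y] Z) (f : C.Hom L Y) (c : C.Hom Θ X) :
    C.post h (C.comp s f c) = C.comp s (C.post h f) c :=
  (C.assoc (Nested.of (by simp) (Replaces.whole _ _) s (Replaces.whole _ _)) h f c).symm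

theorem comp_post {L M N Θ : List C.Ob} {k : ℕ} {X X' Y : C.Ob}
    (S : Nested L k X [X'] 0 X' Θ k M Θ N) (f : C.Hom L Y) (g : C.Hom [X'] X) (h : C.Hom Θ X') :
    C.comp S.inn (C.comp S.out f g) h = C.comp S.out' f (C.post g h) :=
  C.assoc S f g h

/-- `assoc₂_eqToHom` for a unary 1-cell in the middle. -/
theorem comp_post₂_eqToHom {L M N Θ : List C.Ob} {k : ℕ} {X X' Y : C.Ob}
    (S : Nested L k X [X'] 0 X' Θ k M Θ N) {f f' : C.Hom L Y} {g g' : C.Hom [X'] X}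
    {h h' : C.Hom Θ X'} (α : f ⟶ f') (β : g ⟶ g') (δ : h ⟶ h') :
    C.comp₂ S.inn (C.comp₂ S.out α β) δ ≫ eqToHom (C.comp_post S f' g' h') =
      eqToHom (C.comp_post S f g h) ≫ C.comp₂ S.out' α (C.post₂ β δ) :=
  C.assoc₂_eqToHom S α β δ

theorem post₂_comp_eqToHom {L Θ M : List C.Ob} {l : ℕ} {X Y Z : C.Ob} (s : Replaces L l X Θ M)
    {h h' : C.Hom [Y] Z} {f f' : C.Hom L Y} {c c' : C.Hom Θ X} (α : h ⟶ h') (β : f ⟶ f')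
    (δ : c ⟶ c') :
    C.post₂ α (C.comp₂ s β δ) ≫ eqToHom (C.post_comp s h' f' c') =
      eqToHom (C.post_comp s h f c) ≫ C.comp₂ s (C.post₂ α β) δ := by
  have S : Nested [Y] 0 Y L l X Θ l L M M :=
    Nested.of (by simp) (Replaces.whole _ _) s (Replaces.whole _ _)
  have := C.assoc₂_eqToHom S α β δ
  exact eqToHom_swap _ _ this

theorem post_one {X Y : C.Ob} (h : C.Hom [X] Y) : C.post h (C.one X) = h :=
  C.comp_one _ h

end TwoMulticategory

namespace StrongRelativePseudomonad

variable {D : TwoMulticategory.{u, v, w}} {C : TwoMulticategory.{u', v', w'}}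
  {J : MultiFunctor D C} (T : StrongRelativePseudomonad J)

/-! ### Consequences of the axioms of a strong relative pseudomonad -/

/-- Strengthening is faithful, since `f ≅ fᵗ ∘ i` naturally in `f`. -/
theorem str_map_injective {L M : List C.Ob} {j : ℕ} {X Y : D.Ob}
    (s : Replaces L j (J.obj X) [T.obj X] M) {f f' : C.Hom L (T.obj Y)} {α β : f ⟶ f'}
    (h : (T.str s).map α = (T.str s).map β) : α = β := by
  have e₁ := T.unitCell_naturality s s.back α
  have e₂ := T.unitCell_naturality s s.back β
  rw [h, ← e₂] at e₁
  exact (cancel_mono _).mp e₁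

/-- The `unitCell` of `fᵗ ∘ g` is the composite of `fᵗ` with the `unitCell` of `g`. As for monoids,
where a unit law follows from associativity and the other unit law, this follows from `associativity`
and `unitality`. -/
theorem unitCell_multCell {L M Ξ A Ξ' A' : List C.Ob} {j l u : ℕ} {W X Y : D.Ob}
    (s : Replaces L j (J.obj X) [T.obj X] M)
    (S : Nested M j (T.obj X) Ξ l (J.obj W) [T.obj W] u A Ξ' A')
    (f : C.Hom L (T.obj Y)) (g : C.Hom Ξ (T.obj X)) :
    (T.unitCell S.inn S.back.inn (C.comp S.out ((T.str s).obj f) g)).hom ≫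
        C.comp₂ S.back.inn (T.multCell s S f g).hom (𝟙 (T.unit W)) ≫
        eqToHom (C.assoc S.back _ _ _) =
      C.comp₂ S.out (𝟙 _) (T.unitCell S.inn' S.back.inn' g).hom := by
  apply T.str_map_injective S.inn
  have hs : Replaces A' u (T.obj W) [T.obj W] A' := S.back.inn.self
  have hs' : Replaces Ξ' l (T.obj W) [T.obj W] Ξ' := S.back.inn'.self
  have S₂ : Nested Ξ' l (T.obj W) [J.obj W] 0 (J.obj W) [T.obj W] l Ξ [T.obj W] Ξ' :=
    Nested.unary S.inn'.back hs'
  have S₃ : Nested A' u (T.obj W) [J.obj W] 0 (J.obj W) [T.obj W] u A [T.obj W] A' :=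
    Nested.unary S.inn.back hs
  have S₆ := S.back.self
  have as := T.associativity_eqToHom s S S₂ S₃ S S.back S₆ f g (T.unit W)
  have un := T.unitality_eqToHom S.inn hs S₃ (C.comp S.out ((T.str s).obj f) g)
  have un' := T.unitality_eqToHom S.inn' hs' S₂ g
  have nat := T.multCell_naturality s S (𝟙 f) (T.unitCell S.inn' S.back.inn' g).hom
  have a₂ := C.assoc₂_eqToHom S₆ (𝟙 ((T.str s).obj f)) (𝟙 ((T.str S.inn').obj g)) (T.θ W).hom
  rw [C.comp₂_id] at a₂
  have ex := C.comp₂_exchange S₃.out' (T.multCell s S f g).hom (T.θ W).hom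
  have on := C.comp₂_one_eqToHom hs (T.multCell s S f g).hom
  simp only [CategoryTheory.Functor.map_id] at nat
  -- it suffices to compare the two 2-cells after an invertible one, which takes both to `multCell`
  rw [← cancel_mono ((T.multCell s S f (C.comp S₂.out ((T.str S.inn').obj g) (T.unit W))).hom ≫
    C.comp₂ S.out' (𝟙 ((T.str s).obj f)) (T.multCell S.inn' S₂ g (T.unit W)).hom ≫
    C.comp₂ S.out' (𝟙 ((T.str s).obj f)) (C.comp₂ S₂.out' (𝟙 _) (T.θ W).hom ≫
      eqToHom (C.comp_one hs' _)))]
  trans (T.multCell s S f g).hom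
  · simp only [CategoryTheory.Functor.map_comp, Category.assoc]
    rw [← reassoc_of% as, C.comp₂_id_comp, ← reassoc_of% a₂, reassoc_of% ex]
    rw [C.comp₂_id_eqToHom, eqToHom_trans, on, reassoc_of% un]
  · rw [reassoc_of% nat, ← C.comp₂_id_comp, ← C.comp₂_id_comp, un', C.comp₂_id, Category.comp_id]

/-- Composition with `i_Xᵗ` is faithful, since `i_Xᵗ ≅ 1`. -/
theorem comp₂_unit_injective {L : List C.Ob} {X : D.Ob}
    (s : Replaces [J.obj X] 0 (J.obj X) [T.obj X] [T.obj X])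
    (r : Replaces [T.obj X] 0 (T.obj X) L L) {f f' : C.Hom L (T.obj X)} {α β : f ⟶ f'}
    (h : C.comp₂ r (𝟙 ((T.str s).obj (T.unit X))) α =
      C.comp₂ r (𝟙 ((T.str s).obj (T.unit X))) β) : α = β := by
  have e₁ := C.comp₂_exchange r (T.θ X).hom α
  have e₂ := C.comp₂_exchange r (T.θ X).hom β
  rw [h, ← e₂, cancel_epi] at e₁
  have o₁ := C.one_comp₂_eqToHom r α
  rw [e₁, C.one_comp₂_eqToHom r β] at o₁
  exact ((cancel_epi _).mp o₁).symm

/-- The composite of the `unitCell` of `i` with `θ` is trivial. As for monoidal categories, where the two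
unit constraints of the unit agree, this follows from the other axioms, since composition with `iᵗ` is
faithful. -/
theorem unitCell_θ (X : D.Ob) (s : Replaces [J.obj X] 0 (J.obj X) [T.obj X] [T.obj X])
    (s' : Replaces [T.obj X] 0 (T.obj X) [J.obj X] [J.obj X]) :
    (T.unitCell s s' (T.unit X)).hom ≫ C.comp₂ s' (T.θ X).hom (𝟙 (T.unit X)) ≫
      eqToHom (C.one_comp _ _) = 𝟙 (T.unit X) := by
  apply T.comp₂_unit_injective s s'
  have hs : Replaces [T.obj X] 0 (T.obj X) [T.obj X] [T.obj X] := Replaces.whole _ _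
  have S : Nested [T.obj X] 0 (T.obj X) [J.obj X] 0 (J.obj X) [T.obj X] 0 [J.obj X] [T.obj X]
    [T.obj X] := Nested.unary s' hs
  have em := T.unitCell_multCell s S (T.unit X) (T.unit X)
  have un := T.unitality_eqToHom s hs S (T.unit X)
  have a₂ := C.assoc₂_eqToHom S.back (𝟙 ((T.str s).obj (T.unit X))) (T.θ X).hom (𝟙 (T.unit X))
  have nat := T.unitCell_naturality s s' (T.unitCell s s' (T.unit X)).hom
  rw [cancel_epi] at nat
  have key : C.comp₂ s' ((T.str s).map (T.unitCell s s' (T.unit X)).hom) (𝟙 (T.unit X)) ≫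
      C.comp₂ s' (T.multCell s S (T.unit X) (T.unit X)).hom (𝟙 (T.unit X)) ≫
      C.comp₂ s' (C.comp₂ hs (𝟙 _) (T.θ X).hom) (𝟙 (T.unit X)) ≫
      C.comp₂ s' (eqToHom (C.comp_one hs _)) (𝟙 (T.unit X)) = 𝟙 _ := by
    rw [← C.comp₂_comp_id, ← C.comp₂_comp_id, ← C.comp₂_comp_id, un, C.comp₂_id]
  rw [C.comp₂_id_comp, C.comp₂_id_comp, ← em, Category.assoc, Category.assoc, ← reassoc_of% a₂,
    nat, C.comp₂_id]
  rw [C.comp₂_eqToHom_id] at key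
  rw [C.comp₂_id_eqToHom, eqToHom_trans]
  exact key

/-- `θ` is compatible with strengthening in any argument. -/
theorem multCell_θ {L M : List C.Ob} {j : ℕ} {W X : D.Ob}
    (s : Replaces [J.obj X] 0 (J.obj X) [T.obj X] [T.obj X])
    (S : Nested [T.obj X] 0 (T.obj X) L j (J.obj W) [T.obj W] j L M M) (f : C.Hom L (T.obj X)) :
    (T.multCell s S (T.unit X) f).hom ≫ C.comp₂ S.out' (T.θ X).hom (𝟙 ((T.str S.inn').obj f)) ≫
        eqToHom (C.one_comp _ _) =
      (T.str S.inn).map (C.comp₂ S.out (T.θ X).hom (𝟙 f) ≫ eqToHom (C.one_comp _ _)) := by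
  apply T.comp₂_unit_injective s S.out'
  have hs : Replaces [T.obj X] 0 (T.obj X) [T.obj X] [T.obj X] := Replaces.whole _ _
  have S₁ : Nested [T.obj X] 0 (T.obj X) [J.obj X] 0 (J.obj X) [T.obj X] 0 [J.obj X] [T.obj X]
    [T.obj X] := Nested.unary (Replaces.whole _ _) hs
  have S₅ : Nested [T.obj X] 0 (T.obj X) [T.obj X] 0 (T.obj X) L 0 [T.obj X] L L :=
    Nested.of rfl hs S.out S.out
  have S₆ : Nested [T.obj X] 0 (T.obj X) [T.obj X] 0 (T.obj X) M 0 [T.obj X] M M :=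
    Nested.of rfl hs S.out' S.out'
  have as := T.associativity_eqToHom s S₁ S S S S₅ S₆ (T.unit X) (T.unit X) f
  have un := T.unitality_eqToHom s hs S₁ (T.unit X)
  have nat := T.multCell_naturality s S (T.unitCell s S₁.out (T.unit X)).inv (𝟙 f)
  have nat' := T.multCell_naturality s S (𝟙 (T.unit X))
    (C.comp₂ S.out (T.θ X).hom (𝟙 f) ≫ eqToHom (C.one_comp _ _))
  have a₂ := C.assoc₂_eqToHom S₆ (𝟙 ((T.str s).obj (T.unit X))) (T.θ X).hom
    (𝟙 ((T.str S.inn').obj f))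
  have a₂' := C.assoc₂_eqToHom S₅ (𝟙 ((T.str s).obj (T.unit X))) (T.θ X).hom (𝟙 f)
  rw [CategoryTheory.Functor.map_id] at nat nat'
  have key : (T.multCell s S₁ (T.unit X) (T.unit X)).hom ≫
      C.comp₂ S₁.out' (𝟙 ((T.str s).obj (T.unit X))) (T.θ X).hom =
      (T.str s).map (T.unitCell s S₁.out (T.unit X)).inv ≫ eqToHom (C.comp_one hs _).symm := by
    rw [← cancel_mono (eqToHom (C.comp_one hs _)), Category.assoc, Category.assoc, eqToHom_trans,
      eqToHom_refl, Category.comp_id,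
      ← cancel_epi ((T.str s).map (T.unitCell s S₁.out (T.unit X)).hom), un,
      ← CategoryTheory.Functor.map_comp, Iso.hom_inv_id, CategoryTheory.Functor.map_id]
  rw [← cancel_epi ((T.str S.inn).map (C.comp₂ S.out (T.multCell s S₁ _ _).hom (𝟙 f)) ≫
    (T.str S.inn).map (eqToHom (C.assoc S₅ _ _ f)) ≫ (T.multCell s S _ _).hom)]
  simp only [Category.assoc, C.comp₂_id_comp]
  rw [← reassoc_of% as, ← reassoc_of% a₂, ← reassoc_of% C.comp₂_comp_id, key, ← nat']
  simp only [C.comp₂_comp_id, C.comp₂_eqToHom_id, C.comp₂_id_eqToHom, C.comp₂_id_comp,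
    eqToHom_trans, Category.assoc, CategoryTheory.Functor.map_comp]
  have a₃ := congrArg (T.str S.inn).map a₂'
  simp only [CategoryTheory.Functor.map_comp] at a₃
  rw [← reassoc_of% nat, ← reassoc_of% a₃, ← reassoc_of% (T.str S.inn).map_comp,
    ← C.comp₂_comp_id, key]
  simp [C.comp₂_comp_id, eqToHom_map]

end StrongRelativePseudomonad

/-! ### Contexts with a strengthened segment -/

section Contexts

variable {α : Type*}

theorem Replaces.append_right {P P' Ω : List α} {k : ℕ} {B : α} (s : Replaces P k B Ω P')
    (R : List α) : Replaces (P ++ R) k B Ω (P' ++ R) := by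
  obtain ⟨Γ, Δ, h, rfl, rfl⟩ := s
  exact ⟨Γ, Δ ++ R, h, by simp, by simp⟩

theorem Replaces.append_left {P P' Ω : List α} {k : ℕ} {B : α} (Q : List α)
    (s : Replaces P k B Ω P') : Replaces (Q ++ P) (Q.length + k) B Ω (Q ++ P') := by
  obtain ⟨Γ, Δ, h, rfl, rfl⟩ := s
  exact ⟨Q ++ Γ, Δ, by simp [h], by simp, by simp⟩

theorem Replaces.lt_length {P P' Ω : List α} {k : ℕ} {B : α} (s : Replaces P k B Ω P') :
    k < P.length := by
  obtain ⟨Γ, Δ, h, rfl, rfl⟩ := s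
  simp; omega

theorem Replaces.length_eq {P P' Ω : List α} {k : ℕ} {B : α} (s : Replaces P k B Ω P') :
    P'.length = P.length + Ω.length - 1 := by
  obtain ⟨Γ, Δ, h, rfl, rfl⟩ := s
  simp; omega

theorem Parallel.prefix {P P' Ω R M M' : List α} {k : ℕ} {B : α} (s : Replaces P k B Ω P')
    (A A' : α) (hM : M = P ++ A :: R) (hM' : M' = P' ++ A :: R) :
    Parallel M P.length A [A'] k B Ω P'.length k M' (P ++ [A'] ++ R) (P' ++ [A'] ++ R) := by
  subst hM hM'
  have := s.lt_length
  refine ⟨by omega, ?_, ?_, s.append_right _, Replaces.mid _ _ _ _ rfl rfl,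
    Replaces.mid _ _ _ _ rfl rfl, ?_⟩
  · rw [s.length_eq, shift, if_neg (by omega)]
  · simp [shift, this]
  · simpa using s.append_right ([A'] ++ R)

theorem Parallel.suffix {P Q Q' Ω M M' : List α} {k : ℕ} {B : α} (s : Replaces Q k B Ω Q')
    (A A' : α) (hM : M = P ++ A :: Q) (hM' : M' = P ++ A :: Q') {l : ℕ} (hl : l = P.length + 1 + k) :
    Parallel M P.length A [A'] l B Ω P.length l M' (P ++ [A'] ++ Q) (P ++ [A'] ++ Q') := by
  subst hM hM' hl
  have h : (P ++ [A]).length + k = P.length + 1 + k := by simp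
  refine ⟨by omega, ?_, ?_, ?_, Replaces.mid _ _ _ _ rfl rfl, Replaces.mid _ _ _ _ rfl rfl, ?_⟩
  · rw [shift, if_pos (by omega)]
  · rw [shift, if_neg (by omega)]; simp
  · simpa [Nat.add_assoc] using s.append_left (P ++ [A])
  · simpa [Nat.add_assoc] using s.append_left (P ++ [A'])

theorem Nested.segment {P Q PQ Ξ Δ R Mg M MF : List α} {X W W' : α}
    (hMF : MF = P ++ [X] ++ Δ) (hPQ : PQ = P ++ Q) (hMg : Mg = Q ++ W :: Ξ) (hM : M = PQ ++ W :: R)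
    (hR : R = Ξ ++ Δ) :
    Nested MF P.length X Mg Q.length W [W'] PQ.length M (Q ++ [W'] ++ Ξ) (PQ ++ [W'] ++ R) := by
  subst hMF hPQ hMg hM hR
  exact Nested.of (by simp) (Replaces.mid _ _ _ Δ (by simp) (by simp))
    (Replaces.mid _ _ _ _ rfl rfl) (Replaces.mid _ _ _ Δ (by simp) (by simp))

end Contexts

/-- Pasting of two naturality squares, the first of which is the image of a square under a functor. -/
theorem CategoryTheory.Functor.map_paste {A : Type*} {B : Type*} [Category* A] [Category* B]
    (F : A ⥤ B) {a a' b b' : A} {p : a ⟶ a'} {q : b ⟶ b'} {x : a ≅ b} {x' : a' ≅ b'}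
    (h : p ≫ x'.hom = x.hom ≫ q) {c c' : B} {y : F.obj b ≅ c} {y' : F.obj b' ≅ c'} {t : c ⟶ c'}
    (h' : F.map q ≫ y'.hom = y.hom ≫ t) :
    F.map p ≫ (F.mapIso x' ≪≫ y').hom = (F.mapIso x ≪≫ y).hom ≫ t := by
  simp only [Iso.trans_hom, Functor.mapIso_hom, Category.assoc]
  rw [← h', ← F.map_comp_assoc, h, F.map_comp_assoc]

namespace StrongRelativePseudomonad

variable {D : TwoMulticategory.{u, v, w}} {C : TwoMulticategory.{u', v', w'}}
  {J : MultiFunctor D C} (T : StrongRelativePseudomonad J)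

/-! ### Successive strengthening of composites -/

/-- Pseudonaturality of successive strengthening: `(f ∘ₖ b)^{t…t} ≅ f^{t…t} ∘ₖ b`, where `b` is composed
in one of the arguments `P` to the left of the strengthened ones. -/
def strAuxNat {Y : D.Ob} {B : C.Ob} {Ω : List C.Ob} (b : C.Hom Ω B) {k : ℕ} :
    ∀ (Δ : List D.Ob) {P P' M N M' N' : List C.Ob} (hM : M = P ++ Δ.map J.obj)
    (hN : N = P ++ Δ.map T.obj) (hM' : M' = P' ++ Δ.map J.obj) (hN' : N' = P' ++ Δ.map T.obj)
    (_ : Replaces P k B Ω P') (r : Replaces M k B Ω M') (r' : Replaces N k B Ω N')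
    (f : C.Hom M (T.obj Y)),
    (T.strAux Y P' Δ hM' hN').obj (C.comp r f b) ≅ C.comp r' ((T.strAux Y P Δ hM hN).obj f) b
  | [], _, _, _, _, _, _, hM, hN, hM', hN', _, _, _, _ => eqToIso (by
      obtain rfl := hM.trans hN.symm
      obtain rfl := hM'.trans hN'.symm
      rfl)
  | X :: Δ, P, P', _, _, _, _, hM, hN, hM', hN', s, _, r', f =>
      (T.strAux Y (P' ++ [T.obj X]) Δ rfl (hN'.trans (by simp))).mapIso
        (T.strNat (Parallel.prefix s (J.obj X) (T.obj X) hM hM') f b) ≪≫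
      strAuxNat b Δ (P := P ++ [T.obj X]) (P' := P' ++ [T.obj X]) rfl (hN.trans (by simp)) rfl
        (hN'.trans (by simp)) (s.append_right _) (Parallel.prefix s (J.obj X) (T.obj X) hM hM').right'
        r' ((T.str _).obj f)

/-- Successive strengthening of `fᵗ ∘ g`, first in the arguments of `g`, then in the remaining arguments
`Δ` of `fᵗ`: the 2-cell `(fᵗ ∘ g)^{t…t} ≅ (fᵗ)^{t…t} ∘ g^{t…t}`. -/
def strAuxMult {X Y : D.Ob} {P K MF NF : List C.Ob} {Δ : List D.Ob}
    (s : Replaces K P.length (J.obj X) [T.obj X] MF) (hMF : MF = P ++ [T.obj X] ++ Δ.map J.obj)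
    (hNF : NF = P ++ [T.obj X] ++ Δ.map T.obj) (f : C.Hom K (T.obj Y)) :
    ∀ (Ξ : List D.Ob) {L : List D.Ob} (_ : L = Ξ ++ Δ) {Q PQ Mg Ng M N : List C.Ob}
    (_ : PQ = P ++ Q) (hMg : Mg = Q ++ Ξ.map J.obj) (hNg : Ng = Q ++ Ξ.map T.obj)
    (hM : M = PQ ++ L.map J.obj) (hN : N = PQ ++ L.map T.obj)
    (r : Replaces MF P.length (T.obj X) Mg M) (r' : Replaces NF P.length (T.obj X) Ng N)
    (g : C.Hom Mg (T.obj X)),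
    (T.strAux Y PQ L hM hN).obj (C.comp r ((T.str s).obj f) g) ≅
      C.comp r' ((T.strAux Y (P ++ [T.obj X]) Δ hMF hNF).obj ((T.str s).obj f))
        ((T.strAux X Q Ξ hMg hNg).obj g)
  | [], _, rfl, Q, PQ, Mg, Ng, M, N, hPQ, hMg, hNg, hM, hN, r, r', g => by
      obtain rfl : Mg = Ng := hMg.trans hNg.symm
      exact T.strAuxNat g Δ hMF hNF hM hN ⟨P, [], rfl, rfl, by subst hPQ hMg; simp⟩ r r' _
  | W :: Ξ, _, rfl, Q, PQ, _, _, _, _, hPQ, hMg, hNg, hM, hN, r, r', g =>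
      have S := Nested.segment (W' := T.obj W) hMF hPQ hMg hM List.map_append
      (T.strAux Y (PQ ++ [T.obj W]) (Ξ ++ Δ) rfl (hN.trans (by simp))).mapIso
        (T.multCell s S f g) ≪≫
      strAuxMult s hMF hNF f Ξ rfl (Q := Q ++ [T.obj W]) (PQ := PQ ++ [T.obj W]) (by simp [hPQ]) rfl
        (hNg.trans (by simp)) rfl (hN.trans (by simp)) S.out' r' ((T.str _).obj g)

theorem strAuxNat_naturality {Y : D.Ob} {B : C.Ob} {Ω : List C.Ob} {b b' : C.Hom Ω B} (β : b ⟶ b')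
    {k : ℕ} (Δ : List D.Ob) : ∀ {P P' M N M' N' : List C.Ob} (hM : M = P ++ Δ.map J.obj)
    (hN : N = P ++ Δ.map T.obj) (hM' : M' = P' ++ Δ.map J.obj) (hN' : N' = P' ++ Δ.map T.obj)
    (s : Replaces P k B Ω P') (r : Replaces M k B Ω M') (r' : Replaces N k B Ω N')
    {f f' : C.Hom M (T.obj Y)} (φ : f ⟶ f'),
    (T.strAux Y P' Δ hM' hN').map (C.comp₂ r φ β) ≫
        (T.strAuxNat b' Δ hM hN hM' hN' s r r' f').hom =
      (T.strAuxNat b Δ hM hN hM' hN' s r r' f).hom ≫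
        C.comp₂ r' ((T.strAux Y P Δ hM hN).map φ) β := by
  induction Δ with
  | nil =>
    intro P P' M N M' N' hM hN hM' hN' s r r' f f' φ
    obtain rfl := hM.trans hN.symm
    obtain rfl := hM'.trans hN'.symm
    exact (Category.comp_id _).trans (Category.id_comp _).symm
  | cons X Δ ih =>
    intro P P' M N M' N' hM hN hM' hN' s r r' f f' φ
    have S := Parallel.prefix s (J.obj X) (T.obj X) hM hM'
    exact (T.strAux Y (P' ++ [T.obj X]) Δ rfl (hN'.trans (by simp))).map_paste
      (T.strNat_naturality S φ β) (ih (P := P ++ [T.obj X]) rfl (hN.trans (by simp)) rfl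
        (hN'.trans (by simp)) (s.append_right _) S.right' r' ((T.str S.right).map φ))

/-- The recursion of `strAuxMult`, for any witness of the replacements and any list equal to the one in
the definition. -/
theorem strAuxMult_cons {X Y W : D.Ob} {P K MF NF : List C.Ob} {Δ Ξ L : List D.Ob}
    (s : Replaces K P.length (J.obj X) [T.obj X] MF) (hMF : MF = P ++ [T.obj X] ++ Δ.map J.obj)
    (hNF : NF = P ++ [T.obj X] ++ Δ.map T.obj) (f : C.Hom K (T.obj Y))
    (hL : W :: L = W :: Ξ ++ Δ) (hL' : L = Ξ ++ Δ) {Q PQ Mg Ng M N : List C.Ob}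
    (hPQ : PQ = P ++ Q) (hMg : Mg = Q ++ (W :: Ξ).map J.obj) (hNg : Ng = Q ++ (W :: Ξ).map T.obj)
    (hM : M = PQ ++ (W :: L).map J.obj) (hN : N = PQ ++ (W :: L).map T.obj)
    (r : Replaces MF P.length (T.obj X) Mg M) (r' : Replaces NF P.length (T.obj X) Ng N)
    (g : C.Hom Mg (T.obj X)) (S) :
    T.strAuxMult s hMF hNF f (W :: Ξ) hL hPQ hMg hNg hM hN r r' g =
      (T.strAux Y (PQ ++ [T.obj W]) L rfl (hN.trans (by simp))).mapIso (T.multCell s S f g) ≪≫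
      T.strAuxMult s hMF hNF f Ξ hL' (Q := Q ++ [T.obj W]) (PQ := PQ ++ [T.obj W]) (by simp [hPQ]) rfl
        (hNg.trans (by simp)) rfl (hN.trans (by simp)) S.out' r' ((T.str S.inn').obj g) := by
  subst hL'
  rfl

theorem strAuxMult_naturality {X Y : D.Ob} {P K MF NF : List C.Ob} {Δ : List D.Ob}
    (s : Replaces K P.length (J.obj X) [T.obj X] MF) (hMF : MF = P ++ [T.obj X] ++ Δ.map J.obj)
    (hNF : NF = P ++ [T.obj X] ++ Δ.map T.obj) {f f' : C.Hom K (T.obj Y)} (φ : f ⟶ f')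
    (Ξ : List D.Ob) : ∀ {L : List D.Ob} (hL : L = Ξ ++ Δ) {Q PQ Mg Ng M N : List C.Ob}
    (hPQ : PQ = P ++ Q) (hMg : Mg = Q ++ Ξ.map J.obj) (hNg : Ng = Q ++ Ξ.map T.obj)
    (hM : M = PQ ++ L.map J.obj) (hN : N = PQ ++ L.map T.obj)
    (r : Replaces MF P.length (T.obj X) Mg M) (r' : Replaces NF P.length (T.obj X) Ng N)
    {g g' : C.Hom Mg (T.obj X)} (β : g ⟶ g'),
    (T.strAux Y PQ L hM hN).map (C.comp₂ r ((T.str s).map φ) β) ≫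
        (T.strAuxMult s hMF hNF f' Ξ hL hPQ hMg hNg hM hN r r' g').hom =
      (T.strAuxMult s hMF hNF f Ξ hL hPQ hMg hNg hM hN r r' g).hom ≫
        C.comp₂ r' ((T.strAux Y (P ++ [T.obj X]) Δ hMF hNF).map ((T.str s).map φ))
          ((T.strAux X Q Ξ hMg hNg).map β) := by
  induction Ξ with
  | nil =>
    intro L hL Q PQ Mg Ng M N hPQ hMg hNg hM hN r r' g g' β
    obtain rfl : L = Δ := hL
    obtain rfl : Mg = Ng := hMg.trans hNg.symm
    exact T.strAuxNat_naturality β L hMF hNF hM hN _ r r' ((T.str s).map φ)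
  | cons W Ξ ih =>
    intro L hL Q PQ Mg Ng M N hPQ hMg hNg hM hN r r' g g' β
    obtain rfl : L = W :: (Ξ ++ Δ) := hL
    have S := Nested.segment (W' := T.obj W) hMF hPQ hMg hM List.map_append
    exact (T.strAux Y (PQ ++ [T.obj W]) (Ξ ++ Δ) rfl (hN.trans (by simp))).map_paste
      (T.multCell_naturality s S φ β) (ih rfl (Q := Q ++ [T.obj W]) (by simp [hPQ]) rfl
        (hNg.trans (by simp)) rfl (hN.trans (by simp)) S.out' r' ((T.str S.inn').map β))

/-- Successive strengthening of a composite `f ∘ b` with `b : JΞ → JX`, in all the arguments from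
some position on: the 2-cell `(f ∘ b)^{t…t} ≅ f^{t…t} ∘ (i ∘ b)^{t…t}`. -/
def strAuxComp {X Y : D.Ob} {Ξ Δ : List D.Ob} (b : C.Hom (Ξ.map J.obj) (J.obj X)) :
    ∀ (Γ : List D.Ob) {L L' : List D.Ob} (_ : L = Γ ++ X :: Δ) (_ : L' = Γ ++ (Ξ ++ Δ))
    {P M N M' N' : List C.Ob} (hM : M = P ++ L.map J.obj) (hN : N = P ++ L.map T.obj)
    (hM' : M' = P ++ L'.map J.obj) (hN' : N' = P ++ L'.map T.obj) {k : ℕ}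
    (_ : k = P.length + Γ.length) (r : Replaces M k (J.obj X) (Ξ.map J.obj) M')
    (r' : Replaces N k (T.obj X) (Ξ.map T.obj) N') (f : C.Hom M (T.obj Y)),
    (T.strAux Y P L' hM' hN').obj (C.comp r f b) ≅
      C.comp r' ((T.strAux Y P L hM hN).obj f)
        ((T.strAux X [] Ξ rfl rfl).obj (C.post (T.unit X) b))
  | [], _, _, rfl, rfl, P, M, N, M', N', hM, hN, hM', hN', _, rfl, r, r', f =>
      have s := Replaces.mid P (J.obj X) [T.obj X] (Δ.map J.obj) (by simpa using hM) rfl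
      have S : Nested _ P.length (T.obj X) [J.obj X] 0 (J.obj X) (Ξ.map J.obj) P.length M
          (Ξ.map J.obj) M' :=
        Nested.of rfl s.back (Replaces.whole _ _) (Replaces.mid P _ _ (Δ.map J.obj) (by simp)
          (by simp [hM']))
      (T.strAux Y P (Ξ ++ Δ) hM' hN').mapIso
        (C.compIso r (T.unitCell s s.back f) (Iso.refl b) ≪≫ eqToIso (C.comp_post S _ _ _)) ≪≫
      T.strAuxMult s rfl (hN.trans (by simp)) f Ξ rfl (Q := []) (by simp) rfl rfl hM' hN' S.out' r'
        (C.post (T.unit X) b)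
  | W :: Γ, _, _, rfl, rfl, P, M, N, M', N', hM, hN, hM', hN', k, hk, r, r', f =>
      have S := Parallel.suffix (P := P) (k := Γ.length) (B := J.obj X) (Ω := Ξ.map J.obj)
        (Q := (Γ ++ X :: Δ).map J.obj) (Q' := (Γ ++ (Ξ ++ Δ)).map J.obj)
        ⟨Γ.map J.obj, Δ.map J.obj, by simp, by simp, by simp⟩ (J.obj W) (T.obj W)
        (M := M) (M' := M') (by simpa using hM) (by simpa using hM') (l := k)
        (by simp at hk; omega)
      (T.strAux Y (P ++ [T.obj W]) (Γ ++ (Ξ ++ Δ)) rfl (hN'.trans (by simp))).mapIso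
        (T.strNat S f b) ≪≫
      strAuxComp b Γ rfl rfl (P := P ++ [T.obj W]) rfl (hN.trans (by simp)) rfl
        (hN'.trans (by simp)) (by simp at hk ⊢; omega) S.right' r' ((T.str S.right).obj f)

/-- The base of the recursion of `strAuxComp`, for any witnesses of the replacements. -/
theorem strAuxComp_nil {X Y : D.Ob} {Ξ Δ L' : List D.Ob} (b : C.Hom (Ξ.map J.obj) (J.obj X))
    (hL' : L' = Ξ ++ Δ)
    {P M N M' N' : List C.Ob} (hM : M = P ++ (X :: Δ).map J.obj) (hN : N = P ++ (X :: Δ).map T.obj)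
    (hM' : M' = P ++ L'.map J.obj) (hN' : N' = P ++ L'.map T.obj)
    (hk : P.length = P.length + ([] : List D.Ob).length)
    (r : Replaces M P.length (J.obj X) (Ξ.map J.obj) M')
    (r' : Replaces N P.length (T.obj X) (Ξ.map T.obj) N') (f : C.Hom M (T.obj Y))
    (s : Replaces M P.length (J.obj X) [T.obj X] (P ++ [T.obj X] ++ Δ.map J.obj))
    (S : Nested _ P.length (T.obj X) [J.obj X] 0 (J.obj X) (Ξ.map J.obj) P.length M
          (Ξ.map J.obj) M') :
    T.strAuxComp b [] rfl hL' hM hN hM' hN' hk r r' f =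
      (T.strAux Y P L' hM' hN').mapIso
        (C.compIso r (T.unitCell s S.out f) (Iso.refl b) ≪≫ eqToIso (C.comp_post S _ _ _)) ≪≫
      T.strAuxMult s rfl (hN.trans (by simp)) f Ξ hL' (Q := []) (by simp) rfl rfl hM' hN' S.out' r'
        (C.post (T.unit X) b) := by
  subst hL'
  rfl

/-- The recursion of `strAuxComp`, for any witnesses of the replacements. -/
theorem strAuxComp_cons {X Y W : D.Ob} {Ξ Δ Γ L L' : List D.Ob}
    (b : C.Hom (Ξ.map J.obj) (J.obj X))
    (hL₁ : W :: L = W :: Γ ++ X :: Δ) (hL₁' : W :: L' = W :: Γ ++ (Ξ ++ Δ))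
    (hL : L = Γ ++ X :: Δ) (hL' : L' = Γ ++ (Ξ ++ Δ))
    {P M N M' N' : List C.Ob} (hM : M = P ++ (W :: L).map J.obj)
    (hN : N = P ++ (W :: L).map T.obj)
    (hM' : M' = P ++ (W :: L').map J.obj) (hN' : N' = P ++ (W :: L').map T.obj) {k : ℕ}
    (hk : k = P.length + (W :: Γ).length) (r : Replaces M k (J.obj X) (Ξ.map J.obj) M')
    (r' : Replaces N k (T.obj X) (Ξ.map T.obj) N') (f : C.Hom M (T.obj Y)) (S) :
    T.strAuxComp b (W :: Γ) hL₁ hL₁' hM hN hM' hN' hk r r' f =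
      (T.strAux Y (P ++ [T.obj W]) L' rfl (hN'.trans (by simp))).mapIso (T.strNat S f b) ≪≫
      T.strAuxComp b Γ hL hL' (P := P ++ [T.obj W]) rfl (hN.trans (by simp)) rfl
        (hN'.trans (by simp)) (by simp at hk ⊢; omega) S.right' r'
        ((T.str S.right).obj f) := by
  subst hL hL'
  rfl

theorem strAuxComp_naturality {X Y : D.Ob} {Ξ Δ : List D.Ob} {b b' : C.Hom (Ξ.map J.obj) (J.obj X)}
    (β : b ⟶ b') (Γ : List D.Ob) : ∀ {L L' : List D.Ob} (hL : L = Γ ++ X :: Δ)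
    (hL' : L' = Γ ++ (Ξ ++ Δ))
    {P M N M' N' : List C.Ob} (hM : M = P ++ L.map J.obj) (hN : N = P ++ L.map T.obj)
    (hM' : M' = P ++ L'.map J.obj) (hN' : N' = P ++ L'.map T.obj) {k : ℕ}
    (hk : k = P.length + Γ.length) (r : Replaces M k (J.obj X) (Ξ.map J.obj) M')
    (r' : Replaces N k (T.obj X) (Ξ.map T.obj) N') {f f' : C.Hom M (T.obj Y)} (φ : f ⟶ f'),
    (T.strAux Y P L' hM' hN').map (C.comp₂ r φ β) ≫
        (T.strAuxComp b' Γ hL hL' hM hN hM' hN' hk r r' f').hom =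
      (T.strAuxComp b Γ hL hL' hM hN hM' hN' hk r r' f).hom ≫
        C.comp₂ r' ((T.strAux Y P L hM hN).map φ)
          ((T.strAux X [] Ξ rfl rfl).map (C.post₂ (𝟙 (T.unit X)) β)) := by
  induction Γ with
  | nil =>
    intro L L' hL hL' P M N M' N' hM hN hM' hN' k hk r r' f f' φ
    obtain rfl : L = X :: Δ := hL
    obtain rfl : k = P.length := hk
    have s := Replaces.mid P (J.obj X) [T.obj X] (Δ.map J.obj) (by simpa using hM) rfl
    have S : Nested _ P.length (T.obj X) [J.obj X] 0 (J.obj X) (Ξ.map J.obj) P.length M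
        (Ξ.map J.obj) M' :=
      Nested.of rfl s.back (Replaces.whole _ _) (Replaces.mid P _ _ (Δ.map J.obj) (by simp)
        (by simp [hM', hL']))
    have := C.comp_post₂_eqToHom S ((T.str s).map φ) (𝟙 (T.unit X)) β
    obtain rfl : L' = Ξ ++ Δ := hL'
    refine (T.strAux Y P (Ξ ++ Δ) hM' hN').map_paste
      (x := C.compIso r (T.unitCell s S.out f) (Iso.refl b) ≪≫ eqToIso (C.comp_post S _ _ _))
      (x' := C.compIso r (T.unitCell s S.out f') (Iso.refl b') ≪≫ eqToIso (C.comp_post S _ _ _)) ?_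
      (T.strAuxMult_naturality s rfl (hN.trans (by simp)) φ Ξ rfl (Q := []) (by simp) rfl rfl hM' hN'
        S.out' r' (C.post₂ (𝟙 (T.unit X)) β))
    change C.comp₂ r φ β ≫ C.comp₂ r (T.unitCell s S.out f').hom (𝟙 b') ≫ eqToHom (C.comp_post S _ _ _) =
      (C.comp₂ r (T.unitCell s S.out f).hom (𝟙 b) ≫
        eqToHom (C.comp_post S ((T.str s).obj f) (T.unit X) b)) ≫
        C.comp₂ S.out' ((T.str s).map φ) (C.post₂ (𝟙 (T.unit X)) β)
    rw [Category.assoc, ← this, ← reassoc_of% C.comp₂_comp, ← reassoc_of% C.comp₂_comp,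
      T.unitCell_naturality s S.out, Category.comp_id, Category.id_comp]
  | cons W Γ ih =>
    intro L L' hL hL' P M N M' N' hM hN hM' hN' k hk r r' f f' φ
    obtain rfl : L = W :: (Γ ++ X :: Δ) := hL
    obtain rfl : L' = W :: (Γ ++ (Ξ ++ Δ)) := hL'
    have S := Parallel.suffix (P := P) (k := Γ.length) (B := J.obj X) (Ω := Ξ.map J.obj)
        (Q := (Γ ++ X :: Δ).map J.obj) (Q' := (Γ ++ (Ξ ++ Δ)).map J.obj)
        ⟨Γ.map J.obj, Δ.map J.obj, by simp, by simp, by simp⟩ (J.obj W) (T.obj W)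
        (M := M) (M' := M') (by simpa using hM) (by simpa using hM') (l := k)
        (by simp at hk; omega)
    exact (T.strAux Y (P ++ [T.obj W]) (Γ ++ (Ξ ++ Δ)) rfl (hN'.trans (by simp))).map_paste
      (T.strNat_naturality S φ β) (ih rfl rfl (P := P ++ [T.obj W]) rfl (hN.trans (by simp)) rfl
        (hN'.trans (by simp)) (by simp at hk ⊢; omega) S.right' r' ((T.str S.right).map φ))

end StrongRelativePseudomonad

/-! ### Iterated composites -/

section Paste

variable {A : Type*} {B : Type*} [Category* A] [Category* B] (F : A ⥤ B)

/-- The step in the inductive comparison of two composites of successively defined 2-cells. -/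
theorem CategoryTheory.Functor.map_paste_cons {a₀ a₁ a₂ a₃ b₁ b₃ : A} {c₁ c₂ c₃ d₁ d₂ d : B}
    {x : a₀ ≅ a₁} {w : a₁ ⟶ a₂} {e : a₂ ⟶ a₃} {p : a₀ ⟶ b₁} {x' : b₁ ≅ b₃} {w' : b₃ ⟶ a₃}
    (h : x.hom ≫ w ≫ e = p ≫ x'.hom ≫ w')
    {y : F.obj a₁ ≅ c₁} {y₁ : F.obj a₂ ≅ c₂} {W : c₁ ⟶ c₂} (hW : F.map w ≫ y₁.hom = y.hom ≫ W)
    {y' : F.obj b₃ ≅ d₁} {y₁' : F.obj a₃ ≅ d₂} {W' : d₁ ⟶ d₂}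
    (hW' : F.map w' ≫ y₁'.hom = y'.hom ≫ W')
    {V : c₂ ⟶ c₃} {q : c₃ ⟶ d} {V' : d₂ ⟶ d}
    (ih : y₁.hom ≫ V ≫ q = F.map e ≫ y₁'.hom ≫ V') :
    (F.mapIso x ≪≫ y).hom ≫ (W ≫ V) ≫ q = F.map p ≫ (F.mapIso x' ≪≫ y').hom ≫ W' ≫ V' := by
  simp only [Iso.trans_hom, Functor.mapIso_hom, Category.assoc]
  rw [← reassoc_of% hW, ih, ← reassoc_of% hW', ← F.map_comp_assoc, ← F.map_comp_assoc, Category.assoc, h]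
  simp

end Paste

namespace StrongRelativePseudomonad

variable {D : TwoMulticategory.{u, v, w}} {C : TwoMulticategory.{u', v', w'}}
  {J : MultiFunctor D C} (T : StrongRelativePseudomonad J)

/-- Pseudonaturality of successive strengthening is coherent with iterated composition in one argument. -/
theorem strAuxNat_comp {Y : D.Ob} {B B' : C.Ob} {Ω Ω' Θ : List C.Ob} (b : C.Hom Ω B)
    (b' : C.Hom Θ B') {k l r : ℕ} (Δ : List D.Ob) :
    ∀ {P P' P'' M N M' N' M'' N'' : List C.Ob} (hM : M = P ++ Δ.map J.obj)
    (hN : N = P ++ Δ.map T.obj) (hM' : M' = P' ++ Δ.map J.obj) (hN' : N' = P' ++ Δ.map T.obj)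
    (hM'' : M'' = P'' ++ Δ.map J.obj) (hN'' : N'' = P'' ++ Δ.map T.obj)
    (S : Nested P k B Ω l B' Θ r P' Ω' P'') (SM : Nested M k B Ω l B' Θ r M' Ω' M'')
    (SN : Nested N k B Ω l B' Θ r N' Ω' N'') (f : C.Hom M (T.obj Y)),
    (T.strAuxNat b' Δ hM' hN' hM'' hN'' S.inn SM.inn SN.inn (C.comp SM.out f b)).hom ≫
        C.comp₂ SN.inn (T.strAuxNat b Δ hM hN hM' hN' S.out SM.out SN.out f).hom (𝟙 b') ≫
        eqToHom (C.assoc SN _ b b') =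
      (T.strAux Y P'' Δ hM'' hN'').map (eqToHom (C.assoc SM f b b')) ≫
        (T.strAuxNat (C.comp SM.inn' b b') Δ hM hN hM'' hN'' S.out' SM.out' SN.out' f).hom := by
  induction Δ with
  | nil => intros; simp [strAuxNat, eqToHom_map]
  | cons X Δ ih =>
    intro P P' P'' M N M' N' M'' N'' hM hN hM' hN' hM'' hN'' S SM SN f
    have S₁ := Parallel.prefix S.out (J.obj X) (T.obj X) hM hM'
    have S₂ := Parallel.prefix S.inn (J.obj X) (T.obj X) hM' hM''
    have S₃ := Parallel.prefix S.out' (J.obj X) (T.obj X) hM hM''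
    have S' := Nested.of S.hr S₁.right' SM.inn' S₃.right'
    have S'' : Nested (P ++ [T.obj X]) k B Ω l B' Θ r (P' ++ [T.obj X]) Ω' (P'' ++ [T.obj X]) :=
      Nested.of S.hr (S.out.append_right _) SM.inn' (S.out'.append_right _)
    have key := (T.strAux Y (P'' ++ [T.obj X]) Δ rfl (hN''.trans (by simp))).map_paste_cons (w' := 𝟙 _)
      ((T.strNat_comp_eqToHom SM S₁ S₂ S₃ S' f b b').trans
        (congrArg _ (Category.comp_id _).symm))
      (T.strAuxNat_naturality (𝟙 b') Δ rfl (hN'.trans (by simp)) rfl (hN''.trans (by simp)) S''.inn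
        S₂.right' SN.inn (T.strNat S₁ f b).hom)
      (W' := 𝟙 _) (V' := 𝟙 _)
      (by rw [CategoryTheory.Functor.map_id, Category.id_comp, Category.comp_id])
      ((ih rfl (hN.trans (by simp)) rfl (hN'.trans (by simp)) rfl (hN''.trans (by simp)) S'' S' SN
        ((T.str S₁.right).obj f)).trans (congrArg _ (Category.comp_id _).symm))
    rw [← C.comp₂_comp_id, Category.comp_id, Category.comp_id] at key
    exact key

/-- `strAuxMult` is coherent with the composition of `h` in an argument of `g` to the left of the
strengthened ones. -/
theorem strAuxMult_strAuxNat {X Y : D.Ob} {P K MF NF : List C.Ob} {Δ : List D.Ob}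
    (s : Replaces K P.length (J.obj X) [T.obj X] MF) (hMF : MF = P ++ [T.obj X] ++ Δ.map J.obj)
    (hNF : NF = P ++ [T.obj X] ++ Δ.map T.obj) (f : C.Hom K (T.obj Y)) {B : C.Ob} {Θ : List C.Ob}
    (h : C.Hom Θ B) {l u : ℕ} (hu : u = P.length + l) (Δ' : List D.Ob) :
    ∀ {L : List D.Ob} (hL : L = Δ' ++ Δ) {Q Q' PQ PQ' Mg Ng Mg' Ng' M N M' N' : List C.Ob}
    (hPQ : PQ = P ++ Q) (hPQ' : PQ' = P ++ Q') (t : Replaces Q l B Θ Q') (t' : Replaces PQ u B Θ PQ')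
    (hMg : Mg = Q ++ Δ'.map J.obj) (hNg : Ng = Q ++ Δ'.map T.obj)
    (hMg' : Mg' = Q' ++ Δ'.map J.obj) (hNg' : Ng' = Q' ++ Δ'.map T.obj)
    (hM : M = PQ ++ L.map J.obj) (hN : N = PQ ++ L.map T.obj)
    (hM' : M' = PQ' ++ L.map J.obj) (hN' : N' = PQ' ++ L.map T.obj)
    (SM : Nested MF P.length (T.obj X) Mg l B Θ u M Mg' M')
    (SN : Nested NF P.length (T.obj X) Ng l B Θ u N Ng' N') (g : C.Hom Mg (T.obj X)),
    (T.strAuxNat h L hM hN hM' hN' t' SM.inn SN.inn (C.comp SM.out ((T.str s).obj f) g)).hom ≫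
        C.comp₂ SN.inn
          (T.strAuxMult s hMF hNF f Δ' hL hPQ hMg hNg hM hN SM.out SN.out g).hom (𝟙 h) ≫
        eqToHom (C.assoc SN _ _ h) =
      (T.strAux Y PQ' L hM' hN').map (eqToHom (C.assoc SM _ g h)) ≫
        (T.strAuxMult s hMF hNF f Δ' hL hPQ' hMg' hNg' hM' hN' SM.out' SN.out'
          (C.comp SM.inn' g h)).hom ≫
        C.comp₂ SN.out' (𝟙 _) (T.strAuxNat h Δ' hMg hNg hMg' hNg' t SM.inn' SN.inn' g).hom := by
  induction Δ' with
  | nil =>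
    intro L hL Q Q' PQ PQ' Mg Ng Mg' Ng' M N M' N' hPQ hPQ' t t' hMg hNg hMg' hNg' hM hN hM' hN' SM SN g
    obtain rfl : L = Δ := hL
    obtain rfl : Mg = Ng := hMg.trans hNg.symm
    obtain rfl : Mg' = Ng' := hMg'.trans hNg'.symm
    have S : Nested (P ++ [T.obj X]) P.length (T.obj X) Mg l B Θ u PQ Mg' PQ' :=
      Nested.of hu ⟨P, [], rfl, rfl, by simp [hPQ, hMg]⟩ SM.inn' ⟨P, [], rfl, rfl, by simp [hPQ', hMg']⟩
    have key := T.strAuxNat_comp g h L hMF hNF hM hN hM' hN' S SM SN ((T.str s).obj f)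
    refine key.trans (congrArg _ ((Category.comp_id _).symm.trans (congrArg _ ?_)))
    exact (C.comp₂_id _ _ _).symm
  | cons W Δ' ih =>
    intro L hL Q Q' PQ PQ' Mg Ng Mg' Ng' M N M' N' hPQ hPQ' t t' hMg hNg hMg' hNg' hM hN hM' hN' SM SN g
    obtain rfl : L = W :: (Δ' ++ Δ) := hL
    have S := Parallel.prefix t (J.obj W) (T.obj W) hMg hMg'
    have S₁ := Parallel.prefix t' (J.obj W) (T.obj W) hM hM'
    have R := Nested.segment (W' := T.obj W) hMF hPQ hMg hM List.map_append
    have R₁ := Nested.segment (W' := T.obj W) hMF hPQ' hMg' hM' List.map_append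
    have R₃ := Nested.of hu R.out' S.right' R₁.out'
    have nat := T.strAuxMult_naturality s hMF hNF (𝟙 f) Δ' rfl (Q := Q' ++ [T.obj W])
      (PQ := PQ' ++ [T.obj W]) (by simp [hPQ']) rfl (hNg'.trans (by simp)) rfl
      (hN'.trans (by simp)) R₁.out' SN.out' (T.strNat S g h).hom
    rw [CategoryTheory.Functor.map_id, CategoryTheory.Functor.map_id] at nat
    have key := (T.strAux Y (PQ' ++ [T.obj W]) (Δ' ++ Δ) rfl (hN'.trans (by simp))).map_paste_cons
      (T.multCell_strNat_right_eqToHom s S R R₁ SM R₃ S₁ f g h)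
      (T.strAuxNat_naturality (𝟙 h) (Δ' ++ Δ) rfl (hN.trans (by simp)) rfl (hN'.trans (by simp))
        (t'.append_right _) S₁.right' SN.inn (T.multCell s R f g).hom)
      nat
      (ih rfl (Q := Q ++ [T.obj W]) (Q' := Q' ++ [T.obj W]) (by simp [hPQ]) (by simp [hPQ'])
        (t.append_right _) (t'.append_right _) rfl (hNg.trans (by simp)) rfl (hNg'.trans (by simp))
        rfl (hN.trans (by simp)) rfl (hN'.trans (by simp)) R₃ SN ((T.str S.right).obj g))
    rw [← C.comp₂_comp_id, ← C.comp₂_id_comp] at key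
    exact key

end StrongRelativePseudomonad

section Paste

variable {A : Type*} {B : Type*} [Category* A] [Category* B] (F : A ⥤ B)

/-- A variant of `Functor.map_paste_cons`, in which the first naturality square is part of the induction
hypothesis. -/
theorem CategoryTheory.Functor.map_paste_cons_of_ih {a₀ a₁ a₂ a₃ b₁ b₂ b₃ : A} {c₁ c₃ d₁ d₂ d : B}
    {x : a₀ ≅ a₁} {w : a₁ ⟶ a₂} {e : a₂ ⟶ a₃} {p : a₀ ⟶ b₁} {p' : b₁ ⟶ b₂} {x' : b₂ ≅ b₃}
    {w' : b₃ ⟶ a₃} (h : x.hom ≫ w ≫ e = p ≫ p' ≫ x'.hom ≫ w')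
    {y : F.obj a₁ ≅ c₁} {y' : F.obj b₃ ≅ d₁} {y₁' : F.obj a₃ ≅ d₂} {W' : d₁ ⟶ d₂}
    (hW' : F.map w' ≫ y₁'.hom = y'.hom ≫ W')
    {V : c₁ ⟶ c₃} {q : c₃ ⟶ d} {V' : d₂ ⟶ d}
    (ih : y.hom ≫ V ≫ q = F.map w ≫ F.map e ≫ y₁'.hom ≫ V') :
    (F.mapIso x ≪≫ y).hom ≫ V ≫ q =
      F.map p ≫ F.map p' ≫ (F.mapIso x' ≪≫ y').hom ≫ W' ≫ V' := by
  simp only [Iso.trans_hom, Functor.mapIso_hom, Category.assoc]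
  rw [ih, ← reassoc_of% hW', ← F.map_comp_assoc, ← F.map_comp_assoc, Category.assoc, h]
  simp

/-- The base of the inductive comparison of two composites of successively defined 2-cells. -/
theorem CategoryTheory.Functor.map_paste_nil {a₀ a₁ a₂ a₃ b₁ : A} {c₁ c₃ d₁ d₂ d : B}
    {x : a₀ ≅ a₁} {w : a₁ ⟶ a₂} {e : a₂ ⟶ a₃} {p : a₀ ⟶ b₁} {t : b₁ ⟶ a₃}
    (h : x.hom ≫ w ≫ e = p ≫ t) {y : F.obj a₁ ≅ c₁} {y' : F.obj b₁ ≅ d₁} {y₁' : F.obj a₃ ≅ d₂}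
    {W' : d₁ ⟶ d₂} (hW' : F.map t ≫ y₁'.hom = y'.hom ≫ W')
    {V : c₁ ⟶ c₃} {q : c₃ ⟶ d} {V' : d₂ ⟶ d}
    (ih : y.hom ≫ V ≫ q = F.map w ≫ F.map e ≫ y₁'.hom ≫ V') :
    (F.mapIso x ≪≫ y).hom ≫ V ≫ q = F.map p ≫ y'.hom ≫ W' ≫ V' := by
  simp only [Iso.trans_hom, Functor.mapIso_hom, Category.assoc]
  rw [ih, ← reassoc_of% hW', ← F.map_comp_assoc, ← F.map_comp_assoc, Category.assoc, h]
  simp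

/-- A variant of `Functor.map_paste_nil`, in which the 2-cell on the left is a component of a natural
transformation. -/
theorem CategoryTheory.Functor.map_paste_natural {a₀ a₁ a₃ b₁ b₂ : A} {c₁ c₂ c₃ d₁ d₂ d : B}
    {m : a₀ ⟶ a₁} {e : a₁ ⟶ a₃} {p : a₀ ⟶ b₁} {x : b₁ ≅ b₂} {t : b₂ ⟶ a₃}
    (h : m ≫ e = p ≫ x.hom ≫ t) {y : F.obj a₀ ≅ c₁} {y₁ : F.obj a₁ ≅ c₂} {W : c₁ ⟶ c₂}
    (hW : F.map m ≫ y₁.hom = y.hom ≫ W) {y' : F.obj b₂ ≅ d₁} {y₁' : F.obj a₃ ≅ d₂} {W' : d₁ ⟶ d₂}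
    (hW' : F.map t ≫ y₁'.hom = y'.hom ≫ W')
    {V : c₂ ⟶ c₃} {q : c₃ ⟶ d} {V' : d₂ ⟶ d} (ih : y₁.hom ≫ V ≫ q = F.map e ≫ y₁'.hom ≫ V') :
    y.hom ≫ (W ≫ V) ≫ q = F.map p ≫ (F.mapIso x ≪≫ y').hom ≫ W' ≫ V' := by
  simp only [Iso.trans_hom, Functor.mapIso_hom, Category.assoc]
  rw [← reassoc_of% hW, ih, ← reassoc_of% hW', ← F.map_comp_assoc, h]
  simp

end Paste

/-! ### Associativity of the 2-cells for strengthened composites -/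

namespace StrongRelativePseudomonad

variable {D : TwoMulticategory.{u, v, w}} {C : TwoMulticategory.{u', v', w'}}
  {J : MultiFunctor D C} (T : StrongRelativePseudomonad J)

/-- The two ways of strengthening `((fᵗ ∘ g)ᵗ ∘ h)` in the arguments of `h`, then in those of `g` and
then in those of `f`, agree. At the arguments of `h` this is `associativity`; at those of `g` it is the
compatibility of `multCell` with pseudonaturality. -/
theorem strAuxMult_strAuxMult {X X' Y : D.Ob} {P K MF NF Q Kg MG NG PQ KK MM NN : List C.Ob}
    {Δ Δ' L₂ : List D.Ob}
    (s : Replaces K P.length (J.obj X) [T.obj X] MF) (hMF : MF = P ++ [T.obj X] ++ Δ.map J.obj)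
    (hNF : NF = P ++ [T.obj X] ++ Δ.map T.obj) (f : C.Hom K (T.obj Y)) (hPQ : PQ = P ++ Q)
    (hL₂ : L₂ = Δ' ++ Δ)
    (R : Nested MF P.length (T.obj X) Kg Q.length (J.obj X') [T.obj X'] PQ.length KK MG MM)
    (hMG : MG = Q ++ [T.obj X'] ++ Δ'.map J.obj) (hNG : NG = Q ++ [T.obj X'] ++ Δ'.map T.obj)
    (hMM : MM = PQ ++ [T.obj X'] ++ L₂.map J.obj) (hNN : NN = PQ ++ [T.obj X'] ++ L₂.map T.obj)
    (g : C.Hom Kg (T.obj X)) (Θ : List D.Ob) :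
    ∀ {L₃ L₃' : List D.Ob} (hL₃ : L₃ = Θ ++ L₂) (hL₃' : L₃' = Θ ++ Δ') (hL : L₃ = L₃' ++ Δ)
    {R' QR PQR Mh Nh Mgh Ngh M N : List C.Ob} (hQR : QR = Q ++ R') (hPQR : PQR = PQ ++ R')
    (hPQR' : PQR = P ++ QR) (hMh : Mh = R' ++ Θ.map J.obj) (hNh : Nh = R' ++ Θ.map T.obj)
    (hMgh : Mgh = QR ++ L₃'.map J.obj) (hNgh : Ngh = QR ++ L₃'.map T.obj)
    (hM : M = PQR ++ L₃.map J.obj) (hN : N = PQR ++ L₃.map T.obj)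
    (SM : Nested MF P.length (T.obj X) MG Q.length (T.obj X') Mh PQ.length MM Mgh M)
    (SN : Nested NF P.length (T.obj X) NG Q.length (T.obj X') Nh PQ.length NN Ngh N)
    (h : C.Hom Mh (T.obj X')),
    (T.strAuxMult R.inn hMM hNN (C.comp R.out ((T.str s).obj f) g) Θ hL₃ hPQR hMh hNh hM hN
          SM.inn SN.inn h).hom ≫
        C.comp₂ SN.inn ((T.strAux Y (PQ ++ [T.obj X']) L₂ hMM hNN).map (T.multCell s R f g).hom ≫
          (T.strAuxMult s hMF hNF f Δ' hL₂ (Q := Q ++ [T.obj X']) (by simp [hPQ]) hMG hNG hMM hNN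
            R.out' SN.out ((T.str R.inn').obj g)).hom) (𝟙 _) ≫
        eqToHom (C.assoc SN _ _ _) =
      (T.strAux Y PQR L₃ hM hN).map (C.comp₂ SM.inn (T.multCell s R f g).hom (𝟙 h)) ≫
        (T.strAux Y PQR L₃ hM hN).map (eqToHom (C.assoc SM _ _ h)) ≫
        (T.strAuxMult s hMF hNF f L₃' hL hPQR' hMgh hNgh hM hN SM.out' SN.out'
          (C.comp SM.inn' ((T.str R.inn').obj g) h)).hom ≫
        C.comp₂ SN.out' (𝟙 _) (T.strAuxMult R.inn' hMG hNG g Θ hL₃' hQR hMh hNh hMgh hNgh SM.inn'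
          SN.inn' h).hom := by
  induction Θ with
  | nil =>
    intro L₃ L₃' hL₃ hL₃' hL R' QR PQR Mh Nh Mgh Ngh M N hQR hPQR hPQR' hMh hNh hMgh hNgh hM hN SM SN h
    obtain rfl : L₃ = L₂ := hL₃
    obtain rfl : L₃' = Δ' := hL₃'
    obtain rfl : Mh = Nh := hMh.trans hNh.symm
    have t : Replaces (Q ++ [T.obj X']) Q.length (T.obj X') Mh QR :=
      ⟨Q, [], rfl, rfl, by simp [hQR, hMh]⟩
    have t' : Replaces (PQ ++ [T.obj X']) PQ.length (T.obj X') Mh PQR :=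
      ⟨PQ, [], rfl, rfl, by simp [hPQR, hMh]⟩
    have key := T.strAuxMult_strAuxNat s hMF hNF f h R.hr L₃' hL₂ (Q := Q ++ [T.obj X'])
      (PQ := PQ ++ [T.obj X']) (by simp [hPQ]) hPQR' t t' hMG hNG hMgh hNgh hMM hNN hM hN SM SN
      ((T.str R.inn').obj g)
    have nat := T.strAuxNat_naturality (𝟙 h) L₃ hMM hNN hM hN t' SM.inn SN.inn (T.multCell s R f g).hom
    rw [C.comp₂_comp_id, Category.assoc]
    refine Eq.trans ?_ (congrArg _ key)
    rw [← Category.assoc]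
    refine Eq.trans ?_ ((congrArg (· ≫ _) nat.symm).trans (Category.assoc _ _ _))
    rfl
  | cons V Θ ih =>
    intro L₃ L₃' hL₃ hL₃' hL R' QR PQR Mh Nh Mgh Ngh M N hQR hPQR hPQR' hMh hNh hMgh hNgh hM hN SM SN h
    obtain rfl : L₃ = V :: (Θ ++ L₂) := hL₃
    obtain rfl : L₃' = V :: (Θ ++ Δ') := hL₃'
    have hL' : Θ ++ L₂ = (Θ ++ Δ') ++ Δ := (List.cons.inj hL).2
    have S₃ := Nested.segment (W' := T.obj V) hMM hPQR hMh hM List.map_append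
    have S₂ := Nested.segment (W' := T.obj V) hMG hQR hMh hMgh List.map_append
    have S₄ := Nested.segment (W' := T.obj V) hMF hPQR' hMgh hM (by rw [hL', List.map_append])
    have S₆ := Nested.of R.hr SM.out S₂.out' S₄.out'
    have nat := T.strAuxMult_naturality s hMF hNF (𝟙 f) (Θ ++ Δ') hL' (Q := QR ++ [T.obj V])
      (PQ := PQR ++ [T.obj V]) (by simp [hPQR']) rfl (hNgh.trans (by simp)) rfl
      (hN.trans (by simp)) S₄.out' SN.out' (T.multCell R.inn' S₂ g h).hom
    rw [CategoryTheory.Functor.map_id, CategoryTheory.Functor.map_id] at nat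
    have key := (T.strAux Y (PQR ++ [T.obj V]) (Θ ++ L₂) rfl (hN.trans (by simp))).map_paste_cons_of_ih
      (T.associativity_eqToHom s R S₂ S₃ S₄ SM S₆ f g h) nat
      (ih rfl rfl hL' (R' := R' ++ [T.obj V]) (QR := QR ++ [T.obj V]) (PQR := PQR ++ [T.obj V])
        (by simp [hQR]) (by simp [hPQR]) (by simp [hPQR']) rfl (hNh.trans (by simp)) rfl
        (hNgh.trans (by simp)) rfl (hN.trans (by simp)) S₆ SN ((T.str S₂.inn').obj h))
    rw [← C.comp₂_id_comp] at key
    rw [T.strAuxMult_cons s hMF hNF f hL hL' hPQR' hMgh hNgh hM hN SM.out' SN.out' _ S₄]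
    exact key

end StrongRelativePseudomonad

namespace StrongRelativePseudomonad

variable {D : TwoMulticategory.{u, v, w}} {C : TwoMulticategory.{u', v', w'}}
  {J : MultiFunctor D C} (T : StrongRelativePseudomonad J)

/-- `unitCell_multCell`, composed with a 1-cell `c` in the argument which is strengthened. -/
theorem unitCell_multCell_comp {L M Ξ A Ξ' A' Ω Ξc Ac : List C.Ob} {j l u : ℕ} {W X Y : D.Ob}
    (s : Replaces L j (J.obj X) [T.obj X] M)
    (S : Nested M j (T.obj X) Ξ l (J.obj W) [T.obj W] u A Ξ' A')
    (SM : Nested M j (T.obj X) Ξ l (J.obj W) Ω u A Ξc Ac)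
    (SB : Nested A' u (T.obj W) [J.obj W] 0 (J.obj W) Ω u A Ω Ac)
    (SG : Nested Ξ' l (T.obj W) [J.obj W] 0 (J.obj W) Ω l Ξ Ω Ξc)
    (S₃ : Nested M j (T.obj X) Ξ' l (T.obj W) Ω u A' Ξc Ac)
    (f : C.Hom L (T.obj Y)) (g : C.Hom Ξ (T.obj X)) (c : C.Hom Ω (J.obj W)) :
    C.comp₂ SM.inn (T.unitCell S.inn SB.out (C.comp S.out ((T.str s).obj f) g)).hom (𝟙 c) ≫
        eqToHom (C.comp_post SB _ (T.unit W) c) ≫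
        C.comp₂ S₃.inn (T.multCell s S f g).hom (𝟙 (C.post (T.unit W) c)) ≫
        eqToHom (C.assoc S₃ _ _ _) =
      eqToHom (C.assoc SM _ g c) ≫
        C.comp₂ SM.out' (𝟙 ((T.str s).obj f)) (C.comp₂ SM.inn' (T.unitCell S.inn' SG.out g).hom (𝟙 c) ≫
          eqToHom (C.comp_post SG _ (T.unit W) c)) := by
  have a₁ := C.comp_post₂_eqToHom SB (T.multCell s S f g).hom (𝟙 (T.unit W)) (𝟙 c)
  have a₂ := C.assoc₂_eqToHom SM (𝟙 ((T.str s).obj f)) (T.unitCell S.inn' SG.out g).hom (𝟙 c)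
  have em := T.unitCell_multCell s S f g
  rw [show C.post₂ (𝟙 (T.unit W)) (𝟙 c) = 𝟙 _ from C.comp₂_id _ _ _] at a₁
  rw [← reassoc_of% a₁, C.comp₂_id_comp, ← reassoc_of% a₂, ← em]
  simp [C.comp₂_comp_id]

/-- For `c` composed in an argument of `g`, strengthening of `(fᵗ ∘ g) ∘ c` agrees with strengthening of
`fᵗ ∘ (g ∘ c)`. At the argument of `c` this is `associativity` together with `unitCell_multCell`. -/
theorem strAuxComp_strAuxMult {X X' Y : D.Ob} {P K MF NF : List C.Ob} {Δ Δ' Θ : List D.Ob}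
    (s : Replaces K P.length (J.obj X) [T.obj X] MF) (hMF : MF = P ++ [T.obj X] ++ Δ.map J.obj)
    (hNF : NF = P ++ [T.obj X] ++ Δ.map T.obj) (f : C.Hom K (T.obj Y))
    (c : C.Hom (Θ.map J.obj) (J.obj X')) (Γ : List D.Ob) :
    ∀ {Lg Lg' L L' : List D.Ob} (hLg : Lg = Γ ++ X' :: Δ') (hLg' : Lg' = Γ ++ (Θ ++ Δ'))
    (hL : L = Γ ++ X' :: (Δ' ++ Δ)) (hL' : L' = Γ ++ (Θ ++ (Δ' ++ Δ))) (hLΔ : L = Lg ++ Δ)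
    (hLΔ' : L' = Lg' ++ Δ)
    {Q PQ Mg Ng Mg' Ng' M N M' N' : List C.Ob} (hPQ : PQ = P ++ Q)
    (hMg : Mg = Q ++ Lg.map J.obj) (hNg : Ng = Q ++ Lg.map T.obj)
    (hMg' : Mg' = Q ++ Lg'.map J.obj) (hNg' : Ng' = Q ++ Lg'.map T.obj)
    (hM : M = PQ ++ L.map J.obj) (hN : N = PQ ++ L.map T.obj)
    (hM' : M' = PQ ++ L'.map J.obj) (hN' : N' = PQ ++ L'.map T.obj) {l u : ℕ}
    (hl : l = Q.length + Γ.length) (hu : u = PQ.length + Γ.length)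
    (SM : Nested MF P.length (T.obj X) Mg l (J.obj X') (Θ.map J.obj) u M Mg' M')
    (SN : Nested NF P.length (T.obj X) Ng l (T.obj X') (Θ.map T.obj) u N Ng' N')
    (g : C.Hom Mg (T.obj X)),
    (T.strAuxComp c Γ hL hL' hM hN hM' hN' hu SM.inn SN.inn
          (C.comp SM.out ((T.str s).obj f) g)).hom ≫
        C.comp₂ SN.inn (T.strAuxMult s hMF hNF f Lg hLΔ hPQ hMg hNg hM hN SM.out SN.out g).hom (𝟙 _) ≫
        eqToHom (C.assoc SN _ _ _) =
      (T.strAux Y PQ L' hM' hN').map (eqToHom (C.assoc SM _ g c)) ≫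
        (T.strAuxMult s hMF hNF f Lg' hLΔ' hPQ hMg' hNg' hM' hN' SM.out' SN.out'
          (C.comp SM.inn' g c)).hom ≫
        C.comp₂ SN.out' (𝟙 _)
          (T.strAuxComp c Γ hLg hLg' hMg hNg hMg' hNg' hl SM.inn' SN.inn' g).hom := by
  induction Γ with
  | nil =>
    intro Lg Lg' L L' hLg hLg' hL hL' hLΔ hLΔ' Q PQ Mg Ng Mg' Ng' M N M' N' hPQ hMg hNg hMg' hNg' hM
      hN hM' hN' l u hl hu SM SN g
    obtain rfl : Lg = X' :: Δ' := hLg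
    obtain rfl : L = X' :: (Δ' ++ Δ) := hL
    obtain rfl : l = Q.length := hl
    obtain rfl : u = PQ.length := hu
    have S := Nested.segment (W' := T.obj X') hMF hPQ hMg hM List.map_append
    have SB : Nested _ PQ.length (T.obj X') [J.obj X'] 0 (J.obj X') (Θ.map J.obj) PQ.length M
      (Θ.map J.obj) M' := Nested.of rfl S.inn.back (Replaces.whole _ _)
        ⟨PQ, (Δ' ++ Δ).map J.obj, rfl, by simp, by simp [hM', hL']⟩
    have SG : Nested _ Q.length (T.obj X') [J.obj X'] 0 (J.obj X') (Θ.map J.obj) Q.length Mg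
      (Θ.map J.obj) Mg' := Nested.of rfl S.inn'.back (Replaces.whole _ _)
        ⟨Q, Δ'.map J.obj, rfl, by simp, by simp [hMg', hLg']⟩
    have S₃ := Nested.of SM.hr S.out' SG.out' SM.out'
    have st := T.strAuxMult_strAuxMult s hMF hNF f hPQ rfl S rfl (hNg.trans (by simp)) rfl
      (hN.trans (by simp)) g Θ hL' hLg' hLΔ' (R' := []) (QR := Q) (PQR := PQ) (by simp) (by simp) hPQ rfl rfl hMg'
      hNg' hM' hN' S₃ SN (C.post (T.unit X') c)
    have nat := T.strAuxMult_naturality s hMF hNF (𝟙 f) Lg' hLΔ' hPQ hMg' hNg' hM' hN' SM.out' SN.out'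
      (C.comp₂ SM.inn' (T.unitCell S.inn' SG.out g).hom (𝟙 c) ≫
          eqToHom (C.comp_post SG _ (T.unit X') c))
    rw [CategoryTheory.Functor.map_id, CategoryTheory.Functor.map_id] at nat
    rw [T.strAuxComp_nil c hL' hM hN hM' hN' rfl SM.inn SN.inn _ S.inn SB,
      T.strAuxComp_nil c hLg' hMg hNg hMg' hNg' rfl SM.inn' SN.inn' _ S.inn' SG]
    have key := (T.strAux Y PQ L' hM' hN').map_paste_nil
      (x := C.compIso SM.inn (T.unitCell S.inn SB.out _) (Iso.refl c) ≪≫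
        eqToIso (C.comp_post SB _ _ _))
      ((Category.assoc _ _ _).trans (T.unitCell_multCell_comp s S SM SB SG S₃ f g c)) nat st
    rw [← C.comp₂_id_comp] at key
    rw [T.strAuxMult_cons s hMF hNF f hLΔ rfl hPQ hMg hNg hM hN SM.out SN.out _ S]
    exact key
  | cons W Γ ih =>
    intro Lg Lg' L L' hLg hLg' hL hL' hLΔ hLΔ' Q PQ Mg Ng Mg' Ng' M N M' N' hPQ hMg hNg hMg' hNg' hM
      hN hM' hN' l u hl hu SM SN g
    obtain rfl : Lg = W :: (Γ ++ X' :: Δ') := hLg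
    obtain rfl : Lg' = W :: (Γ ++ (Θ ++ Δ')) := hLg'
    obtain rfl : L = W :: (Γ ++ X' :: (Δ' ++ Δ)) := hL
    obtain rfl : L' = W :: (Γ ++ (Θ ++ (Δ' ++ Δ))) := hL'
    have hΔ : Γ ++ X' :: (Δ' ++ Δ) = (Γ ++ X' :: Δ') ++ Δ := (List.cons.inj hLΔ).2
    have hΔ' : Γ ++ (Θ ++ (Δ' ++ Δ)) = (Γ ++ (Θ ++ Δ')) ++ Δ := (List.cons.inj hLΔ').2
    have S := Parallel.suffix (P := Q) (k := Γ.length) (B := J.obj X') (Ω := Θ.map J.obj)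
      (Q := (Γ ++ X' :: Δ').map J.obj) (Q' := (Γ ++ (Θ ++ Δ')).map J.obj)
      ⟨Γ.map J.obj, Δ'.map J.obj, by simp, by simp, by simp⟩ (J.obj W) (T.obj W)
      (M := Mg) (M' := Mg') (by simpa using hMg) (by simpa using hMg') (l := l)
      (by simp at hl; omega)
    have S₁ := Parallel.suffix (P := PQ) (k := Γ.length) (B := J.obj X') (Ω := Θ.map J.obj)
      (Q := (Γ ++ X' :: (Δ' ++ Δ)).map J.obj) (Q' := (Γ ++ (Θ ++ (Δ' ++ Δ))).map J.obj)
      ⟨Γ.map J.obj, (Δ' ++ Δ).map J.obj, by simp, by simp, by simp⟩ (J.obj W) (T.obj W)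
      (M := M) (M' := M') (by simpa using hM) (by simpa using hM') (l := u)
      (by simp at hu; omega)
    have R := Nested.segment (W' := T.obj W) hMF hPQ hMg hM (by rw [hΔ, List.map_append])
    have R₁ := Nested.segment (W' := T.obj W) hMF hPQ hMg' hM' (by rw [hΔ', List.map_append])
    have R₃ := Nested.of SM.hr R.out' S.right' R₁.out'
    have nat := T.strAuxMult_naturality s hMF hNF (𝟙 f) (Γ ++ (Θ ++ Δ')) hΔ' (Q := Q ++ [T.obj W])
      (PQ := PQ ++ [T.obj W]) (by simp [hPQ]) rfl (hNg'.trans (by simp)) rfl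
      (hN'.trans (by simp)) R₁.out' SN.out' (T.strNat S g c).hom
    rw [CategoryTheory.Functor.map_id, CategoryTheory.Functor.map_id] at nat
    have nat' := T.strAuxComp_naturality (𝟙 c) Γ rfl rfl (P := PQ ++ [T.obj W]) rfl
      (hN.trans (by simp)) rfl (hN'.trans (by simp)) (by simp at hu ⊢; omega) S₁.right' SN.inn
      (T.multCell s R f g).hom
    rw [show C.post₂ (𝟙 (T.unit X')) (𝟙 c) = 𝟙 _ from C.comp₂_id _ _ _,
      CategoryTheory.Functor.map_id] at nat'
    have key := (T.strAux Y (PQ ++ [T.obj W]) (Γ ++ (Θ ++ (Δ' ++ Δ))) rfl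
        (hN'.trans (by simp))).map_paste_cons
      (T.multCell_strNat_right_eqToHom s S R R₁ SM R₃ S₁ f g c) nat' nat
      (ih rfl rfl rfl rfl hΔ hΔ' (Q := Q ++ [T.obj W]) (PQ := PQ ++ [T.obj W])
        (by simp [hPQ]) rfl (hNg.trans (by simp)) rfl (hNg'.trans (by simp)) rfl (hN.trans (by simp))
        rfl (hN'.trans (by simp)) (by simp at hl ⊢; omega) (by simp at hu ⊢; omega) R₃ SN
        ((T.str S.right).obj g))
    rw [← C.comp₂_comp_id, ← C.comp₂_id_comp] at key
    rw [T.strAuxMult_cons s hMF hNF f hLΔ hΔ hPQ hMg hNg hM hN SM.out SN.out _ R,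
      T.strAuxMult_cons s hMF hNF f hLΔ' hΔ' hPQ hMg' hNg' hM' hN' SM.out' SN.out' _ R₁]
    exact key

/-- Replacing `f` by `fᵗ ∘ i` is compatible with the associativity of `(f ∘ b) ∘ c`. -/
theorem unitCell_assoc {L M Ξ Θ N N' Ξ' : List C.Ob} {j l r : ℕ} {X Y : D.Ob} {X' : C.Ob}
    (s : Replaces L j (J.obj X) [T.obj X] M)
    (S : Nested M j (T.obj X) [J.obj X] 0 (J.obj X) Ξ j L Ξ N)
    (S' : Nested M j (T.obj X) [J.obj X] 0 (J.obj X) Ξ' j L Ξ' N')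
    (SM : Nested L j (J.obj X) Ξ l X' Θ r N Ξ' N')
    (S₂ : Nested M j (T.obj X) Ξ l X' Θ r N Ξ' N') (f : C.Hom L (T.obj Y)) (b : C.Hom Ξ (J.obj X))
    (c : C.Hom Θ X') :
    C.comp₂ SM.inn (C.comp₂ SM.out (T.unitCell s S.out f).hom (𝟙 b) ≫ eqToHom (C.comp_post S _ _ _))
        (𝟙 c) ≫ eqToHom (C.assoc S₂ _ _ c) =
      eqToHom (C.assoc SM f b c) ≫ (C.comp₂ S'.inn (T.unitCell s S'.out f).hom (𝟙 _) ≫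
        eqToHom (C.comp_post S' _ _ _)) ≫
        C.comp₂ S'.out' (𝟙 _) (eqToHom (C.post_comp SM.inn' (T.unit X) b c)) := by
  have a₁ := C.assoc₂_eqToHom SM (T.unitCell s S.out f).hom (𝟙 b) (𝟙 c)
  rw [C.comp₂_id] at a₁
  rw [C.comp₂_comp_id, C.comp₂_eqToHom_id, C.comp₂_id_eqToHom, Category.assoc, eqToHom_trans,
    Category.assoc, eqToHom_trans, ← reassoc_of% a₁, eqToHom_trans]

/-- Associativity of `strAuxComp`, which gives the associativity axiom of the pseudo-multifunctor. -/
theorem strAuxComp_strAuxComp {X X' Y : D.Ob} {Γ' Δ Δ' Θ Ξ Ξ' : List D.Ob}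
    (hΞ : Ξ = Γ' ++ X' :: Δ') (hΞ' : Ξ' = Γ' ++ (Θ ++ Δ'))
    (b : C.Hom (Ξ.map J.obj) (J.obj X)) (c : C.Hom (Θ.map J.obj) (J.obj X')) {l : ℕ}
    (hl : l = ([] : List C.Ob).length + Γ'.length)
    (Γ : List D.Ob) :
    ∀ {L L' L'' Γ₂ : List D.Ob} (hL : L = Γ ++ X :: Δ) (hL₁ : L' = Γ ++ (Ξ ++ Δ))
    (_ : Γ₂ = Γ ++ Γ')
    (hL₂ : L' = Γ₂ ++ X' :: (Δ' ++ Δ)) (hL₁' : L'' = Γ ++ (Ξ' ++ Δ))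
    (hL₂' : L'' = Γ₂ ++ (Θ ++ (Δ' ++ Δ)))
    {P M N M' N' M'' N'' : List C.Ob}
    (hM : M = P ++ L.map J.obj) (hN : N = P ++ L.map T.obj)
    (hM' : M' = P ++ L'.map J.obj) (hN' : N' = P ++ L'.map T.obj)
    (hM'' : M'' = P ++ L''.map J.obj) (hN'' : N'' = P ++ L''.map T.obj) {k r : ℕ}
    (hk : k = P.length + Γ.length) (hr : r = P.length + Γ₂.length)
    (SM : Nested M k (J.obj X) (Ξ.map J.obj) l (J.obj X') (Θ.map J.obj) r M' (Ξ'.map J.obj) M'')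
    (SN : Nested N k (T.obj X) (Ξ.map T.obj) l (T.obj X') (Θ.map T.obj) r N' (Ξ'.map T.obj) N'')
    (f : C.Hom M (T.obj Y)),
    (T.strAuxComp c Γ₂ hL₂ hL₂' hM' hN' hM'' hN'' hr SM.inn SN.inn (C.comp SM.out f b)).hom ≫
        C.comp₂ SN.inn (T.strAuxComp b Γ hL hL₁ hM hN hM' hN' hk SM.out SN.out f).hom (𝟙 _) ≫
        eqToHom (C.assoc SN _ _ _) =
      (T.strAux Y P L'' hM'' hN'').map (eqToHom (C.assoc SM f b c)) ≫
        (T.strAuxComp (C.comp SM.inn' b c) Γ hL hL₁' hM hN hM'' hN'' hk SM.out' SN.out' f).hom ≫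
        C.comp₂ SN.out' (𝟙 _)
          ((T.strAux X [] Ξ' rfl rfl).map (eqToHom (C.post_comp SM.inn' (T.unit X) b c)) ≫
            (T.strAuxComp c Γ' hΞ hΞ' rfl rfl rfl rfl hl SM.inn' SN.inn' (C.post (T.unit X) b)).hom) := by
  induction Γ with
  | nil =>
    intro L L' L'' Γ₂ hL hL₁ hΓ₂ hL₂ hL₁' hL₂' P M N M' N' M'' N'' hM hN hM' hN' hM'' hN'' k r hk hr
      SM SN f
    obtain rfl : L = X :: Δ := hL
    obtain rfl : Γ₂ = Γ' := hΓ₂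
    obtain rfl : k = P.length := hk
    have hL₁ : L' = Ξ ++ Δ := hL₁
    have hL₁' : L'' = Ξ' ++ Δ := hL₁'
    have s := Replaces.mid P (J.obj X) [T.obj X] (Δ.map J.obj) (by simpa using hM) rfl
    have S : Nested _ P.length (T.obj X) [J.obj X] 0 (J.obj X) (Ξ.map J.obj) P.length M
        (Ξ.map J.obj) M' :=
      Nested.of rfl s.back (Replaces.whole _ _) (Replaces.mid P _ _ (Δ.map J.obj) (by simp)
        (by simp [hM', hL₁]))
    have S' : Nested _ P.length (T.obj X) [J.obj X] 0 (J.obj X) (Ξ'.map J.obj) P.length M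
        (Ξ'.map J.obj) M'' :=
      Nested.of rfl s.back (Replaces.whole _ _) (Replaces.mid P _ _ (Δ.map J.obj) (by simp)
        (by simp [hM'', hL₁']))
    have S₂ := Nested.of SM.hr S.out' SM.inn' S'.out'
    have st := T.strAuxComp_strAuxMult s rfl (hN.trans (by simp)) f c Γ₂ hΞ hΞ' hL₂ hL₂' hL₁ hL₁'
      (Q := []) (by simp) rfl rfl rfl rfl hM' hN' hM'' hN'' hl hr S₂ SN (C.post (T.unit X) b)
    have nat' := T.strAuxComp_naturality (𝟙 c) Γ₂ hL₂ hL₂' hM' hN' hM'' hN'' hr SM.inn SN.inn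
      (C.comp₂ SM.out (T.unitCell s S.out f).hom (𝟙 b) ≫ eqToHom (C.comp_post S _ _ _))
    rw [show C.post₂ (𝟙 (T.unit X')) (𝟙 c) = 𝟙 _ from C.comp₂_id _ _ _,
      CategoryTheory.Functor.map_id] at nat'
    have nat := T.strAuxMult_naturality s rfl (hN.trans (by simp)) (𝟙 f) Ξ' hL₁' (Q := [])
      (PQ := P) (by simp) rfl rfl hM'' hN'' S'.out' SN.out' (eqToHom (C.post_comp SM.inn' (T.unit X) b c))
    rw [CategoryTheory.Functor.map_id, CategoryTheory.Functor.map_id] at nat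
    have key := (T.strAux Y P L'' hM'' hN'').map_paste_natural
      (x := C.compIso S'.inn (T.unitCell s S'.out f) (Iso.refl (C.comp SM.inn' b c)) ≪≫
        eqToIso (C.comp_post S' _ _ _))
      (T.unitCell_assoc s S S' SM S₂ f b c)
      nat' nat st
    rw [← C.comp₂_comp_id, ← C.comp₂_id_comp] at key
    rw [T.strAuxComp_nil b hL₁ hM hN hM' hN' rfl SM.out SN.out f s S,
      T.strAuxComp_nil (C.comp SM.inn' b c) hL₁' hM hN hM'' hN'' rfl SM.out' SN.out' f s S']
    exact key
  | cons W Γ ih =>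
    intro L L' L'' Γ₂ hL hL₁ hΓ₂ hL₂ hL₁' hL₂' P M N M' N' M'' N'' hM hN hM' hN' hM'' hN'' k r hk hr
      SM SN f
    obtain rfl : L = W :: (Γ ++ X :: Δ) := hL
    obtain rfl : L' = W :: (Γ ++ (Ξ ++ Δ)) := hL₁
    obtain rfl : L'' = W :: (Γ ++ (Ξ' ++ Δ)) := hL₁'
    obtain rfl : Γ₂ = W :: (Γ ++ Γ') := hΓ₂
    have e₂ : Γ ++ (Ξ ++ Δ) = (Γ ++ Γ') ++ X' :: (Δ' ++ Δ) := (List.cons.inj hL₂).2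
    have e₂' : Γ ++ (Ξ' ++ Δ) = (Γ ++ Γ') ++ (Θ ++ (Δ' ++ Δ)) := (List.cons.inj hL₂').2
    have S₁ := Parallel.suffix (P := P) (k := Γ.length) (B := J.obj X) (Ω := Ξ.map J.obj)
      (Q := (Γ ++ X :: Δ).map J.obj) (Q' := (Γ ++ (Ξ ++ Δ)).map J.obj)
      ⟨Γ.map J.obj, Δ.map J.obj, by simp, by simp, by simp⟩ (J.obj W) (T.obj W)
      (M := M) (M' := M') (by simpa using hM) (by simpa using hM') (l := k)
      (by simp at hk; omega)
    have S₃ := Parallel.suffix (P := P) (k := Γ.length) (B := J.obj X) (Ω := Ξ'.map J.obj)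
      (Q := (Γ ++ X :: Δ).map J.obj) (Q' := (Γ ++ (Ξ' ++ Δ)).map J.obj)
      ⟨Γ.map J.obj, Δ.map J.obj, by simp, by simp, by simp⟩ (J.obj W) (T.obj W)
      (M := M) (M' := M'') (by simpa using hM) (by simpa using hM'') (l := k)
      (by simp at hk; omega)
    have S₂ := Parallel.suffix (P := P) (k := (Γ ++ Γ').length) (B := J.obj X') (Ω := Θ.map J.obj)
      (Q := (Γ ++ (Ξ ++ Δ)).map J.obj) (Q' := (Γ ++ (Ξ' ++ Δ)).map J.obj)
      ⟨(Γ ++ Γ').map J.obj, (Δ' ++ Δ).map J.obj, by simp, by simp [e₂], by simp [e₂']⟩ (J.obj W)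
      (T.obj W) (M := M') (M' := M'') (by simpa using hM') (by simpa using hM'') (l := r)
      (by simp at hr ⊢; omega)
    have S' := Nested.of SM.hr S₁.right' SM.inn' S₃.right'
    have nat' := T.strAuxComp_naturality (𝟙 c) (Γ ++ Γ') e₂ e₂' (P := P ++ [T.obj W]) rfl
      (hN'.trans (by simp)) rfl (hN''.trans (by simp)) (by simp at hr ⊢; omega) S₂.right' SN.inn
      (T.strNat S₁ f b).hom
    rw [show C.post₂ (𝟙 (T.unit X')) (𝟙 c) = 𝟙 _ from C.comp₂_id _ _ _,
      CategoryTheory.Functor.map_id] at nat'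
    have key := (T.strAux Y (P ++ [T.obj W]) (Γ ++ (Ξ' ++ Δ)) rfl (hN''.trans (by simp))).map_paste_cons
      (w' := 𝟙 _)
      ((T.strNat_comp_eqToHom SM S₁ S₂ S₃ S' f b c).trans
        (congrArg _ (Category.comp_id _).symm))
      nat' (W' := 𝟙 _)
      (by rw [CategoryTheory.Functor.map_id, Category.id_comp, Category.comp_id])
      (ih rfl rfl rfl e₂ rfl e₂' rfl (hN.trans (by simp)) rfl (hN'.trans (by simp)) rfl
        (hN''.trans (by simp)) (by simp at hk ⊢; omega) (by simp at hr ⊢; omega) S' SN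
        ((T.str S₁.right).obj f))
    rw [← C.comp₂_comp_id, Category.id_comp] at key
    rw [T.strAuxComp_cons c hL₂ hL₂' e₂ e₂' hM' hN' hM'' hN'' hr SM.inn SN.inn _ S₂]
    exact key

end StrongRelativePseudomonad

namespace StrongRelativePseudomonad

variable {D : TwoMulticategory.{u, v, w}} {C : TwoMulticategory.{u', v', w'}}
  {J : MultiFunctor D C} (T : StrongRelativePseudomonad J)

/-! ### Unit laws -/

/-- Strengthening of `iᵗ ∘ g`, followed by `θ : iᵗ → 1`, is strengthening of the 2-cell
`iᵗ ∘ g → g`. -/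
theorem strAuxMult_θ {X : D.Ob} {Δ : List D.Ob} (hΔ : Δ = [])
    (s : Replaces [J.obj X] 0 (J.obj X) [T.obj X] [T.obj X])
    (hMF hNF) (Ξ : List D.Ob) : ∀ (hL : Ξ = Ξ ++ Δ) {Q Mg Ng : List C.Ob}
    (hMg : Mg = Q ++ Ξ.map J.obj) (hNg : Ng = Q ++ Ξ.map T.obj)
    (r : Replaces [T.obj X] 0 (T.obj X) Mg Mg) (r' : Replaces [T.obj X] 0 (T.obj X) Ng Ng)
    (g : C.Hom Mg (T.obj X)),
    (T.strAuxMult (P := []) (NF := [T.obj X]) s hMF hNF (T.unit X) Ξ hL rfl hMg hNg hMg hNg r r' g).hom ≫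
        eqToHom (by subst hΔ; rfl) ≫ C.comp₂ r' (T.θ X).hom (𝟙 _) ≫ eqToHom (C.one_comp r' _) =
      (T.strAux X Q Ξ hMg hNg).map (C.comp₂ r (T.θ X).hom (𝟙 g) ≫ eqToHom (C.one_comp r g)) := by
  subst hΔ
  induction Ξ with
  | nil =>
    intro hL Q Mg Ng hMg hNg r r' g
    obtain rfl := hMg.trans hNg.symm
    exact (Category.id_comp _).trans (Category.id_comp _)
  | cons W Ξ ih =>
    intro hL Q Mg Ng hMg hNg r r' g
    have hL' : Ξ = Ξ ++ [] := by simp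
    have S := Nested.segment (P := []) (W' := T.obj W) hMF rfl hMg hMg
      (show Ξ.map J.obj = Ξ.map J.obj ++ [].map J.obj by simp)
    have S' : Nested [T.obj X] 0 (T.obj X) Mg Q.length (J.obj W) [T.obj W] Q.length Mg
      (Q ++ [T.obj W] ++ Ξ.map J.obj) (Q ++ [T.obj W] ++ Ξ.map J.obj) := S
    have ih := ih hL' (Q := Q ++ [T.obj W]) rfl (hNg.trans (by simp)) S'.out' r' ((T.str S'.inn').obj g)
    have mθ := congrArg (T.strAux X (Q ++ [T.obj W]) Ξ rfl (hNg.trans (by simp))).map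
      (T.multCell_θ s S' g)
    rw [T.strAuxMult_cons s hMF hNF (T.unit X) hL hL' rfl hMg hNg hMg hNg r r' _ S]
    rw [CategoryTheory.Functor.map_comp] at mθ
    refine (Category.assoc _ _ _).trans ((congrArg _ ih).trans mθ)

theorem strAuxNat_one {Y : D.Ob} {B : C.Ob} {k : ℕ} (Δ : List D.Ob) :
    ∀ {P M N : List C.Ob} (hM : M = P ++ Δ.map J.obj) (hN : N = P ++ Δ.map T.obj)
    (s : Replaces P k B [B] P) (r : Replaces M k B [B] M) (r' : Replaces N k B [B] N)
    (f : C.Hom M (T.obj Y)),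
    (T.strAuxNat (C.one B) Δ hM hN hM hN s r r' f).hom ≫ eqToHom (C.comp_one r' _) =
      (T.strAux Y P Δ hM hN).map (eqToHom (C.comp_one r f)) := by
  induction Δ with
  | nil =>
    intro P M N hM hN s r r' f
    obtain rfl := hM.trans hN.symm
    exact Category.id_comp _
  | cons X Δ ih =>
    intro P M N hM hN s r r' f
    have S := Parallel.prefix s (J.obj X) (T.obj X) hM hM
    have ih := ih (P := P ++ [T.obj X]) rfl (hN.trans (by simp)) (s.append_right _) S.right' r'
      ((T.str S.right).obj f)
    have key := congrArg (T.strAux Y (P ++ [T.obj X]) Δ rfl (hN.trans (by simp))).map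
      (T.strNat_one_eqToHom S f)
    rw [eqToHom_refl, Category.comp_id, CategoryTheory.Functor.map_comp] at key
    exact (Category.assoc _ _ _).trans ((congrArg _ ih).trans key)

/-- Strengthening of `fᵗ ∘ i`, followed by `θ : iᵗ → 1`, is successive strengthening of the 2-cell
`(fᵗ ∘ i)ᵗ → fᵗ` given by `multCell` and `θ`. -/
theorem strAuxMult_unit {X Y : D.Ob} {P K NF : List C.Ob} {Δ : List D.Ob}
    (s : Replaces K P.length (J.obj X) [T.obj X] (P ++ [T.obj X] ++ Δ.map J.obj))
    (hNF : NF = P ++ [T.obj X] ++ Δ.map T.obj) (f : C.Hom K (T.obj Y)) (hPQ : P = P ++ [])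
    (hK : K = P ++ (X :: Δ).map J.obj) (hN : NF = P ++ (X :: Δ).map T.obj)
    (S : Nested (P ++ [T.obj X] ++ Δ.map J.obj) P.length (T.obj X) [J.obj X] 0 (J.obj X) [T.obj X]
      P.length K [T.obj X] (P ++ [T.obj X] ++ Δ.map J.obj))
    (r' : Replaces NF P.length (T.obj X) [T.obj X] NF) :
    (T.strAuxMult s rfl hNF f [X] rfl hPQ rfl rfl hK hN S.out r' (T.unit X)).hom ≫
        C.comp₂ r' (𝟙 _) (T.θ X).hom ≫ eqToHom (C.comp_one r' _) =
      (T.strAux Y (P ++ [T.obj X]) Δ rfl hNF).map ((T.multCell s S f (T.unit X)).hom ≫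
        C.comp₂ S.out' (𝟙 _) (T.θ X).hom ≫ eqToHom (C.comp_one S.out' _)) := by
  have t : Replaces (P ++ [T.obj X]) P.length (T.obj X) [T.obj X] (P ++ [T.obj X]) :=
    Replaces.mid P (T.obj X) [T.obj X] [] rfl (by simp)
  have nat := T.strAuxNat_naturality (T.θ X).hom Δ rfl hNF rfl hNF t S.out' r'
    (𝟙 ((T.str s).obj f))
  rw [CategoryTheory.Functor.map_id] at nat
  have on := T.strAuxNat_one Δ rfl hNF t S.out' r' ((T.str s).obj f)
  have key : (T.strAuxNat ((T.str S.inn').obj (T.unit X)) Δ rfl hNF rfl hNF t S.out' r'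
      ((T.str s).obj f)).hom ≫ C.comp₂ r' (𝟙 _) (T.θ X).hom ≫ eqToHom (C.comp_one r' _) =
      (T.strAux Y (P ++ [T.obj X]) Δ rfl hNF).map (C.comp₂ S.out' (𝟙 _) (T.θ X).hom ≫
        eqToHom (C.comp_one S.out' _)) := by
    rw [CategoryTheory.Functor.map_comp, ← on]
    exact (Category.assoc _ _ _).symm.trans ((congrArg (· ≫ _) nat.symm).trans (Category.assoc _ _ _))
  rw [CategoryTheory.Functor.map_comp]
  exact (Category.assoc _ _ _).trans (congrArg _ key)

end StrongRelativePseudomonad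

namespace StrongRelativePseudomonad

variable {D : TwoMulticategory.{u, v, w}} {C : TwoMulticategory.{u', v', w'}}
  {J : MultiFunctor D C} (T : StrongRelativePseudomonad J)

/-- The left unit law of `strAuxComp`, which is a consequence of `multCell_θ` and `unitCell_θ`. -/
theorem strAuxComp_θ_left {X : D.Ob} {Δ Ξ : List D.Ob} (hΔ : Δ = []) (hL' : Ξ = Ξ ++ Δ)
    (b : C.Hom (Ξ.map J.obj) (J.obj X)) (hM hN hM' hN' hk)
    (r : Replaces [J.obj X] 0 (J.obj X) (Ξ.map J.obj) (Ξ.map J.obj))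
    (r' : Replaces [T.obj X] 0 (T.obj X) (Ξ.map T.obj) (Ξ.map T.obj)) :
    (T.strAuxComp (Δ := Δ) (L := X :: Δ) (M := [J.obj X]) (N := [T.obj X]) (P := []) (k := 0) b [] rfl
        hL' hM hN hM' hN' hk r r' (T.unit X)).hom ≫ eqToHom (by subst hΔ; rfl) ≫
      C.comp₂ r' (T.θ X).hom (𝟙 _) ≫ eqToHom (C.one_comp r' _) = 𝟙 _ := by
  have s : Replaces [J.obj X] 0 (J.obj X) [T.obj X] ([T.obj X] ++ Δ.map J.obj) :=
    Replaces.mid [] (J.obj X) [T.obj X] (Δ.map J.obj) hM rfl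
  subst hΔ
  have S : Nested [T.obj X] 0 (T.obj X) [J.obj X] 0 (J.obj X) (Ξ.map J.obj) 0 [J.obj X]
    (Ξ.map J.obj) (Ξ.map J.obj) := Nested.of rfl s.back r (Replaces.whole _ _)
  have st := T.strAuxMult_θ (Δ := []) rfl s rfl rfl Ξ hL' (Q := []) rfl rfl S.out' r' (C.post (T.unit X) b)
  have a₁ := C.comp_post₂_eqToHom S (T.θ X).hom (𝟙 (T.unit X)) (𝟙 b)
  have u := T.unitCell_θ X s S.out
  rw [show C.post₂ (𝟙 (T.unit X)) (𝟙 b) = 𝟙 _ from C.comp₂_id _ _ _] at a₁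
  have key : (C.comp₂ r (T.unitCell s S.out (T.unit X)).hom (𝟙 b) ≫ eqToHom (C.comp_post S _ _ _)) ≫
      C.comp₂ S.out' (T.θ X).hom (𝟙 (C.post (T.unit X) b)) ≫ eqToHom (C.one_comp S.out' _) = 𝟙 _ := by
    have u' := congrArg (C.comp₂ r · (𝟙 b)) u
    simp only [C.comp₂_comp_id, C.comp₂_eqToHom_id, C.comp₂_id] at u'
    refine Eq.trans ?_ u'
    rw [Category.assoc]
    congr 1
    refine (Category.assoc _ _ _).symm.trans ((congrArg (· ≫ _) a₁.symm).trans ?_)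
    rw [Category.assoc, eqToHom_trans]
    rfl
  rw [T.strAuxComp_nil b hL' hM hN hM' hN' hk r r' (T.unit X) s S]
  refine (Category.assoc _ _ _).trans ((congrArg _ st).trans ?_)
  refine ((T.strAux X [] Ξ hM' hN').map_comp _ _).symm.trans ?_
  rw [← (T.strAux X [] Ξ hM' hN').map_id]
  exact congrArg _ key

/-- The right unit law of `strAuxComp`, which is a consequence of `unitality`. -/
theorem strAuxComp_θ_right {X Y : D.Ob} {Δ : List D.Ob} (Γ : List D.Ob) : ∀ {L : List D.Ob}
    (hL : L = Γ ++ X :: Δ) (hL' : L = Γ ++ ([X] ++ Δ)) {P M N : List C.Ob}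
    (hM : M = P ++ L.map J.obj) (hN : N = P ++ L.map T.obj)
    {k : ℕ} (hk : k = P.length + Γ.length) (r : Replaces M k (J.obj X) [J.obj X] M)
    (r' : Replaces N k (T.obj X) [T.obj X] N) (f : C.Hom M (T.obj Y)),
    (T.strAuxComp (Ξ := [X]) (C.one (J.obj X)) Γ hL hL' hM hN hM hN hk r r' f).hom ≫
        C.comp₂ r' (𝟙 _) ((T.strAux X [] [X] rfl rfl).map (eqToHom (C.post_one (T.unit X)))) ≫
        C.comp₂ r' (𝟙 _) (T.θ X).hom ≫ eqToHom (C.comp_one r' _) =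
      (T.strAux Y P L hM hN).map (eqToHom (C.comp_one r f)) := by
  induction Γ with
  | nil =>
    intro L hL hL' P M N hM hN k hk r r' f
    obtain rfl : L = X :: Δ := hL
    obtain rfl : k = P.length := hk
    have s : Replaces M P.length (J.obj X) [T.obj X] (P ++ [T.obj X] ++ Δ.map J.obj) :=
      Replaces.mid P (J.obj X) [T.obj X] (Δ.map J.obj) (by simpa using hM) rfl
    have S : Nested (P ++ [T.obj X] ++ Δ.map J.obj) P.length (T.obj X) [J.obj X] 0 (J.obj X) [J.obj X]
      P.length M [J.obj X] M := Nested.of rfl s.back (Replaces.whole _ _) s.back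
    have S' : Nested (P ++ [T.obj X] ++ Δ.map J.obj) P.length (T.obj X) [J.obj X] 0 (J.obj X) [T.obj X]
      P.length M [T.obj X] _ := Nested.unary s.back s.back.self
    have hN' : N = P ++ [T.obj X] ++ Δ.map T.obj := hN.trans (by simp)
    have mu := T.strAuxMult_unit s hN' f (List.append_nil P).symm hM hN S' r'
    have nat := T.strAuxMult_naturality s rfl hN' (𝟙 f) [X] rfl (Q := []) (PQ := P) (by simp) rfl rfl hM
      hN S.out r' (eqToHom (C.post_one (T.unit X)))
    rw [CategoryTheory.Functor.map_id, CategoryTheory.Functor.map_id, C.comp₂_id_eqToHom] at nat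
    have un := T.unitality_eqToHom s s.back.self S' f
    rw [T.strAuxComp_nil (Ξ := [X]) (C.one (J.obj X)) hL' hM hN hM hN rfl r r' f s S]
    have on := C.comp₂_one_eqToHom r (T.unitCell s S.out f).hom
    have key : (T.str s).map (C.comp₂ r (T.unitCell s S.out f).hom (𝟙 _) ≫ eqToHom (C.comp_post S _ _ _)) ≫
        (T.str s).map (eqToHom (by rw [C.post_one])) ≫ (T.multCell s S' f (T.unit X)).hom ≫
        C.comp₂ S'.out' (𝟙 _) (T.θ X).hom ≫ eqToHom (C.comp_one S'.out' _) =
        (T.str s).map (eqToHom (C.comp_one r f)) := by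
      rw [← (T.str s).map_comp_assoc, Category.assoc, eqToHom_trans, on, (T.str s).map_comp_assoc, un,
        Category.comp_id]
    let F := T.strAux Y (P ++ [T.obj X]) Δ rfl hN'
    refine Eq.trans ?_ (((F.map_comp _ _).trans (congrArg _ (F.map_comp _ _))).symm.trans
      (congrArg F.map key))
    refine (Category.assoc _ _ _).trans (congrArg _ ?_)
    refine (Category.assoc _ _ _).symm.trans ((congrArg (· ≫ _) nat.symm).trans ?_)
    exact (Category.assoc _ _ _).trans (congrArg _ mu)
  | cons W Γ ih =>
    intro L hL hL' P M N hM hN k hk r r' f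
    obtain rfl : L = W :: (Γ ++ X :: Δ) := hL
    have S := Parallel.suffix (P := P) (k := Γ.length) (B := J.obj X) (Ω := [J.obj X])
        (Q := (Γ ++ X :: Δ).map J.obj) (Q' := (Γ ++ X :: Δ).map J.obj)
        ⟨Γ.map J.obj, Δ.map J.obj, by simp, by simp, by simp⟩ (J.obj W) (T.obj W)
        (M := M) (M' := M) (by simpa using hM) (by simpa using hM) (l := k)
        (by simp at hk; omega)
    have ih := ih rfl rfl (P := P ++ [T.obj W]) rfl (hN.trans (by simp)) (by simp at hk ⊢; omega)
      S.right' r' ((T.str S.right).obj f)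
    have key := congrArg (T.strAux Y (P ++ [T.obj W]) (Γ ++ X :: Δ) rfl (hN.trans (by simp))).map
      (T.strNat_one_eqToHom S f)
    rw [eqToHom_refl, Category.comp_id, CategoryTheory.Functor.map_comp] at key
    exact (Category.assoc _ _ _).trans ((congrArg _ ih).trans key)

end StrongRelativePseudomonad

/-! ### The pseudo-multifunctor -/

theorem Replaces.eq_take_cons_drop {α : Type*} {L M Ξ : List α} {k : ℕ} {X : α}
    (s : Replaces L k X Ξ M) : L = L.take k ++ X :: L.drop (k + 1) := by
  obtain ⟨Γ, Δ, rfl, rfl, rfl⟩ := s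
  simp

theorem Replaces.eq_take_append_drop {α : Type*} {L M Ξ : List α} {k : ℕ} {X : α}
    (s : Replaces L k X Ξ M) : M = L.take k ++ (Ξ ++ L.drop (k + 1)) := by
  obtain ⟨Γ, Δ, rfl, rfl, rfl⟩ := s
  simp

theorem Replaces.eq_length_take {α : Type*} {L M Ξ : List α} {k : ℕ} {X : α}
    (s : Replaces L k X Ξ M) : k = (L.take k).length := by
  obtain ⟨Γ, Δ, rfl, rfl, rfl⟩ := s
  simp

section Paste

variable {A : Type*} {B : Type*} [Category* A] [Category* B] (F : A ⥤ B)

theorem CategoryTheory.Functor.map_eqToHom_comp {a b c : A} (p : a = b) (q : b = c) :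
    F.map (eqToHom (p.trans q)) = F.map (eqToHom p) ≫ F.map (eqToHom q) := by
  rw [← F.map_comp, eqToHom_trans]

theorem CategoryTheory.Functor.map_eqToHom_eq {a b c d : A} (p : a = b) (q : b = c) (r : c = d) :
    F.map (eqToHom p ≫ eqToHom q ≫ eqToHom r) = eqToHom (by rw [p, q, r]) := by
  simp [eqToHom_map]

/-- The pasting of 2-cells in the unit axioms of the pseudo-multifunctor. -/
theorem CategoryTheory.Functor.map_paste_unit {a a₁ a₂ a₃ : A} {c₁ c₂ c₃ : B} {x : a ≅ a₁}
    {n : a₁ ⟶ a₂} {c : a₂ ⟶ a₃} {y₁ : F.obj a₁ ≅ c₁} {y₂ : F.obj a₂ ≅ c₂} {W : c₁ ⟶ c₂}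
    (nat : F.map n ≫ y₂.hom = y₁.hom ≫ W) {V : c₂ ⟶ c₃} {q : c₃ ⟶ F.obj a₃}
    (un : y₂.hom ≫ V ≫ q = F.map c) :
    (F.mapIso x ≪≫ y₁).hom ≫ (W ≫ V) ≫ q = F.map (x.hom ≫ n ≫ c) := by
  simp only [Iso.trans_hom, Functor.mapIso_hom, Category.assoc]
  rw [← reassoc_of% nat, un, F.map_comp, F.map_comp]

/-- The pasting of 2-cells in the associativity axiom of the pseudo-multifunctor. -/
theorem CategoryTheory.Functor.map_paste_assoc {a a' a₁ a₂ a₃ a₄ : A} {c₁ c₂ c₃ c₄ d₁ d₂ d₃ : B}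
    {x₁ : a ≅ a₁} {e : a ⟶ a'} {x₃ : a' ≅ a₃} {n : a₁ ⟶ a₂} {m : a₃ ⟶ a₄} {p : a₄ ⟶ a₂}
    (h : x₁.hom ≫ n = e ≫ x₃.hom ≫ m ≫ p)
    {y₁ : F.obj a₁ ≅ c₁} {y₂ : F.obj a₂ ≅ c₂} {W : c₁ ⟶ c₂} (nat : F.map n ≫ y₂.hom = y₁.hom ≫ W)
    {y₃ : F.obj a₃ ≅ d₁} {y₄ : F.obj a₄ ≅ d₂} {W' : d₁ ⟶ d₂}
    (nat' : F.map m ≫ y₄.hom = y₃.hom ≫ W')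
    {V : c₂ ⟶ c₃} {V₁ : c₃ ⟶ c₄} {V' : d₂ ⟶ d₃} {q : d₃ ⟶ c₄}
    (ih : y₄.hom ≫ V' ≫ q = F.map p ≫ y₂.hom ≫ V ≫ V₁) :
    (F.mapIso x₁ ≪≫ y₁).hom ≫ (W ≫ V) ≫ V₁ =
      F.map e ≫ (F.mapIso x₃ ≪≫ y₃).hom ≫ (W' ≫ V') ≫ q := by
  simp only [Iso.trans_hom, Functor.mapIso_hom, Category.assoc]
  rw [← reassoc_of% nat, ← reassoc_of% nat', ih, ← F.map_comp_assoc, h]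
  simp

end Paste

namespace StrongRelativePseudomonad

variable {D : TwoMulticategory.{u, v, w}} {C : TwoMulticategory.{u', v', w'}}
  {J : MultiFunctor D C} (T : StrongRelativePseudomonad J)

/-- `strAuxComp` depends on the decomposition of the contexts only up to equality. Neither its source nor
its target mentions it. -/
theorem strAuxComp_congr {X Y : D.Ob} {Ξ Δ Δ₁ : List D.Ob} (b : C.Hom (Ξ.map J.obj) (J.obj X))
    {Γ Γ₁ L L' : List D.Ob} (hΓ : Γ = Γ₁) (hΔ : Δ = Δ₁) (hL : L = Γ ++ X :: Δ)
    (hL' : L' = Γ ++ (Ξ ++ Δ))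
    {P M N M' N' : List C.Ob} (hM : M = P ++ L.map J.obj) (hN : N = P ++ L.map T.obj)
    (hM' : M' = P ++ L'.map J.obj) (hN' : N' = P ++ L'.map T.obj) {k : ℕ}
    (hk : k = P.length + Γ.length) (r : Replaces M k (J.obj X) (Ξ.map J.obj) M')
    (r' : Replaces N k (T.obj X) (Ξ.map T.obj) N') (f : C.Hom M (T.obj Y)) :
    T.strAuxComp b Γ hL hL' hM hN hM' hN' hk r r' f =
      T.strAuxComp b Γ₁ (hΓ ▸ hΔ ▸ hL) (hΓ ▸ hΔ ▸ hL') hM hN hM' hN' (hΓ ▸ hk) r r' f := by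
  subst hΓ hΔ
  rfl

theorem post_map_comp {L Ξ M : List D.Ob} {k : ℕ} {X Y : D.Ob} (s : Replaces L k X Ξ M)
    (f : D.Hom L Y) (g : D.Hom Ξ X) :
    C.post (T.unit Y) ((J.map M Y).obj (D.comp s f g)) =
      C.comp (s.map J.obj) (C.post (T.unit Y) ((J.map L Y).obj f)) ((J.map Ξ X).obj g) := by
  rw [J.map_comp, C.post_comp]

/-- The 2-cell `T(f ∘ₖ g) ≅ Tf ∘ₖ Tg`. -/
def mapComp {L Ξ M : List D.Ob} {k : ℕ} {X Y : D.Ob} (s : Replaces L k X Ξ M) (f : D.Hom L Y)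
    (g : D.Hom Ξ X) : (T.map M Y).obj (D.comp s f g) ≅
      C.comp (s.map T.obj) ((T.map L Y).obj f) ((T.map Ξ X).obj g) :=
  (T.strAux Y [] M rfl rfl).mapIso (eqToIso (T.post_map_comp s f g)) ≪≫
    T.strAuxComp (P := []) ((J.map Ξ X).obj g) (L.take k) s.eq_take_cons_drop s.eq_take_append_drop rfl rfl rfl
      rfl (s.eq_length_take.trans (Nat.zero_add _).symm) (s.map J.obj) (s.map T.obj)
      (C.post (T.unit Y) ((J.map L Y).obj f))

/-- The 2-cell `T1_X ≅ 1_{TX}`. -/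
def mapOne (X : D.Ob) : (T.map [X] X).obj (D.one X) ≅ C.one (T.obj X) :=
  (T.strAux X [] [X] rfl rfl).mapIso
    (eqToIso (by rw [J.map_one, C.post_one] : C.post (T.unit X) ((J.map [X] X).obj (D.one X)) =
      T.unit X)) ≪≫ T.θ X

theorem mapComp_naturality {L Ξ M : List D.Ob} {k : ℕ} {X Y : D.Ob} (s : Replaces L k X Ξ M)
    {f f' : D.Hom L Y} {g g' : D.Hom Ξ X} (α : f ⟶ f') (β : g ⟶ g') :
    (T.map M Y).map (D.comp₂ s α β) ≫ (T.mapComp s f' g').hom =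
      (T.mapComp s f g).hom ≫ C.comp₂ (s.map T.obj) ((T.map L Y).map α) ((T.map Ξ X).map β) := by
  refine (T.strAux Y [] M rfl rfl).map_paste (x := eqToIso (T.post_map_comp s f g))
    (x' := eqToIso (T.post_map_comp s f' g')) ?_
    (T.strAuxComp_naturality (P := []) ((J.map Ξ X).map β) (L.take k) s.eq_take_cons_drop
      s.eq_take_append_drop rfl rfl rfl rfl (s.eq_length_take.trans (Nat.zero_add _).symm) (s.map J.obj) (s.map T.obj)
      (C.post₂ (𝟙 (T.unit Y)) ((J.map L Y).map α)))
  have h : (J.map M Y).map (D.comp₂ s α β) ≫ eqToHom (J.map_comp s f' g') =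
      eqToHom (J.map_comp s f g) ≫ C.comp₂ (s.map J.obj) ((J.map L Y).map α) ((J.map Ξ X).map β) := by
    apply eq_of_heq
    simpa [-heq_eq_eq] using J.map_comp₂ s α β
  have h₁ := congrArg (C.postFunctor _ (T.unit Y)).map h
  simp only [CategoryTheory.Functor.map_comp, eqToHom_map] at h₁
  have h₂ := C.post₂_comp_eqToHom (s.map J.obj) (𝟙 (T.unit Y)) ((J.map L Y).map α) ((J.map Ξ X).map β)
  simp only [eqToIso.hom]
  rw [← eqToHom_trans (p := congrArg (C.post (T.unit Y)) (J.map_comp s f' g')) (q := C.post_comp _ _ _ _),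
    ← eqToHom_trans (p := congrArg (C.post (T.unit Y)) (J.map_comp s f g)) (q := C.post_comp _ _ _ _),
    Category.assoc, ← h₂]
  exact (Category.assoc _ _ _).symm.trans ((congrArg (· ≫ _) h₁).trans (Category.assoc _ _ _))

theorem mapComp_one_left {L : List D.Ob} {Y : D.Ob} (f : D.Hom L Y) :
    (T.mapComp (Replaces.whole Y L) (D.one Y) f).hom ≫
        C.comp₂ ((Replaces.whole Y L).map T.obj) (T.mapOne Y).hom (𝟙 ((T.map L Y).obj f)) =
      eqToHom ((congrArg (T.map L Y).obj (D.one_comp _ f)).trans (C.one_comp _ _).symm) := by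
  have s := Replaces.whole Y L
  have h₀ : C.post (T.unit Y) ((J.map [Y] Y).obj (D.one Y)) = T.unit Y := by rw [J.map_one, C.post_one]
  have nat := T.strAuxComp_naturality (P := []) (𝟙 ((J.map L Y).obj f)) [] s.eq_take_cons_drop
    s.eq_take_append_drop rfl rfl rfl rfl rfl (s.map J.obj) (s.map T.obj) (eqToHom h₀)
  rw [show C.post₂ (𝟙 (T.unit Y)) (𝟙 ((J.map L Y).obj f)) = 𝟙 _ from C.comp₂_id _ _ _,
    CategoryTheory.Functor.map_id, C.comp₂_eqToHom_id] at nat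
  have un := T.strAuxComp_θ_left (Δ := []) rfl s.eq_take_append_drop ((J.map L Y).obj f) rfl rfl rfl
    rfl rfl (s.map J.obj) (s.map T.obj)
  have un := (congrArg (_ ≫ ·) (Category.id_comp _)).symm.trans un
  have h₁ : C.comp₂ (s.map T.obj) (T.mapOne Y).hom (𝟙 ((T.map L Y).obj f)) =
      C.comp₂ (s.map T.obj) ((T.strAux Y [] [Y] rfl rfl).map (eqToHom h₀)) (𝟙 ((T.map L Y).obj f)) ≫
        C.comp₂ (s.map T.obj) (T.θ Y).hom (𝟙 ((T.map L Y).obj f)) :=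
    C.comp₂_comp_id _ _ _ _
  rw [← cancel_mono (eqToHom (C.one_comp (s.map T.obj) _)), eqToHom_trans]
  let F := T.strAux Y [] L rfl rfl
  refine (congrArg (fun x => (_ ≫ x) ≫ _) h₁).trans ((Category.assoc _ _ _).trans ?_)
  exact (F.map_paste_unit nat (un.trans (F.map_id _).symm)).trans
    (F.map_eqToHom_eq (T.post_map_comp s _ f) (congrArg (C.comp _ · _) h₀) rfl)

theorem mapComp_one_right {L : List D.Ob} {k : ℕ} {X Y : D.Ob} (s : Replaces L k X [X] L)
    (f : D.Hom L Y) :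
    (T.mapComp s f (D.one X)).hom ≫ C.comp₂ (s.map T.obj) (𝟙 ((T.map L Y).obj f)) (T.mapOne X).hom =
      eqToHom ((congrArg (T.map L Y).obj (D.comp_one s f)).trans (C.comp_one _ _).symm) := by
  have h₀ := J.map_one X
  have nat := T.strAuxComp_naturality (P := []) (eqToHom h₀) (L.take k) s.eq_take_cons_drop
    s.eq_take_append_drop rfl rfl rfl rfl (s.eq_length_take.trans (Nat.zero_add _).symm) (s.map J.obj)
    (s.map T.obj) (𝟙 (C.post (T.unit Y) ((J.map L Y).obj f)))
  rw [CategoryTheory.Functor.map_id, C.comp₂_id_eqToHom] at nat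
  have un := T.strAuxComp_θ_right (P := []) (L.take k) s.eq_take_cons_drop s.eq_take_append_drop rfl rfl
    (s.eq_length_take.trans (Nat.zero_add _).symm) (s.map J.obj) (s.map T.obj)
    (C.post (T.unit Y) ((J.map L Y).obj f))
  let A := T.strAux X [] [X] rfl rfl
  have h₂ : (T.mapOne X).hom = A.map (C.post₂ (𝟙 (T.unit X)) (eqToHom h₀)) ≫
      (A.map (eqToHom (C.post_one (T.unit X))) ≫ (T.θ X).hom) := by
    refine Eq.trans (congrArg (· ≫ _) ?_) (Category.assoc _ _ _)
    rw [show C.post₂ (𝟙 (T.unit X)) (eqToHom h₀) = eqToHom (congrArg (C.post (T.unit X)) h₀) from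
      C.comp₂_id_eqToHom _ _ _]
    exact A.map_eqToHom_comp _ _
  have h₁ := (congrArg (C.comp₂ (s.map T.obj) (𝟙 ((T.map L Y).obj f))) h₂).trans
    ((C.comp₂_id_comp _ _ _ _).trans (congrArg (_ ≫ ·) (C.comp₂_id_comp _ _ _ _)))
  rw [← cancel_mono (eqToHom (C.comp_one (s.map T.obj) _)), eqToHom_trans]
  refine (congrArg (fun x => (_ ≫ x) ≫ _) h₁).trans ((Category.assoc _ _ _).trans ?_)
  let F := T.strAux Y [] L rfl rfl
  exact (F.map_paste_unit nat ((congrArg (_ ≫ ·) (Category.assoc _ _ _)).trans un)).trans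
    (F.map_eqToHom_eq (T.post_map_comp s f _) (congrArg (C.comp _ _) h₀) (C.comp_one _ _))

theorem mapComp_associativity {L Ξ Θ M Ξ' N : List D.Ob} {k l r : ℕ} {X X' Y : D.Ob}
    (S : Nested L k X Ξ l X' Θ r M Ξ' N) (f : D.Hom L Y) (g : D.Hom Ξ X) (h : D.Hom Θ X') :
    (T.mapComp S.out' f (D.comp S.inn' g h)).hom ≫
        C.comp₂ (S.out'.map T.obj) (𝟙 ((T.map L Y).obj f)) (T.mapComp S.inn' g h).hom =
      eqToHom (congrArg (T.map N Y).obj (D.assoc S f g h).symm) ≫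
        (T.mapComp S.inn (D.comp S.out f g) h).hom ≫
        C.comp₂ (S.inn.map T.obj) (T.mapComp S.out f g).hom (𝟙 ((T.map Θ X').obj h)) ≫
        eqToHom (C.assoc ⟨S.hr, S.out.map T.obj, S.inn.map T.obj, S.inn'.map T.obj,
          S.out'.map T.obj⟩ _ _ _) := by
  have SJ : Nested (L.map J.obj) k (J.obj X) (Ξ.map J.obj) l (J.obj X') (Θ.map J.obj) r (M.map J.obj)
      (Ξ'.map J.obj) (N.map J.obj) :=
    ⟨S.hr, S.out.map J.obj, S.inn.map J.obj, S.inn'.map J.obj, S.out'.map J.obj⟩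
  have ST : Nested (L.map T.obj) k (T.obj X) (Ξ.map T.obj) l (T.obj X') (Θ.map T.obj) r (M.map T.obj)
      (Ξ'.map T.obj) (N.map T.obj) :=
    ⟨S.hr, S.out.map T.obj, S.inn.map T.obj, S.inn'.map T.obj, S.out'.map T.obj⟩
  obtain ⟨hM₁, hM₂⟩ : M.take r = L.take k ++ Ξ.take l ∧
      M.drop (r + 1) = Ξ.drop (l + 1) ++ L.drop (k + 1) := by
    have e : M = (L.take k ++ Ξ.take l) ++ X' :: (Ξ.drop (l + 1) ++ L.drop (k + 1)) :=
      S.out.eq_take_append_drop.trans ((congrArg (fun Z => L.take k ++ (Z ++ L.drop (k + 1)))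
        S.inn'.eq_take_cons_drop).trans (by simp))
    have h₁ := S.out.eq_length_take
    have h₂ := S.inn'.eq_length_take
    have h₃ := S.inn.eq_length_take
    obtain ⟨h₄, h₅⟩ := List.append_inj (S.inn.eq_take_cons_drop.symm.trans e)
      (by rw [List.length_append, ← h₁, ← h₂, ← h₃, S.hr])
    exact ⟨h₄, (List.cons.inj h₅).2⟩
  have hk := S.out.eq_length_take.trans (Nat.zero_add _).symm
  have hl := S.inn'.eq_length_take.trans (Nat.zero_add _).symm
  have hr := S.inn.eq_length_take.trans (Nat.zero_add _).symm
  have st := T.strAuxComp_strAuxComp S.inn'.eq_take_cons_drop S.inn'.eq_take_append_drop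
    ((J.map Ξ X).obj g) ((J.map Θ X').obj h) hl (L.take k) S.out.eq_take_cons_drop
    S.out.eq_take_append_drop hM₁ (hM₂ ▸ S.inn.eq_take_cons_drop) S.out'.eq_take_append_drop
    (hM₂ ▸ S.inn.eq_take_append_drop) (P := []) rfl rfl rfl rfl rfl rfl hk hr SJ ST
    (C.post (T.unit Y) ((J.map L Y).obj f))
  have e₂ := T.strAuxComp_congr (Y := Y) (P := []) ((J.map Θ X').obj h) rfl hM₂ S.inn.eq_take_cons_drop
    S.inn.eq_take_append_drop rfl rfl rfl rfl hr (S.inn.map J.obj) (S.inn.map T.obj)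
  have nat := T.strAuxComp_naturality (P := []) (eqToHom (J.map_comp S.inn' g h)) (L.take k)
    S.out'.eq_take_cons_drop
    S.out'.eq_take_append_drop rfl rfl rfl rfl hk (S.out'.map J.obj)
    (S.out'.map T.obj) (𝟙 (C.post (T.unit Y) ((J.map L Y).obj f)))
  have nat' := T.strAuxComp_naturality (P := []) (𝟙 ((J.map Θ X').obj h)) (M.take r)
    S.inn.eq_take_cons_drop
    S.inn.eq_take_append_drop rfl rfl rfl rfl hr (S.inn.map J.obj)
    (S.inn.map T.obj) (eqToHom (T.post_map_comp S.out f g))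
  rw [CategoryTheory.Functor.map_id] at nat
  rw [show C.post₂ (𝟙 (T.unit X')) (𝟙 ((J.map Θ X').obj h)) = 𝟙 _ from C.comp₂_id _ _ _,
    CategoryTheory.Functor.map_id] at nat'
  rw [← e₂, C.comp₂_id_comp] at st
  let A := T.strAux X [] Ξ' rfl rfl
  have key := (T.strAux Y [] N rfl rfl).map_paste_assoc
    (x₁ := eqToIso (T.post_map_comp S.out' f (D.comp S.inn' g h)))
    (x₃ := eqToIso (T.post_map_comp S.inn (D.comp S.out f g) h))
    (e := eqToHom (by rw [D.assoc S])) (by simp) nat nat' st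
  rw [← C.comp₂_comp_id, ← C.comp₂_id_comp, ← C.comp₂_id_comp] at key
  have h₂ : A.map (eqToHom (T.post_map_comp S.inn' g h)) =
      A.map (C.post₂ (𝟙 (T.unit X)) (eqToHom (J.map_comp S.inn' g h))) ≫
        A.map (eqToHom (C.post_comp (S.inn'.map J.obj) _ _ _)) := by
    rw [show C.post₂ (𝟙 (T.unit X)) (eqToHom (J.map_comp S.inn' g h)) =
      eqToHom (congrArg (C.post (T.unit X)) (J.map_comp S.inn' g h)) from C.comp₂_id_eqToHom _ _ _]
    exact A.map_eqToHom_comp _ _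
  have h₃ := congrArg (C.comp₂ (S.out'.map T.obj) (𝟙 ((T.map L Y).obj f)))
    (congrArg (· ≫ _) h₂ : (T.mapComp S.inn' g h).hom = _)
  exact (congrArg (_ ≫ ·) h₃).trans (key.trans (congrArg (· ≫ _) (eqToHom_map _ _)))

/-- The pseudo-multifunctor of a strong relative pseudomonad. -/
def toPseudoMultifunctor : PseudoMultifunctor D C T.obj where
  map := T.map
  mapOne := T.mapOne
  mapComp := T.mapComp
  mapComp_naturality := T.mapComp_naturality
  one_left := T.mapComp_one_left
  one_right := T.mapComp_one_right
  associativity := T.mapComp_associativity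

theorem map_unary (X Y : D.Ob) : T.map [X] Y =
    J.map [X] Y ⋙ C.postFunctor [J.obj X] (T.unit Y) ⋙ T.toRelativePseudomonad.ext X Y := rfl

end StrongRelativePseudomonad

namespace StrongRelativePseudomonad

variable {D : TwoMulticategory.{u, v, w}} {C : TwoMulticategory.{u', v', w'}}
  {J : MultiFunctor D C} (T : StrongRelativePseudomonad J)

/-! ### Linear structures -/

/-- A linear structure on a 1-cell `F` in an argument `TX`: a presentation of `F`, up to an invertible
2-cell, as the strengthening of a 1-cell with the argument `JX` in its place. -/
structure LinStr {M N : List C.Ob} {k : ℕ} {X Y : D.Ob} (s : Replaces N k (J.obj X) [T.obj X] M)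
    (F : C.Hom M (T.obj Y)) where
  pre : C.Hom N (T.obj Y)
  iso : (T.str s).obj pre ≅ F

namespace LinStr

variable {T}

/-- The linear structure of `fᵗ`. -/
def free {M N : List C.Ob} {k : ℕ} {X Y : D.Ob} (s : Replaces N k (J.obj X) [T.obj X] M)
    (f : C.Hom N (T.obj Y)) : T.LinStr s ((T.str s).obj f) :=
  ⟨f, Iso.refl _⟩

/-- The linear structure of an identity, given by `θ`. -/
def one (X : D.Ob) (s : Replaces [J.obj X] 0 (J.obj X) [T.obj X] [T.obj X]) :
    T.LinStr s (C.one (T.obj X)) :=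
  ⟨T.unit X, T.θ X⟩

/-- The linear structure of `F ∘ b` in an argument of `F`, where `b` is composed in another one. -/
def compOther {N Ω N' M M' : List C.Ob} {k l p q : ℕ} {X Y : D.Ob} {B : C.Ob}
    (S : Parallel N k (J.obj X) [T.obj X] l B Ω p q N' M M') {F : C.Hom M (T.obj Y)}
    (A : T.LinStr S.right F) (b : C.Hom Ω B) : T.LinStr S.left' (C.comp S.right' F b) :=
  ⟨C.comp S.left A.pre b, T.strNat S A.pre b ≪≫ C.compIso S.right' A.iso (Iso.refl b)⟩

/-- The linear structure of `F ∘ G` in an argument of `G`. -/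
def compInside {N M Ξ K Ξ' K' : List C.Ob} {k l p : ℕ} {W X Y : D.Ob}
    {s : Replaces N k (J.obj X) [T.obj X] M}
    (S : Nested M k (T.obj X) Ξ l (J.obj W) [T.obj W] p K Ξ' K') {F : C.Hom M (T.obj Y)}
    (A : T.LinStr s F) {G : C.Hom Ξ' (T.obj X)} (B : T.LinStr S.inn' G) :
    T.LinStr S.inn (C.comp S.out' F G) :=
  ⟨C.comp S.out ((T.str s).obj A.pre) B.pre,
    T.multCell s S A.pre B.pre ≪≫ C.compIso S.out' A.iso B.iso⟩

end LinStr

/-- A 2-cell is linear if it is, up to the presentations, the strengthening of a 2-cell. -/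
def IsLin {M N : List C.Ob} {k : ℕ} {X Y : D.Ob} {s : Replaces N k (J.obj X) [T.obj X] M}
    {F F' : C.Hom M (T.obj Y)} (A : T.LinStr s F) (A' : T.LinStr s F') (φ : F ⟶ F') : Prop :=
  ∃ φ₀ : A.pre ⟶ A'.pre, (T.str s).map φ₀ ≫ A'.iso.hom = A.iso.hom ≫ φ

namespace IsLin

variable {T}

section

variable {M N : List C.Ob} {k : ℕ} {X Y : D.Ob} {s : Replaces N k (J.obj X) [T.obj X] M}
  {F F' F'' : C.Hom M (T.obj Y)} {A : T.LinStr s F} {A' : T.LinStr s F'} {A'' : T.LinStr s F''}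

theorem id (A : T.LinStr s F) : T.IsLin A A (𝟙 F) := ⟨𝟙 _, by simp⟩

theorem comp {φ : F ⟶ F'} {ψ : F' ⟶ F''} (h : T.IsLin A A' φ) (h' : T.IsLin A' A'' ψ) :
    T.IsLin A A'' (φ ≫ ψ) := by
  obtain ⟨φ₀, h⟩ := h
  obtain ⟨ψ₀, h'⟩ := h'
  exact ⟨φ₀ ≫ ψ₀, by rw [CategoryTheory.Functor.map_comp, Category.assoc, h', reassoc_of% h]⟩

/-- The inverse of a linear 2-cell is linear, since strengthening reflects isomorphisms. -/
theorem inv {φ : F ⟶ F'} [IsIso φ] (h : T.IsLin A A' φ) : T.IsLin A' A (CategoryTheory.inv φ) := by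
  obtain ⟨φ₀, h⟩ := h
  have h₁ : (T.str s).map φ₀ = A.iso.hom ≫ φ ≫ A'.iso.inv := by simp [← reassoc_of% h]
  have : IsIso ((T.str s).map φ₀) := by rw [h₁]; infer_instance
  have h₂ : φ₀ = (T.unitCell s s.back A.pre).hom ≫
      C.comp₂ s.back ((T.str s).map φ₀) (𝟙 (T.unit X)) ≫ (T.unitCell s s.back A'.pre).inv := by
    rw [← reassoc_of% T.unitCell_naturality s s.back φ₀, Iso.hom_inv_id, Category.comp_id]
  have : IsIso φ₀ := by rw [h₂]; infer_instance
  refine ⟨CategoryTheory.inv φ₀, ?_⟩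
  rw [CategoryTheory.Functor.map_inv, IsIso.inv_comp_eq, reassoc_of% h, IsIso.hom_inv_id,
    Category.comp_id]

theorem eqToHom_symm {e : F = F'} (h : T.IsLin A A' (eqToHom e)) :
    T.IsLin A' A (eqToHom e.symm) := by
  simpa using h.inv

/-- A linear 2-cell is determined by its composite with the unit. -/
theorem ext {φ ψ : F ⟶ F'} (hφ : T.IsLin A A' φ) (hψ : T.IsLin A A' ψ)
    (s' : Replaces M k (T.obj X) [J.obj X] N)
    (h : C.comp₂ s' φ (𝟙 (T.unit X)) = C.comp₂ s' ψ (𝟙 (T.unit X))) : φ = ψ := by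
  obtain ⟨φ₀, hφ⟩ := hφ
  obtain ⟨ψ₀, hψ⟩ := hψ
  have e₁ := T.unitCell_naturality s s' φ₀
  have e₂ := T.unitCell_naturality s s' ψ₀
  have h₁ : C.comp₂ s' ((T.str s).map φ₀) (𝟙 (T.unit X)) =
      C.comp₂ s' ((T.str s).map ψ₀) (𝟙 (T.unit X)) := by
    rw [← cancel_mono (C.comp₂ s' A'.iso.hom (𝟙 (T.unit X))), ← C.comp₂_comp_id, ← C.comp₂_comp_id,
      hφ, hψ, C.comp₂_comp_id, C.comp₂_comp_id, h]
  rw [h₁, ← e₂, cancel_mono] at e₁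
  rw [e₁, hψ, cancel_epi] at hφ
  exact hφ.symm

end

theorem compOther {N Ω N' M M' : List C.Ob} {k l p q : ℕ} {X Y : D.Ob} {B : C.Ob}
    (S : Parallel N k (J.obj X) [T.obj X] l B Ω p q N' M M') {F F' : C.Hom M (T.obj Y)}
    {A : T.LinStr S.right F} {A' : T.LinStr S.right F'} {φ : F ⟶ F'} (h : T.IsLin A A' φ)
    {b b' : C.Hom Ω B} (β : b ⟶ b') :
    T.IsLin (A.compOther S b) (A'.compOther S b') (C.comp₂ S.right' φ β) := by
  obtain ⟨φ₀, h⟩ := h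
  refine ⟨C.comp₂ S.left φ₀ β, ?_⟩
  dsimp only [LinStr.free, LinStr.one, LinStr.compOther, LinStr.compInside, Iso.trans_hom,
    TwoMulticategory.compIso, Iso.refl_hom]
  simp only [Category.assoc]
  rw [reassoc_of% T.strNat_naturality S φ₀ β, ← C.comp₂_comp, ← C.comp₂_comp, h]
  simp

theorem compInside {N M Ξ K Ξ' K' : List C.Ob} {k l p : ℕ} {W X Y : D.Ob}
    {s : Replaces N k (J.obj X) [T.obj X] M}
    (S : Nested M k (T.obj X) Ξ l (J.obj W) [T.obj W] p K Ξ' K') {F F' : C.Hom M (T.obj Y)}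
    {A : T.LinStr s F} {A' : T.LinStr s F'} {φ : F ⟶ F'} (h : T.IsLin A A' φ)
    {G G' : C.Hom Ξ' (T.obj X)} {B : T.LinStr S.inn' G} {B' : T.LinStr S.inn' G'} {ψ : G ⟶ G'}
    (h' : T.IsLin B B' ψ) :
    T.IsLin (A.compInside S B) (A'.compInside S B') (C.comp₂ S.out' φ ψ) := by
  obtain ⟨φ₀, h⟩ := h
  obtain ⟨ψ₀, h'⟩ := h'
  refine ⟨C.comp₂ S.out ((T.str s).map φ₀) ψ₀, ?_⟩
  dsimp only [LinStr.free, LinStr.one, LinStr.compOther, LinStr.compInside, Iso.trans_hom,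
    TwoMulticategory.compIso, Iso.refl_hom]
  simp only [Category.assoc]
  rw [reassoc_of% T.multCell_naturality s S φ₀ ψ₀, ← C.comp₂_comp, ← C.comp₂_comp, h, h']

/-- The 2-cell `(fᵗ ∘ g)ᵗ ≅ fᵗ ∘ gᵗ` is linear, since it defines the linear structure of its target. -/
theorem multCell {L M Ξ K Ξ' K' : List C.Ob} {j l p : ℕ} {W X Y : D.Ob}
    (s : Replaces L j (J.obj X) [T.obj X] M)
    (S : Nested M j (T.obj X) Ξ l (J.obj W) [T.obj W] p K Ξ' K')
    (f : C.Hom L (T.obj Y)) (g : C.Hom Ξ (T.obj X)) :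
    T.IsLin (LinStr.free S.inn _) ((LinStr.free s f).compInside S (LinStr.free S.inn' g))
      (T.multCell s S f g).hom :=
  by
  refine ⟨𝟙 _, ?_⟩
  dsimp only [LinStr.free, LinStr.compInside, Iso.trans_hom, TwoMulticategory.compIso, Iso.refl_hom]
  rw [C.comp₂_id, CategoryTheory.Functor.map_id, Category.comp_id]

theorem θ (X : D.Ob) (s : Replaces [J.obj X] 0 (J.obj X) [T.obj X] [T.obj X]) :
    T.IsLin (LinStr.free s (T.unit X)) (LinStr.one X s) (T.θ X).hom := by
  refine ⟨𝟙 _, ?_⟩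
  dsimp only [LinStr.free, LinStr.one, Iso.refl_hom]
  rw [CategoryTheory.Functor.map_id]

/-- Linearity of `(F ∘ b) ∘ b' = F ∘ (b ∘ b')` in an argument of `F`, by the coherence of pseudonaturality
with iterated composition. -/
theorem assoc_other_other {L Ξ Θ M Ξ' N L₁ M₁ N₁ : List C.Ob} {j k l r p p' q q' : ℕ}
    {X Y : D.Ob} {B B' : C.Ob} (S : Nested L k B Ξ l B' Θ r M Ξ' N)
    (S₁ : Parallel L j (J.obj X) [T.obj X] k B Ξ p q M L₁ M₁)
    (S₂ : Parallel M p (J.obj X) [T.obj X] r B' Θ p' q' N M₁ N₁)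
    (S₃ : Parallel L j (J.obj X) [T.obj X] k B Ξ' p' q N L₁ N₁)
    (S' : Nested L₁ q B Ξ l B' Θ q' M₁ Ξ' N₁) {F : C.Hom L₁ (T.obj Y)} (A : T.LinStr S₁.right F)
    (b : C.Hom Ξ B) (b' : C.Hom Θ B') :
    T.IsLin ((A.compOther S₁ b).compOther S₂ b') (A.compOther S₃ (C.comp S.inn' b b'))
      (eqToHom (C.assoc S' F b b')) := by
  refine ⟨eqToHom (C.assoc S A.pre b b'), ?_⟩
  have a₁ := C.assoc₂_eqToHom S' A.iso.hom (𝟙 b) (𝟙 b')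
  have ax := T.strNat_comp_eqToHom S S₁ S₂ S₃ S' A.pre b b'
  rw [C.comp₂_id] at a₁
  dsimp only [LinStr.free, LinStr.one, LinStr.compOther, LinStr.compInside, Iso.trans_hom,
    TwoMulticategory.compIso, Iso.refl_hom]
  simp only [Category.assoc]
  rw [← reassoc_of% ax, ← a₁, C.comp₂_comp_id]
  simp

/-- Linearity of `(F ∘ G) ∘ b = F ∘ (G ∘ b)` in an argument of `G`, by the compatibility of `multCell` with
pseudonaturality in the arguments of `G`. -/
theorem assoc_inside_other {L M Ξ Ω Ξ₁ Ξ' Ξ₁' K K' K₁ K₁' : List C.Ob}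
    {j l m p q u u₁ a a' : ℕ} {W X Y : D.Ob} {B : C.Ob}
    {s : Replaces L j (J.obj X) [T.obj X] M}
    (S : Parallel Ξ l (J.obj W) [T.obj W] m B Ω p q Ξ₁ Ξ' Ξ₁')
    (R : Nested M j (T.obj X) Ξ l (J.obj W) [T.obj W] u K Ξ' K')
    (R₁ : Nested M j (T.obj X) Ξ₁ p (J.obj W) [T.obj W] u₁ K₁ Ξ₁' K₁')
    (R₂ : Nested M j (T.obj X) Ξ m B Ω a K Ξ₁ K₁)
    (R₃ : Nested M j (T.obj X) Ξ' q B Ω a' K' Ξ₁' K₁')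
    (S₁ : Parallel K u (J.obj W) [T.obj W] a B Ω u₁ a' K₁ K' K₁')
    {F : C.Hom M (T.obj Y)} (A : T.LinStr s F) {G : C.Hom Ξ' (T.obj X)} (A' : T.LinStr S.right G)
    (b : C.Hom Ω B) :
    T.IsLin ((A.compInside R A').compOther S₁ b) (A.compInside R₁ (A'.compOther S b))
      (eqToHom (C.assoc R₃ F G b)) := by
  refine ⟨eqToHom (C.assoc R₂ _ A'.pre b), ?_⟩
  have a₁ := C.assoc₂_eqToHom R₃ A.iso.hom A'.iso.hom (𝟙 b)
  have ax := T.multCell_strNat_right_eqToHom s S R R₁ R₂ R₃ S₁ A.pre A'.pre b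
  dsimp only [LinStr.free, LinStr.one, LinStr.compOther, LinStr.compInside, Iso.trans_hom,
    TwoMulticategory.compIso, Iso.refl_hom]
  simp only [Category.assoc]
  rw [C.comp₂_comp_id, Category.assoc, a₁, reassoc_of% ax, ← C.comp₂_comp, Category.id_comp]

/-- Linearity of `(F ∘ G) ∘ H = F ∘ (G ∘ H)` in an argument of `H`, by `associativity`. -/
theorem assoc_inside_inside {L M Ξ K Ξ' K' Θ B Θ' B' E E' : List C.Ob} {j l m u r x : ℕ}
    {V W X Y : D.Ob} {s : Replaces L j (J.obj X) [T.obj X] M}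
    (S₁ : Nested M j (T.obj X) Ξ l (J.obj W) [T.obj W] u K Ξ' K')
    (S₂ : Nested Ξ' l (T.obj W) Θ m (J.obj V) [T.obj V] r B Θ' B')
    (S₃ : Nested K' u (T.obj W) Θ m (J.obj V) [T.obj V] x E Θ' E')
    (S₄ : Nested M j (T.obj X) B r (J.obj V) [T.obj V] x E B' E')
    (S₅ : Nested M j (T.obj X) Ξ' l (T.obj W) Θ u K' B E)
    (S₆ : Nested M j (T.obj X) Ξ' l (T.obj W) Θ' u K' B' E')
    {F : C.Hom M (T.obj Y)} (A₁ : T.LinStr s F) {G : C.Hom Ξ' (T.obj X)} (A₂ : T.LinStr S₁.inn' G)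
    {H : C.Hom Θ' (T.obj W)} (A₃ : T.LinStr S₂.inn' H) :
    T.IsLin ((A₁.compInside S₁ A₂).compInside S₃ A₃) (A₁.compInside S₄ (A₂.compInside S₂ A₃))
      (eqToHom (C.assoc S₆ F G H)) := by
  refine ⟨C.comp₂ S₃.out (T.multCell s S₁ A₁.pre A₂.pre).hom (𝟙 A₃.pre) ≫ eqToHom (C.assoc S₅ _ _ _), ?_⟩
  have a₁ := C.assoc₂_eqToHom S₆ A₁.iso.hom A₂.iso.hom A₃.iso.hom
  have ax := T.associativity_eqToHom s S₁ S₂ S₃ S₄ S₅ S₆ A₁.pre A₂.pre A₃.pre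
  dsimp only [LinStr.free, LinStr.one, LinStr.compOther, LinStr.compInside, Iso.trans_hom,
    TwoMulticategory.compIso, Iso.refl_hom]
  simp only [Category.assoc]
  have e₁ := C.comp₂_comp S₄.out' (𝟙 _) A₁.iso.hom (T.multCell S₁.inn' S₂ A₂.pre A₃.pre).hom
    (C.comp₂ S₂.out' A₂.iso.hom A₃.iso.hom)
  have e₂ := C.comp₂_comp S₃.out' (T.multCell s S₁ A₁.pre A₂.pre).hom
    (C.comp₂ S₁.out' A₁.iso.hom A₂.iso.hom) (𝟙 _) A₃.iso.hom
  rw [Category.id_comp] at e₁ e₂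
  rw [e₁, e₂, Category.assoc, a₁, reassoc_of% ax, CategoryTheory.Functor.map_comp, Category.assoc]

/-- Linearity of `(F ∘ b') ∘ b = (F ∘ b) ∘ b'` in a third argument of `F`, by the coherence of
pseudonaturality with composition in two different arguments. -/
theorem parallel_other_other {L Ξ Ξ' M M' R L₁ M₁ M₁' R₁ : List C.Ob}
    {j k k' c c' p p' q q' r d d' : ℕ}
    {X Y : D.Ob} {B B' : C.Ob} (S : Parallel L k B Ξ k' B' Ξ' c c' M' M R)
    (S₁ : Parallel L j (J.obj X) [T.obj X] k B Ξ p q M L₁ M₁)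
    (S₂ : Parallel M p (J.obj X) [T.obj X] c' B' Ξ' r d R M₁ R₁)
    (S₁' : Parallel L j (J.obj X) [T.obj X] k' B' Ξ' p' q' M' L₁ M₁')
    (S₂' : Parallel M' p' (J.obj X) [T.obj X] c B Ξ r d' R M₁' R₁)
    (S' : Parallel L₁ q B Ξ q' B' Ξ' d' d M₁' M₁ R₁) {F : C.Hom L₁ (T.obj Y)}
    (A : T.LinStr S₁.right F) (b : C.Hom Ξ B) (b' : C.Hom Ξ' B') :
    T.IsLin ((A.compOther S₁' b').compOther S₂' b) ((A.compOther S₁ b).compOther S₂ b')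
      (eqToHom (C.parallel S' F b b')) := by
  refine ⟨eqToHom (C.parallel S A.pre b b'), ?_⟩
  have a₁ := C.parallel₂_eqToHom S' A.iso.hom (𝟙 b) (𝟙 b')
  have ax := T.strNat_parallel_eqToHom S S₁ S₂ S₁' S₂' S' A.pre b b'
  dsimp only [LinStr.free, LinStr.one, LinStr.compOther, LinStr.compInside, Iso.trans_hom,
    TwoMulticategory.compIso, Iso.refl_hom]
  simp only [Category.assoc]
  simp only [C.comp₂_comp_id, Category.assoc]
  rw [a₁, reassoc_of% ax]

/-- Linearity of `(F ∘ b) ∘ G = (F ∘ G) ∘ b` in an argument of `G`, by the compatibility of `multCell` with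
pseudonaturality in the other arguments of `F`. -/
theorem parallel_inside_other {L Ω M N P Ξ K Ξ' K' K₁ K₁' : List C.Ob}
    {j k p q l u u₁ a a' : ℕ} {W X Y : D.Ob} {B : C.Ob}
    (S : Parallel L j (J.obj X) [T.obj X] k B Ω p q M N P)
    (R : Nested N j (T.obj X) Ξ l (J.obj W) [T.obj W] u K Ξ' K')
    (R₁ : Nested P p (T.obj X) Ξ l (J.obj W) [T.obj W] u₁ K₁ Ξ' K₁')
    (S₁ : Parallel K u (J.obj W) [T.obj W] a B Ω u₁ a' K₁ K' K₁')
    (S₂ : Parallel N j (T.obj X) Ξ q B Ω p a P K K₁)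
    (S₃ : Parallel N j (T.obj X) Ξ' q B Ω p a' P K' K₁')
    {F : C.Hom N (T.obj Y)} (A : T.LinStr S.right F) (b : C.Hom Ω B) {G : C.Hom Ξ' (T.obj X)}
    (A' : T.LinStr R.inn' G) :
    T.IsLin ((A.compOther S b).compInside R₁ A') ((A.compInside R A').compOther S₁ b)
      (eqToHom (C.parallel S₃ F G b)) := by
  refine ⟨C.comp₂ R₁.out (T.strNat S A.pre b).hom (𝟙 A'.pre) ≫ eqToHom (C.parallel S₂ _ _ _), ?_⟩
  have a₁ := C.parallel₂_eqToHom S₃ A.iso.hom A'.iso.hom (𝟙 b)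
  have ax := T.multCell_strNat_left_eqToHom S R R₁ S₁ S₂ S₃ A.pre b A'.pre
  dsimp only [LinStr.free, LinStr.one, LinStr.compOther, LinStr.compInside, Iso.trans_hom,
    TwoMulticategory.compIso, Iso.refl_hom]
  simp only [Category.assoc]
  have e₂ := C.comp₂_comp R₁.out' (T.strNat S A.pre b).hom
    (C.comp₂ S.right' A.iso.hom (𝟙 b)) (𝟙 _) A'.iso.hom
  rw [Category.id_comp] at e₂
  rw [e₂, Category.assoc, a₁, reassoc_of% ax, CategoryTheory.Functor.map_comp, Category.assoc,
    C.comp₂_comp_id]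

theorem comp_one_other {L N : List C.Ob} {j k : ℕ} {X Y : D.Ob} {B : C.Ob}
    (S : Parallel L j (J.obj X) [T.obj X] k B [B] j k L N N) {F : C.Hom N (T.obj Y)}
    (A : T.LinStr S.right F) :
    T.IsLin (A.compOther S (C.one B)) A (eqToHom (C.comp_one S.right' F)) := by
  refine ⟨eqToHom (C.comp_one S.left _), ?_⟩
  have a₁ := C.comp₂_one_eqToHom S.right' A.iso.hom
  have ax := T.strNat_one_eqToHom S A.pre
  rw [eqToHom_refl, Category.comp_id] at ax
  dsimp only [LinStr.free, LinStr.one, LinStr.compOther, LinStr.compInside, Iso.trans_hom,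
    TwoMulticategory.compIso, Iso.refl_hom]
  simp only [Category.assoc]
  rw [a₁, reassoc_of% ax]

/-- Linearity of `F ∘ 1 = F` in the argument of `1`, by `unitality`. -/
theorem comp_one_inside {L M : List C.Ob} {j : ℕ} {X Y : D.Ob}
    {s : Replaces L j (J.obj X) [T.obj X] M}
    (S : Nested M j (T.obj X) [J.obj X] 0 (J.obj X) [T.obj X] j L [T.obj X] M)
    {F : C.Hom M (T.obj Y)} (A : T.LinStr s F) :
    T.IsLin (A.compInside S (LinStr.one X S.inn')) A (eqToHom (C.comp_one S.out' F)) := by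
  refine ⟨(T.unitCell s S.out A.pre).inv, ?_⟩
  have a₁ := C.comp₂_one_eqToHom S.out' A.iso.hom
  have ax := T.unitality_eqToHom s S.out' S A.pre
  have e := C.comp₂_right_left S.out' A.iso.hom (T.θ X).hom
  dsimp only [LinStr.free, LinStr.one, LinStr.compOther, LinStr.compInside, Iso.trans_hom,
    TwoMulticategory.compIso, Iso.refl_hom]
  simp only [Category.assoc]
  rw [← cancel_epi ((T.str s).map (T.unitCell s S.out A.pre).hom), ← e, Category.assoc, a₁,
    reassoc_of% ax, ← CategoryTheory.Functor.map_comp_assoc, Iso.hom_inv_id,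
    CategoryTheory.Functor.map_id, Category.id_comp]

/-- Linearity of `1 ∘ F = F`, by `multCell_θ`. -/
theorem one_comp {L M : List C.Ob} {j : ℕ} {W X : D.Ob}
    {s : Replaces [J.obj X] 0 (J.obj X) [T.obj X] [T.obj X]}
    (S : Nested [T.obj X] 0 (T.obj X) L j (J.obj W) [T.obj W] j L M M) {F : C.Hom M (T.obj X)}
    (A : T.LinStr S.inn' F) :
    T.IsLin ((LinStr.one X s).compInside S A) A (eqToHom (C.one_comp S.out' F)) := by
  refine ⟨C.comp₂ S.out (T.θ X).hom (𝟙 A.pre) ≫ eqToHom (C.one_comp S.out _), ?_⟩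
  have a₁ := C.one_comp₂_eqToHom S.out' A.iso.hom
  have ax := T.multCell_θ s S A.pre
  have e := C.comp₂_left_right S.out' (T.θ X).hom A.iso.hom
  dsimp only [LinStr.free, LinStr.one, LinStr.compOther, LinStr.compInside, Iso.trans_hom,
    TwoMulticategory.compIso, Iso.refl_hom]
  simp only [Category.assoc]
  rw [← e, Category.assoc, a₁]
  have ax' := congrArg (· ≫ A.iso.hom) ax
  simp only [Category.assoc] at ax'
  exact ax'.symm

end IsLin

end StrongRelativePseudomonad

namespace StrongRelativePseudomonad

variable {D : TwoMulticategory.{u, v, w}} {C : TwoMulticategory.{u', v', w'}}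
  {J : MultiFunctor D C} {T : StrongRelativePseudomonad J}

/-! ### Commuting linear structures -/

/-- The linear structure of `fᵗ` in an argument of `f` to the left of the strengthened one, given by
the pseudocommutativity. -/
def LinStr.strOther (γ : T.Pseudocommutativity) {L M N P : List C.Ob} {j k : ℕ} {X Y Z : D.Ob}
    (S : Parallel L j (J.obj X) [T.obj X] k (J.obj Y) [T.obj Y] j k M N P) (hjk : j < k)
    {f : C.Hom N (T.obj Z)} (A : T.LinStr S.right f) : T.LinStr S.left' ((T.str S.right').obj f) :=
  ⟨(T.str S.left).obj A.pre, γ.γ S hjk A.pre ≪≫ (T.str S.right').mapIso A.iso⟩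

/-- Linear structures of `F` in two arguments commute if both come, up to `γ`, from one 1-cell with
the arguments `JX` and `JY` in place of `TX` and `TY`. -/
def Comm (γ : T.Pseudocommutativity) {L M N P : List C.Ob} {j k : ℕ} {X Y Z : D.Ob}
    (S : Parallel L j (J.obj X) [T.obj X] k (J.obj Y) [T.obj Y] j k M N P) (hjk : j < k)
    {F : C.Hom P (T.obj Z)} (A : T.LinStr S.left' F) (B : T.LinStr S.right' F) : Prop :=
  ∃ (h : C.Hom L (T.obj Z)) (a : (T.str S.left).obj h ≅ A.pre) (b : (T.str S.right).obj h ≅ B.pre),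
    (T.str S.left').map a.hom ≫ A.iso.hom =
      (γ.γ S hjk h).hom ≫ (T.str S.right').map b.hom ≫ B.iso.hom

namespace Comm

variable (γ : T.Pseudocommutativity)

/-- The two linear structures of `fᵗ`, in an argument of `f` and in the strengthened one, commute. -/
theorem str_self {L M N P : List C.Ob} {j k : ℕ} {X Y Z : D.Ob}
    (S : Parallel L j (J.obj X) [T.obj X] k (J.obj Y) [T.obj Y] j k M N P) (hjk : j < k)
    {f : C.Hom N (T.obj Z)} (A : T.LinStr S.right f) :
    Comm γ S hjk (A.strOther γ S hjk) (LinStr.free S.right' f) := by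
  refine ⟨A.pre, Iso.refl _, A.iso, ?_⟩
  dsimp only [LinStr.strOther, LinStr.free, Iso.trans_hom, Functor.mapIso_hom, Iso.refl_hom]
  rw [CategoryTheory.Functor.map_id, Category.id_comp, Category.comp_id]

/-- Strengthening a third argument, to the right of two commuting ones, leaves these commuting. This is
where the braid axiom of the pseudocommutativity is used. -/
theorem str_other {L Ls Lt Lu Lst Lsu Ltu Lstu : List C.Ob} {a b c : ℕ} {W X Y Z : D.Ob}
    (hab : a < b) (hbc : b < c) (hac : a < c)
    (Stu : Parallel L b (J.obj X) [T.obj X] c (J.obj Y) [T.obj Y] b c Lu Lt Ltu)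
    (Ssu : Parallel L a (J.obj W) [T.obj W] c (J.obj Y) [T.obj Y] a c Lu Ls Lsu)
    (Sst : Parallel L a (J.obj W) [T.obj W] b (J.obj X) [T.obj X] a b Lt Ls Lst)
    (Rsu : Parallel Lt a (J.obj W) [T.obj W] c (J.obj Y) [T.obj Y] a c Ltu Lst Lstu)
    (Rst : Parallel Lu a (J.obj W) [T.obj W] b (J.obj X) [T.obj X] a b Ltu Lsu Lstu)
    (Rtu : Parallel Ls b (J.obj X) [T.obj X] c (J.obj Y) [T.obj Y] b c Lsu Lst Lstu)
    {f : C.Hom Lst (T.obj Z)} {A : T.LinStr Sst.left' f} {B : T.LinStr Sst.right' f}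
    (H : Comm γ Sst hab A B) :
    Comm γ Rst hab (LinStr.strOther γ Rsu hac A) (LinStr.strOther γ Rtu hbc B) := by
  obtain ⟨h, x, y, e⟩ := H
  refine ⟨(T.str Stu.left).obj h, γ.γ Stu hbc h ≪≫ (T.str Stu.right').mapIso x,
    γ.γ Ssu hac h ≪≫ (T.str Ssu.right').mapIso y, ?_⟩
  dsimp only [LinStr.strOther, Iso.trans_hom, Functor.mapIso_hom]
  have br := γ.γ_braid hab hbc hac Stu Ssu Sst Rsu Rst Rtu h
  have n₁ := γ.γ_naturality Rsu hac x.hom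
  have n₂ := γ.γ_naturality Rtu hbc y.hom
  have e' := congrArg (T.str Rsu.right').map e
  simp only [CategoryTheory.Functor.map_comp, Category.assoc] at e' ⊢
  rw [reassoc_of% n₁, e', reassoc_of% br, reassoc_of% n₂]

/-- Compatibility of the pseudocommutativity with pseudonaturality in a third argument. -/
theorem compOther {L M N P Ω L₁ M₁ N₁ P₁ : List C.Ob} {j k l j₁ k₁ c d e : ℕ} {X Y Z : D.Ob}
    {B : C.Ob}
    (S : Parallel L j (J.obj X) [T.obj X] k (J.obj Y) [T.obj Y] j k M N P) (hjk : j < k)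
    (S₁ : Parallel L₁ j₁ (J.obj X) [T.obj X] k₁ (J.obj Y) [T.obj Y] j₁ k₁ M₁ N₁ P₁)
    (hjk₁ : j₁ < k₁)
    (Rj : Parallel L j (J.obj X) [T.obj X] l B Ω j₁ c L₁ N N₁)
    (Rk : Parallel L k (J.obj Y) [T.obj Y] l B Ω k₁ d L₁ M M₁)
    (Rkj : Parallel M j (J.obj X) [T.obj X] d B Ω j₁ e M₁ P P₁)
    (Rjk : Parallel N k (J.obj Y) [T.obj Y] c B Ω k₁ e N₁ P P₁)
    {F : C.Hom P (T.obj Z)} {A : T.LinStr S.left' F} {A' : T.LinStr S.right' F}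
    (H : Comm γ S hjk A A') (b : C.Hom Ω B) :
    Comm γ S₁ hjk₁ (LinStr.compOther Rkj A b) (LinStr.compOther Rjk A' b) := by
  obtain ⟨h, x, y, e⟩ := H
  refine ⟨C.comp Rj.left h b, T.strNat Rk h b ≪≫ C.compIso Rk.right' x (Iso.refl b),
    T.strNat Rj h b ≪≫ C.compIso Rj.right' y (Iso.refl b), ?_⟩
  dsimp only [LinStr.compOther, TwoMulticategory.compIso, Iso.trans_hom, Iso.refl_hom]
  have ax := γ.γ_strNat S hjk S₁ hjk₁ Rj Rk Rkj Rjk h b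
  have n₁ := T.strNat_naturality Rkj x.hom (𝟙 b)
  have n₂ := T.strNat_naturality Rjk y.hom (𝟙 b)
  have e' := congrArg (C.comp₂ Rkj.right' · (𝟙 b)) e
  simp only [CategoryTheory.Functor.map_comp, Category.assoc, C.comp₂_comp_id] at e' ⊢
  rw [reassoc_of% n₁, e', reassoc_of% n₂, reassoc_of% ax]

/-- Commutation of an argument of `G` with an argument of `F` to the right of it, for `F ∘ G`. -/
theorem comp_left {L M N P Ξ K Ξ' K' B B' : List C.Ob} {j k l u k₁ : ℕ} {W X Y Z : D.Ob}
    (S : Parallel L j (J.obj X) [T.obj X] k (J.obj Y) [T.obj Y] j k M N P) (hjk : j < k)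
    (R₁ : Nested P j (T.obj X) Ξ l (J.obj W) [T.obj W] u K Ξ' K')
    (R₂ : Nested N j (T.obj X) Ξ l (J.obj W) [T.obj W] u B Ξ' B')
    (Q : Parallel N k (J.obj Y) [T.obj Y] j (T.obj X) Ξ k₁ j B P K)
    (Q' : Parallel N k (J.obj Y) [T.obj Y] j (T.obj X) Ξ' k₁ j B' P K')
    (S' : Parallel B u (J.obj W) [T.obj W] k₁ (J.obj Y) [T.obj Y] u k₁ K B' K') (hjk' : u < k₁)
    {F : C.Hom P (T.obj Z)} {A : T.LinStr S.left' F} {A' : T.LinStr S.right' F}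
    (H : Comm γ S hjk A A') {G : C.Hom Ξ' (T.obj X)} (E : T.LinStr R₁.inn' G) :
    Comm γ S' hjk' (LinStr.compInside R₁ A E) (LinStr.compOther Q' A' G) := by
  obtain ⟨h, x, y, e⟩ := H
  refine ⟨C.comp Q.left ((T.str S.right).obj h) E.pre,
    T.strNat Q ((T.str S.right).obj h) E.pre ≪≫ C.compIso R₁.out
      ((γ.γ S hjk h).symm ≪≫ (T.str S.left').mapIso x) (Iso.refl _),
    T.multCell S.right R₂ h E.pre ≪≫ C.compIso R₂.out' y E.iso, ?_⟩
  dsimp only [LinStr.compOther, LinStr.compInside, TwoMulticategory.compIso, Iso.trans_hom,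
    Iso.refl_hom, Iso.symm_hom, Functor.mapIso_hom]
  have ax := γ.γ_mult_left S hjk R₁ R₂ Q Q' S' hjk' h E.pre
  have n₁ := T.multCell_naturality S.left' R₁ x.hom (𝟙 E.pre)
  have n₂ := T.strNat_naturality Q' y.hom E.iso.hom
  have e' := congrArg (C.comp₂ R₁.out' · E.iso.hom) e
  have ax' : (T.str S'.left').map (T.strNat Q ((T.str S.right).obj h) E.pre).hom ≫
      (T.str R₁.inn).map (C.comp₂ R₁.out (γ.γ S hjk h).inv (𝟙 E.pre)) ≫
      (T.multCell S.left' R₁ ((T.str S.left).obj h) E.pre).hom ≫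
      C.comp₂ R₁.out' (γ.γ S hjk h).hom (𝟙 ((T.str R₁.inn').obj E.pre)) =
      (γ.γ S' hjk' (C.comp Q.left ((T.str S.right).obj h) E.pre)).hom ≫
        (T.str S'.right').map (T.multCell S.right R₂ h E.pre).hom ≫
        (T.strNat Q' ((T.str S.right).obj h) ((T.str R₁.inn').obj E.pre)).hom := by
    have i₁ := congrArg (T.str R₁.inn).map
      (C.compIso R₁.out (γ.γ S hjk h) (Iso.refl E.pre)).inv_hom_id
    have i₂ := congrArg (T.str R₁.inn).map (T.strNat Q ((T.str S.right).obj h) E.pre).hom_inv_id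
    dsimp only [TwoMulticategory.compIso, Iso.refl_hom, Iso.refl_inv] at i₁
    rw [CategoryTheory.Functor.map_comp, CategoryTheory.Functor.map_id] at i₁ i₂
    have ax₁ := congrArg (· ≫
      (T.strNat Q' ((T.str S.right).obj h) ((T.str R₁.inn').obj E.pre)).hom) ax
    simp only [Category.assoc, Iso.inv_hom_id] at ax₁
    rw [(ax₁.symm.trans (congrArg (_ ≫ ·) (Category.comp_id _))).symm]
    exact (congrArg (_ ≫ ·) ((Category.assoc _ _ _).symm.trans
      ((congrArg (· ≫ _) i₁).trans (Category.id_comp _)))).trans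
      ((Category.assoc _ _ _).symm.trans ((congrArg (· ≫ _) i₂).trans (Category.id_comp _)))
  rw [CategoryTheory.Functor.map_id] at n₁
  have e₁ := C.comp₂_comp R₁.out' ((T.str S.left').map x.hom) A.iso.hom (𝟙 _) E.iso.hom
  have e₂ := C.comp₂_comp R₁.out' (γ.γ S hjk h).hom ((T.str S.right').map y.hom ≫ A'.iso.hom)
    (𝟙 _) E.iso.hom
  have e₃ := C.comp₂_comp R₁.out' ((T.str S.right').map y.hom) A'.iso.hom E.iso.hom (𝟙 _)
  have f₁ := C.comp₂_comp_id R₁.out (γ.γ S hjk h).inv ((T.str S.left').map x.hom) E.pre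
  rw [Category.id_comp] at e₁ e₂
  rw [Category.comp_id] at e₃
  rw [e₁, e₂, e₃] at e'
  simp only [CategoryTheory.Functor.map_comp, Category.assoc]
  rw [f₁, CategoryTheory.Functor.map_comp, Category.assoc, reassoc_of% n₁, e', reassoc_of% n₂,
    reassoc_of% ax']

/-- Commutation of an argument of `F` with an argument of `G` to the right of it, for `F ∘ G`. -/
theorem comp_right {L M N P Ξ K Ξ' K' B B' : List C.Ob} {j k l u : ℕ} {V X Y Z : D.Ob}
    (S : Parallel L j (J.obj X) [T.obj X] k (J.obj Y) [T.obj Y] j k M N P) (hjk : j < k)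
    (R₁ : Nested P k (T.obj Y) Ξ l (J.obj V) [T.obj V] u K Ξ' K')
    (R₂ : Nested M k (T.obj Y) Ξ l (J.obj V) [T.obj V] u B Ξ' B')
    (Q : Parallel M j (J.obj X) [T.obj X] k (T.obj Y) Ξ j k B P K)
    (Q' : Parallel M j (J.obj X) [T.obj X] k (T.obj Y) Ξ' j k B' P K')
    (S' : Parallel B j (J.obj X) [T.obj X] u (J.obj V) [T.obj V] j u B' K K') (hjk' : j < u)
    {F : C.Hom P (T.obj Z)} {A : T.LinStr S.left' F} {A' : T.LinStr S.right' F}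
    (H : Comm γ S hjk A A') {G : C.Hom Ξ' (T.obj Y)} (E : T.LinStr R₁.inn' G) :
    Comm γ S' hjk' (LinStr.compOther Q' A G) (LinStr.compInside R₁ A' E) := by
  obtain ⟨h, x, y, e⟩ := H
  refine ⟨C.comp Q.left ((T.str S.left).obj h) E.pre,
    T.multCell S.left R₂ h E.pre ≪≫ C.compIso R₂.out' x E.iso,
    T.strNat Q ((T.str S.left).obj h) E.pre ≪≫ C.compIso R₁.out
      (γ.γ S hjk h ≪≫ (T.str S.right').mapIso y) (Iso.refl _), ?_⟩
  dsimp only [LinStr.compOther, LinStr.compInside, TwoMulticategory.compIso, Iso.trans_hom,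
    Iso.refl_hom, Functor.mapIso_hom]
  have ax := γ.γ_mult_right S hjk R₁ R₂ Q Q' S' hjk' h E.pre
  have n₁ := T.multCell_naturality S.right' R₁ y.hom (𝟙 E.pre)
  have n₂ := T.strNat_naturality Q' x.hom E.iso.hom
  have e' := congrArg (C.comp₂ R₁.out' · E.iso.hom) e
  rw [CategoryTheory.Functor.map_id] at n₁
  have e₁ := C.comp₂_comp R₁.out' ((T.str S.left').map x.hom) A.iso.hom E.iso.hom (𝟙 _)
  have e₂ := C.comp₂_comp R₁.out' (γ.γ S hjk h).hom ((T.str S.right').map y.hom ≫ A'.iso.hom)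
    (𝟙 _) E.iso.hom
  have e₃ := C.comp₂_comp R₁.out' ((T.str S.right').map y.hom) A'.iso.hom (𝟙 _) E.iso.hom
  have f₁ := C.comp₂_comp_id R₁.out (γ.γ S hjk h).hom ((T.str S.right').map y.hom) E.pre
  rw [Category.id_comp] at e₂ e₃
  rw [Category.comp_id] at e₁
  rw [e₁, e₂, e₃] at e'
  simp only [CategoryTheory.Functor.map_comp, Category.assoc]
  rw [f₁, CategoryTheory.Functor.map_comp, Category.assoc, reassoc_of% n₁, reassoc_of% n₂, e',
    reassoc_of% ax]

/-- Compatibility of the pseudocommutativity with composition in the codomain. -/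
theorem compInside {L M N P : List C.Ob} {j k : ℕ} {X Y Z Z' : D.Ob}
    (S : Parallel L j (J.obj X) [T.obj X] k (J.obj Y) [T.obj Y] j k M N P) (hjk : j < k)
    (R₁ : Nested [T.obj Z] 0 (T.obj Z) L k (J.obj Y) [T.obj Y] k L M M)
    (R₂ : Nested [T.obj Z] 0 (T.obj Z) M j (J.obj X) [T.obj X] j M P P)
    (R₃ : Nested [T.obj Z] 0 (T.obj Z) L j (J.obj X) [T.obj X] j L N N)
    (R₄ : Nested [T.obj Z] 0 (T.obj Z) N k (J.obj Y) [T.obj Y] k N P P)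
    {s : Replaces [J.obj Z] 0 (J.obj Z) [T.obj Z] [T.obj Z]}
    {H : C.Hom [T.obj Z] (T.obj Z')} (E : T.LinStr s H) {F : C.Hom P (T.obj Z)}
    {A : T.LinStr S.left' F} {A' : T.LinStr S.right' F} (h : Comm γ S hjk A A') :
    Comm γ S hjk (LinStr.compInside R₂ E A) (LinStr.compInside R₄ E A') := by
  obtain ⟨h, x, y, e⟩ := h
  refine ⟨C.comp R₁.out ((T.str s).obj E.pre) h,
    T.multCell s R₁ E.pre h ≪≫ C.compIso R₁.out' (Iso.refl _) x,
    T.multCell s R₃ E.pre h ≪≫ C.compIso R₃.out' (Iso.refl _) y, ?_⟩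
  dsimp only [LinStr.compInside, TwoMulticategory.compIso, Iso.trans_hom, Iso.refl_hom]
  have ax := γ.γ_codomain S hjk R₁ R₂ R₃ R₄ s E.pre h
  have n₁ := T.multCell_naturality s R₂ (𝟙 E.pre) x.hom
  have n₂ := T.multCell_naturality s R₄ (𝟙 E.pre) y.hom
  have e' := congrArg (C.comp₂ R₂.out' E.iso.hom ·) e
  rw [CategoryTheory.Functor.map_id] at n₁ n₂
  have e₁ := C.comp₂_comp R₂.out' (𝟙 _) E.iso.hom ((T.str S.left').map x.hom) A.iso.hom
  have e₂ := C.comp₂_comp R₂.out' (𝟙 _) E.iso.hom (γ.γ S hjk h).hom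
    ((T.str S.right').map y.hom ≫ A'.iso.hom)
  have e₃ := C.comp₂_comp R₂.out' (𝟙 _) E.iso.hom ((T.str S.right').map y.hom) A'.iso.hom
  rw [Category.id_comp] at e₁ e₂ e₃
  rw [e₁, e₂, e₃] at e'
  simp only [CategoryTheory.Functor.map_comp, Category.assoc]
  rw [reassoc_of% n₁, reassoc_of% n₂, e', reassoc_of% ax]

end Comm

/-- The step of the universal property of strengthening: if `φ : f → G ∘ i` is linear in an argument
of `f` to the left of the one at `k`, then so is the extension `fᵗ → G` of `φ`. -/
theorem IsLin.extend (γ : T.Pseudocommutativity) {L M N P : List C.Ob} {j k : ℕ} {X Y Z : D.Ob}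
    (S : Parallel L j (J.obj X) [T.obj X] k (J.obj Y) [T.obj Y] j k M N P) (hjk : j < k)
    (R : Parallel M j (J.obj X) [T.obj X] k (T.obj Y) [J.obj Y] j k L P N)
    {f : C.Hom N (T.obj Z)} {E : T.LinStr S.right f}
    {G : C.Hom P (T.obj Z)} {A : T.LinStr S.left' G} {A' : T.LinStr S.right' G}
    (H : Comm γ S hjk A A') {φ : f ⟶ C.comp R.right' G (T.unit Y)}
    (hφ : T.IsLin E (LinStr.compOther R A (T.unit Y)) φ) :
    T.IsLin (E.strOther γ S hjk) A ((T.str S.right').map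
      (φ ≫ C.comp₂ R.right' A'.iso.inv (𝟙 _) ≫ (T.unitCell S.right' R.right' A'.pre).inv) ≫
        A'.iso.hom) := by
  obtain ⟨h, x, y, e⟩ := H
  obtain ⟨ψ, hψ⟩ := hφ
  dsimp only [LinStr.compOther, TwoMulticategory.compIso, Iso.trans_hom, Iso.refl_hom] at ψ hψ
  refine ⟨(T.str S.left).map (ψ ≫ C.comp₂ R.left x.inv (𝟙 _) ≫ (T.unitCell S.left R.left h).inv) ≫
    x.hom, ?_⟩
  dsimp only [LinStr.strOther, Iso.trans_hom, Functor.mapIso_hom]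
  have ax := γ.γ_unit_right S hjk R h
  have n₁ := γ.γ_naturality S hjk (ψ ≫ C.comp₂ R.left x.inv (𝟙 _) ≫ (T.unitCell S.left R.left h).inv)
  have n₂ := T.unitCell_naturality S.right' R.right' y.hom
  have n₃ := T.strNat_naturality R x.inv (𝟙 (T.unit Y))
  -- by faithfulness of strengthening at `k`, the claim is an equation between 2-cells before it
  have key : (T.str S.right).map (ψ ≫ C.comp₂ R.left x.inv (𝟙 _) ≫ (T.unitCell S.left R.left h).inv) ≫
      y.hom = E.iso.hom ≫ φ ≫ C.comp₂ R.right' A'.iso.inv (𝟙 _) ≫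
        (T.unitCell S.right' R.right' A'.pre).inv := by
    have q : C.comp₂ R.right' ((T.str S.left').map x.inv) (𝟙 _) ≫
        C.comp₂ R.right' (γ.γ S hjk h).hom (𝟙 _) ≫
        C.comp₂ R.right' ((T.str S.right').map y.hom) (𝟙 _) ≫ C.comp₂ R.right' A'.iso.hom (𝟙 _) =
        C.comp₂ R.right' A.iso.hom (𝟙 (T.unit Y)) := by
      rw [← C.comp₂_comp_id, ← C.comp₂_comp_id, ← C.comp₂_comp_id, ← e,
        ← CategoryTheory.Functor.map_comp_assoc, Iso.inv_hom_id, CategoryTheory.Functor.map_id,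
        Category.id_comp]
    have i₁ := congrArg (T.str S.right).map (T.unitCell S.left R.left h).inv_hom_id
    rw [CategoryTheory.Functor.map_comp, CategoryTheory.Functor.map_id] at i₁
    rw [← cancel_mono (T.unitCell S.right' R.right' A'.pre).hom,
      ← cancel_mono (C.comp₂ R.right' A'.iso.hom (𝟙 (T.unit Y)))]
    simp only [CategoryTheory.Functor.map_comp, Category.assoc, Iso.inv_hom_id_assoc]
    rw [← C.comp₂_comp_id, A'.iso.inv_hom_id, C.comp₂_id, Category.comp_id, ← hψ,
      reassoc_of% n₂, ← reassoc_of% ax, reassoc_of% i₁, reassoc_of% n₃, q]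
  have key' := congrArg (T.str S.right').map key
  simp only [CategoryTheory.Functor.map_comp, Category.assoc] at n₁ key' ⊢
  rw [e, reassoc_of% n₁, reassoc_of% key']

end StrongRelativePseudomonad

/-! ### Squares and cubes of unary replacements -/

section Contexts

variable {α : Type*}

theorem Replaces.set_back {L M Ξ : List α} {k : ℕ} {X : α} (s : Replaces L k X Ξ M) (Y : α) :
    Replaces (L.set k Y) k Y [X] L := by
  obtain ⟨Γ, Δ, h, rfl, rfl⟩ := s
  exact ⟨Γ, Δ, h, by simp [← h], by simp⟩

theorem Replaces.trans {L M N Ξ : List α} {k : ℕ} {X Y : α} (s : Replaces L k X [Y] M)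
    (s' : Replaces M k Y Ξ N) : Replaces L k X Ξ N := by
  obtain ⟨Γ, Δ, h, rfl, rfl⟩ := s
  obtain ⟨Γ', Δ', h', e, rfl⟩ := s'
  rw [List.append_assoc, List.singleton_append] at e
  obtain ⟨rfl, e⟩ := List.append_inj e (by omega)
  obtain rfl : Δ = Δ' := by simpa using e
  exact ⟨Γ, Δ, h, rfl, rfl⟩

/-- The square of unary replacements at `k` and `l` determined by the two sides which end in `M'`. -/
theorem Parallel.of_set {M M' N' : List α} {k l : ℕ} {A A' B B' : α} (h : k ≠ l)
    (s : Replaces N' k A [A'] M') (r : Replaces M l B [B'] M') :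
    Parallel (N'.set l B) k A [A'] l B [B'] k l N' M M' := by
  rw [Replaces.unary_iff] at s r
  obtain ⟨s, rfl⟩ := s
  obtain ⟨r, e⟩ := r
  have hlen := congrArg List.length e
  simp only [List.length_set] at hlen
  have e' : ∀ i : ℕ, (N'.set k A')[i]? = (M.set l B')[i]? := fun i => by rw [e]
  simp only [List.getElem?_set] at e'
  have hl : l < M.length := (List.getElem?_eq_some_iff.mp r).1
  have hN : N'[l]? = some B' := by grind
  refine ⟨h, by simp [shift], by simp [shift], ?_, ?_, ?_, ?_⟩ <;> rw [Replaces.unary_iff]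
  · refine ⟨by grind, List.ext_getElem? fun i => ?_⟩
    simp only [List.getElem?_set, List.length_set]
    grind
  · exact ⟨s, rfl⟩
  · refine ⟨by grind, List.ext_getElem? fun i => ?_⟩
    simp only [List.getElem?_set, List.length_set]
    grind
  · exact ⟨r, e⟩

theorem Parallel.symm {L M N P : List α} {j k : ℕ} {A A' B B' : α}
    (S : Parallel L j A [A'] k B [B'] j k M N P) : Parallel L k B [B'] j A [A'] k j N M P :=
  ⟨S.ne.symm, S.hq, S.hp, S.right, S.right', S.left, S.left'⟩

theorem Nested.whole {L M Ξ : List α} {k : ℕ} {A : α} (Z : α) (s : Replaces L k A Ξ M) :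
    Nested [Z] 0 Z L k A Ξ k L M M :=
  Nested.of (by simp) (Replaces.whole _ _) s (Replaces.whole _ _)

/-- The opposite face of a cube of unary replacements at positions `j`, `k` and `l`. -/
theorem Parallel.cube {L M N P P' : List α} {j k l : ℕ} {A A' B B' E E' : α}
    (S : Parallel L j A [A'] k B [B'] j k M N P) (r : Replaces P' l E [E'] P) (hj : j ≠ l)
    (hk : k ≠ l) :
    Parallel (L.set l E) j A [A'] k B [B'] j k (M.set l E) (N.set l E) P' :=
  have R₁ := Parallel.of_set hj S.left' r
  have R₂ := Parallel.of_set hk S.right' r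
  ⟨S.ne, S.hp, S.hq, (Parallel.of_set hk S.left R₁.left).right, R₁.right,
    (Parallel.of_set hj S.right R₂.left).right, R₂.right⟩

end Contexts

namespace StrongRelativePseudomonad

variable {D : TwoMulticategory.{u, v, w}} {C : TwoMulticategory.{u', v', w'}}
  {J : MultiFunctor D C} {T : StrongRelativePseudomonad J}

/-! ### Multilinear structures -/

variable (T) in
/-- A linear structure of `F` in each argument marked by `Q`. A mark is an object `X` of `D`, which
says that the argument is to be regarded as `TX`. -/
structure MultiLin (Q : ℕ → Option D.Ob) {M : List C.Ob} {Y : D.Ob} (F : C.Hom M (T.obj Y)) where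
  lin : ∀ {k : ℕ} {X : D.Ob} {N : List C.Ob}, Q k = some X →
    ∀ s : Replaces N k (J.obj X) [T.obj X] M, T.LinStr s F

/-- The restriction of a multilinear structure to fewer marked arguments. -/
def MultiLin.restrict {Q Q' : ℕ → Option D.Ob} (h : ∀ k Z, Q' k = some Z → Q k = some Z)
    {M : List C.Ob} {Y : D.Ob} {F : C.Hom M (T.obj Y)} (A : T.MultiLin Q F) : T.MultiLin Q' F where
  lin hk s := A.lin (h _ _ hk) s

/-- A 2-cell is multilinear if it is linear in each marked argument. -/
def IsMultiLin {Q : ℕ → Option D.Ob} {M : List C.Ob} {Y : D.Ob} {F F' : C.Hom M (T.obj Y)}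
    (A : T.MultiLin Q F) (A' : T.MultiLin Q F') (φ : F ⟶ F') : Prop :=
  ∀ ⦃k : ℕ⦄ ⦃X : D.Ob⦄ ⦃N : List C.Ob⦄ (hk : Q k = some X)
    (s : Replaces N k (J.obj X) [T.obj X] M), T.IsLin (A.lin hk s) (A'.lin hk s) φ

/-- A multilinear structure is commutative if its linear structures commute pairwise. -/
def MultiLin.IsComm (γ : T.Pseudocommutativity) {Q : ℕ → Option D.Ob} {P : List C.Ob} {Z : D.Ob}
    {F : C.Hom P (T.obj Z)} (A : T.MultiLin Q F) : Prop :=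
  ∀ ⦃j k : ℕ⦄ ⦃X Y : D.Ob⦄ ⦃L M N : List C.Ob⦄ (hj : Q j = some X) (hk : Q k = some Y)
    (S : Parallel L j (J.obj X) [T.obj X] k (J.obj Y) [T.obj Y] j k M N P) (hjk : j < k),
    Comm γ S hjk (A.lin hj S.left') (A.lin hk S.right')

/-- A linear structure, transported along equations between the data which determine it. -/
def LinStr.cast {k p : ℕ} {X Z : D.Ob} {L M N : List C.Ob} {Y : D.Ob} {F : C.Hom M (T.obj Y)}
    {r : Replaces L p (J.obj X) [T.obj X] M} (A : T.LinStr r F) (hk : k = p) (hX : X = Z)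
    (s : Replaces N k (J.obj Z) [T.obj Z] M) : T.LinStr s F :=
  have hN : L = N := by subst hk hX; exact r.source_unique s
  by subst hk hX hN; exact A

namespace IsMultiLin

variable {Q : ℕ → Option D.Ob} {M : List C.Ob} {Y : D.Ob} {F F' F'' : C.Hom M (T.obj Y)}
  {A : T.MultiLin Q F} {A' : T.MultiLin Q F'} {A'' : T.MultiLin Q F''}

theorem id (A : T.MultiLin Q F) : IsMultiLin A A (𝟙 F) := fun _ _ _ hk s => IsLin.id (A.lin hk s)

theorem comp {φ : F ⟶ F'} {ψ : F' ⟶ F''} (h : IsMultiLin A A' φ) (h' : IsMultiLin A' A'' ψ) :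
    IsMultiLin A A'' (φ ≫ ψ) := fun _ _ _ hk s => (h hk s).comp (h' hk s)

theorem inv {φ : F ⟶ F'} [IsIso φ] (h : IsMultiLin A A' φ) :
    IsMultiLin A' A (CategoryTheory.inv φ) := fun _ _ _ hk s => (h hk s).inv

theorem eqToHom_symm {e : F = F'} (h : IsMultiLin A A' (eqToHom e)) :
    IsMultiLin A' A (eqToHom e.symm) := fun _ _ _ hk s => (h hk s).eqToHom_symm

theorem eqToHom_trans {e : F = F'} {e' : F' = F''} (h : IsMultiLin A A' (eqToHom e))
    (h' : IsMultiLin A' A'' (eqToHom e')) : IsMultiLin A A'' (eqToHom (e.trans e')) := by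
  have := h.comp h'
  rwa [CategoryTheory.eqToHom_trans] at this

end IsMultiLin

/-! ### Strengthening of multilinear structures -/

section Str

variable (γ : T.Pseudocommutativity) {Q Q' : ℕ → Option D.Ob} {p : ℕ} {L M : List C.Ob} {X Y : D.Ob}
  (r : Replaces L p (J.obj X) [T.obj X] M)
  (hQ : ∀ k Z, k ≠ p → Q' k = some Z → k < p ∧ Q k = some Z) (hp : Q' p = some X)

/-- The multilinear structure of `fᵗ`, where `f` is multilinear in arguments to the left of the
strengthened one. -/
def MultiLin.str {f : C.Hom L (T.obj Y)} (A : T.MultiLin Q f) : T.MultiLin Q' ((T.str r).obj f) where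
  lin {k Z _} hk s :=
    if h : k = p then (LinStr.free r f).cast h (Option.some.inj (by rw [← hp, ← hk, h])) s
    else (A.lin (hQ k Z h hk).2 (Parallel.of_set h s r).right).strOther γ (Parallel.of_set h s r)
      (hQ k Z h hk).1

theorem MultiLin.str_lin_self {f : C.Hom L (T.obj Y)} (A : T.MultiLin Q f) :
    (A.str γ r hQ hp).lin hp r = LinStr.free r f := dif_pos rfl

theorem MultiLin.str_lin_ne {f : C.Hom L (T.obj Y)} (A : T.MultiLin Q f) {k : ℕ} {Z : D.Ob}
    {N : List C.Ob} (hk : Q' k = some Z) (s : Replaces N k (J.obj Z) [T.obj Z] M) (h : k ≠ p) :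
    (A.str γ r hQ hp).lin hk s = (A.lin (hQ k Z h hk).2 (Parallel.of_set h s r).right).strOther γ
      (Parallel.of_set h s r) (hQ k Z h hk).1 := dif_neg h

theorem MultiLin.IsComm.str {f : C.Hom L (T.obj Y)} {A : T.MultiLin Q f} (h : A.IsComm γ) :
    (A.str γ r hQ hp).IsComm γ := by
  intro j k Z W L₀ M₀ N₀ hj hk S hjk
  by_cases hkp : k = p
  · subst hkp
    obtain rfl := Option.some.inj (hk.symm.trans hp)
    obtain rfl := S.right'.source_unique r
    obtain rfl := S.left.source_unique (Parallel.of_set S.ne S.left' r).left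
    rw [MultiLin.str_lin_self, MultiLin.str_lin_ne _ _ _ _ _ _ _ S.ne]
    exact Comm.str_self γ S hjk _
  · have hkp' := (hQ k W hkp hk).1
    have hjp : j ≠ p := by omega
    rw [MultiLin.str_lin_ne _ _ _ _ _ _ _ hkp, MultiLin.str_lin_ne _ _ _ _ _ _ _ hjp]
    have R₁ := Parallel.of_set hjp S.left' r
    have R₂ := Parallel.of_set hkp S.right' r
    exact Comm.str_other γ hjk hkp' (by omega) (Parallel.of_set hkp S.left R₁.left)
      (Parallel.of_set hjp S.right R₂.left) (S.cube r hjp hkp) R₁ S R₂ (h _ _ _ _)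

end Str

/-! ### Composition of multilinear structures -/

section Comp

variable {Q Q' : ℕ → Option D.Ob} {p : ℕ} {M M' : List C.Ob} {Y : D.Ob}

/-- The multilinear structure of `F ∘ b` in arguments other than the one in which `b` is composed. -/
def MultiLin.compOther {B B' : C.Ob} (r : Replaces M p B [B'] M')
    (hQ : ∀ k Z, Q' k = some Z → k ≠ p ∧ Q k = some Z) {F : C.Hom M (T.obj Y)} (A : T.MultiLin Q F)
    (b : C.Hom [B'] B) : T.MultiLin Q' (C.comp r F b) where
  lin {k Z _} hk s := (A.lin (hQ k Z hk).2 (Parallel.of_set (hQ k Z hk).1 s r).right).compOther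
    (Parallel.of_set (hQ k Z hk).1 s r) b

theorem IsMultiLin.compOther {B B' : C.Ob} (r : Replaces M p B [B'] M')
    (hQ : ∀ k Z, Q' k = some Z → k ≠ p ∧ Q k = some Z) {F F' : C.Hom M (T.obj Y)}
    {A : T.MultiLin Q F} {A' : T.MultiLin Q F'} {φ : F ⟶ F'} (h : IsMultiLin A A' φ)
    {b b' : C.Hom [B'] B} (β : b ⟶ b') :
    IsMultiLin (A.compOther r hQ b) (A'.compOther r hQ b') (C.comp₂ r φ β) :=
  fun _ _ _ _ _ => (h _ _).compOther _ β

theorem MultiLin.IsComm.compOther (γ : T.Pseudocommutativity) {B B' : C.Ob}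
    (r : Replaces M p B [B'] M') (hQ : ∀ k Z, Q' k = some Z → k ≠ p ∧ Q k = some Z)
    {F : C.Hom M (T.obj Y)} {A : T.MultiLin Q F} (h : A.IsComm γ) (b : C.Hom [B'] B) :
    (A.compOther r hQ b).IsComm γ := by
  intro j k Z W L₀ M₀ N₀ hj hk S hjk
  have hjp := (hQ _ _ hj).1
  have hkp := (hQ _ _ hk).1
  have R₁ := Parallel.of_set hjp S.left' r
  have R₂ := Parallel.of_set hkp S.right' r
  exact Comm.compOther γ (S.cube r hjp hkp) hjk S hjk (Parallel.of_set hjp S.right R₂.left)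
    (Parallel.of_set hkp S.left R₁.left) R₁ R₂ (h _ _ _ _) b

variable {W X : D.Ob} (r : Replaces M p (T.obj X) [T.obj W] M')
  (hQ : ∀ k Z, k ≠ p → Q' k = some Z → Q k = some Z) (hp : Q p = some X) (hp' : Q' p = some W)
  {s₀ : Replaces [J.obj W] 0 (J.obj W) [T.obj W] [T.obj W]}

/-- The multilinear structure of `F ∘ G` for a linear unary 1-cell `G`. -/
def MultiLin.comp {F : C.Hom M (T.obj Y)} (A : T.MultiLin Q F) {G : C.Hom [T.obj W] (T.obj X)}
    (B : T.LinStr s₀ G) : T.MultiLin Q' (C.comp r F G) where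
  lin {k Z _} hk s :=
    if h : k = p then
      ((A.lin hp (r.set_back _)).compInside
        (Nested.unary (r.trans (r.back.set_back (J.obj W)).back) r) B).cast h
          (Option.some.inj (by rw [← hp', ← hk, h])) s
    else (A.lin (hQ k Z h hk) (Parallel.of_set h s r).right).compOther (Parallel.of_set h s r) G

theorem MultiLin.comp_lin_self {F : C.Hom M (T.obj Y)} (A : T.MultiLin Q F)
    {G : C.Hom [T.obj W] (T.obj X)} (B : T.LinStr s₀ G) {N : List C.Ob}
    (s : Replaces N p (J.obj W) [T.obj W] M') : (A.comp r hQ hp hp' B).lin hp' s =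
      (A.lin hp (r.set_back _)).compInside (Nested.unary (r.trans s.back) r) B := by
  obtain rfl := s.source_unique (r.back.set_back (J.obj W))
  exact dif_pos rfl

theorem MultiLin.comp_lin_ne {F : C.Hom M (T.obj Y)} (A : T.MultiLin Q F)
    {G : C.Hom [T.obj W] (T.obj X)} (B : T.LinStr s₀ G) {k : ℕ} {Z : D.Ob} {N : List C.Ob}
    (hk : Q' k = some Z) (s : Replaces N k (J.obj Z) [T.obj Z] M') (h : k ≠ p) :
    (A.comp r hQ hp hp' B).lin hk s = (A.lin (hQ k Z h hk) (Parallel.of_set h s r).right).compOther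
      (Parallel.of_set h s r) G := dif_neg h

/-- `MultiLin.comp_lin_self` with the contexts, which are determined by the others, given independently. -/
theorem MultiLin.comp_lin_self_of {F : C.Hom M (T.obj Y)} (A : T.MultiLin Q F)
    {G : C.Hom [T.obj W] (T.obj X)} (B : T.LinStr s₀ G) {N N₀ : List C.Ob}
    (s : Replaces N₀ p (J.obj X) [T.obj X] M)
    (S : Nested M p (T.obj X) [J.obj W] 0 (J.obj W) [T.obj W] p N [T.obj W] M') :
    (A.comp r hQ hp hp' B).lin hp' S.inn = (A.lin hp s).compInside S B := by
  obtain rfl := s.source_unique (r.set_back (J.obj X))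
  exact A.comp_lin_self r hQ hp hp' B S.inn

/-- `MultiLin.comp_lin_ne` with the contexts, which are determined by the others, given independently. -/
theorem MultiLin.comp_lin_ne_of {F : C.Hom M (T.obj Y)} (A : T.MultiLin Q F)
    {G : C.Hom [T.obj W] (T.obj X)} (B : T.LinStr s₀ G) {k : ℕ} {Z : D.Ob} {N N₀ : List C.Ob}
    (hk : Q' k = some Z)
    (S : Parallel N₀ k (J.obj Z) [T.obj Z] p (T.obj X) [T.obj W] k p N M M') :
    (A.comp r hQ hp hp' B).lin hk S.left' = (A.lin (hQ k Z S.ne hk) S.right).compOther S G := by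
  obtain rfl := S.right.source_unique (Parallel.of_set S.ne S.left' r).right
  exact A.comp_lin_ne r hQ hp hp' B hk S.left' S.ne

theorem IsMultiLin.comp₂ {F F' : C.Hom M (T.obj Y)} {A : T.MultiLin Q F} {A' : T.MultiLin Q F'}
    {G G' : C.Hom [T.obj W] (T.obj X)} {B : T.LinStr s₀ G} {B' : T.LinStr s₀ G'} {φ : F ⟶ F'}
    {ψ : G ⟶ G'} (h : IsMultiLin A A' φ) (h' : T.IsLin B B' ψ) :
    IsMultiLin (A.comp r hQ hp hp' B) (A'.comp r hQ hp hp' B') (C.comp₂ r φ ψ) := by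
  intro k Z N hk s
  by_cases hkp : k = p
  · subst hkp
    obtain rfl := Option.some.inj (hk.symm.trans hp')
    rw [MultiLin.comp_lin_self, MultiLin.comp_lin_self]
    exact (h _ _).compInside _ h'
  · rw [MultiLin.comp_lin_ne _ _ _ _ _ _ _ _ hkp, MultiLin.comp_lin_ne _ _ _ _ _ _ _ _ hkp]
    exact (h _ _).compOther _ _

theorem MultiLin.IsComm.comp (γ : T.Pseudocommutativity) {F : C.Hom M (T.obj Y)}
    {A : T.MultiLin Q F} (h : A.IsComm γ) {G : C.Hom [T.obj W] (T.obj X)} (B : T.LinStr s₀ G) :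
    (A.comp r hQ hp hp' B).IsComm γ := by
  intro j k Z V L₀ M₀ N₀ hj hk S hjk
  by_cases hjp : j = p
  · subst hjp
    obtain rfl := Option.some.inj (hj.symm.trans hp')
    rw [MultiLin.comp_lin_self, MultiLin.comp_lin_ne _ _ _ _ _ _ _ _ S.ne.symm]
    have Q' := Parallel.of_set S.ne.symm S.right' r
    have R₁ := Nested.unary (r.trans S.left'.back) r
    have R₂ := Nested.unary (Q'.left.trans S.right.back) Q'.left
    exact Comm.comp_left γ (Parallel.of_set S.ne (r.set_back _) Q'.right) hjk R₁ R₂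
      ⟨Q'.ne, Q'.hp, Q'.hq, R₂.out, S.left, Q'.right, R₁.out⟩ Q' S hjk (h _ _ _ _) B
  · by_cases hkp : k = p
    · subst hkp
      obtain rfl := Option.some.inj (hk.symm.trans hp')
      rw [MultiLin.comp_lin_self, MultiLin.comp_lin_ne _ _ _ _ _ _ _ _ S.ne]
      have Q' := Parallel.of_set S.ne S.left' r
      have R₁ := Nested.unary (r.trans S.right'.back) r
      have R₂ := Nested.unary (Q'.left.trans S.left.back) Q'.left
      exact Comm.comp_right γ (Parallel.of_set S.ne Q'.right (r.set_back _)) hjk R₁ R₂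
        ⟨Q'.ne, Q'.hp, Q'.hq, R₂.out, S.right, Q'.right, R₁.out⟩ Q' S hjk (h _ _ _ _) B
    · rw [MultiLin.comp_lin_ne _ _ _ _ _ _ _ _ hkp, MultiLin.comp_lin_ne _ _ _ _ _ _ _ _ hjp]
      have R₁ := Parallel.of_set hjp S.left' r
      have R₂ := Parallel.of_set hkp S.right' r
      exact Comm.compOther γ (S.cube r hjp hkp) hjk S hjk (Parallel.of_set hjp S.right R₂.left)
        (Parallel.of_set hkp S.left R₁.left) R₁ R₂ (h _ _ _ _) G

end Comp

/-! ### Composites of a linear unary 1-cell with a multilinear one -/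

section Post

variable {Q : ℕ → Option D.Ob} {M : List C.Ob} {Y Z : D.Ob}
  {s₀ : Replaces [J.obj Y] 0 (J.obj Y) [T.obj Y] [T.obj Y]}

/-- The multilinear structure of `H ∘ F` for a linear unary 1-cell `H`. -/
def MultiLin.post {H : C.Hom [T.obj Y] (T.obj Z)} (E : T.LinStr s₀ H) {F : C.Hom M (T.obj Y)}
    (A : T.MultiLin Q F) : T.MultiLin Q (C.post H F) where
  lin hk s := E.compInside (Nested.whole _ s) (A.lin hk s)

theorem IsMultiLin.post₂ {H H' : C.Hom [T.obj Y] (T.obj Z)} {E : T.LinStr s₀ H}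
    {E' : T.LinStr s₀ H'} {φ : H ⟶ H'} (h : T.IsLin E E' φ) {F F' : C.Hom M (T.obj Y)}
    {A : T.MultiLin Q F} {A' : T.MultiLin Q F'} {ψ : F ⟶ F'} (h' : IsMultiLin A A' ψ) :
    IsMultiLin (A.post E) (A'.post E') (C.post₂ φ ψ) :=
  fun _ _ _ hk s => h.compInside (Nested.whole _ s) (h' hk s)

theorem MultiLin.IsComm.post (γ : T.Pseudocommutativity) {H : C.Hom [T.obj Y] (T.obj Z)}
    (E : T.LinStr s₀ H) {F : C.Hom M (T.obj Y)} {A : T.MultiLin Q F} (h : A.IsComm γ) :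
    (A.post E).IsComm γ :=
  fun _ _ _ _ _ _ _ hj hk S hjk => Comm.compInside γ S hjk (Nested.whole _ S.left) (Nested.whole _ S.left')
    (Nested.whole _ S.right) (Nested.whole _ S.right') E (h hj hk S hjk)

end Post

end StrongRelativePseudomonad

namespace StrongRelativePseudomonad

variable {D : TwoMulticategory.{u, v, w}} {C : TwoMulticategory.{u', v', w'}}
  {J : MultiFunctor D C} {T : StrongRelativePseudomonad J}

/-! ### Multilinearity of the associativities and unities of composition -/

namespace IsMultiLin

section

variable {Q Q' : ℕ → Option D.Ob} {p : ℕ} {M M' : List C.Ob} {X Y Z W V : D.Ob}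
  {s₀ : Replaces [J.obj Y] 0 (J.obj Y) [T.obj Y] [T.obj Y]}
  {t₀ : Replaces [J.obj X] 0 (J.obj X) [T.obj X] [T.obj X]}

theorem post_post {H : C.Hom [T.obj Y] (T.obj Z)} (E : T.LinStr s₀ H)
    {G : C.Hom [T.obj X] (T.obj Y)} (B : T.LinStr t₀ G) {F : C.Hom M (T.obj X)}
    (A : T.MultiLin Q F) (S : Nested [T.obj Y] 0 (T.obj Y) [J.obj X] 0 (J.obj X) [T.obj X] 0
      [J.obj X] [T.obj X] [T.obj X]) :
    IsMultiLin (A.post (E.compInside S B)) ((A.post B).post E) (eqToHom (C.post_post H G F)) :=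
  fun _ _ _ hk s => IsLin.assoc_inside_inside S (Nested.whole _ s) (Nested.whole _ s) (Nested.whole _ s)
    (Nested.of rfl (Replaces.whole _ _) (Replaces.whole _ _) (Replaces.whole _ _))
    (Nested.of rfl (Replaces.whole _ _) (Replaces.whole _ _) (Replaces.whole _ _))
    E B (A.lin hk s)

theorem one_comp {F : C.Hom M (T.obj X)} (A : T.MultiLin Q F) :
    IsMultiLin (A.post (LinStr.one X t₀)) A (eqToHom (C.one_comp (Replaces.whole _ _) F)) :=
  fun _ _ _ hk s => IsLin.one_comp (Nested.whole _ s) (A.lin hk s)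

variable {r₀ : Replaces [J.obj W] 0 (J.obj W) [T.obj W] [T.obj W]}
  (r : Replaces M p (T.obj X) [T.obj W] M')
  (hQ : ∀ k Z, k ≠ p → Q' k = some Z → Q k = some Z) (hp : Q p = some X) (hp' : Q' p = some W)

theorem post_comp {H : C.Hom [T.obj Y] (T.obj Z)} (E : T.LinStr s₀ H) {F : C.Hom M (T.obj Y)}
    (A : T.MultiLin Q F) {G : C.Hom [T.obj W] (T.obj X)} (B : T.LinStr r₀ G) :
    IsMultiLin ((A.comp r hQ hp hp' B).post E) ((A.post E).comp r hQ hp hp' B)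
      (eqToHom (C.post_comp r H F G)) := by
  refine eqToHom_symm (e := (C.post_comp r H F G).symm) ?_
  intro k V N hk s
  by_cases hkp : k = p
  · subst hkp
    obtain rfl := Option.some.inj (hk.symm.trans hp')
    change T.IsLin _ (E.compInside _ ((A.comp r hQ hp hp' B).lin hk s)) _
    rw [MultiLin.comp_lin_self, MultiLin.comp_lin_self]
    exact IsLin.assoc_inside_inside (Nested.whole _ (r.set_back _)) _ _ (Nested.whole _ s)
      (Nested.whole _ (r.trans s.back)) (Nested.whole _ r) E _ B
  · change T.IsLin _ (E.compInside _ ((A.comp r hQ hp hp' B).lin hk s)) _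
    rw [MultiLin.comp_lin_ne _ _ _ _ _ _ _ _ hkp, MultiLin.comp_lin_ne _ _ _ _ _ _ _ _ hkp]
    have S := Parallel.of_set hkp s r
    exact IsLin.assoc_inside_other S (Nested.whole _ S.right) (Nested.whole _ s)
      (Nested.whole _ S.left) (Nested.whole _ r) S E _ G

theorem comp_one (hQ : ∀ k Z, k ≠ p → Q' k = some Z → Q k = some Z) (hp : Q p = some X)
    (hp' : Q' p = some X) (hQ' : ∀ k Z, Q' k = some Z → Q k = some Z)
    (r : Replaces M p (T.obj X) [T.obj X] M) {F : C.Hom M (T.obj Y)} (A : T.MultiLin Q F) :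
    IsMultiLin (A.comp r hQ hp hp' (LinStr.one X t₀)) (A.restrict hQ')
      (eqToHom (C.comp_one r F)) := by
  intro k V N hk s
  by_cases hkp : k = p
  · subst hkp
    obtain rfl := Option.some.inj (hk.symm.trans hp')
    obtain rfl := s.source_unique (r.set_back (J.obj V))
    rw [MultiLin.comp_lin_self]
    exact IsLin.comp_one_inside _ (A.lin hp s)
  · have S : Parallel N k (J.obj V) [T.obj V] p (T.obj X) [T.obj X] k p N M M := by
      have S := Parallel.of_set hkp s r
      have e := S.right.source_unique s
      rwa [e] at S
    have e : (A.comp r hQ hp hp' (LinStr.one X t₀)).lin hk s = (A.lin (hQ k V hkp hk) s).compOther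
      S _ := A.comp_lin_ne_of r hQ hp hp' (LinStr.one X t₀) hk S
    rw [e]
    exact IsLin.comp_one_other S _

end

section

variable {Q Q₁ Q₂ Q₃ : ℕ → Option D.Ob} {p q : ℕ} {M M₁ M₂ M₃ : List C.Ob} {X X' X'' Y W V : D.Ob}
  {r₀ : Replaces [J.obj W] 0 (J.obj W) [T.obj W] [T.obj W]}
  {t₀ : Replaces [J.obj V] 0 (J.obj V) [T.obj V] [T.obj V]}

theorem comp_post (r : Replaces M p (T.obj X) [T.obj W] M₁)
    (r₁ : Replaces M₁ p (T.obj W) [T.obj V] M₂) (r₂ : Replaces M p (T.obj X) [T.obj V] M₂)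
    (hQ : ∀ k Z, k ≠ p → Q₁ k = some Z → Q k = some Z) (hp : Q p = some X) (hp₁ : Q₁ p = some W)
    (hQ₁ : ∀ k Z, k ≠ p → Q₂ k = some Z → Q₁ k = some Z) (hp₂ : Q₂ p = some V)
    (hQ₂ : ∀ k Z, k ≠ p → Q₂ k = some Z → Q k = some Z)
    {F : C.Hom M (T.obj Y)} (A : T.MultiLin Q F) {G : C.Hom [T.obj W] (T.obj X)}
    (B : T.LinStr r₀ G) {H : C.Hom [T.obj V] (T.obj W)} (E : T.LinStr t₀ H)
    (S : Nested [T.obj W] 0 (T.obj W) [J.obj V] 0 (J.obj V) [T.obj V] 0 [J.obj V] [T.obj V]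
      [T.obj V]) :
    IsMultiLin ((A.comp r hQ hp hp₁ B).comp r₁ hQ₁ hp₁ hp₂ E)
      (A.comp r₂ hQ₂ hp hp₂ (B.compInside S E))
      (eqToHom (C.comp_post (Nested.unary r r₂) F G H)) := by
  intro k U N hk s
  by_cases hkp : k = p
  · subst hkp
    obtain rfl := Option.some.inj (hk.symm.trans hp₂)
    rw [MultiLin.comp_lin_self, MultiLin.comp_lin_self, MultiLin.comp_lin_self]
    exact IsLin.assoc_inside_inside _ S _ _
      (Nested.of rfl r (Replaces.whole _ _) (r₂.trans s.back))
      (Nested.of rfl r (Replaces.whole _ _) r₂) _ B E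
  · have S₂ := Parallel.of_set hkp s r₁
    have S₁ := Parallel.of_set hkp S₂.right r
    have S₃ : Parallel ((N.set p (T.obj W)).set p (T.obj X)) k (J.obj U) [T.obj U] p (T.obj X)
        [T.obj V] k p N M M₂ := by
      have S₃ := Parallel.of_set hkp s r₂
      have e := S₃.right.source_unique S₁.right
      rwa [e] at S₃
    rw [MultiLin.comp_lin_ne _ _ _ _ _ _ _ _ hkp, MultiLin.comp_lin_ne _ _ _ _ _ _ _ _ hkp]
    have e : (A.comp r₂ hQ₂ hp hp₂ (B.compInside S E)).lin hk s = (A.lin (hQ₂ k U hkp hk)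
      S₃.right).compOther S₃ _ := A.comp_lin_ne_of r₂ hQ₂ hp hp₂ _ hk S₃
    rw [e]
    exact IsLin.assoc_other_other (Nested.unary S₁.left S₃.left) S₁ S₂ S₃ (Nested.unary r r₂) _ G H

/-- `(F ∘ H) ∘ G = (F ∘ G) ∘ H` is linear in the argument of `G`. -/
theorem comp_comp_aux (hpq : p ≠ q) (r : Replaces M p (T.obj X) [T.obj W] M₁)
    (r₁ : Replaces M₁ q (T.obj X') [T.obj V] M₃)
    (r' : Replaces M q (T.obj X') [T.obj V] M₂)
    (r₁' : Replaces M₂ p (T.obj X) [T.obj W] M₃)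
    (hQ : ∀ k Z, k ≠ p → Q₁ k = some Z → Q k = some Z) (hp : Q p = some X) (hp₁ : Q₁ p = some W)
    (hQ₁ : ∀ k Z, k ≠ q → Q₃ k = some Z → Q₁ k = some Z) (hq : Q₁ q = some X') (hq₁ : Q₃ q = some V)
    (hQ' : ∀ k Z, k ≠ q → Q₂ k = some Z → Q k = some Z) (hq' : Q q = some X') (hq₁' : Q₂ q = some V)
    (hQ₁' : ∀ k Z, k ≠ p → Q₃ k = some Z → Q₂ k = some Z) (hp' : Q₂ p = some X)
    (hp₁' : Q₃ p = some W)
    {F : C.Hom M (T.obj Y)} (A : T.MultiLin Q F) {G : C.Hom [T.obj W] (T.obj X)}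
    (B : T.LinStr r₀ G) {H : C.Hom [T.obj V] (T.obj X')} (E : T.LinStr t₀ H)
    (S : Parallel M p (T.obj X) [T.obj W] q (T.obj X') [T.obj V] p q M₂ M₁ M₃) {N : List C.Ob}
    (hk : Q₃ p = some W) (s : Replaces N p (J.obj W) [T.obj W] M₃) :
    T.IsLin (((A.comp r' hQ' hq' hq₁' E).comp r₁' hQ₁' hp' hp₁' B).lin hk s)
      (((A.comp r hQ hp hp₁ B).comp r₁ hQ₁ hq hq₁ E).lin hk s) (eqToHom (C.parallel S F G H)) := by
  have P₁ := Parallel.of_set hpq s r₁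
  have R := Nested.unary (r.trans P₁.right.back) r
  have R₁ := Nested.unary (r₁'.trans s.back) r₁'
  have P := Parallel.of_set hpq (r₁'.set_back (J.obj X)) r'
  rw [MultiLin.comp_lin_ne _ _ _ _ _ _ _ _ hpq]
  have e₁ : (A.comp r hQ hp hp₁ B).lin (hQ₁ p W hpq hk) P₁.right =
      (A.lin hp P.right).compInside R B := A.comp_lin_self_of r hQ hp hp₁ B _ R
  have e₂ : ((A.comp r' hQ' hq' hq₁' E).comp r₁' hQ₁' hp' hp₁' B).lin hk s =
      ((A.lin hp P.right).compOther P H).compInside R₁ B := by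
    refine ((A.comp r' hQ' hq' hq₁' E).comp_lin_self_of r₁' hQ₁' hp' hp₁' B P.left' R₁).trans ?_
    congr 1
    exact A.comp_lin_ne_of r' hQ' hq' hq₁' E _ P
  rw [e₁, e₂]
  exact IsLin.parallel_inside_other P R R₁ P₁
    ⟨hpq, S.hp, S.hq, r', R₁.out, R.out, P₁.left⟩ S (A.lin hp P.right) H B

/-- `(F ∘ H) ∘ G = (F ∘ G) ∘ H` is multilinear, for unary `G` and `H` in different arguments of `F`. -/
theorem comp_comp (hpq : p ≠ q) (r : Replaces M p (T.obj X) [T.obj W] M₁)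
    (r₁ : Replaces M₁ q (T.obj X') [T.obj V] M₃)
    (r' : Replaces M q (T.obj X') [T.obj V] M₂)
    (r₁' : Replaces M₂ p (T.obj X) [T.obj W] M₃)
    (hQ : ∀ k Z, k ≠ p → Q₁ k = some Z → Q k = some Z) (hp : Q p = some X) (hp₁ : Q₁ p = some W)
    (hQ₁ : ∀ k Z, k ≠ q → Q₃ k = some Z → Q₁ k = some Z) (hq : Q₁ q = some X') (hq₁ : Q₃ q = some V)
    (hQ' : ∀ k Z, k ≠ q → Q₂ k = some Z → Q k = some Z) (hq' : Q q = some X') (hq₁' : Q₂ q = some V)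
    (hQ₁' : ∀ k Z, k ≠ p → Q₃ k = some Z → Q₂ k = some Z) (hp' : Q₂ p = some X)
    (hp₁' : Q₃ p = some W)
    {F : C.Hom M (T.obj Y)} (A : T.MultiLin Q F) {G : C.Hom [T.obj W] (T.obj X)}
    (B : T.LinStr r₀ G) {H : C.Hom [T.obj V] (T.obj X')} (E : T.LinStr t₀ H)
    (S : Parallel M p (T.obj X) [T.obj W] q (T.obj X') [T.obj V] p q M₂ M₁ M₃) :
    IsMultiLin ((A.comp r' hQ' hq' hq₁' E).comp r₁' hQ₁' hp' hp₁' B)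
      ((A.comp r hQ hp hp₁ B).comp r₁ hQ₁ hq hq₁ E)
      (eqToHom (C.parallel S F G H)) := by
  intro k U N hk s
  by_cases hkp : k = p
  · subst hkp
    obtain rfl := Option.some.inj (hk.symm.trans hp₁')
    exact comp_comp_aux hpq r r₁ r' r₁' hQ hp hp₁ hQ₁ hq hq₁ hQ' hq' hq₁' hQ₁' hp' hp₁' A B E S hk s
  · by_cases hkq : k = q
    · subst hkq
      obtain rfl := Option.some.inj (hk.symm.trans hq₁)
      exact (comp_comp_aux hpq.symm r' r₁' r r₁ hQ' hq' hq₁' hQ₁' hp' hp₁' hQ hp hp₁ hQ₁ hq hq₁ A E B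
        S.symm hk s).eqToHom_symm
    · have P₁ := Parallel.of_set hkq s r₁
      have P₂ := Parallel.of_set hkp P₁.right r
      have P₁' := Parallel.of_set hkp s r₁'
      have P₂' : Parallel ((N.set q (T.obj X')).set p (T.obj X)) k (J.obj U) [T.obj U] q (T.obj X')
          [T.obj V] k q (N.set p (T.obj X)) M M₂ := by
        have P₂' := Parallel.of_set hkq P₁'.right r'
        have e := P₂'.right.source_unique P₂.right
        rwa [e] at P₂'
      have e : ((A.comp r' hQ' hq' hq₁' E).comp r₁' hQ₁' hp' hp₁' B).lin hk s =
          ((A.lin (hQ _ _ hkp (hQ₁ _ _ hkq hk)) P₂'.right).compOther P₂' H).compOther P₁' G := by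
        rw [MultiLin.comp_lin_ne _ _ _ _ _ _ _ _ hkp]
        congr 1
        exact A.comp_lin_ne_of r' hQ' hq' hq₁' E _ P₂'
      rw [e, MultiLin.comp_lin_ne _ _ _ _ _ _ _ _ hkq, MultiLin.comp_lin_ne _ _ _ _ _ _ _ _ hkp]
      exact IsLin.parallel_other_other ⟨hpq, S.hp, S.hq, P₂'.left, P₁'.left, P₂.left, P₁.left⟩
        P₂ P₁ P₂' P₁' S _ G H

/-- `IsMultiLin.comp_comp` for a position which is only propositionally the same. -/
theorem comp_comp' (hpq : p ≠ q) {q' : ℕ} (hqq : q' = q) (r : Replaces M p (T.obj X) [T.obj W] M₁)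
    (r₁ : Replaces M₁ q' (T.obj X') [T.obj V] M₃)
    (r' : Replaces M q (T.obj X') [T.obj V] M₂)
    (r₁' : Replaces M₂ p (T.obj X) [T.obj W] M₃)
    (hQ : ∀ k Z, k ≠ p → Q₁ k = some Z → Q k = some Z) (hp : Q p = some X) (hp₁ : Q₁ p = some W)
    (hQ₁ : ∀ k Z, k ≠ q' → Q₃ k = some Z → Q₁ k = some Z) (hq : Q₁ q' = some X')
    (hq₁ : Q₃ q' = some V)
    (hQ' : ∀ k Z, k ≠ q → Q₂ k = some Z → Q k = some Z) (hq' : Q q = some X') (hq₁' : Q₂ q = some V)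
    (hQ₁' : ∀ k Z, k ≠ p → Q₃ k = some Z → Q₂ k = some Z) (hp' : Q₂ p = some X)
    (hp₁' : Q₃ p = some W)
    {F : C.Hom M (T.obj Y)} (A : T.MultiLin Q F) {G : C.Hom [T.obj W] (T.obj X)}
    (B : T.LinStr r₀ G) {H : C.Hom [T.obj V] (T.obj X')} (E : T.LinStr t₀ H)
    (S : Parallel M p (T.obj X) [T.obj W] q (T.obj X') [T.obj V] p q' M₂ M₁ M₃) :
    IsMultiLin ((A.comp r' hQ' hq' hq₁' E).comp r₁' hQ₁' hp' hp₁' B)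
      ((A.comp r hQ hp hp₁ B).comp r₁ hQ₁ hq hq₁ E)
      (eqToHom (C.parallel S F G H)) := by
  subst hqq
  exact comp_comp hpq r r₁ r' r₁' hQ hp hp₁ hQ₁ hq hq₁ hQ' hq' hq₁' hQ₁' hp' hp₁' A B E S

end

end IsMultiLin

end StrongRelativePseudomonad

/-! ### Simultaneous composition of multilinear structures -/

namespace TwoMulticategory

variable (C : TwoMulticategory.{u, v, w})

theorem simultAux₂_id (n : ℕ) : ∀ (P : List C.Ob) {A B : Fin n → C.Ob} {M N : List C.Ob} {Z : C.Ob}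
    (hM : M = P ++ List.ofFn B) (hN : N = P ++ List.ofFn A) (F : C.Hom M Z)
    (g : ∀ k, C.Hom [A k] (B k)),
    C.simultAux₂ n P hM hN (𝟙 F) (fun k => 𝟙 (g k)) = 𝟙 (C.simultAux n P hM hN F g) := by
  induction n with
  | zero => intros; exact CategoryTheory.Functor.map_id _ _
  | succ n ih =>
    intro P A B M N Z hM hN F g
    rw [simultAux₂, C.comp₂_id]
    exact ih _ _ _ _ _

theorem simultAux₂_comp (n : ℕ) : ∀ (P : List C.Ob) {A B : Fin n → C.Ob} {M N : List C.Ob} {Z : C.Ob}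
    (hM : M = P ++ List.ofFn B) (hN : N = P ++ List.ofFn A) {F F' F'' : C.Hom M Z}
    {g g' g'' : ∀ k, C.Hom [A k] (B k)} (φ : F ⟶ F') (φ' : F' ⟶ F'') (β : ∀ k, g k ⟶ g' k)
    (β' : ∀ k, g' k ⟶ g'' k),
    C.simultAux₂ n P hM hN (φ ≫ φ') (fun k => β k ≫ β' k) =
      C.simultAux₂ n P hM hN φ β ≫ C.simultAux₂ n P hM hN φ' β' := by
  induction n with
  | zero => intros; exact CategoryTheory.Functor.map_comp _ _ _
  | succ n ih =>
    intros
    simp only [simultAux₂, C.comp₂_comp]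
    exact ih _ _ _ _ _ _ _

theorem simultAux₂_eqToHom (n : ℕ) (P : List C.Ob) {A B : Fin n → C.Ob} {M N : List C.Ob} {Z : C.Ob}
    (hM : M = P ++ List.ofFn B) (hN : N = P ++ List.ofFn A) {F F' : C.Hom M Z} (h : F = F')
    (g : ∀ k, C.Hom [A k] (B k)) :
    C.simultAux₂ n P hM hN (eqToHom h) (fun k => 𝟙 (g k)) = eqToHom (by rw [h]) := by
  subst h
  exact C.simultAux₂_id n P hM hN F g

end TwoMulticategory

namespace StrongRelativePseudomonad

variable {D : TwoMulticategory.{u, v, w}} {C : TwoMulticategory.{u', v', w'}}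
  {J : MultiFunctor D C} {T : StrongRelativePseudomonad J}

/-- The restriction of a multilinear structure to the arguments marked by `Q'`, for equal contexts. -/
def MultiLin.castCtx {Q Q' : ℕ → Option D.Ob} {M N : List C.Ob} {Y : D.Ob} {F : C.Hom M (T.obj Y)}
    (h : M = N) (hQ : ∀ k Z, k < N.length → Q' k = some Z → Q k = some Z) (A : T.MultiLin Q F) :
    T.MultiLin Q' ((C.castCtx h (T.obj Y)).obj F) where
  lin hk s := by
    subst h
    exact A.lin (hQ _ _ s.back.lt_length hk) s

theorem update_length_some {P : List C.Ob} {n : ℕ} {Q Q' : ℕ → Option D.Ob} {X : Fin (n + 1) → D.Ob}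
    {A : C.Ob} (hQ : ∀ k Z, k < P.length → Q' k = some Z → Q k = some Z)
    (hX : ∀ i : Fin (n + 1), Q' (P.length + i) = some (X i)) :
    ∀ k Z, k < (P ++ [A]).length → Q' k = some Z →
      Function.update Q P.length (some (X 0)) k = some Z := by
  intro k Z hk hZ
  by_cases h : k = P.length
  · subst h
    have := hX 0
    simp_all
  · rw [Function.update_of_ne h]
    exact hQ k Z (by simp at hk; omega) hZ

theorem update_length_ne {P : List C.Ob} {Q : ℕ → Option D.Ob} {X : D.Ob} :
    ∀ k Z, k ≠ P.length → Function.update Q P.length (some X) k = some Z → Q k = some Z := by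
  intro k Z h
  rw [Function.update_of_ne h]
  exact fun h => h

theorem update_length_succ {P : List C.Ob} {n : ℕ} {Q : ℕ → Option D.Ob} {X : Fin (n + 1) → D.Ob}
    {A : C.Ob} (hX : ∀ i : Fin (n + 1), Q (P.length + i) = some (X i)) (W : Option D.Ob) :
    ∀ i : Fin n, Function.update Q P.length W ((P ++ [A]).length + i) = some (X i.succ) := by
  intro i
  rw [Function.update_of_ne (by simp; omega), ← hX i.succ]
  simp [add_assoc, add_comm 1]

theorem marks_succ {P : List C.Ob} {n : ℕ} {Q : ℕ → Option D.Ob} {X : Fin (n + 1) → D.Ob}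
    {A : C.Ob} (hX : ∀ i : Fin (n + 1), Q (P.length + i) = some (X i)) :
    ∀ i : Fin n, Q ((P ++ [A]).length + i) = some (X i.succ) := by
  intro i
  rw [← hX i.succ]
  simp [add_assoc, add_comm 1]

/-- The multilinear structure of `F ∘ (g₁, …, gₙ)` for linear unary 1-cells `gₖ`. -/
def MultiLin.simultAux : ∀ (n : ℕ) (P : List C.Ob) {X X' : Fin n → D.Ob} {M N : List C.Ob} {Y : D.Ob}
    (hM : M = P ++ List.ofFn fun k => T.obj (X' k)) (hN : N = P ++ List.ofFn fun k => T.obj (X k))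
    {Q Q' : ℕ → Option D.Ob} (_ : ∀ k Z, k < P.length → Q' k = some Z → Q k = some Z)
    (_ : ∀ i : Fin n, Q (P.length + i) = some (X' i))
    (_ : ∀ i : Fin n, Q' (P.length + i) = some (X i)) {F : C.Hom M (T.obj Y)} (_ : T.MultiLin Q F)
    {g : ∀ k, C.Hom [T.obj (X k)] (T.obj (X' k))}
    (_ : ∀ k, T.LinStr (Replaces.whole (J.obj (X k)) [T.obj (X k)]) (g k)),
    T.MultiLin Q' (C.simultAux n P hM hN F g)
  | 0, P, _, _, _, _, _, hM, hN, _, _, hQ, _, _, _, A, _, _ =>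
    A.castCtx (hM.trans (by simpa using hN.symm)) fun k Z hk => hQ k Z (by rw [hN] at hk; simpa using hk)
  | n + 1, P, X, X', M, N, Y, hM, hN, Q, Q', hQ, hX', hX, F, A, g, B =>
    simultAux n (P ++ [T.obj (X 0)]) (X := fun k => X k.succ) (X' := fun k => X' k.succ)
      (M := P ++ T.obj (X 0) :: List.ofFn fun k => T.obj (X' k.succ)) (by simp)
      (by simpa [List.ofFn_succ] using hN) (Q := Function.update Q P.length (some (X 0)))
      (update_length_some hQ hX) (update_length_succ hX' _) (marks_succ hX)
      (A.comp _ update_length_ne (hX' 0) (Function.update_self ..) (B 0)) fun k => B k.succ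

theorem MultiLin.IsComm.simultAux (γ : T.Pseudocommutativity) (n : ℕ) : ∀ (P : List C.Ob)
    {X X' : Fin n → D.Ob} {M N : List C.Ob} {Y : D.Ob}
    (hM : M = P ++ List.ofFn fun k => T.obj (X' k)) (hN : N = P ++ List.ofFn fun k => T.obj (X k))
    {Q Q' : ℕ → Option D.Ob} (hQ : ∀ k Z, k < P.length → Q' k = some Z → Q k = some Z)
    (hX' : ∀ i : Fin n, Q (P.length + i) = some (X' i))
    (hX : ∀ i : Fin n, Q' (P.length + i) = some (X i)) {F : C.Hom M (T.obj Y)} {A : T.MultiLin Q F}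
    (_ : A.IsComm γ) {g : ∀ k, C.Hom [T.obj (X k)] (T.obj (X' k))}
    (B : ∀ k, T.LinStr (Replaces.whole (J.obj (X k)) [T.obj (X k)]) (g k)),
    (MultiLin.simultAux n P hM hN hQ hX' hX A B).IsComm γ := by
  induction n with
  | zero =>
    intro P X X' M N Y hM hN Q Q' hQ hX' hX F A h g B
    obtain rfl : M = N := hM.trans (by simpa using hN.symm)
    exact fun _ _ _ _ _ _ _ hj hk S hjk => h _ _ S hjk
  | succ n ih =>
    intro P X X' M N Y hM hN Q Q' hQ hX' hX F A h g B
    exact ih _ _ _ _ _ _ (h.comp _ _ _ _ γ _) _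

namespace IsMultiLin

theorem simultAux₂ (n : ℕ) : ∀ (P : List C.Ob)
    {X X' : Fin n → D.Ob} {M N : List C.Ob} {Y : D.Ob}
    (hM : M = P ++ List.ofFn fun k => T.obj (X' k)) (hN : N = P ++ List.ofFn fun k => T.obj (X k))
    {Q Q' : ℕ → Option D.Ob} (hQ : ∀ k Z, k < P.length → Q' k = some Z → Q k = some Z)
    (hX' : ∀ i : Fin n, Q (P.length + i) = some (X' i))
    (hX : ∀ i : Fin n, Q' (P.length + i) = some (X i)) {F F' : C.Hom M (T.obj Y)}
    {A : T.MultiLin Q F} {A' : T.MultiLin Q F'} {φ : F ⟶ F'} (_ : IsMultiLin A A' φ)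
    {g g' : ∀ k, C.Hom [T.obj (X k)] (T.obj (X' k))}
    {B : ∀ k, T.LinStr (Replaces.whole (J.obj (X k)) [T.obj (X k)]) (g k)}
    {B' : ∀ k, T.LinStr (Replaces.whole (J.obj (X k)) [T.obj (X k)]) (g' k)}
    {β : ∀ k, g k ⟶ g' k} (_ : ∀ k, T.IsLin (B k) (B' k) (β k)),
    IsMultiLin (MultiLin.simultAux n P hM hN hQ hX' hX A B)
      (MultiLin.simultAux n P hM hN hQ hX' hX A' B') (C.simultAux₂ n P hM hN φ β) := by
  induction n with
  | zero =>
    intro P X X' M N Y hM hN Q Q' hQ hX' hX F F' A A' φ h g g' B B' β h'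
    obtain rfl : M = N := hM.trans (by simpa using hN.symm)
    exact fun _ _ _ hk s => h _ s
  | succ n ih =>
    intro P X X' M N Y hM hN Q Q' hQ hX' hX F F' A A' φ h g g' B B' β h'
    exact ih _ _ _ _ _ _ (h.comp₂ _ _ _ _ (h' 0)) fun k => h' k.succ

theorem simultAux_eqToHom (n : ℕ) (P : List C.Ob)
    {X X' : Fin n → D.Ob} {M N : List C.Ob} {Y : D.Ob}
    (hM : M = P ++ List.ofFn fun k => T.obj (X' k)) (hN : N = P ++ List.ofFn fun k => T.obj (X k))
    {Q Q' : ℕ → Option D.Ob} (hQ : ∀ k Z, k < P.length → Q' k = some Z → Q k = some Z)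
    (hX' : ∀ i : Fin n, Q (P.length + i) = some (X' i))
    (hX : ∀ i : Fin n, Q' (P.length + i) = some (X i)) {F F' : C.Hom M (T.obj Y)}
    {A : T.MultiLin Q F} {A' : T.MultiLin Q F'} {e : F = F'} (h : IsMultiLin A A' (eqToHom e))
    {g : ∀ k, C.Hom [T.obj (X k)] (T.obj (X' k))}
    (B : ∀ k, T.LinStr (Replaces.whole (J.obj (X k)) [T.obj (X k)]) (g k)) :
    IsMultiLin (MultiLin.simultAux n P hM hN hQ hX' hX A B)
      (MultiLin.simultAux n P hM hN hQ hX' hX A' B) (eqToHom (by rw [e])) := by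
  have h₂ := simultAux₂ n P hM hN hQ hX' hX h fun k => IsLin.id (B k)
  rwa [C.simultAux₂_eqToHom] at h₂

theorem post_simultAux (n : ℕ) : ∀ (P : List C.Ob)
    {X X' : Fin n → D.Ob} {M N : List C.Ob} {Y Z : D.Ob}
    {s₀ : Replaces [J.obj Y] 0 (J.obj Y) [T.obj Y] [T.obj Y]}
    (hM : M = P ++ List.ofFn fun k => T.obj (X' k)) (hN : N = P ++ List.ofFn fun k => T.obj (X k))
    {Q Q' : ℕ → Option D.Ob} (hQ : ∀ k Z, k < P.length → Q' k = some Z → Q k = some Z)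
    (hX' : ∀ i : Fin n, Q (P.length + i) = some (X' i))
    (hX : ∀ i : Fin n, Q' (P.length + i) = some (X i)) {H : C.Hom [T.obj Y] (T.obj Z)}
    (E : T.LinStr s₀ H) {F : C.Hom M (T.obj Y)} (A : T.MultiLin Q F)
    {g : ∀ k, C.Hom [T.obj (X k)] (T.obj (X' k))}
    (B : ∀ k, T.LinStr (Replaces.whole (J.obj (X k)) [T.obj (X k)]) (g k)),
    IsMultiLin ((MultiLin.simultAux n P hM hN hQ hX' hX A B).post E)
      (MultiLin.simultAux n P hM hN hQ hX' hX (A.post E) B)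
      (eqToHom (C.post_simultAux n P hM hN H F g)) := by
  induction n with
  | zero =>
    intro P X X' M N Y Z s₀ hM hN Q Q' hQ hX' hX H E F A g B
    obtain rfl : M = N := hM.trans (by simpa using hN.symm)
    exact fun _ _ _ hk s => IsLin.id _
  | succ n ih =>
    intro P X X' M N Y Z s₀ hM hN Q Q' hQ hX' hX H E F A g B
    have h₁ := ih (P ++ [T.obj (X 0)]) (X := fun k => X k.succ) (X' := fun k => X' k.succ)
      (M := P ++ T.obj (X 0) :: List.ofFn fun k => T.obj (X' k.succ)) (N := N) (by simp)
      (by simpa [List.ofFn_succ] using hN) (Q := Function.update Q P.length (some (X 0)))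
      (update_length_some hQ hX) (update_length_succ hX' _) (marks_succ hX) E
      (A.comp (Replaces.mid P _ [T.obj (X 0)] (List.ofFn fun k => T.obj (X' k.succ))
        (by simpa [List.ofFn_succ] using hM) (by simp)) update_length_ne (hX' 0)
        (Function.update_self ..) (B 0)) fun k => B k.succ
    have r : Replaces M P.length (T.obj (X' 0)) [T.obj (X 0)]
        (P ++ T.obj (X 0) :: List.ofFn fun k => T.obj (X' k.succ)) :=
      Replaces.mid P _ [T.obj (X 0)] (List.ofFn fun k => T.obj (X' k.succ))
        (by simpa [List.ofFn_succ] using hM) (by simp)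
    have h₂ := simultAux_eqToHom n (P ++ [T.obj (X 0)]) (X := fun k => X k.succ) (X' := fun k => X' k.succ)
      (M := P ++ T.obj (X 0) :: List.ofFn fun k => T.obj (X' k.succ)) (N := N) (by simp)
      (by simpa [List.ofFn_succ] using hN) (Q := Function.update Q P.length (some (X 0)))
      (update_length_some hQ hX) (update_length_succ hX' _) (marks_succ hX)
      (post_comp r update_length_ne (hX' 0) (Function.update_self ..) E A (B 0))
      (fun k => B k.succ)
    exact h₁.eqToHom_trans h₂

end IsMultiLin

end StrongRelativePseudomonad

namespace StrongRelativePseudomonad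

variable {D : TwoMulticategory.{u, v, w}} {C : TwoMulticategory.{u', v', w'}}
  {J : MultiFunctor D C} {T : StrongRelativePseudomonad J}

/-! ### Multilinearity of the associativities and unities of simultaneous composition -/

namespace IsMultiLin

theorem comp_simultAux (n : ℕ) : ∀ (P P' : List C.Ob) {p : ℕ} {V W : D.Ob}
    (_ : Replaces P p (T.obj V) [T.obj W] P')
    {X X' : Fin n → D.Ob} {M N M' N' : List C.Ob} {Y : D.Ob}
    (hM : M = P ++ List.ofFn fun k => T.obj (X' k)) (hN : N = P ++ List.ofFn fun k => T.obj (X k))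
    (hM' : M' = P' ++ List.ofFn fun k => T.obj (X' k))
    (hN' : N' = P' ++ List.ofFn fun k => T.obj (X k))
    (s : Replaces N p (T.obj V) [T.obj W] N') (s' : Replaces M p (T.obj V) [T.obj W] M')
    {Q Q₁ Q₁' Q₂ : ℕ → Option D.Ob} (hQ : ∀ k Z, k < P.length → Q₁ k = some Z → Q k = some Z)
    (hX' : ∀ i : Fin n, Q (P.length + i) = some (X' i))
    (hX : ∀ i : Fin n, Q₁ (P.length + i) = some (X i))
    (hQ₁ : ∀ k Z, k ≠ p → Q₂ k = some Z → Q₁ k = some Z) (hp : Q₁ p = some V) (hp' : Q₂ p = some W)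
    (hQ' : ∀ k Z, k ≠ p → Q₁' k = some Z → Q k = some Z) (hq : Q p = some V) (hq' : Q₁' p = some W)
    (hQ₁' : ∀ k Z, k < P'.length → Q₂ k = some Z → Q₁' k = some Z)
    (hY' : ∀ i : Fin n, Q₁' (P'.length + i) = some (X' i))
    (hY : ∀ i : Fin n, Q₂ (P'.length + i) = some (X i)) {F : C.Hom M (T.obj Y)} (A : T.MultiLin Q F)
    {r₀ : Replaces [J.obj W] 0 (J.obj W) [T.obj W] [T.obj W]} {a : C.Hom [T.obj W] (T.obj V)}
    (E : T.LinStr r₀ a) {g : ∀ k, C.Hom [T.obj (X k)] (T.obj (X' k))}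
    (B : ∀ k, T.LinStr (Replaces.whole (J.obj (X k)) [T.obj (X k)]) (g k)),
    ∃ e, IsMultiLin ((MultiLin.simultAux n P hM hN hQ hX' hX A B).comp s hQ₁ hp hp' E)
      (MultiLin.simultAux n P' hM' hN' hQ₁' hY' hY (A.comp s' hQ' hq hq' E) B) (eqToHom e) := by
  induction n with
  | zero =>
    intro P P' p V W hP X X' M N M' N' Y hM hN hM' hN' s s' Q Q₁ Q₁' Q₂ hQ hX' hX hQ₁ hp hp' hQ' hq hq'
      hQ₁' hY' hY F A r₀ a E g B
    obtain rfl : M = N := hM.trans (by simpa using hN.symm)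
    obtain rfl : M' = N' := hM'.trans (by simpa using hN'.symm)
    refine ⟨rfl, fun k Z L hk t => ?_⟩
    change T.IsLin _ ((A.comp s' hQ' hq hq' E).lin (hQ₁' _ _ (by simpa [hM'] using t.back.lt_length) hk) t) (𝟙 _)
    by_cases hkp : k = p
    · subst hkp
      obtain rfl := Option.some.inj (hk.symm.trans hp')
      rw [MultiLin.comp_lin_self, MultiLin.comp_lin_self]
      exact IsLin.id _
    · rw [MultiLin.comp_lin_ne _ _ _ _ _ _ _ _ hkp, MultiLin.comp_lin_ne _ _ _ _ _ _ _ _ hkp]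
      exact IsLin.id _
  | succ n ih =>
    intro P P' p V W hP X X' M N M' N' Y hM hN hM' hN' s s' Q Q₁ Q₁' Q₂ hQ hX' hX hQ₁ hp hp' hQ' hq hq'
      hQ₁' hY' hY F A r₀ a E g B
    have hl : P'.length = P.length := hP.length_eq
    have hpl : p < P.length := hP.lt_length
    have r : Replaces M P.length (T.obj (X' 0)) [T.obj (X 0)]
        (P ++ T.obj (X 0) :: List.ofFn fun k => T.obj (X' k.succ)) :=
      Replaces.mid P _ [T.obj (X 0)] (List.ofFn fun k => T.obj (X' k.succ))
        (by simpa [List.ofFn_succ] using hM) (by simp)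
    have r' : Replaces M' P'.length (T.obj (X' 0)) [T.obj (X 0)]
        (P' ++ T.obj (X 0) :: List.ofFn fun k => T.obj (X' k.succ)) :=
      Replaces.mid P' _ [T.obj (X 0)] (List.ofFn fun k => T.obj (X' k.succ))
        (by simpa [List.ofFn_succ] using hM') (by simp)
    have t : Replaces (P ++ T.obj (X 0) :: List.ofFn fun k => T.obj (X' k.succ)) p (T.obj V)
        [T.obj W] (P' ++ T.obj (X 0) :: List.ofFn fun k => T.obj (X' k.succ)) :=
      hP.append_right _
    have c : ∀ k Z, k ≠ p → Function.update Q₁' P'.length (some (X 0)) k = some Z →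
        Function.update Q P.length (some (X 0)) k = some Z := by
      intro k Z hk
      rw [hl, Function.update_apply, Function.update_apply]
      split_ifs
      · exact fun h => h
      · exact hQ' k Z hk
    have c₁ : Function.update Q P.length (some (X 0)) p = some V := by
      rw [Function.update_of_ne (by omega), hq]
    have c₂ : Function.update Q₁' P'.length (some (X 0)) p = some W := by
      rw [Function.update_of_ne (by omega), hq']
    obtain ⟨e, h₁⟩ := ih (P ++ [T.obj (X 0)]) (P' ++ [T.obj (X 0)]) (hP.append_right _)
      (X := fun k => X k.succ) (X' := fun k => X' k.succ)
      (M := P ++ T.obj (X 0) :: List.ofFn fun k => T.obj (X' k.succ)) (N := N)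
      (M' := P' ++ T.obj (X 0) :: List.ofFn fun k => T.obj (X' k.succ)) (N' := N') (by simp)
      (by simpa [List.ofFn_succ] using hN) (by simp) (by simpa [List.ofFn_succ] using hN') s t
      (Q := Function.update Q P.length (some (X 0)))
      (Q₁' := Function.update Q₁' P'.length (some (X 0)))
      (update_length_some hQ hX) (update_length_succ hX' _) (marks_succ hX) hQ₁ hp hp' c c₁ c₂
      (update_length_some hQ₁' hY) (update_length_succ hY' _) (marks_succ hY)
      (A.comp r update_length_ne (hX' 0) (Function.update_self ..) (B 0)) E fun k => B k.succ
    have S : Parallel M p (T.obj V) [T.obj W] P.length (T.obj (X' 0)) [T.obj (X 0)] p P'.length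
        (P ++ T.obj (X 0) :: List.ofFn fun k => T.obj (X' k.succ)) M'
        (P' ++ T.obj (X 0) :: List.ofFn fun k => T.obj (X' k.succ)) :=
      ⟨by omega, by simp [shift], by simp [shift, hl], r, t, s', r'⟩
    have h₂ := simultAux_eqToHom n (P' ++ [T.obj (X 0)]) (X := fun k => X k.succ) (X' := fun k => X' k.succ)
      (M := P' ++ T.obj (X 0) :: List.ofFn fun k => T.obj (X' k.succ)) (N := N') (by simp)
      (by simpa [List.ofFn_succ] using hN') (Q := Function.update Q₁' P'.length (some (X 0)))
      (update_length_some hQ₁' hY) (update_length_succ hY' _) (marks_succ hY)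
      (comp_comp' (by omega) hl s' r' r t hQ' hq hq' update_length_ne (hY' 0)
        (Function.update_self ..) update_length_ne (hX' 0) (Function.update_self ..) c c₁ c₂ A E
        (B 0) S)
      (fun k => B k.succ)
    exact ⟨_, h₁.eqToHom_trans h₂⟩

theorem simultAux_simultAux (n : ℕ) : ∀ (P : List C.Ob) {X X' X'' : Fin n → D.Ob}
    {M N R : List C.Ob} {Y : D.Ob} (hM : M = P ++ List.ofFn fun k => T.obj (X'' k))
    (hN : N = P ++ List.ofFn fun k => T.obj (X' k)) (hR : R = P ++ List.ofFn fun k => T.obj (X k))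
    {Q Q' Q'' : ℕ → Option D.Ob} (hQ : ∀ k Z, k < P.length → Q' k = some Z → Q'' k = some Z)
    (hQ' : ∀ k Z, k < P.length → Q k = some Z → Q' k = some Z)
    (hQ'' : ∀ k Z, k < P.length → Q k = some Z → Q'' k = some Z)
    (hX'' : ∀ i : Fin n, Q'' (P.length + i) = some (X'' i))
    (hX' : ∀ i : Fin n, Q' (P.length + i) = some (X' i))
    (hX : ∀ i : Fin n, Q (P.length + i) = some (X i)) {F : C.Hom M (T.obj Y)} (A : T.MultiLin Q'' F)
    {g' : ∀ k, C.Hom [T.obj (X' k)] (T.obj (X'' k))}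
    (B' : ∀ k, T.LinStr (Replaces.whole (J.obj (X' k)) [T.obj (X' k)]) (g' k))
    {g : ∀ k, C.Hom [T.obj (X k)] (T.obj (X' k))}
    (B : ∀ k, T.LinStr (Replaces.whole (J.obj (X k)) [T.obj (X k)]) (g k)),
    IsMultiLin (MultiLin.simultAux n P hN hR hQ' hX' hX (MultiLin.simultAux n P hM hN hQ hX'' hX' A B') B)
      (MultiLin.simultAux n P hM hR hQ'' hX'' hX A
        fun k => (B' k).compInside (nested_unary _ _ _) (B k))
      (eqToHom (C.simultAux_simultAux n P hM hN hR F g' g)) := by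
  induction n with
  | zero =>
    intro P X X' X'' M N R Y hM hN hR Q Q' Q'' hQ hQ' hQ'' hX'' hX' hX F A g' B' g B
    obtain rfl : M = N := hM.trans (by simpa using hN.symm)
    obtain rfl : M = R := hM.trans (by simpa using hR.symm)
    exact fun _ _ _ hk s => IsLin.id _
  | succ n ih =>
    intro P X X' X'' M N R Y hM hN hR Q Q' Q'' hQ hQ' hQ'' hX'' hX' hX F A g' B' g B
    have t : Replaces M P.length (T.obj (X'' 0)) [T.obj (X' 0)]
        (P ++ T.obj (X' 0) :: List.ofFn fun k => T.obj (X'' k.succ)) :=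
      Replaces.mid _ _ _ _ (by simpa [List.ofFn_succ] using hM) (by simp)
    have t₁ : Replaces N P.length (T.obj (X' 0)) [T.obj (X 0)]
        (P ++ T.obj (X 0) :: List.ofFn fun k => T.obj (X' k.succ)) :=
      Replaces.mid _ _ _ _ (by simpa [List.ofFn_succ] using hN) (by simp)
    have t' : Replaces (P ++ T.obj (X' 0) :: List.ofFn fun k => T.obj (X'' k.succ)) P.length
        (T.obj (X' 0)) [T.obj (X 0)] (P ++ T.obj (X 0) :: List.ofFn fun k => T.obj (X'' k.succ)) :=
      Replaces.mid _ _ _ _ rfl (by simp)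
    have t'' : Replaces M P.length (T.obj (X'' 0)) [T.obj (X 0)]
        (P ++ T.obj (X 0) :: List.ofFn fun k => T.obj (X'' k.succ)) :=
      Replaces.mid _ _ _ _ (by simpa [List.ofFn_succ] using hM) (by simp)
    have l : (P ++ [T.obj (X' 0)]).length = (P ++ [T.obj (X 0)]).length := by simp
    obtain ⟨e, h₁⟩ := comp_simultAux n (P ++ [T.obj (X' 0)]) (P ++ [T.obj (X 0)])
      (p := P.length) (Replaces.mid P _ _ [] rfl (by simp)) (X := fun k => X' k.succ)
      (X' := fun k => X'' k.succ)
      (M := P ++ T.obj (X' 0) :: List.ofFn fun k => T.obj (X'' k.succ)) (N := N)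
      (M' := P ++ T.obj (X 0) :: List.ofFn fun k => T.obj (X'' k.succ))
      (N' := P ++ T.obj (X 0) :: List.ofFn fun k => T.obj (X' k.succ)) (by simp)
      (by simpa [List.ofFn_succ] using hN) (by simp) (by simp) t₁ t'
      (Q := Function.update Q'' P.length (some (X' 0))) (Q₁ := Q')
      (Q₁' := Function.update Q'' P.length (some (X 0)))
      (Q₂ := Function.update Q' P.length (some (X 0)))
      (update_length_some hQ hX') (update_length_succ hX'' _) (marks_succ hX')
      update_length_ne (hX' 0) (Function.update_self ..)
      (fun k Z hk h => by
        rw [Function.update_of_ne hk] at h ⊢; exact h)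
      (Function.update_self ..) (Function.update_self ..)
      (fun k Z hk h => by
        by_cases hkp : k = P.length
        · subst hkp; rw [Function.update_self] at h ⊢; exact h
        · rw [Function.update_of_ne hkp] at h ⊢
          exact hQ k Z (by simp at hk; omega) h)
      (update_length_succ hX'' _) (update_length_succ hX' _)
      (A.comp t update_length_ne (hX'' 0) (Function.update_self ..) (B' 0)) (B 0)
      fun k => B' k.succ
    have hM₁ : P ++ T.obj (X 0) :: List.ofFn (fun k => T.obj (X'' k.succ)) =
        (P ++ [T.obj (X 0)]) ++ List.ofFn fun k => T.obj (X'' k.succ) := by simp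
    have hN₁ : P ++ T.obj (X 0) :: List.ofFn (fun k => T.obj (X' k.succ)) =
        (P ++ [T.obj (X 0)]) ++ List.ofFn fun k => T.obj (X' k.succ) := by simp
    have hR₁ : R = (P ++ [T.obj (X 0)]) ++ List.ofFn fun k => T.obj (X k.succ) := by
      simpa [List.ofFn_succ] using hR
    have c : ∀ k Z, k < (P ++ [T.obj (X 0)]).length →
        Function.update Q' P.length (some (X 0)) k = some Z →
        Function.update Q'' P.length (some (X 0)) k = some Z := by
      intro k Z hk h
      by_cases hkp : k = P.length
      · subst hkp; rw [Function.update_self] at h ⊢; exact h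
      · rw [Function.update_of_ne hkp] at h ⊢
        exact hQ k Z (by simp at hk; omega) h
    have h₂ := simultAux_eqToHom n (P ++ [T.obj (X 0)]) hN₁ hR₁ (update_length_some hQ' hX)
      (update_length_succ hX' _) (marks_succ hX) h₁ (fun k => B k.succ)
    have h₃ := ih (P ++ [T.obj (X 0)]) hM₁ hN₁ hR₁ c
      (update_length_some hQ' hX) (update_length_some hQ'' hX) (update_length_succ hX'' _)
      (update_length_succ hX' _) (marks_succ hX)
      ((A.comp t update_length_ne (hX'' 0) (Function.update_self ..) (B' 0)).comp t'
        (Q' := Function.update Q'' P.length (some (X 0)))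
        (fun k Z hk h => by rw [Function.update_of_ne hk] at h ⊢; exact h)
        (Function.update_self ..) (Function.update_self ..) (B 0))
      (fun k => B' k.succ) (fun k => B k.succ)
    have h₄ := simultAux_eqToHom n (P ++ [T.obj (X 0)]) hM₁ hR₁ (update_length_some hQ'' hX)
      (update_length_succ hX'' _) (marks_succ hX)
      (comp_post t t' t'' update_length_ne (hX'' 0) (Function.update_self ..)
        (fun k Z hk h => by rw [Function.update_of_ne hk] at h ⊢; exact h) (Function.update_self ..)
        update_length_ne A (B' 0) (B 0) (nested_unary _ _ _))
      (fun k => (B' k.succ).compInside (nested_unary _ _ _) (B k.succ))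
    exact (h₂.eqToHom_trans h₃).eqToHom_trans h₄

theorem simultAux_one (n : ℕ) : ∀ (P : List C.Ob) {X : Fin n → D.Ob} {M : List C.Ob} {Y : D.Ob}
    (hM : M = P ++ List.ofFn fun k => T.obj (X k))
    {Q Q' : ℕ → Option D.Ob} (hQ : ∀ k Z, k < P.length → Q' k = some Z → Q k = some Z)
    (hX : ∀ i : Fin n, Q (P.length + i) = some (X i))
    (hX' : ∀ i : Fin n, Q' (P.length + i) = some (X i))
    (hQ' : ∀ k Z, Q' k = some Z → Q k = some Z) {F : C.Hom M (T.obj Y)} (A : T.MultiLin Q F),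
    IsMultiLin (MultiLin.simultAux n P hM hM hQ hX hX' A fun k => LinStr.one (X k) _)
      (A.restrict hQ') (eqToHom (C.simultAux_one n P hM hM F)) := by
  induction n with
  | zero =>
    intro P X M Y hM Q Q' hQ hX hX' hQ' F A
    exact fun _ _ _ hk s => IsLin.id _
  | succ n ih =>
    intro P X M Y hM Q Q' hQ hX hX' hQ' F A
    obtain rfl : M = P ++ T.obj (X 0) :: List.ofFn fun k => T.obj (X k.succ) := by
      simpa [List.ofFn_succ] using hM
    have hM₁ : P ++ T.obj (X 0) :: List.ofFn (fun k => T.obj (X k.succ)) =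
        (P ++ [T.obj (X 0)]) ++ List.ofFn fun k => T.obj (X k.succ) := by simp
    have hX₀ : Q P.length = some (X 0) := hX 0
    have r : Replaces (P ++ T.obj (X 0) :: List.ofFn fun k => T.obj (X k.succ)) P.length
        (T.obj (X 0)) [T.obj (X 0)] (P ++ T.obj (X 0) :: List.ofFn fun k => T.obj (X k.succ)) :=
      Replaces.mid _ _ _ _ rfl (by simp)
    have c : Function.update Q P.length (some (X 0)) = Q := by
      rw [← hX₀, Function.update_eq_self]
    have h₁ := simultAux_eqToHom n (P ++ [T.obj (X 0)]) hM₁ hM₁ (update_length_some hQ hX')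
      (update_length_succ hX _) (marks_succ hX')
      (comp_one (t₀ := Replaces.whole _ _) update_length_ne (hX 0) (Function.update_self ..)
        (fun k Z h => by rwa [c] at h) r A)
      (fun k => LinStr.one (X k.succ) (Replaces.whole _ _))
    exact h₁.eqToHom_trans (ih (P ++ [T.obj (X 0)]) hM₁ (update_length_some hQ hX')
      (update_length_succ hX _) (marks_succ hX') (fun k Z h => by rw [c]; exact hQ' k Z h)
      (A.restrict fun k Z h => by rwa [c] at h))

end IsMultiLin

end StrongRelativePseudomonad

/-! ### The universal property of strengthening -/

namespace TwoMulticategory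

/-- `- ∘ g` as a functor. -/
def compRight (C : TwoMulticategory.{u, v, w}) {L Ξ M : List C.Ob} {k : ℕ} {X : C.Ob}
    (s : Replaces L k X Ξ M) (Y : C.Ob) (g : C.Hom Ξ X) : C.Hom L Y ⥤ C.Hom M Y where
  obj f := C.comp s f g
  map α := C.comp₂ s α (𝟙 g)
  map_id f := C.comp₂_id s f g
  map_comp α β := C.comp₂_comp_id s α β g

end TwoMulticategory

namespace StrongRelativePseudomonad

variable {D : TwoMulticategory.{u, v, w}} {C : TwoMulticategory.{u', v', w'}}
  {J : MultiFunctor D C}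

section

variable (T : StrongRelativePseudomonad J)

/-- Composition with the units `i_{X₁}, …, i_{Xₙ}` in the arguments which follow `P`. -/
def evAux (Y : D.Ob) : ∀ (P : List C.Ob) (L : List D.Ob) {M N : List C.Ob},
    M = P ++ L.map J.obj → N = P ++ L.map T.obj → (C.Hom N (T.obj Y) ⥤ C.Hom M (T.obj Y))
  | _, [], _, _, hM, hN => C.castCtx (hN.trans hM.symm) (T.obj Y)
  | P, X :: L, _, _, hM, hN =>
    evAux Y (P ++ [T.obj X]) L rfl (hN.trans (by simp)) ⋙
      C.compRight (Replaces.mid P (J.obj X) [T.obj X] (L.map J.obj) hM rfl).back (T.obj Y)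
        (T.unit X)

/-- The 2-cell `f ≅ f^{t₁ ⋯ tₙ} ∘ (i, …, i)`. -/
def unitAux (Y : D.Ob) : ∀ (P : List C.Ob) (L : List D.Ob) {M N : List C.Ob}
    (hM : M = P ++ L.map J.obj) (hN : N = P ++ L.map T.obj) (f : C.Hom M (T.obj Y)),
    f ≅ (T.evAux Y P L hM hN).obj ((T.strAux Y P L hM hN).obj f)
  | _, [], _, _, hM, hN, f => eqToIso (by subst hM; subst hN; rfl)
  | P, X :: L, _, _, hM, hN, f =>
    T.unitCell (Replaces.mid P (J.obj X) [T.obj X] (L.map J.obj) hM rfl)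
        (Replaces.mid P (J.obj X) [T.obj X] (L.map J.obj) hM rfl).back f ≪≫
      (C.compRight (Replaces.mid P (J.obj X) [T.obj X] (L.map J.obj) hM rfl).back (T.obj Y)
        (T.unit X)).mapIso (unitAux Y (P ++ [T.obj X]) L rfl (hN.trans (by simp)) _)

end

variable {T : StrongRelativePseudomonad J}

/-- The linear structures of `MultiLin.compOther`, with the contexts, which are determined by the
others, given independently. -/
theorem MultiLin.compOther_lin_of {Q Q' : ℕ → Option D.Ob} {p : ℕ} {M M' : List C.Ob} {Y : D.Ob}
    {B B' : C.Ob} (r : Replaces M p B [B'] M')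
    (hQ : ∀ k Z, Q' k = some Z → k ≠ p ∧ Q k = some Z) {F : C.Hom M (T.obj Y)} (A : T.MultiLin Q F)
    (b : C.Hom [B'] B) {k : ℕ} {Z : D.Ob} {N N₀ : List C.Ob} (hk : Q' k = some Z)
    (S : Parallel N₀ k (J.obj Z) [T.obj Z] p B [B'] k p N M M') :
    (A.compOther r hQ b).lin hk S.left' = (A.lin (hQ k Z hk).2 S.right).compOther S b := by
  obtain rfl := S.right.source_unique (Parallel.of_set S.ne S.left' r).right
  rfl

/-- The marks given by a list of objects. -/
abbrev marks (R : List D.Ob) : ℕ → Option D.Ob := fun k => R[k]?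

theorem marks_append_ne {R : List D.Ob} {P : List C.Ob} (hR : R.length = P.length) {X : D.Ob} :
    ∀ k Z, k ≠ P.length → marks (R ++ [X]) k = some Z → k < P.length ∧ marks R k = some Z := by
  intro k Z hk h
  grind

theorem marks_append_self {R : List D.Ob} {P : List C.Ob} (hR : R.length = P.length) {X : D.Ob} :
    marks (R ++ [X]) P.length = some X := by
  grind

theorem ne_marks_append {R : List D.Ob} {P : List C.Ob} (hR : R.length = P.length) {X : D.Ob} :
    ∀ k Z, marks R k = some Z → k ≠ P.length ∧ marks (R ++ [X]) k = some Z := by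
  intro k Z h
  grind

/-- The multilinear structure of `f^{t₁ ⋯ tₙ}`. -/
def MultiLin.strAux (γ : T.Pseudocommutativity) {Y : D.Ob} : ∀ (P : List C.Ob) (L : List D.Ob)
    {M N : List C.Ob} (hM : M = P ++ L.map J.obj) (hN : N = P ++ L.map T.obj) {R R' : List D.Ob}
    (_ : R.length = P.length) (_ : R' = R ++ L) {f : C.Hom M (T.obj Y)}
    (_ : T.MultiLin (marks R) f), T.MultiLin (marks R') ((T.strAux Y P L hM hN).obj f)
  | _, [], _, _, hM, hN, _, _, _, hR', _, A =>
    A.castCtx (hM.trans hN.symm) (fun k Z _ h => by subst hR'; simpa using h)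
  | P, X :: L, _, _, hM, hN, R, _, hR, hR', _, A =>
    MultiLin.strAux γ (P ++ [T.obj X]) L rfl (hN.trans (by simp)) (R := R ++ [X]) (by simp [hR])
      (by simp [hR']) (A.str γ (Replaces.mid P (J.obj X) [T.obj X] (L.map J.obj) hM rfl)
        (marks_append_ne hR) (marks_append_self hR))

/-- The multilinear structure of `F ∘ (i, …, i)` in the remaining arguments of `F`. -/
def MultiLin.evAux {Y : D.Ob} : ∀ (P : List C.Ob) (L : List D.Ob)
    {M N : List C.Ob} (hM : M = P ++ L.map J.obj) (hN : N = P ++ L.map T.obj) {R R' : List D.Ob}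
    (_ : R.length = P.length) (_ : R' = R ++ L) {F : C.Hom N (T.obj Y)}
    (_ : T.MultiLin (marks R') F), T.MultiLin (marks R) ((T.evAux Y P L hM hN).obj F)
  | _, [], _, _, hM, hN, _, _, _, hR', _, A =>
    A.castCtx (hN.trans hM.symm) (fun k Z _ h => by subst hR'; simpa using h)
  | P, X :: L, _, _, hM, hN, R, _, hR, hR', _, A =>
    (MultiLin.evAux (P ++ [T.obj X]) L rfl (hN.trans (by simp)) (R := R ++ [X]) (by simp [hR])
      (by simp [hR']) A).compOther (Replaces.mid P (J.obj X) [T.obj X] (L.map J.obj) hM rfl).back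
        (ne_marks_append hR) (T.unit X)

theorem MultiLin.IsComm.evAux (γ : T.Pseudocommutativity) {Y : D.Ob} (L : List D.Ob) :
    ∀ (P : List C.Ob) {M N : List C.Ob} (hM : M = P ++ L.map J.obj) (hN : N = P ++ L.map T.obj)
    {R R' : List D.Ob} (hR : R.length = P.length) (hR' : R' = R ++ L) {F : C.Hom N (T.obj Y)}
    {A : T.MultiLin (marks R') F} (_ : A.IsComm γ), (A.evAux P L hM hN hR hR').IsComm γ := by
  induction L with
  | nil =>
    intro P M N hM hN R R' hR hR' F A h
    obtain rfl : N = M := hN.trans hM.symm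
    exact fun _ _ _ _ _ _ _ hj hk S hjk => h _ _ S hjk
  | cons X L ih =>
    intro P M N hM hN R R' hR hR' F A h
    exact MultiLin.IsComm.compOther γ _ _ (ih _ _ _ _ _ h) _

theorem MultiLin.IsComm.strAux (γ : T.Pseudocommutativity) {Y : D.Ob} (L : List D.Ob) :
    ∀ (P : List C.Ob) {M N : List C.Ob} (hM : M = P ++ L.map J.obj) (hN : N = P ++ L.map T.obj)
    {R R' : List D.Ob} (hR : R.length = P.length) (hR' : R' = R ++ L) {f : C.Hom M (T.obj Y)}
    {A : T.MultiLin (marks R) f} (_ : A.IsComm γ), (A.strAux γ P L hM hN hR hR').IsComm γ := by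
  induction L with
  | nil =>
    intro P M N hM hN R R' hR hR' F A h
    obtain rfl : M = N := hM.trans hN.symm
    exact fun _ _ _ _ _ _ _ hj hk S hjk => h _ _ S hjk
  | cons X L ih =>
    intro P M N hM hN R R' hR hR' F A h
    exact ih _ _ _ _ _ (MultiLin.IsComm.str γ _ _ _ h)

theorem IsMultiLin.evAux_map {Y : D.Ob} (L : List D.Ob) :
    ∀ (P : List C.Ob) {M N : List C.Ob} (hM : M = P ++ L.map J.obj) (hN : N = P ++ L.map T.obj)
    {R R' : List D.Ob} (hR : R.length = P.length) (hR' : R' = R ++ L) {F F' : C.Hom N (T.obj Y)}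
    {A : T.MultiLin (marks R') F} {A' : T.MultiLin (marks R') F'} {φ : F ⟶ F'}
    (_ : IsMultiLin A A' φ),
    IsMultiLin (A.evAux P L hM hN hR hR') (A'.evAux P L hM hN hR hR')
      ((T.evAux Y P L hM hN).map φ) := by
  induction L with
  | nil =>
    intro P M N hM hN R R' hR hR' F F' A A' φ h
    obtain rfl : N = M := hN.trans hM.symm
    exact fun _ _ _ hk s => h _ s
  | cons X L ih =>
    intro P M N hM hN R R' hR hR' F F' A A' φ h
    exact IsMultiLin.compOther _ _ (ih _ _ _ _ _ h) _

/-- A multilinear 2-cell is determined by its composite with the units. -/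
theorem IsMultiLin.ext_evAux {Y : D.Ob} (L : List D.Ob) :
    ∀ (P : List C.Ob) {M N : List C.Ob} (hM : M = P ++ L.map J.obj) (hN : N = P ++ L.map T.obj)
    {R R' : List D.Ob} (_ : R.length = P.length) (_ : R' = R ++ L) {F F' : C.Hom N (T.obj Y)}
    {A : T.MultiLin (marks R') F} {A' : T.MultiLin (marks R') F'} {φ ψ : F ⟶ F'}
    (_ : IsMultiLin A A' φ) (_ : IsMultiLin A A' ψ)
    (_ : (T.evAux Y P L hM hN).map φ = (T.evAux Y P L hM hN).map ψ), φ = ψ := by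
  induction L with
  | nil =>
    intro P M N hM hN R R' hR hR' F F' A A' φ ψ h h' e
    obtain rfl : N = M := hN.trans hM.symm
    exact e
  | cons X L ih =>
    intro P M N hM hN R R' hR hR' F F' A A' φ ψ h h' e
    refine ih (P ++ [T.obj X]) rfl (hN.trans (by simp)) (R := R ++ [X]) (by simp [hR])
      (by simp [hR']) h h' ?_
    have r := Replaces.mid P (J.obj X) [T.obj X] (L.map J.obj) hM rfl
    exact IsLin.ext (IsMultiLin.evAux_map L _ rfl _ (by simp [hR]) (by simp [hR']) h
      (marks_append_self hR) r) (IsMultiLin.evAux_map L _ rfl _ (by simp [hR]) (by simp [hR']) h'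
      (marks_append_self hR) r) r.back e

/-- The extension of a 2-cell `f → G ∘ i` along the unit, for a linear `G`. -/
def LinStr.extend {M N : List C.Ob} {k : ℕ} {X Y : D.Ob} {r : Replaces N k (J.obj X) [T.obj X] M}
    {f : C.Hom N (T.obj Y)} {G : C.Hom M (T.obj Y)} (A : T.LinStr r G)
    (φ : f ⟶ C.comp r.back G (T.unit X)) : (T.str r).obj f ⟶ G :=
  (T.str r).map (φ ≫ C.comp₂ r.back A.iso.inv (𝟙 _) ≫ (T.unitCell r r.back A.pre).inv) ≫ A.iso.hom

theorem LinStr.unitCell_extend {M N : List C.Ob} {k : ℕ} {X Y : D.Ob}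
    {r : Replaces N k (J.obj X) [T.obj X] M} {f : C.Hom N (T.obj Y)} {G : C.Hom M (T.obj Y)}
    (A : T.LinStr r G) (φ : f ⟶ C.comp r.back G (T.unit X)) :
    (T.unitCell r r.back f).hom ≫ C.comp₂ r.back (A.extend φ) (𝟙 (T.unit X)) = φ := by
  rw [LinStr.extend, C.comp₂_comp_id, ← reassoc_of% T.unitCell_naturality r r.back]
  simp only [Category.assoc, Iso.inv_hom_id_assoc]
  rw [← C.comp₂_comp_id, Iso.inv_hom_id, C.comp₂_id, Category.comp_id]

instance LinStr.isIso_extend {M N : List C.Ob} {k : ℕ} {X Y : D.Ob}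
    {r : Replaces N k (J.obj X) [T.obj X] M} {f : C.Hom N (T.obj Y)} {G : C.Hom M (T.obj Y)}
    (A : T.LinStr r G) (φ : f ⟶ C.comp r.back G (T.unit X)) [IsIso φ] : IsIso (A.extend φ) := by
  rw [LinStr.extend]
  infer_instance

/-- The universal property of `f ≅ f^{t₁ ⋯ tₙ} ∘ (i, …, i)`: a multilinear 2-cell
`f → G ∘ (i, …, i)`, where `G` is multilinear and commutative, extends to a multilinear 2-cell
`f^{t₁ ⋯ tₙ} → G`. -/
theorem exists_extension (γ : T.Pseudocommutativity) {Y : D.Ob} (L : List D.Ob) :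
    ∀ (P : List C.Ob) {M N : List C.Ob} (hM : M = P ++ L.map J.obj) (hN : N = P ++ L.map T.obj)
    {R R' : List D.Ob} (hR : R.length = P.length) (hR' : R' = R ++ L) {f : C.Hom M (T.obj Y)}
    (A : T.MultiLin (marks R) f) {G : C.Hom N (T.obj Y)} (B : T.MultiLin (marks R') G)
    (_ : B.IsComm γ) (φ : f ⟶ (T.evAux Y P L hM hN).obj G)
    (_ : IsMultiLin A (B.evAux P L hM hN hR hR') φ),
    ∃ ψ : (T.strAux Y P L hM hN).obj f ⟶ G, IsMultiLin (A.strAux γ P L hM hN hR hR') B ψ ∧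
      (T.unitAux Y P L hM hN f).hom ≫ (T.evAux Y P L hM hN).map ψ = φ ∧ (IsIso φ → IsIso ψ) := by
  induction L with
  | nil =>
    intro P M N hM hN R R' hR hR' f A G B hB φ h
    obtain rfl : M = N := hM.trans hN.symm
    refine ⟨φ, fun _ _ _ hk s => h (by subst hR'; simpa using hk) s, ?_, fun h => h⟩
    exact Category.id_comp (X := f) φ
  | cons X L ih =>
    intro P M N hM hN R R' hR hR' f A G B hB φ h
    have r : Replaces M P.length (J.obj X) [T.obj X] (P ++ [T.obj X] ++ L.map J.obj) :=
      Replaces.mid P (J.obj X) [T.obj X] (L.map J.obj) hM rfl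
    have hN' : N = (P ++ [T.obj X]) ++ L.map T.obj := hN.trans (by simp)
    have hR₁ : (R ++ [X]).length = (P ++ [T.obj X]).length := by simp [hR]
    have hR₁' : R' = (R ++ [X]) ++ L := by simp [hR']
    have hB' := MultiLin.IsComm.evAux γ L (P ++ [T.obj X]) rfl hN' hR₁ hR₁' hB
    let A' := (B.evAux (P ++ [T.obj X]) L rfl hN' hR₁ hR₁').lin (marks_append_self hR) r
    obtain ⟨ψ, h₁, h₂, h₃⟩ := ih (P ++ [T.obj X]) rfl hN' hR₁ hR₁'
      (A.str γ r (marks_append_ne hR) (marks_append_self hR)) B hB (A'.extend φ)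
      (by
        intro k Z K hk s
        by_cases hkp : k = P.length
        · subst hkp
          obtain rfl := Option.some.inj (hk.symm.trans (marks_append_self hR))
          obtain rfl := s.source_unique r
          rw [MultiLin.str_lin_self]
          exact ⟨_, (Category.id_comp _).symm⟩
        · rw [MultiLin.str_lin_ne _ _ _ _ _ _ _ hkp]
          have S := Parallel.of_set hkp s r
          have U : Parallel K k (J.obj Z) [T.obj Z] P.length (T.obj X) [J.obj X] k P.length
              (K.set P.length (J.obj X)) (P ++ [T.obj X] ++ L.map J.obj) M :=
            ⟨hkp, by simp [shift], by simp [shift], S.left.back, S.right, s, r.back⟩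
          have e : IsMultiLin A ((B.evAux (P ++ [T.obj X]) L rfl hN' hR₁ hR₁').compOther r.back
            (ne_marks_append hR) (T.unit X)) φ := h
          have e' := e (marks_append_ne hR k Z hkp hk).2 S.right
          rw [MultiLin.compOther_lin_of r.back (ne_marks_append hR) _ (T.unit X) _ U] at e'
          exact IsLin.extend γ S (marks_append_ne hR k Z hkp hk).1 U
            (hB' hk (marks_append_self hR) S _) e')
    refine ⟨ψ, h₁, ?_, fun hφ => h₃ ?_⟩
    · refine (Category.assoc _ _ _).trans ((congrArg (_ ≫ ·) ?_).trans (A'.unitCell_extend φ))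
      exact ((C.compRight r.back _ (T.unit X)).map_comp _ _).symm.trans (congrArg _ h₂)
    · exact @LinStr.isIso_extend _ _ _ _ _ _ _ _ _ _ _ _ A' φ hφ

end StrongRelativePseudomonad

/-! ### Naturality of simultaneous composition -/

namespace TwoMulticategory

variable (C : TwoMulticategory.{u, v, w})

theorem post_post₂ {L : List C.Ob} {X Y Z : C.Ob} {h h' : C.Hom [Y] Z} {g g' : C.Hom [X] Y}
    {f f' : C.Hom L X} (α : h ⟶ h') (β : g ⟶ g') (δ : f ⟶ f') :
    C.post₂ (C.post₂ α β) δ ≫ eqToHom (C.post_post h' g' f') =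
      eqToHom (C.post_post h g f) ≫ C.post₂ α (C.post₂ β δ) :=
  C.assoc₂_eqToHom (k := 0) (l := 0) (r := 0)
    ⟨rfl, Replaces.whole _ _, Replaces.whole _ _, Replaces.whole _ _, Replaces.whole _ _⟩ α β δ

theorem eqToHom_square_trans {A : Type*} [Category* A] {a b c a' b' c' : A} {x : a ⟶ a'} {y : b ⟶ b'}
    {z : c ⟶ c'} {e : a = b} {e' : a' = b'} {h : b = c} {h' : b' = c'}
    (H : x ≫ eqToHom e' = eqToHom e ≫ y) (H' : y ≫ eqToHom h' = eqToHom h ≫ z) :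
    x ≫ eqToHom (e'.trans h') = eqToHom (e.trans h) ≫ z := by
  subst e e' h h'
  simpa using H.trans (by simpa using H')

section

variable {n : ℕ} {P : List C.Ob} {A B : Fin n → C.Ob} {M N : List C.Ob} {Z : C.Ob}
  (hM : M = P ++ List.ofFn B) (hN : N = P ++ List.ofFn A)

/-- Naturality of an equality of 1-cells is preserved by simultaneous composition. -/
theorem simultAux₂_square {F F₁ F' F₁' : C.Hom M Z} {φ : F ⟶ F₁} {φ' : F' ⟶ F₁'} {e : F = F'}
    {e₁ : F₁ = F₁'} (h : φ ≫ eqToHom e₁ = eqToHom e ≫ φ') {g g' : ∀ k, C.Hom [A k] (B k)}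
    (β : ∀ k, g k ⟶ g' k) :
    C.simultAux₂ n P hM hN φ β ≫ eqToHom (by rw [e₁]) =
      eqToHom (by rw [e]) ≫ C.simultAux₂ n P hM hN φ' β := by
  subst e e₁
  obtain rfl : φ = φ' := by simpa using h
  simp

end

theorem post_simultAux₂ (n : ℕ) : ∀ (P : List C.Ob) {A B : Fin n → C.Ob} {M N : List C.Ob}
    {Y Z : C.Ob} (hM : M = P ++ List.ofFn B) (hN : N = P ++ List.ofFn A) {h h' : C.Hom [Y] Z}
    (α : h ⟶ h') {F F' : C.Hom M Y} (φ : F ⟶ F') {g g' : ∀ k, C.Hom [A k] (B k)}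
    (β : ∀ k, g k ⟶ g' k),
    C.post₂ α (C.simultAux₂ n P hM hN φ β) ≫ eqToHom (C.post_simultAux n P hM hN h' F' g') =
      eqToHom (C.post_simultAux n P hM hN h F g) ≫ C.simultAux₂ n P hM hN (C.post₂ α φ) β := by
  induction n with
  | zero =>
    intro P A B M N Y Z hM hN h h' α F F' φ g g' β
    obtain rfl : M = N := hM.trans (by simpa using hN.symm)
    exact (Category.comp_id _).trans (Category.id_comp _).symm
  | succ n ih =>
    intro P A B M N Y Z hM hN h h' α F F' φ g g' β
    have s : Replaces M P.length (B 0) [A 0] (P ++ A 0 :: List.ofFn fun k => B k.succ) :=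
      Replaces.mid P (B 0) [A 0] (List.ofFn fun k => B k.succ)
        (by simpa [List.ofFn_succ] using hM) (by simp)
    have S : Nested [Y] 0 Y M P.length (B 0) [A 0] P.length M
        (P ++ A 0 :: List.ofFn fun k => B k.succ) (P ++ A 0 :: List.ofFn fun k => B k.succ) :=
      ⟨by simp, Replaces.whole _ _, s, s, Replaces.whole _ _⟩
    have hM₁ : P ++ A 0 :: List.ofFn (fun k => B k.succ) =
        (P ++ [A 0]) ++ List.ofFn fun k => B k.succ := by simp
    have hN₁ : N = (P ++ [A 0]) ++ List.ofFn fun k => A k.succ := by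
      simpa [List.ofFn_succ] using hN
    have h₁ := ih (P ++ [A 0]) hM₁ hN₁ α (C.comp₂ s φ (β 0)) fun k => β k.succ
    have h₂ := C.simultAux₂_square hM₁ hN₁ (φ := C.post₂ α (C.comp₂ s φ (β 0)))
      (φ' := C.comp₂ s (C.post₂ α φ) (β 0)) (e := (C.assoc S h F (g 0)).symm)
      (e₁ := (C.assoc S h' F' (g' 0)).symm) (eqToHom_swap _ _ (C.assoc₂_eqToHom S α φ (β 0)))
      (fun k => β k.succ)
    exact eqToHom_square_trans h₁ h₂

/-- Composition in an argument to the left of those of a simultaneous composition. -/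
theorem comp_simultAux_left {n : ℕ} {P P' : List C.Ob} {p : ℕ} {V W : C.Ob}
    (hP : Replaces P p V [W] P') {A B : Fin n → C.Ob} {M N M' N' : List C.Ob} {Z : C.Ob}
    (hM : M = P ++ List.ofFn B) (hN : N = P ++ List.ofFn A)
    (hM' : M' = P' ++ List.ofFn B) (hN' : N' = P' ++ List.ofFn A)
    (s : Replaces N p V [W] N') (s' : Replaces M p V [W] M')
    (F : C.Hom M Z) (a : C.Hom [W] V) (g : ∀ k, C.Hom [A k] (B k)) :
    C.comp s (C.simultAux n P hM hN F g) a = C.simultAux n P' hM' hN' (C.comp s' F a) g := by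
  obtain ⟨Γ, Δ, rfl, rfl, hP'⟩ := hP
  obtain rfl : P' = Γ ++ W :: Δ := by simpa using hP'
  exact C.comp_simultAux n Γ Δ hM hN hM' hN' s s' F a g

theorem comp_simultAux₂_left (n : ℕ) : ∀ {P P' : List C.Ob} {p : ℕ} {V W : C.Ob}
    (hP : Replaces P p V [W] P') {A B : Fin n → C.Ob} {M N M' N' : List C.Ob} {Z : C.Ob}
    (hM : M = P ++ List.ofFn B) (hN : N = P ++ List.ofFn A)
    (hM' : M' = P' ++ List.ofFn B) (hN' : N' = P' ++ List.ofFn A)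
    (s : Replaces N p V [W] N') (s' : Replaces M p V [W] M')
    {F F' : C.Hom M Z} (φ : F ⟶ F') {a a' : C.Hom [W] V} (α : a ⟶ a')
    {g g' : ∀ k, C.Hom [A k] (B k)} (β : ∀ k, g k ⟶ g' k),
    C.comp₂ s (C.simultAux₂ n P hM hN φ β) α ≫
        eqToHom (C.comp_simultAux_left hP hM hN hM' hN' s s' F' a' g') =
      eqToHom (C.comp_simultAux_left hP hM hN hM' hN' s s' F a g) ≫
        C.simultAux₂ n P' hM' hN' (C.comp₂ s' φ α) β := by
  induction n with
  | zero =>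
    intro P P' p V W hP A B M N M' N' Z hM hN hM' hN' s s' F F' φ a a' α g g' β
    obtain rfl : M = N := hM.trans (by simpa using hN.symm)
    obtain rfl : M' = N' := hM'.trans (by simpa using hN'.symm)
    exact (Category.comp_id _).trans (Category.id_comp _).symm
  | succ n ih =>
    intro P P' p V W hP A B M N M' N' Z hM hN hM' hN' s s' F F' φ a a' α g g' β
    have hl : P'.length = P.length := hP.length_eq
    have hpl : p < P.length := hP.lt_length
    have r : Replaces M P.length (B 0) [A 0] (P ++ A 0 :: List.ofFn fun k => B k.succ) :=
      Replaces.mid P _ [A 0] (List.ofFn fun k => B k.succ)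
        (by simpa [List.ofFn_succ] using hM) (by simp)
    have r' : Replaces M' P'.length (B 0) [A 0] (P' ++ A 0 :: List.ofFn fun k => B k.succ) :=
      Replaces.mid P' _ [A 0] (List.ofFn fun k => B k.succ)
        (by simpa [List.ofFn_succ] using hM') (by simp)
    have t : Replaces (P ++ A 0 :: List.ofFn fun k => B k.succ) p V [W]
        (P' ++ A 0 :: List.ofFn fun k => B k.succ) := hP.append_right _
    have S : Parallel M p V [W] P.length (B 0) [A 0] p P'.length
        (P ++ A 0 :: List.ofFn fun k => B k.succ) M'
        (P' ++ A 0 :: List.ofFn fun k => B k.succ) :=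
      ⟨by omega, by simp [shift], by simp [shift, hl], r, t, s', r'⟩
    have hM₁ : P ++ A 0 :: List.ofFn (fun k => B k.succ) =
        (P ++ [A 0]) ++ List.ofFn fun k => B k.succ := by simp
    have hM₁' : P' ++ A 0 :: List.ofFn (fun k => B k.succ) =
        (P' ++ [A 0]) ++ List.ofFn fun k => B k.succ := by simp
    have hN₁ : N = (P ++ [A 0]) ++ List.ofFn fun k => A k.succ := by
      simpa [List.ofFn_succ] using hN
    have hN₁' : N' = (P' ++ [A 0]) ++ List.ofFn fun k => A k.succ := by
      simpa [List.ofFn_succ] using hN'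
    exact eqToHom_square_trans (ih (hP.append_right _) hM₁ hN₁ hM₁' hN₁' s t
        (C.comp₂ r φ (β 0)) α fun k => β k.succ)
      (C.simultAux₂_square hM₁' hN₁' (C.parallel₂_eqToHom S φ α (β 0)) fun k => β k.succ)

theorem simultAux₂_simultAux₂ (n : ℕ) : ∀ (P : List C.Ob) {A B E : Fin n → C.Ob}
    {M N R : List C.Ob} {Z : C.Ob} (hM : M = P ++ List.ofFn E) (hN : N = P ++ List.ofFn B)
    (hR : R = P ++ List.ofFn A) {F F' : C.Hom M Z} (φ : F ⟶ F')
    {g' h' : ∀ k, C.Hom [B k] (E k)} (β' : ∀ k, g' k ⟶ h' k)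
    {g h : ∀ k, C.Hom [A k] (B k)} (β : ∀ k, g k ⟶ h k),
    C.simultAux₂ n P hN hR (C.simultAux₂ n P hM hN φ β') β ≫
        eqToHom (C.simultAux_simultAux n P hM hN hR F' h' h) =
      eqToHom (C.simultAux_simultAux n P hM hN hR F g' g) ≫
        C.simultAux₂ n P hM hR φ fun k => C.post₂ (β' k) (β k) := by
  induction n with
  | zero =>
    intro P A B E M N R Z hM hN hR F F' φ g' h' β' g h β
    obtain rfl : M = N := hM.trans (by simpa using hN.symm)
    obtain rfl : M = R := hN.trans (by simpa using hR.symm)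
    exact (Category.comp_id _).trans (Category.id_comp _).symm
  | succ n ih =>
    intro P A B E M N R Z hM hN hR F F' φ g' h' β' g h β
    have t : Replaces M P.length (E 0) [B 0] (P ++ B 0 :: List.ofFn fun k => E k.succ) :=
      Replaces.mid _ _ _ _ (by simpa [List.ofFn_succ] using hM) (by simp)
    have t₁ : Replaces N P.length (B 0) [A 0] (P ++ A 0 :: List.ofFn fun k => B k.succ) :=
      Replaces.mid _ _ _ _ (by simpa [List.ofFn_succ] using hN) (by simp)
    have t' : Replaces (P ++ B 0 :: List.ofFn fun k => E k.succ) P.length (B 0) [A 0]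
        (P ++ A 0 :: List.ofFn fun k => E k.succ) :=
      Replaces.mid _ _ _ _ rfl (by simp)
    have S : Nested M P.length (E 0) [B 0] 0 (B 0) [A 0] P.length
        (P ++ B 0 :: List.ofFn fun k => E k.succ) [A 0] (P ++ A 0 :: List.ofFn fun k => E k.succ) :=
      ⟨by simp, t, t', Replaces.whole _ _,
        Replaces.mid _ _ _ _ (by simpa [List.ofFn_succ] using hM) (by simp)⟩
    have hM₀ : P ++ B 0 :: List.ofFn (fun k => E k.succ) =
        (P ++ [B 0]) ++ List.ofFn fun k => E k.succ := by simp
    have hN₀ : N = (P ++ [B 0]) ++ List.ofFn fun k => B k.succ := by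
      simpa [List.ofFn_succ] using hN
    have hM₁ : P ++ A 0 :: List.ofFn (fun k => E k.succ) =
        (P ++ [A 0]) ++ List.ofFn fun k => E k.succ := by simp
    have hN₁ : P ++ A 0 :: List.ofFn (fun k => B k.succ) =
        (P ++ [A 0]) ++ List.ofFn fun k => B k.succ := by simp
    have hR₁ : R = (P ++ [A 0]) ++ List.ofFn fun k => A k.succ := by
      simpa [List.ofFn_succ] using hR
    have h₁ := C.simultAux₂_square hN₁ hR₁ (C.comp_simultAux₂_left n
      (Replaces.mid P (B 0) [A 0] [] rfl (by simp)) hM₀ hN₀ hM₁ hN₁ t₁ t' (C.comp₂ t φ (β' 0))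
      (β 0) fun k => β' k.succ) fun k => β k.succ
    have h₂ := ih (P ++ [A 0]) hM₁ hN₁ hR₁ (C.comp₂ t' (C.comp₂ t φ (β' 0)) (β 0))
      (fun k => β' k.succ) fun k => β k.succ
    have h₃ := C.simultAux₂_square hM₁ hR₁ (C.assoc₂_eqToHom S φ (β' 0) (β 0))
      fun k => C.post₂ (β' k.succ) (β k.succ)
    exact eqToHom_square_trans (eqToHom_square_trans h₁ h₂) h₃

end TwoMulticategory

/-! ### Composition with the units -/

namespace StrongRelativePseudomonad

variable {D : TwoMulticategory.{u, v, w}} {C : TwoMulticategory.{u', v', w'}}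
  {J : MultiFunctor D C} (T : StrongRelativePseudomonad J)

theorem simultAux_unit (n : ℕ) : ∀ (P : List C.Ob) {X : Fin n → D.Ob} {L : List D.Ob}
    (_ : L = List.ofFn X) {M N : List C.Ob} {Y : D.Ob}
    (hM : M = P ++ List.ofFn fun k => T.obj (X k)) (hN : N = P ++ List.ofFn fun k => J.obj (X k))
    (hM' : M = P ++ L.map T.obj) (hN' : N = P ++ L.map J.obj) (G : C.Hom M (T.obj Y)),
    C.simultAux n P hM hN G (fun k => T.unit (X k)) = (T.evAux Y P L hN' hM').obj G := by
  induction n with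
  | zero =>
    intro P X L hL M N Y hM hN hM' hN' G
    obtain rfl : L = [] := by simpa using hL
    rfl
  | succ n ih =>
    intro P X L hL M N Y hM hN hM' hN' G
    obtain rfl : L = X 0 :: List.ofFn fun k => X k.succ := by simpa [List.ofFn_succ] using hL
    have r : Replaces M P.length (T.obj (X 0)) [J.obj (X 0)]
        (P ++ J.obj (X 0) :: List.ofFn fun k => T.obj (X k.succ)) :=
      Replaces.mid _ _ _ _ (by simpa [List.ofFn_succ] using hM) (by simp)
    rw [TwoMulticategory.simultAux, ← C.comp_simultAux_left
      (Replaces.mid P (T.obj (X 0)) [J.obj (X 0)] [] rfl (by simp)) (by simpa [List.ofFn_succ] using hM)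
      (N := P ++ [T.obj (X 0)] ++ List.map J.obj (List.ofFn fun k => X k.succ))
      (by simp [List.map_ofFn, Function.comp_def]) _ _ _ r,
      ih (P ++ [T.obj (X 0)]) rfl]
    rfl

theorem simultAux₂_unit (n : ℕ) : ∀ (P : List C.Ob) {X : Fin n → D.Ob} {L : List D.Ob}
    (hL : L = List.ofFn X) {M N : List C.Ob} {Y : D.Ob}
    (hM : M = P ++ List.ofFn fun k => T.obj (X k)) (hN : N = P ++ List.ofFn fun k => J.obj (X k))
    (hM' : M = P ++ L.map T.obj) (hN' : N = P ++ L.map J.obj) {G G' : C.Hom M (T.obj Y)}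
    (φ : G ⟶ G'),
    C.simultAux₂ n P hM hN φ (fun k => 𝟙 (T.unit (X k))) ≫
        eqToHom (T.simultAux_unit n P hL hM hN hM' hN' G') =
      eqToHom (T.simultAux_unit n P hL hM hN hM' hN' G) ≫ (T.evAux Y P L hN' hM').map φ := by
  induction n with
  | zero =>
    intro P X L hL M N Y hM hN hM' hN' G G' φ
    obtain rfl : L = [] := by simpa using hL
    exact (Category.comp_id _).trans (Category.id_comp _).symm
  | succ n ih =>
    intro P X L hL M N Y hM hN hM' hN' G G' φ
    obtain rfl : L = X 0 :: List.ofFn fun k => X k.succ := by simpa [List.ofFn_succ] using hL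
    have r : Replaces M P.length (T.obj (X 0)) [J.obj (X 0)]
        (P ++ J.obj (X 0) :: List.ofFn fun k => T.obj (X k.succ)) :=
      Replaces.mid _ _ _ _ (by simpa [List.ofFn_succ] using hM) (by simp)
    have s : Replaces (P ++ [T.obj (X 0)] ++ List.map J.obj (List.ofFn fun k => X k.succ)) P.length
        (T.obj (X 0)) [J.obj (X 0)] N :=
      (Replaces.mid P (J.obj (X 0)) [T.obj (X 0)] _ hN' rfl).back
    have hM₀ : M = (P ++ [T.obj (X 0)]) ++ List.ofFn fun k => T.obj (X k.succ) := by
      simpa [List.ofFn_succ] using hM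
    have hN₀ : P ++ [T.obj (X 0)] ++ List.map J.obj (List.ofFn fun k => X k.succ) =
        (P ++ [T.obj (X 0)]) ++ List.ofFn fun k => J.obj (X k.succ) := by
      simp [List.map_ofFn, Function.comp_def]
    have hM₁ : P ++ J.obj (X 0) :: List.ofFn (fun k => T.obj (X k.succ)) =
        (P ++ [J.obj (X 0)]) ++ List.ofFn fun k => T.obj (X k.succ) := by simp
    have hN₁ : N = (P ++ [J.obj (X 0)]) ++ List.ofFn fun k => J.obj (X k.succ) := by
      simpa [List.ofFn_succ] using hN
    have h₁ := TwoMulticategory.eqToHom_swap _ _ (C.comp_simultAux₂_left n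
      (Replaces.mid P (T.obj (X 0)) [J.obj (X 0)] [] rfl (by simp)) hM₀ hN₀ hM₁ hN₁ s r φ
      (𝟙 (T.unit (X 0))) fun k => 𝟙 (T.unit (X k.succ)))
    have h₂ := ih (P ++ [T.obj (X 0)]) rfl hM₀ hN₀ (hM'.trans (by simp)) rfl φ
    have h₃ := congrArg (fun ψ => C.comp₂ s ψ (𝟙 (T.unit (X 0)))) h₂
    simp only [C.comp₂_comp_id, TwoMulticategory.comp₂_eqToHom_id] at h₃
    exact TwoMulticategory.eqToHom_square_trans h₁ h₃

end StrongRelativePseudomonad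

/-! ### Calculus of simultaneous composites of 2-cells -/

namespace TwoMulticategory

variable (C : TwoMulticategory.{u, v, w}) {n : ℕ} {A B E : Fin n → C.Ob} {M N R : List C.Ob}
  {Y Z : C.Ob} (hM : M = List.ofFn B) (hN : N = List.ofFn A)

theorem post₂_id (h : C.Hom [Y] Z) (F : C.Hom M Y) : C.post₂ (𝟙 h) (𝟙 F) = 𝟙 (C.post h F) :=
  C.comp₂_id _ h F

theorem post₂_comp {h h' h'' : C.Hom [Y] Z} (α : h ⟶ h') (α' : h' ⟶ h'') {F F' F'' : C.Hom M Y}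
    (φ : F ⟶ F') (φ' : F' ⟶ F'') :
    C.post₂ α φ ≫ C.post₂ α' φ' = C.post₂ (α ≫ α') (φ ≫ φ') :=
  (C.comp₂_comp _ α α' φ φ').symm

theorem post₂_comp_left {h h' h'' : C.Hom [Y] Z} (α : h ⟶ h') (α' : h' ⟶ h'') (F : C.Hom M Y) :
    C.post₂ (α ≫ α') (𝟙 F) = C.post₂ α (𝟙 F) ≫ C.post₂ α' (𝟙 F) :=
  C.comp₂_comp_id _ α α' F

theorem post₂_comp_right (h : C.Hom [Y] Z) {F F' F'' : C.Hom M Y} (φ : F ⟶ F') (φ' : F' ⟶ F'') :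
    C.post₂ (𝟙 h) (φ ≫ φ') = C.post₂ (𝟙 h) φ ≫ C.post₂ (𝟙 h) φ' :=
  C.comp₂_id_comp _ h φ φ'

theorem post₂_eqToHom_left {h h' : C.Hom [Y] Z} (e : h = h') (F : C.Hom M Y) :
    C.post₂ (eqToHom e) (𝟙 F) = eqToHom (by rw [e]) :=
  C.comp₂_eqToHom_id _ F e

theorem post₂_eqToHom_right (h : C.Hom [Y] Z) {F F' : C.Hom M Y} (e : F = F') :
    C.post₂ (𝟙 h) (eqToHom e) = eqToHom (by rw [e]) :=
  C.comp₂_id_eqToHom _ h e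

theorem one_post (F : C.Hom M Y) : C.post (C.one Y) F = F := C.one_comp _ F

theorem one_post₂ {F F' : C.Hom M Y} (φ : F ⟶ F') :
    C.post₂ (𝟙 (C.one Y)) φ ≫ eqToHom (C.one_post F') = eqToHom (C.one_post F) ≫ φ :=
  C.one_comp₂_eqToHom _ φ

theorem simult₂_id (F : C.Hom M Z) (g : ∀ k, C.Hom [A k] (B k)) :
    C.simult₂ hM hN (𝟙 F) (fun k => 𝟙 (g k)) = 𝟙 (C.simult hM hN F g) :=
  C.simultAux₂_id n [] hM hN F g

theorem simult₂_comp {F F' F'' : C.Hom M Z} {g g' g'' : ∀ k, C.Hom [A k] (B k)} (φ : F ⟶ F')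
    (φ' : F' ⟶ F'') (β : ∀ k, g k ⟶ g' k) (β' : ∀ k, g' k ⟶ g'' k) :
    C.simult₂ hM hN φ β ≫ C.simult₂ hM hN φ' β' =
      C.simult₂ hM hN (φ ≫ φ') (fun k => β k ≫ β' k) :=
  (C.simultAux₂_comp n [] hM hN φ φ' β β').symm

theorem simult₂_comp_left {F F' F'' : C.Hom M Z} (φ : F ⟶ F') (φ' : F' ⟶ F'')
    (g : ∀ k, C.Hom [A k] (B k)) : C.simult₂ hM hN (φ ≫ φ') (fun k => 𝟙 (g k)) =
      C.simult₂ hM hN φ (fun k => 𝟙 (g k)) ≫ C.simult₂ hM hN φ' (fun k => 𝟙 (g k)) := by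
  simp only [simult₂_comp, Category.comp_id]

theorem simult₂_eqToHom {F F' : C.Hom M Z} (e : F = F') {g g' : ∀ k, C.Hom [A k] (B k)}
    (h : g = g') : C.simult₂ hM hN (eqToHom e) (fun k => eqToHom (congrFun h k)) =
      eqToHom (by rw [e, h]) := by
  subst e h
  exact C.simult₂_id hM hN F g

theorem simult₂_eqToHom_left {F F' : C.Hom M Z} (e : F = F') (g : ∀ k, C.Hom [A k] (B k)) :
    C.simult₂ hM hN (eqToHom e) (fun k => 𝟙 (g k)) = eqToHom (by rw [e]) :=
  C.simult₂_eqToHom hM hN e rfl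

theorem post_simult₂ {h h' : C.Hom [Y] Z} (α : h ⟶ h') {F F' : C.Hom M Y} (φ : F ⟶ F')
    {g g' : ∀ k, C.Hom [A k] (B k)} (β : ∀ k, g k ⟶ g' k) :
    C.post₂ α (C.simult₂ hM hN φ β) ≫ eqToHom (C.post_simult hM hN h' F' g') =
      eqToHom (C.post_simult hM hN h F g) ≫ C.simult₂ hM hN (C.post₂ α φ) β :=
  C.post_simultAux₂ n [] hM hN α φ β

theorem simult₂_simult₂ (hM : M = List.ofFn E) (hN : N = List.ofFn B) (hR : R = List.ofFn A)
    {F F' : C.Hom M Z} (φ : F ⟶ F') {g' h' : ∀ k, C.Hom [B k] (E k)} (β' : ∀ k, g' k ⟶ h' k)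
    {g h : ∀ k, C.Hom [A k] (B k)} (β : ∀ k, g k ⟶ h k) :
    C.simult₂ hN hR (C.simult₂ hM hN φ β') β ≫ eqToHom (C.simult_simult hM hN hR F' h' h) =
      eqToHom (C.simult_simult hM hN hR F g' g) ≫
        C.simult₂ hM hR φ fun k => C.post₂ (β' k) (β k) :=
  C.simultAux₂_simultAux₂ n [] hM hN hR φ β' β

instance isIso_post₂ {h h' : C.Hom [Y] Z} (α : h ⟶ h') [IsIso α] {F F' : C.Hom M Y} (φ : F ⟶ F')
    [IsIso φ] : IsIso (C.post₂ α φ) :=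
  C.isIso_comp₂ _ α φ

end TwoMulticategory

namespace StrongRelativePseudomonad

variable {D : TwoMulticategory.{u, v, w}} {C : TwoMulticategory.{u', v', w'}}
  {J : MultiFunctor D C} {T : StrongRelativePseudomonad J}

/-! ### Multilinear structure of `Tf`, and its universal property -/

/-- A 1-cell without marked arguments is multilinear. -/
def MultiLin.ofNil {M : List C.Ob} {Y : D.Ob} (F : C.Hom M (T.obj Y)) : T.MultiLin (marks []) F where
  lin hk := by simp at hk

theorem MultiLin.ofNil_isComm (γ : T.Pseudocommutativity) {M : List C.Ob} {Y : D.Ob}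
    (F : C.Hom M (T.obj Y)) : (MultiLin.ofNil F).IsComm γ :=
  fun _ _ _ _ _ _ _ hj => by simp at hj

/-- The multilinear structure of `Tf`. -/
def mapLin (γ : T.Pseudocommutativity) {L : List D.Ob} {Y : D.Ob} (f : D.Hom L Y) :
    T.MultiLin (marks L) ((T.map L Y).obj f) :=
  (MultiLin.ofNil _).strAux γ [] L rfl rfl rfl rfl

theorem mapLin_isComm (γ : T.Pseudocommutativity) {L : List D.Ob} {Y : D.Ob} (f : D.Hom L Y) :
    (mapLin γ f).IsComm γ :=
  MultiLin.IsComm.strAux γ L _ _ _ _ _ (MultiLin.ofNil_isComm γ _)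

section

variable {n : ℕ} {X X' X'' : Fin n → D.Ob} {Y Y' : D.Ob}

theorem marks_ofFn (P : List C.Ob) (hP : P = []) (i : Fin n) :
    marks (List.ofFn X) (P.length + i) = some (X i) := by
  subst hP
  simp

/-- The multilinear structure of `F ∘ (g₁, …, gₙ)`, for a multilinear `F` and linear `gₖ`. -/
def MultiLin.simult {F : C.Hom ((List.ofFn X').map T.obj) (T.obj Y)}
    (A : T.MultiLin (marks (List.ofFn X')) F) {g : ∀ k, C.Hom [T.obj (X k)] (T.obj (X' k))}
    (B : ∀ k, T.LinStr (Replaces.whole (J.obj (X k)) [T.obj (X k)]) (g k)) :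
    T.MultiLin (marks (List.ofFn X)) (C.simult (B := fun k => T.obj (X' k))
      (A := fun k => T.obj (X k)) List.map_ofFn List.map_ofFn F g) :=
  MultiLin.simultAux n [] List.map_ofFn List.map_ofFn (fun _ _ h => by simp at h)
    (marks_ofFn [] rfl) (marks_ofFn [] rfl) A B

variable (T) in
theorem simult_unit (G : C.Hom ((List.ofFn X).map T.obj) (T.obj Y)) :
    C.simult (B := fun k => T.obj (X k)) (A := fun k => J.obj (X k)) (N := (List.ofFn X).map J.obj)
      List.map_ofFn List.map_ofFn G (fun k => T.unit (X k)) =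
      (T.evAux Y [] (List.ofFn X) rfl rfl).obj G :=
  T.simultAux_unit n [] rfl _ _ rfl rfl G

variable (T) in
theorem simult₂_unit {G G' : C.Hom ((List.ofFn X).map T.obj) (T.obj Y)} (φ : G ⟶ G') :
    C.simult₂ (B := fun k => T.obj (X k)) (A := fun k => J.obj (X k)) (N := (List.ofFn X).map J.obj)
      List.map_ofFn List.map_ofFn φ (fun k => 𝟙 (T.unit (X k))) ≫ eqToHom (T.simult_unit G') =
      eqToHom (T.simult_unit G) ≫ (T.evAux Y [] (List.ofFn X) rfl rfl).map φ :=
  T.simultAux₂_unit n [] rfl _ _ rfl rfl φ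

variable (T) in
/-- The 2-cell `f ≅ f^{t₁ ⋯ tₙ} ∘ (i, …, i)`. -/
def unitSimult (f : C.Hom ((List.ofFn X).map J.obj) (T.obj Y)) :
    f ≅ C.simult (B := fun k => T.obj (X k)) (A := fun k => J.obj (X k)) List.map_ofFn
      List.map_ofFn ((T.strAux Y [] (List.ofFn X) rfl rfl).obj f) (fun k => T.unit (X k)) :=
  T.unitAux Y [] (List.ofFn X) rfl rfl f ≪≫
    eqToIso (T.simult_unit _).symm

/-- A multilinear 2-cell is determined by its composite with `(i, …, i)`. -/
theorem IsMultiLin.ext_simult {F F' : C.Hom ((List.ofFn X).map T.obj) (T.obj Y)}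
    {A : T.MultiLin (marks (List.ofFn X)) F} {A' : T.MultiLin (marks (List.ofFn X)) F'}
    {φ ψ : F ⟶ F'} (h : IsMultiLin A A' φ) (h' : IsMultiLin A A' ψ)
    (e : C.simult₂ (B := fun k => T.obj (X k)) (A := fun k => J.obj (X k)) List.map_ofFn
        List.map_ofFn φ (fun k => 𝟙 (T.unit (X k))) =
      C.simult₂ (B := fun k => T.obj (X k)) (A := fun k => J.obj (X k)) List.map_ofFn
        List.map_ofFn ψ (fun k => 𝟙 (T.unit (X k)))) : φ = ψ := by
  refine IsMultiLin.ext_evAux (T := T) (List.ofFn X) [] rfl rfl (R := []) rfl rfl h h' ?_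
  rw [← cancel_epi (eqToHom (T.simult_unit _)), ← T.simult₂_unit φ, ← T.simult₂_unit ψ, e]

/-- `exists_extension` for all the arguments of `f`, in terms of simultaneous composition. -/
theorem exists_extension_simult (γ : T.Pseudocommutativity)
    (f : C.Hom ((List.ofFn X).map J.obj) (T.obj Y)) {G : C.Hom ((List.ofFn X).map T.obj) (T.obj Y)}
    (B : T.MultiLin (marks (List.ofFn X)) G) (hB : B.IsComm γ)
    (φ : f ⟶ C.simult (B := fun k => T.obj (X k)) (A := fun k => J.obj (X k)) List.map_ofFn
      List.map_ofFn G (fun k => T.unit (X k))) :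
    ∃ ψ : (T.strAux Y [] (List.ofFn X) rfl rfl).obj f ⟶ G,
      IsMultiLin ((MultiLin.ofNil f).strAux γ [] (List.ofFn X) rfl rfl rfl rfl) B ψ ∧
      (T.unitSimult f).hom ≫ C.simult₂ _ _ ψ (fun k => 𝟙 (T.unit (X k))) = φ ∧
      (IsIso φ → IsIso ψ) := by
  obtain ⟨ψ, h₁, h₂, h₃⟩ := exists_extension γ (List.ofFn X) [] rfl rfl rfl rfl (MultiLin.ofNil f)
    B hB (φ ≫ eqToHom (T.simult_unit G)) (fun k _ _ hk _ => by simp at hk)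
  refine ⟨ψ, h₁, ?_, fun h => h₃ inferInstance⟩
  rw [← cancel_mono (eqToHom (T.simult_unit G)), ← h₂, unitSimult]
  simp only [Iso.trans_hom, eqToIso.hom, Category.assoc]
  rw [T.simult₂_unit]
  simp

end

end StrongRelativePseudomonad

/-! ### The extension of 2-cells -/

namespace StrongRelativePseudomonad

variable {D : TwoMulticategory.{u, v, w}} {C : TwoMulticategory.{u', v', w'}}
  {J : MultiFunctor D C} {T : StrongRelativePseudomonad J} {n : ℕ} {X X' X'' : Fin n → D.Ob}
  {Y Y' Y'' : D.Ob}

variable (T) in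
/-- The functor `h ↦ h^*`. -/
abbrev ext (Y Y' : D.Ob) : C.Hom [J.obj Y] (T.obj Y') ⥤ C.Hom [T.obj Y] (T.obj Y') :=
  T.str (Replaces.whole (J.obj Y) [T.obj Y])

variable (T) in
/-- The 2-cell `h ≅ h^* ∘ i`. -/
def η (h : C.Hom [J.obj Y] (T.obj Y')) : h ≅ C.post ((T.ext Y Y').obj h) (T.unit Y) :=
  T.unitCell _ (Replaces.whole _ _) h

variable (T) in
/-- The 2-cell `(h'^* ∘ h)^* ≅ h'^* ∘ h^*`. -/
def μ (h' : C.Hom [J.obj Y'] (T.obj Y'')) (h : C.Hom [J.obj Y] (T.obj Y')) :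
    (T.ext Y Y'').obj (C.post ((T.ext Y' Y'').obj h') h) ≅
      C.post ((T.ext Y' Y'').obj h') ((T.ext Y Y').obj h) :=
  T.multCell _ (nested_unary _ _ _) h' h

variable (T) in
/-- The 2-cell `i ∘ Jf ≅ Tf ∘ (i, …, i)`. -/
def unitMap (f : D.Hom (List.ofFn X) Y) :
    C.post (T.unit Y) ((J.map _ _).obj f) ≅
      C.simult (B := fun k => T.obj (X k)) (A := fun k => J.obj (X k)) List.map_ofFn
        List.map_ofFn ((T.map _ _).obj f) (fun k => T.unit (X k)) :=
  T.unitSimult (C.post (T.unit Y) ((J.map _ _).obj f))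

variable (T) in
/-- The 2-cell `h ∘ Jf ≅ (h^* ∘ Tf) ∘ (i, …, i)`. -/
def postUnit (f : D.Hom (List.ofFn X) Y) (h : C.Hom [J.obj Y] (T.obj Y')) :
    C.post h ((J.map _ _).obj f) ⟶
      C.simult (B := fun k => T.obj (X k)) (A := fun k => J.obj (X k)) List.map_ofFn
        List.map_ofFn (C.post ((T.ext Y Y').obj h)
          ((T.map _ _).obj f)) (fun k => T.unit (X k)) :=
  C.post₂ (T.η h).hom (𝟙 ((J.map _ _).obj f)) ≫
    eqToHom (C.post_post _ _ _) ≫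
    C.post₂ (𝟙 ((T.ext Y Y').obj h)) (T.unitMap f).hom ≫
    eqToHom (C.post_simult _ _ _ _ _)

instance (f : D.Hom (List.ofFn X) Y) (h : C.Hom [J.obj Y] (T.obj Y')) :
    IsIso (T.postUnit f h) := by
  unfold postUnit
  infer_instance

/-- The multilinear structure of `h^* ∘ Tf`. -/
abbrev postLin (γ : T.Pseudocommutativity) (f : D.Hom (List.ofFn X) Y)
    (h : C.Hom [J.obj Y] (T.obj Y')) :=
  (mapLin γ f).post (LinStr.free (Replaces.whole (J.obj Y) [T.obj Y]) h)

/-- The multilinear structure of `Tf' ∘ (g₁^*, …, gₙ^*)`. -/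
abbrev simultLin (γ : T.Pseudocommutativity) (f' : D.Hom (List.ofFn X') Y')
    (g : ∀ k, C.Hom [J.obj (X k)] (T.obj (X' k))) :=
  (mapLin γ f').simult fun k => LinStr.free (Replaces.whole (J.obj (X k)) [T.obj (X k)]) (g k)

/-- The extension of a 2-cell `h ∘ Jf → Tf' ∘ (g₁, …, gₙ)` to a multilinear one. -/
theorem exists_star (γ : T.Pseudocommutativity) (f : D.Hom (List.ofFn X) Y)
    (f' : D.Hom (List.ofFn X') Y') (h : C.Hom [J.obj Y] (T.obj Y'))
    (g : ∀ k, C.Hom [J.obj (X k)] (T.obj (X' k)))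
    (α : C.post h ((J.map _ _).obj f) ⟶
      C.simult (B := fun k => T.obj (X' k)) (A := fun k => J.obj (X k)) List.map_ofFn
        List.map_ofFn ((T.map _ _).obj f') g) :
    ∃ s : C.post ((T.ext Y Y').obj h) ((T.map _ _).obj f) ⟶
      C.simult (B := fun k => T.obj (X' k)) (A := fun k => T.obj (X k)) List.map_ofFn
        List.map_ofFn ((T.map _ _).obj f')
        (fun k => (T.ext (X k) (X' k)).obj (g k)),
      IsMultiLin (postLin γ f h) (simultLin γ f' g) s ∧
      T.postUnit f h ≫ C.simult₂ _ _ s (fun k => 𝟙 (T.unit (X k))) ≫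
          eqToHom (C.simult_simult _ _ _ _ _ _) =
        α ≫ C.simult₂ _ _ (𝟙 ((T.map _ _).obj f'))
          (fun k => (T.η (g k)).hom) := by
  -- With `F = (h ∘ Jf)^{t₁ ⋯ tₙ}`, the 2-cells `κ : F → h^* ∘ Tf` and `σ : F → Tf' ∘ (g₁^*, …, gₙ^*)` are
  -- the multilinear extensions of `postUnit` and of `α` followed by `η_{g₁}, …, η_{gₙ}`. The former
  -- is invertible, because `postUnit` is.
  obtain ⟨κ, h₁, h₂, h₃⟩ := exists_extension_simult γ _ (postLin γ f h)
    ((mapLin_isComm γ f).post γ _) (T.postUnit f h)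
  obtain ⟨σ, h₄, h₅, -⟩ := exists_extension_simult γ _ (simultLin γ f' g)
    (MultiLin.IsComm.simultAux γ n _ _ _ _ _ _ (mapLin_isComm γ f') _)
    (α ≫ C.simult₂ _ _ (𝟙 ((T.map _ _).obj f'))
      (fun k => (T.η (g k)).hom) ≫
      eqToHom (C.simult_simult _ _ _ _ _ _).symm)
  have := h₃ inferInstance
  rw [← h₂]
  have e : C.simult₂ (B := fun k => T.obj (X k)) (A := fun k => J.obj (X k)) (N := (List.ofFn X).map J.obj)
      List.map_ofFn List.map_ofFn κ (fun k => 𝟙 (T.unit (X k))) ≫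
      C.simult₂ (B := fun k => T.obj (X k)) (A := fun k => J.obj (X k)) (N := (List.ofFn X).map J.obj)
      List.map_ofFn List.map_ofFn (inv κ ≫ σ) (fun k => 𝟙 (T.unit (X k))) =
      C.simult₂ (B := fun k => T.obj (X k)) (A := fun k => J.obj (X k)) (N := (List.ofFn X).map J.obj)
      List.map_ofFn List.map_ofFn σ (fun k => 𝟙 (T.unit (X k))) := by
    rw [← TwoMulticategory.simult₂_comp_left, IsIso.hom_inv_id_assoc]
  refine ⟨inv κ ≫ σ, h₁.inv.comp h₄, ?_⟩
  rw [Category.assoc, reassoc_of% e, reassoc_of% h₅]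
  simp

end StrongRelativePseudomonad

/-! ### Units of the relative pseudomonad and `h^* ∘ Tf` -/

namespace StrongRelativePseudomonad

variable {D : TwoMulticategory.{u, v, w}} {C : TwoMulticategory.{u', v', w'}}
  {J : MultiFunctor D C} {T : StrongRelativePseudomonad J} {n : ℕ} {X X' X'' : Fin n → D.Ob}
  {Y Y' Y'' : D.Ob}

theorem η_μ (h' : C.Hom [J.obj Y'] (T.obj Y'')) (h : C.Hom [J.obj Y] (T.obj Y')) :
    (T.η (C.post ((T.ext Y' Y'').obj h') h)).hom ≫ C.post₂ (T.μ h' h).hom (𝟙 (T.unit Y)) =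
      C.post₂ (𝟙 ((T.ext Y' Y'').obj h')) (T.η h).hom ≫ eqToHom (C.post_post _ _ _).symm := by
  rw [← cancel_mono (eqToHom (C.post_post _ _ _))]
  simp only [Category.assoc, eqToHom_trans, eqToHom_refl, Category.comp_id]
  exact T.unitCell_multCell _ (nested_unary _ _ _) h' h

theorem η_θ (Y : D.Ob) : (T.η (T.unit Y)).hom ≫ C.post₂ (T.θ Y).hom (𝟙 (T.unit Y)) =
    eqToHom (C.one_post _).symm := by
  rw [← cancel_mono (eqToHom (C.one_post _))]
  simp only [Category.assoc, eqToHom_trans, eqToHom_refl]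
  exact T.unitCell_θ Y _ _

/-- Compatibility of `postUnit` with 2-cells out of `h^*`. -/
theorem postUnit_comp (f : D.Hom (List.ofFn X) Y) (h : C.Hom [J.obj Y] (T.obj Y'))
    {H : C.Hom [T.obj Y] (T.obj Y')} (ψ : (T.ext Y Y').obj h ⟶ H) :
    T.postUnit f h ≫ C.simult₂ _ _ (C.post₂ ψ (𝟙 ((T.map _ _).obj f))) (fun k => 𝟙 (T.unit (X k))) =
      C.post₂ ((T.η h).hom ≫ C.post₂ ψ (𝟙 (T.unit Y))) (𝟙 ((J.map _ _).obj f)) ≫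
        eqToHom (C.post_post _ _ _) ≫ C.post₂ (𝟙 H) (T.unitMap f).hom ≫
        eqToHom (C.post_simult _ _ _ _ _) := by
  have h₁ := C.post_simult₂ (B := fun k => T.obj (X k)) (A := fun k => J.obj (X k))
    (N := (List.ofFn X).map J.obj) List.map_ofFn List.map_ofFn ψ (𝟙 ((T.map _ _).obj f))
    (fun k => 𝟙 (T.unit (X k)))
  have h₂ := C.post_post₂ ψ (𝟙 (T.unit Y)) (𝟙 ((J.map _ _).obj f))
  rw [C.simult₂_id] at h₁
  rw [C.post₂_id] at h₂
  simp only [postUnit, Category.assoc, C.post₂_comp_left]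
  rw [← h₁, reassoc_of% h₂, reassoc_of% C.post₂_comp, reassoc_of% C.post₂_comp]
  simp

/-- On the units, `μ` replaces `h'^* ∘ h ∘ Jf` by `h'^*` composed with `postUnit` for `h`. -/
theorem postUnit_μ (f : D.Hom (List.ofFn X) Y) (h' : C.Hom [J.obj Y'] (T.obj Y''))
    (h : C.Hom [J.obj Y] (T.obj Y')) :
    T.postUnit f (C.post ((T.ext Y' Y'').obj h') h) ≫
      C.simult₂ _ _ (C.post₂ (T.μ h' h).hom (𝟙 ((T.map _ _).obj f)))
        (fun k => 𝟙 (T.unit (X k))) ≫ eqToHom (congrArg (fun F => C.simult _ _ F _) (C.post_post _ _ _)) =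
      eqToHom (C.post_post _ _ _) ≫
        C.post₂ (𝟙 ((T.ext Y' Y'').obj h')) (T.postUnit f h) ≫
        eqToHom (C.post_simult _ _ _ _ _) := by
  rw [← Category.assoc, postUnit_comp, η_μ, C.post₂_comp_left, ← C.post₂_id]
  have h₁ := C.post_post₂ (𝟙 ((T.ext Y' Y'').obj h')) (T.η h).hom (𝟙 ((J.map _ _).obj f))
  have h₂ := C.post_post₂ (𝟙 ((T.ext Y' Y'').obj h')) (𝟙 ((T.ext Y Y').obj h)) (T.unitMap f).hom
  simp only [postUnit, C.post₂_comp_right, Category.assoc, C.post₂_eqToHom_right,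
    C.post₂_eqToHom_left, ← reassoc_of% h₁]
  rw [← cancel_mono (eqToHom (C.post_simult _ _ _ _ _).symm)]
  simp only [Category.assoc, eqToHom_trans, eqToHom_trans_assoc]
  rw [(eqToHom_comp_iff _ _ _).mp h₂.symm]
  simp

/-- On the units, `θ ∘ Tf` is `i ∘ Jf ≅ Tf ∘ (i, …, i)`. -/
theorem postUnit_θ (f : D.Hom (List.ofFn X) Y) :
    T.postUnit f (T.unit Y) ≫
      C.simult₂ _ _ (C.post₂ (T.θ Y).hom (𝟙 ((T.map _ _).obj f))) (fun k => 𝟙 (T.unit (X k))) ≫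
        eqToHom (congrArg (fun F => C.simult _ _ F _) (C.one_post _)) = (T.unitMap f).hom := by
  rw [← Category.assoc, postUnit_comp, η_θ, C.post₂_eqToHom_left]
  have h₁ := C.one_post₂ (T.unitMap f).hom
  rw [← cancel_epi (eqToHom (C.one_post _)), ← h₁]
  simp

end StrongRelativePseudomonad

/-! ### The unit and composition laws of the extension of 2-cells -/

namespace StrongRelativePseudomonad

variable {D : TwoMulticategory.{u, v, w}} {C : TwoMulticategory.{u', v', w'}}
  {J : MultiFunctor D C} {T : StrongRelativePseudomonad J} {n : ℕ} {X X' X'' : Fin n → D.Ob}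
  {Y Y' Y'' : D.Ob}

/-- Multilinear 2-cells out of `h^* ∘ Tf` are determined by their composites with the units. -/
theorem ext_postUnit (γ : T.Pseudocommutativity) (f : D.Hom (List.ofFn X) Y)
    (h : C.Hom [J.obj Y] (T.obj Y')) {G : C.Hom ((List.ofFn X).map T.obj) (T.obj Y')}
    {A : T.MultiLin (marks (List.ofFn X)) G} {φ ψ : C.post ((T.ext Y Y').obj h) ((T.map _ _).obj f) ⟶ G}
    (hφ : IsMultiLin (postLin γ f h) A φ) (hψ : IsMultiLin (postLin γ f h) A ψ)
    (e : T.postUnit f h ≫ C.simult₂ _ _ φ (fun k => 𝟙 (T.unit (X k))) =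
      T.postUnit f h ≫ C.simult₂ _ _ ψ (fun k => 𝟙 (T.unit (X k)))) : φ = ψ :=
  IsMultiLin.ext_simult hφ hψ ((cancel_epi _).mp e)

/-- The unit law holds for any multilinear extension of `i ∘ Jf ≅ Tf ∘ (i, …, i)`. -/
theorem star_θ_of (γ : T.Pseudocommutativity) (f : D.Hom (List.ofFn X) Y)
    (s : C.post ((T.ext Y Y).obj (T.unit Y)) ((T.map _ _).obj f) ⟶
      C.simult (B := fun k => T.obj (X k)) (A := fun k => T.obj (X k)) List.map_ofFn
        List.map_ofFn ((T.map _ _).obj f) (fun k => (T.ext (X k) (X k)).obj (T.unit (X k))))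
    (hs : IsMultiLin (postLin γ f (T.unit Y)) (simultLin γ f fun k => T.unit (X k)) s)
    (es : T.postUnit f (T.unit Y) ≫ C.simult₂ _ _ s (fun k => 𝟙 (T.unit (X k))) ≫
          eqToHom (C.simult_simult _ _ _ _ _ _) =
        (T.unitMap f).hom ≫ C.simult₂ _ _ (𝟙 ((T.map _ _).obj f))
          (fun k => (T.η (T.unit (X k))).hom)) :
    s ≫ C.simult₂ _ _ (𝟙 ((T.map _ _).obj f)) (fun k => (T.θ (X k)).hom) ≫
        eqToHom (C.simult_one _ _ _) =
      C.post₂ (T.θ Y).hom (𝟙 ((T.map _ _).obj f)) ≫ eqToHom (C.one_comp _ _) := by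
  -- both sides are multilinear, so it suffices to compare their composites with the units
  refine ext_postUnit (A := mapLin γ f) γ f _ (hs.comp ((IsMultiLin.simultAux₂ n [] _ _ _ _ _
    (IsMultiLin.id _) fun k => IsLin.θ _ _).comp (IsMultiLin.simultAux_one n [] _ _ _ _ (fun _ _ h => h) _)))
    ((IsMultiLin.post₂ (IsLin.θ _ _) (IsMultiLin.id _)).comp (IsMultiLin.one_comp _)) ?_
  have es' := (comp_eqToHom_iff _ _ _).mp ((Category.assoc _ _ _).trans es)
  have h₁ := C.simult₂_simult₂ (B := fun k => T.obj (X k)) (A := fun k => J.obj (X k))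
    (E := fun k => T.obj (X k)) (N := (List.ofFn X).map T.obj) (R := (List.ofFn X).map J.obj)
    List.map_ofFn List.map_ofFn List.map_ofFn (𝟙 ((T.map _ _).obj f)) (fun k => (T.θ (X k)).hom)
    (fun k => 𝟙 (T.unit (X k)))
  have h₂ := (comp_eqToHom_iff _ _ _).mp h₁
  have h₃ : (fun k => (T.η (T.unit (X k))).hom ≫ C.post₂ (T.θ (X k)).hom (𝟙 (T.unit (X k)))) =
      fun k => eqToHom (C.one_post (T.unit (X k))).symm := funext fun k => η_θ (X k)
  have h₄ : T.postUnit f (T.unit Y) ≫ C.simult₂ (B := fun k => T.obj (X k))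
      (A := fun k => J.obj (X k)) (N := (List.ofFn X).map J.obj) List.map_ofFn List.map_ofFn
      (C.post₂ (T.θ Y).hom (𝟙 ((T.map _ _).obj f)) ≫ eqToHom (C.one_post _))
      (fun k => 𝟙 (T.unit (X k))) = (T.unitMap f).hom := by
    rw [C.simult₂_comp_left, C.simult₂_eqToHom_left]
    exact postUnit_θ f
  refine Eq.trans ?_ h₄.symm
  simp only [C.simult₂_comp_left, C.simult₂_eqToHom_left]
  rw [reassoc_of% es', h₂]
  simp only [Category.assoc, eqToHom_trans, eqToHom_trans_assoc, eqToHom_refl, Category.id_comp]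
  rw [reassoc_of% C.simult₂_comp, h₃, Category.id_comp]
  refine (congrArg (fun x => _ ≫ x ≫ _) (C.simult₂_eqToHom _ _ rfl
    (funext fun k => (C.one_post (T.unit (X k))).symm))).trans ?_
  simp

/-- The composition law holds for any multilinear extensions `sα`, `sβ` and `s` of `α`, `β` and `β^*α`. -/
theorem star_μ_of (γ : T.Pseudocommutativity) (f : D.Hom (List.ofFn X) Y)
    (f' : D.Hom (List.ofFn X') Y') (f'' : D.Hom (List.ofFn X'') Y'')
    (h : C.Hom [J.obj Y] (T.obj Y')) (h' : C.Hom [J.obj Y'] (T.obj Y''))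
    (g : ∀ k, C.Hom [J.obj (X k)] (T.obj (X' k))) (g' : ∀ k, C.Hom [J.obj (X' k)] (T.obj (X'' k)))
    (α : C.post h ((J.map _ _).obj f) ⟶
      C.simult (B := fun k => T.obj (X' k)) (A := fun k => J.obj (X k)) List.map_ofFn
        List.map_ofFn ((T.map _ _).obj f') g)
    (sα : C.post ((T.ext Y Y').obj h) ((T.map _ _).obj f) ⟶
      C.simult (B := fun k => T.obj (X' k)) (A := fun k => T.obj (X k)) List.map_ofFn
        List.map_ofFn ((T.map _ _).obj f') (fun k => (T.ext (X k) (X' k)).obj (g k)))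
    (hα : IsMultiLin (postLin γ f h) (simultLin γ f' g) sα)
    (eα : T.postUnit f h ≫ C.simult₂ _ _ sα (fun k => 𝟙 (T.unit (X k))) ≫
          eqToHom (C.simult_simult _ _ _ _ _ _) =
        α ≫ C.simult₂ _ _ (𝟙 ((T.map _ _).obj f')) (fun k => (T.η (g k)).hom))
    (sβ : C.post ((T.ext Y' Y'').obj h') ((T.map _ _).obj f') ⟶
      C.simult (B := fun k => T.obj (X'' k)) (A := fun k => T.obj (X' k)) List.map_ofFn
        List.map_ofFn ((T.map _ _).obj f'') (fun k => (T.ext (X' k) (X'' k)).obj (g' k)))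
    (hβ : IsMultiLin (postLin γ f' h') (simultLin γ f'' g') sβ)
    (s : C.post ((T.ext Y Y'').obj (C.post ((T.ext Y' Y'').obj h') h)) ((T.map _ _).obj f) ⟶
      C.simult (B := fun k => T.obj (X'' k)) (A := fun k => T.obj (X k)) List.map_ofFn
        List.map_ofFn ((T.map _ _).obj f'')
        (fun k => (T.ext (X k) (X'' k)).obj (C.post ((T.ext (X' k) (X'' k)).obj (g' k)) (g k))))
    (hs : IsMultiLin (postLin γ f _) (simultLin γ f'' _) s)
    (es : T.postUnit f (C.post ((T.ext Y' Y'').obj h') h) ≫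
          C.simult₂ _ _ s (fun k => 𝟙 (T.unit (X k))) ≫ eqToHom (C.simult_simult _ _ _ _ _ _) =
        (eqToHom (C.post_post _ _ _) ≫
            C.post₂ (𝟙 ((T.ext Y' Y'').obj h')) α ≫
            eqToHom (C.post_simult _ _ _ _ _) ≫
            C.simult₂ _ _ sβ (fun k => 𝟙 (g k)) ≫
            eqToHom (C.simult_simult _ _ _ _ _ _)) ≫ C.simult₂ _ _ (𝟙 ((T.map _ _).obj f''))
          (fun k => (T.η (C.post ((T.ext (X' k) (X'' k)).obj (g' k)) (g k))).hom)) :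
    C.post₂ (T.μ h' h).hom (𝟙 ((T.map _ _).obj f)) ≫
        eqToHom (C.post_post _ _ _) ≫
        C.post₂ (𝟙 ((T.ext Y' Y'').obj h')) sα ≫
        eqToHom (C.post_simult _ _ _ _ _) ≫
        C.simult₂ _ _ sβ (fun k => 𝟙 ((T.ext (X k) (X' k)).obj (g k))) ≫
        eqToHom (C.simult_simult _ _ _ _ _ _) =
      s ≫ C.simult₂ _ _ (𝟙 ((T.map _ _).obj f'')) (fun k => (T.μ (g' k) (g k)).hom) := by
  -- both sides are multilinear, so it suffices to compare their composites with the units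
  refine ext_postUnit γ f _
    ((IsMultiLin.post₂ (IsLin.multCell _ (nested_unary _ _ _) h' h) (IsMultiLin.id _)).comp
      ((IsMultiLin.post_post _ _ _ _).comp ((IsMultiLin.post₂ (IsLin.id _) hα).comp
      ((IsMultiLin.post_simultAux n [] _ _ _ _ _ _ _ _).comp
      ((IsMultiLin.simultAux₂ n [] _ _ _ _ _ hβ fun k => IsLin.id _).comp
      (IsMultiLin.simultAux_simultAux n [] _ _ _ _ _ (fun _ _ h => by simp at h) _ _ _ _ _ _))))))
    (hs.comp (IsMultiLin.simultAux₂ n [] _ _ _ _ _ (IsMultiLin.id _) fun k =>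
      IsLin.multCell _ (nested_unary _ _ _) (g' k) (g k))) ?_
  have eα' := (comp_eqToHom_iff _ _ _).mp ((Category.assoc _ _ _).trans eα)
  have es' := (comp_eqToHom_iff _ _ _).mp ((Category.assoc _ _ _).trans es)
  have h₁ := (comp_eqToHom_iff _ _ _).mp (C.simult₂_simult₂ (B := fun k => T.obj (X k))
    (A := fun k => J.obj (X k)) (E := fun k => T.obj (X'' k)) (N := (List.ofFn X).map T.obj)
    (R := (List.ofFn X).map J.obj) List.map_ofFn List.map_ofFn List.map_ofFn
    (𝟙 ((T.map _ _).obj f'')) (fun k => (T.μ (g' k) (g k)).hom) (fun k => 𝟙 (T.unit (X k))))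
  have h₂ := (comp_eqToHom_iff _ _ _).mp (C.simult₂_simult₂ (B := fun k => T.obj (X k))
    (A := fun k => J.obj (X k)) (E := fun k => T.obj (X' k)) (N := (List.ofFn X).map T.obj)
    (R := (List.ofFn X).map J.obj) List.map_ofFn List.map_ofFn List.map_ofFn
    sβ (fun k => 𝟙 ((T.ext (X k) (X' k)).obj (g k))) (fun k => 𝟙 (T.unit (X k))))
  have h₃ := C.post_simult₂ (B := fun k => T.obj (X k)) (A := fun k => J.obj (X k))
    (N := (List.ofFn X).map J.obj) List.map_ofFn List.map_ofFn (𝟙 ((T.ext Y' Y'').obj h')) sα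
    (fun k => 𝟙 (T.unit (X k)))
  have h₄ := (comp_eqToHom_iff _ _ _).mp (C.post_simult₂ (B := fun k => T.obj (X' k))
    (A := fun k => J.obj (X k)) (N := (List.ofFn X).map J.obj) List.map_ofFn List.map_ofFn
    (𝟙 ((T.ext Y' Y'').obj h')) (𝟙 ((T.map _ _).obj f')) (fun k => (T.η (g k)).hom))
  have h₅ := C.simult₂_simult₂ (B := fun k => T.obj (X' k))
    (A := fun k => J.obj (X k)) (E := fun k => T.obj (X'' k)) (N := (List.ofFn X').map T.obj)
    (R := (List.ofFn X).map J.obj) List.map_ofFn List.map_ofFn List.map_ofFn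
    (𝟙 ((T.map _ _).obj f'')) (fun k => 𝟙 ((T.ext (X' k) (X'' k)).obj (g' k)))
    (fun k => (T.η (g k)).hom)
  have h₆ : (fun k => (T.η (C.post ((T.ext (X' k) (X'' k)).obj (g' k)) (g k))).hom ≫
      C.post₂ (T.μ (g' k) (g k)).hom (𝟙 (T.unit (X k)))) = _ := funext fun k => η_μ (g' k) (g k)
  have h₇ := C.simult₂_comp (B := fun k => T.obj (X'' k)) (A := fun k => J.obj (X k))
    (M := (List.ofFn X'').map T.obj) (N := (List.ofFn X).map J.obj) List.map_ofFn List.map_ofFn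
    (𝟙 ((T.map _ _).obj f'')) (𝟙 _)
    (fun k => C.post₂ (𝟙 ((T.ext (X' k) (X'' k)).obj (g' k))) (T.η (g k)).hom)
    (fun k => eqToHom (C.post_post ((T.ext (X' k) (X'' k)).obj (g' k)) ((T.ext (X k) (X' k)).obj (g k))
      (T.unit (X k))).symm)
  have h₈ := C.simult₂_eqToHom (B := fun k => T.obj (X'' k)) (A := fun k => J.obj (X k))
    (M := (List.ofFn X'').map T.obj) (N := (List.ofFn X).map J.obj) List.map_ofFn List.map_ofFn
    (Eq.refl ((T.map _ _).obj f'')) (funext fun k => (C.post_post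
      ((T.ext (X' k) (X'' k)).obj (g' k)) ((T.ext (X k) (X' k)).obj (g k)) (T.unit (X k))).symm)
  replace h₇ := h₇.symm.trans (congrArg (_ ≫ ·) h₈)
  rw [Category.id_comp] at h₇
  have lhs : T.postUnit f (C.post ((T.ext Y' Y'').obj h') h) ≫
      C.simult₂ (B := fun k => T.obj (X k)) (A := fun k => J.obj (X k))
        (N := (List.ofFn X).map J.obj) List.map_ofFn List.map_ofFn
        (C.post₂ (T.μ h' h).hom (𝟙 ((T.map _ _).obj f)) ≫
        eqToHom (C.post_post _ _ _) ≫
        C.post₂ (𝟙 ((T.ext Y' Y'').obj h')) sα ≫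
        eqToHom (C.post_simult _ _ _ _ _) ≫
        C.simult₂ _ _ sβ (fun k => 𝟙 ((T.ext (X k) (X' k)).obj (g k))) ≫
        eqToHom (C.simult_simult _ _ _ _ _ _)) (fun k => 𝟙 (T.unit (X k))) =
      eqToHom (C.post_post _ _ _) ≫ C.post₂ (𝟙 ((T.ext Y' Y'').obj h')) α ≫
        eqToHom (C.post_simult _ _ _ _ _) ≫ C.simult₂ _ _ sβ (fun k => (T.η (g k)).hom) ≫
        eqToHom (by rw [C.simult_simult, C.simult_simult]; simp only [C.post_post]) := by
    simp only [C.simult₂_comp_left, C.simult₂_eqToHom_left]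
    rw [reassoc_of% postUnit_μ f h' h, ← reassoc_of% h₃, ← reassoc_of% C.post₂_comp_right, eα', h₂]
    simp only [C.post₂_comp_right, C.post₂_eqToHom_right, h₄, C.post₂_id, Category.assoc,
      eqToHom_trans, eqToHom_trans_assoc, eqToHom_refl, Category.id_comp]
    rw [reassoc_of% C.simult₂_comp]
    simp only [Category.id_comp, Category.comp_id]
  have rhs : T.postUnit f (C.post ((T.ext Y' Y'').obj h') h) ≫
      C.simult₂ (B := fun k => T.obj (X k)) (A := fun k => J.obj (X k))
        (N := (List.ofFn X).map J.obj) List.map_ofFn List.map_ofFn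
        (s ≫ C.simult₂ _ _ (𝟙 ((T.map _ _).obj f'')) (fun k => (T.μ (g' k) (g k)).hom))
        (fun k => 𝟙 (T.unit (X k))) =
      eqToHom (C.post_post _ _ _) ≫ C.post₂ (𝟙 ((T.ext Y' Y'').obj h')) α ≫
        eqToHom (C.post_simult _ _ _ _ _) ≫ C.simult₂ _ _ sβ (fun k => (T.η (g k)).hom) ≫
        eqToHom (by rw [C.simult_simult, C.simult_simult]; simp only [C.post_post]) := by
    simp only [C.simult₂_comp_left]
    rw [reassoc_of% es', h₁]
    simp only [Category.assoc, eqToHom_trans_assoc, eqToHom_refl, Category.id_comp]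
    rw [reassoc_of% C.simult₂_comp, h₆, Category.id_comp, h₇]
    simp only [Category.assoc, eqToHom_trans, ← reassoc_of% h₅, C.simult₂_id]
    rw [reassoc_of% C.simult₂_comp]
    simp only [Category.id_comp, Category.comp_id]
  exact lhs.trans rhs.symm

end StrongRelativePseudomonad


theorem mainTheorem1 {D : TwoMulticategory.{u, v, w}} {C : TwoMulticategory.{u', v', w'}}
    (J : MultiFunctor D C) (T : StrongRelativePseudomonad J)
    (hT : Nonempty T.Pseudocommutativity) :
    ∃ M : MulticategoricalStructure T.toRelativePseudomonad,
      ∀ (L : List D.Ob) (Y : D.Ob), M.functor.map L Y = T.map L Y := by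
  obtain ⟨γ⟩ := hT
  -- the multilinear extension of each 2-cell, its multilinearity and condition (1)
  choose star star_lin star_η using @StrongRelativePseudomonad.exists_star D C J T
  exact ⟨{
    functor := T.toPseudoMultifunctor
    functor_unary := T.map_unary
    ι := T.unitMap
    star := star γ
    star_η := fun f f' h g α => by
      have e := star_η γ f f' h g α
      simp only [StrongRelativePseudomonad.postUnit, Category.assoc] at e
      exact e
    star_μ := fun f f' f'' h h' g g' α β =>
      StrongRelativePseudomonad.star_μ_of γ f f' f'' h h' g g' α _ (star_lin ..) (star_η ..) _
        (star_lin ..) _ (star_lin ..) (star_η ..)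
    star_θ := fun f => StrongRelativePseudomonad.star_θ_of γ f _ (star_lin ..) (star_η ..) },
    fun _ _ => rfl⟩
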